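/- Let $\mathcal C$ be a closed braided monoidal category with unit object $I$ and braiding $\Phi$, having equalizers and coequalizers, and let $H\in\mathcal C$ be a finite and commutative Hopf algebra (finite means that the canonical morphism $H\otimes[H,I]\to[H,H]$ is an isomorphism). Assume that the braiding is $H$-linear, i.e. $\Phi_{X,Y}\colon X\otimes Y\to Y\otimes X$ is $H$-linear for the diagonal actions for all left $H$-modules $X,Y$. Then the category ${}_H\mathcal C$ of left $H$-modules is again closed braided monoidal. For a closed braided monoidal category $\mathcal D$ let $\operatorname{Br}(\mathcal D)$ be the Brauer group of $\mathcal D$: the set of Azumaya algebras $A$ of $\mathcal D$ (that is, $A$ is faithfully projective and the canonical morphisms $A\otimes\overline A\to[A,A]$ and $\overline A\otimes A\to\{A,A\}$ are isomorphisms, $\overline A$ being the opposite algebra, $[A,-]$ the right adjoint of $-\otimes A$ and $\{A,-\}$ that of $A\otimes-$) modulo the relation $A\sim B$ iff $A\otimes[P,P]\cong B\otimes[Q,Q]$ as algebras for some faithfully projective $P,Q$, with multiplication $[A][B]=[A\otimes B]$. Put $\operatorname{BM}(\mathcal C;H)=\operatorname{Br}({}_H\mathcal C)$ and let $\operatorname{BM}_{inn}(\mathcal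 C;H)\subseteq\operatorname{BM}(\mathcal C;H)$ be the subgroup of the classes represented by an algebra $A$ with inner action, i.e. such that there is a convolution invertible $f\colon H\to A$ with $h\cdot a=f(h_{(1)})\,a\,f^{-1}(h_{(2)})$. An $H$-Galois object is a right $H$-comodule algebra $T$ such that $T\otimes-$ preserves and reflects equalizers and $T\otimes T\to T\otimes H$, $x\otimes y\mapsto xy_{(0)}\otimes y_{(1)}$, is an isomorphism; it has a normal basis if $T\cong H$ as right $H$-comodules. Let $\operatorname{Gal}_{nb}(\mathcal C;H)$ be the group of isomorphism classes of $H$-Galois objects with a normal basis, with multiplication induced by the cotensor product over $H$. Let $\operatorname{H}^2(\mathcal C;H,I)$ be the second Sweedler cohomology group of $H$ with values in $I$. Then these are groups, and there is a split exact sequence of groups $$1\to\operatorname{Br}(\mathcal C)\xrightarrow{\ q\ }\operatorname{BM}_{inn}(\mathcal C;H)\xrightarrow{\ \Upsilon'\ }\operatorname{Gal}_{nb}(\mathcal C;H)\to1,$$ where $q$ sends $[A]$ to the class of $A$ with the trivial $H$-action, and $\Upsilon'([A])=[(A\# H)^A]$, where $A\# H$ is the smash product and $(A\# H)^A$ is the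 subalgebra of those $x\in A\#H$ with $ax=xa$ for all $a\in A$ ($a$ being moved past $x$ by the braiding); a splitting $p\colon\operatorname{BM}_{inn}(\mathcal C;H)\to\operatorname{Br}(\mathcal C)$ with $pq=\mathrm{id}$ is given by forgetting the $H$-action. Moreover $$\operatorname{BM}_{inn}(\mathcal C;H)\cong\operatorname{Br}(\mathcal C)\times\operatorname{H}^2(\mathcal C;H,I).$$ -/

import Mathlib

open CategoryTheory MonoidalCategory Limits
open scoped MonObj ComonObj HopfObj

universe v u

namespace HopfBrauer

noncomputable section

section Modules

variable {C : Type u} [Category.{v} C] [MonoidalCategory C] [BraidedCategory C]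
variable {H : C} [HopfObj H]

/-- The action `H ⊗ X ⟶ X` of a left `H`-module. -/
def hact (H : C) [HopfObj H] (X : C) [ModObj H X] : H ⊗ X ⟶ X := γ[H, X]

lemma one_hact (X : C) [ModObj H X] : η[H] ▷ X ≫ hact H X = (λ_ X).hom :=
  ModObj.one_smul_self H X

lemma mul_hact (X : C) [ModObj H X] :
    μ[H] ▷ X ≫ hact H X = (α_ H H X).hom ≫ H ◁ hact H X ≫ hact H X :=
  ModObj.mul_smul_self H X

/-- `h ⊗ x ↦ h₁ x ⊗ h₂`. -/
def slide (H : C) [HopfObj H] (X : C) [ModObj H X] : H ⊗ X ⟶ X ⊗ H :=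
  Δ[H] ▷ X ≫ (α_ H H X).hom ≫ H ◁ (β_ H X).hom ≫ (α_ H X H).inv ≫ hact H X ▷ H

lemma slide_one (X : C) [ModObj H X] :
    η[H] ▷ X ≫ slide H X = (λ_ X).hom ≫ (ρ_ X).inv ≫ X ◁ η[H] := by
  calc
    _ = (η[H] ≫ Δ[H]) ▷ X ≫ (α_ H H X).hom ≫ H ◁ (β_ H X).hom ≫ (α_ H X H).inv ≫ hact H X ▷ H := by
      simp only [slide, comp_whiskerRight, Category.assoc]
    _ = 𝟙 _ ⊗≫ η[H] ▷ (𝟙_ C) ▷ X ⊗≫ H ◁ (η[H] ▷ X ≫ (β_ H X).hom) ⊗≫ hact H X ▷ H := by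
      rw [BimonObj.one_comul]
      simp only [MonObj.tensorObj.one_def, MonoidalCategory.tensorHom_def]
      monoidal
    _ = 𝟙 _ ⊗≫ η[H] ▷ (𝟙_ C) ▷ X ⊗≫ ((H ⊗ X) ◁ η[H] ≫ hact H X ▷ H) := by
      rw [BraidedCategory.braiding_naturality_left, braiding_tensorUnit_left]
      monoidal
    _ = 𝟙 _ ⊗≫ (η[H] ▷ X ≫ hact H X) ⊗≫ X ◁ η[H] := by
      rw [whisker_exchange]; monoidal
    _ = _ := by
      rw [one_hact]; monoidal

lemma slide_mul (X : C) [ModObj H X] :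
    μ[H] ▷ X ≫ slide H X = (α_ H H X).hom ≫ H ◁ slide H X ≫ (α_ H X H).inv ≫
      slide H X ▷ H ≫ (α_ X H H).hom ≫ X ◁ μ[H] := by
  calc
    _ = (μ[H] ≫ Δ[H]) ▷ X ≫ (α_ H H X).hom ≫ H ◁ (β_ H X).hom ≫ (α_ H X H).inv ≫ hact H X ▷ H := by
      simp only [slide, comp_whiskerRight, Category.assoc]
    _ = 𝟙 _ ⊗≫ Δ[H] ▷ (H ⊗ X) ⊗≫ ((H ⊗ H) ◁ Δ[H] ▷ X) ⊗≫ H ◁ (β_ H H).hom ▷ (H ⊗ X) ⊗≫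
         (μ[H] ▷ (H ⊗ H)) ▷ X ⊗≫ H ◁ (μ[H] ▷ X ≫ (β_ H X).hom) ⊗≫ hact H X ▷ H := by
      rw [BimonObj.mul_comul]
      simp only [tensorμ, MonoidalCategory.tensorHom_def]
      monoidal
    _ = 𝟙 _ ⊗≫ Δ[H] ▷ (H ⊗ X) ⊗≫ ((H ⊗ H) ◁ Δ[H] ▷ X) ⊗≫ H ◁ (β_ H H).hom ▷ (H ⊗ X) ⊗≫
         (μ[H] ▷ ((H ⊗ H) ⊗ X) ≫ H ◁ (β_ (H ⊗ H) X).hom) ⊗≫ ((H ⊗ X) ◁ μ[H] ≫ hact H X ▷ H) := by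
      rw [BraidedCategory.braiding_naturality_left]
      monoidal
    _ = 𝟙 _ ⊗≫ Δ[H] ▷ (H ⊗ X) ⊗≫ ((H ⊗ H) ◁ Δ[H] ▷ X) ⊗≫ H ◁ (β_ H H).hom ▷ (H ⊗ X) ⊗≫
         (H ⊗ H) ◁ (β_ (H ⊗ H) X).hom ⊗≫ (μ[H] ▷ X ≫ hact H X) ▷ (H ⊗ H) ⊗≫ X ◁ μ[H] := by
      rw [← whisker_exchange, whisker_exchange (hact H X) μ[H]]
      monoidal
    _ = 𝟙 _ ⊗≫ Δ[H] ▷ (H ⊗ X) ⊗≫ ((H ⊗ H) ◁ Δ[H] ▷ X) ⊗≫ 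
          H ◁ ((β_ H H).hom ▷ (H ⊗ X) ≫ (H ⊗ H) ◁ (β_ H X).hom) ⊗≫
         (H ⊗ H) ◁ (β_ H X).hom ▷ H ⊗≫ (H ◁ hact H X ≫ hact H X) ▷ (H ⊗ H) ⊗≫ X ◁ μ[H] := by
      rw [mul_hact, BraidedCategory.braiding_tensor_left_hom]; monoidal
    _ = 𝟙 _ ⊗≫ Δ[H] ▷ (H ⊗ X) ⊗≫ ((H ⊗ H) ◁ Δ[H] ▷ X) ⊗≫
         (H ⊗ H) ◁ (H ◁ (β_ H X).hom) ⊗≫ H ◁ ((β_ H (H ⊗ X)).hom ≫ hact H X ▷ H) ▷ H ⊗≫ hact H X ▷ (H ⊗ H) ⊗≫ X ◁ μ[H]  := by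
      rw [← whisker_exchange, BraidedCategory.braiding_tensor_right_hom]; monoidal
    _ = 𝟙 _ ⊗≫ (Δ[H] ▷ (H ⊗ X) ≫ (H ⊗ H) ◁ slide H X) ⊗≫ H ◁ (β_ H X).hom ▷ H ⊗≫ hact H X ▷ (H ⊗ H) ⊗≫ X ◁ μ[H]  := by
      rw [← BraidedCategory.braiding_naturality_right]
      simp only [slide]
      monoidal
    _ = _ := by
      rw [← whisker_exchange]
      nth_rw 3 [slide]
      monoidal

lemma slide_counit (X : C) [ModObj H X] :
    slide H X ≫ X ◁ ε[H] = hact H X ≫ (ρ_ X).inv := by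
  calc
    _ = 𝟙 _ ⊗≫ Δ[H] ▷ X ⊗≫ H ◁ (β_ H X).hom ⊗≫ (hact H X ▷ H ≫ X ◁ ε[H]) := by
      simp only [slide]; monoidal
    _ = 𝟙 _ ⊗≫ Δ[H] ▷ X ⊗≫ H ◁ ((β_ H X).hom ≫ X ◁ ε[H]) ⊗≫ hact H X ▷ (𝟙_ C) := by
      rw [← whisker_exchange]; monoidal
    _ = 𝟙 _ ⊗≫ (Δ[H] ≫ H ◁ ε[H]) ▷ X ⊗≫ hact H X ▷ (𝟙_ C) := by
      rw [← BraidedCategory.braiding_naturality_left, braiding_tensorUnit_left]; monoidal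
    _ = _ := by
      rw [ComonObj.comul_counit]; monoidal

lemma slide_comul (X : C) [ModObj H X] :
    slide H X ≫ X ◁ Δ[H] = Δ[H] ▷ X ≫ (α_ H H X).hom ≫ H ◁ (β_ H X).hom ≫ (α_ H X H).inv ≫
      slide H X ▷ H ≫ (α_ X H H).hom := by
  calc
    _ = 𝟙 _ ⊗≫ Δ[H] ▷ X ⊗≫ H ◁ (β_ H X).hom ⊗≫ (hact H X ▷ H ≫ X ◁ Δ[H]) := by
      simp only [slide]; monoidal
    _ = 𝟙 _ ⊗≫ Δ[H] ▷ X ⊗≫ H ◁ ((β_ H X).hom ≫ X ◁ Δ[H]) ⊗≫ hact H X ▷ (H ⊗ H) := by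
      rw [← whisker_exchange]; monoidal
    _ = 𝟙 _ ⊗≫ (Δ[H] ≫ H ◁ Δ[H]) ▷ X ⊗≫ H ◁ (H ◁ (β_ H X).hom) ⊗≫ H ◁ (β_ H X).hom ▷ H ⊗≫ hact H X ▷ (H ⊗ H) := by
      rw [← BraidedCategory.braiding_naturality_left, BraidedCategory.braiding_tensor_left_hom]; monoidal
    _ = 𝟙 _ ⊗≫ Δ[H] ▷ X ⊗≫ (Δ[H] ▷ (H ⊗ X) ≫ (H ⊗ H) ◁ (β_ H X).hom) ⊗≫ H ◁ (β_ H X).hom ▷ H ⊗≫ hact H X ▷ (H ⊗ H) := by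
      rw [ComonObj.comul_assoc]; monoidal
    _ = _ := by
      rw [← whisker_exchange]; simp only [slide]; monoidal

/-- The diagonal action `h (x ⊗ y) = h₁ x ⊗ h₂ y` on `X ⊗ Y`. -/
@[reducible]
def tensorMod (X Y : C) [ModObj H X] [ModObj H Y] : ModObj H (X ⊗ Y) where
  smul := (α_ H X Y).inv ≫ slide H X ▷ Y ≫ (α_ X H Y).hom ≫ X ◁ hact H Y
  one_smul := by
    change η[H] ▷ (X ⊗ Y) ≫ (α_ H X Y).inv ≫ slide H X ▷ Y ≫ (α_ X H Y).hom ≫ X ◁ hact H Y = (λ_ _).hom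
    calc
      _ = 𝟙 _ ⊗≫ (η[H] ▷ X ≫ slide H X) ▷ Y ⊗≫ X ◁ hact H Y := by monoidal
      _ = 𝟙 _ ⊗≫ X ◁ (η[H] ▷ Y ≫ hact H Y) := by rw [slide_one]; monoidal
      _ = _ := by rw [one_hact]; monoidal
  mul_smul := by
    change μ[H] ▷ (X ⊗ Y) ≫ (α_ H X Y).inv ≫ slide H X ▷ Y ≫ (α_ X H Y).hom ≫ X ◁ hact H Y =
      (α_ _ _ _).hom ≫ H ◁ ((α_ H X Y).inv ≫ slide H X ▷ Y ≫ (α_ X H Y).hom ≫ X ◁ hact H Y) ≫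
       (α_ H X Y).inv ≫ slide H X ▷ Y ≫ (α_ X H Y).hom ≫ X ◁ hact H Y
    calc
      _ = 𝟙 _ ⊗≫ (μ[H] ▷ X ≫ slide H X) ▷ Y ⊗≫ X ◁ hact H Y := by monoidal
      _ = 𝟙 _ ⊗≫ H ◁ slide H X ▷ Y ⊗≫ slide H X ▷ (H ⊗ Y) ⊗≫ X ◁ (μ[H] ▷ Y ≫ hact H Y) := by
        rw [slide_mul]; monoidal
      _ = 𝟙 _ ⊗≫ H ◁ slide H X ▷ Y ⊗≫ (slide H X ▷ (H ⊗ Y) ≫ (X ⊗ H) ◁ hact H Y) ⊗≫ X ◁ hact H Y := by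
        rw [mul_hact]; monoidal
      _ = _ := by rw [← whisker_exchange]; monoidal

lemma hact_tensor (X Y : C) [ModObj H X] [ModObj H Y] :
    letI := tensorMod (H := H) X Y
    hact H (X ⊗ Y) = (α_ H X Y).inv ≫ slide H X ▷ Y ≫ (α_ X H Y).hom ≫ X ◁ hact H Y := rfl

lemma slide_tensor (X Y : C) [ModObj H X] [ModObj H Y] :
    letI := tensorMod (H := H) X Y
    slide H (X ⊗ Y) = (α_ H X Y).inv ≫ slide H X ▷ Y ≫ (α_ X H Y).hom ≫ X ◁ slide H Y ≫
      (α_ X Y H).inv := by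
  let := tensorMod (H := H) X Y
  calc
    _ = 𝟙 _ ⊗≫ Δ[H] ▷ (X ⊗ Y) ⊗≫ H ◁ (β_ H (X ⊗ Y)).hom ⊗≫ slide H X ▷ (Y ⊗ H) ⊗≫
        X ◁ hact H Y ▷ H ⊗≫ 𝟙 _ := by
      nth_rw 1 [slide]
      rw [hact_tensor]
      monoidal
    _ = 𝟙 _ ⊗≫ Δ[H] ▷ (X ⊗ Y) ⊗≫ H ◁ (β_ H X).hom ▷ Y ⊗≫
        ((H ⊗ X) ◁ (β_ H Y).hom ≫ slide H X ▷ (Y ⊗ H)) ⊗≫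
        X ◁ hact H Y ▷ H ⊗≫ 𝟙 _ := by
      rw [BraidedCategory.braiding_tensor_right_hom]; monoidal
    _ = 𝟙 _ ⊗≫ (Δ[H] ▷ X ≫ (α_ H H X).hom ≫ H ◁ (β_ H X).hom ≫ (α_ H X H).inv ≫
      slide H X ▷ H ≫ (α_ X H H).hom) ▷ Y ⊗≫ X ◁ (H ◁ (β_ H Y).hom) ⊗≫
        X ◁ hact H Y ▷ H ⊗≫ 𝟙 _ := by
      rw [whisker_exchange]; monoidal
    _ = _ := by
      rw [← slide_comul]; simp only [slide]; monoidal

/-- The trivial action `h x = ε(h) x`. -/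
@[reducible]
def trivMod (H : C) [HopfObj H] (X : C) : ModObj H X where
  smul := ε[H] ▷ X ≫ (λ_ X).hom
  one_smul := by
    change η[H] ▷ X ≫ ε[H] ▷ X ≫ (λ_ X).hom = (λ_ X).hom
    rw [← comp_whiskerRight_assoc, BimonObj.one_counit]; simp
  mul_smul := by
    change μ[H] ▷ X ≫ ε[H] ▷ X ≫ (λ_ X).hom = (α_ H H X).hom ≫ H ◁ (ε[H] ▷ X ≫ (λ_ X).hom) ≫ ε[H] ▷ X ≫ (λ_ X).hom
    calc
      _ = (μ[H] ≫ ε[H]) ▷ X ≫ (λ_ X).hom := by simp only [comp_whiskerRight, Category.assoc]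
      _ = 𝟙 _ ⊗≫ (ε[H] ▷ H ≫ (𝟙_ C) ◁ ε[H]) ▷ X ⊗≫ 𝟙 _ := by
        rw [BimonObj.mul_counit, Comon.tensorObj_counit, MonoidalCategory.tensorHom_def]; monoidal
      _ = _ := by rw [← whisker_exchange]; monoidal

lemma hact_triv (X : C) :
    letI := trivMod H X
    hact H X = ε[H] ▷ X ≫ (λ_ X).hom := rfl

lemma slide_triv (X : C) :
    letI := trivMod H X
    slide H X = (β_ H X).hom := by
  let := trivMod H X
  calc
    _ = 𝟙 _ ⊗≫ Δ[H] ▷ X ⊗≫ (H ◁ (β_ H X).hom ≫ ε[H] ▷ (X ⊗ H)) ⊗≫ 𝟙 _ := by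
      simp only [slide, hact_triv]; monoidal
    _ = 𝟙 _ ⊗≫ (Δ[H] ≫ ε[H] ▷ H) ▷ X ⊗≫ (β_ H X).hom ⊗≫ 𝟙 _ := by
      rw [whisker_exchange]; monoidal
    _ = _ := by
      rw [ComonObj.counit_comul]; monoidal

/-- `slide` is natural for `H`-linear morphisms. -/

lemma slide_natural {X Y : C} [ModObj H X] [ModObj H Y] (f : X ⟶ Y)
    (hf : hact H X ≫ f = H ◁ f ≫ hact H Y) : slide H X ≫ f ▷ H = H ◁ f ≫ slide H Y := by
  calc
    _ = 𝟙 _ ⊗≫ Δ[H] ▷ X ⊗≫ H ◁ (β_ H X).hom ⊗≫ (hact H X ≫ f) ▷ H ⊗≫ 𝟙 _ := by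
      simp only [slide]; monoidal
    _ = 𝟙 _ ⊗≫ Δ[H] ▷ X ⊗≫ H ◁ ((β_ H X).hom ≫ f ▷ H) ⊗≫ hact H Y ▷ H ⊗≫ 𝟙 _ := by
      rw [hf]; monoidal
    _ = 𝟙 _ ⊗≫ (Δ[H] ▷ X ≫ (H ⊗ H) ◁ f) ⊗≫ H ◁ (β_ H Y).hom ⊗≫ hact H Y ▷ H ⊗≫ 𝟙 _ := by
      rw [← BraidedCategory.braiding_naturality_right]; monoidal
    _ = _ := by
      rw [← whisker_exchange]; simp only [slide]; monoidal

instance (X Y : Mod C H) : ModObj H (X.X ⊗ Y.X) := tensorMod X.X Y.X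

lemma lin {X Y : Mod C H} (f : X ⟶ Y) : hact H X.X ≫ f.hom = H ◁ f.hom ≫ hact H Y.X :=
  IsModHom.smul_hom (A := H) (f := f.hom)

/-- An `H`-linear morphism. -/
def mkHom {X Y : Mod C H} (f : X.X ⟶ Y.X) (hf : hact H X.X ≫ f = H ◁ f ≫ hact H Y.X) : X ⟶ Y :=
  Mod.Hom.mk' f hf

@[simp] lemma mkHom_hom {X Y : Mod C H} (f : X.X ⟶ Y.X)
    (hf : hact H X.X ≫ f = H ◁ f ≫ hact H Y.X) : (mkHom f hf).hom = f := rfl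

/-- An `H`-linear isomorphism. -/
def mkIso {X Y : Mod C H} (e : X.X ≅ Y.X) (hf : hact H X.X ≫ e.hom = H ◁ e.hom ≫ hact H Y.X) :
    X ≅ Y where
  hom := mkHom e.hom hf
  inv := mkHom e.inv (by
    rw [Iso.comp_inv_eq, Category.assoc, hf, ← whiskerLeft_comp_assoc]; simp)
  hom_inv_id := by ext; simp
  inv_hom_id := by ext; simp

instance : MonoidalCategoryStruct (Mod C H) where
  tensorObj X Y := ⟨X.X ⊗ Y.X⟩
  tensorUnit := letI := trivMod H (𝟙_ C); ⟨𝟙_ C⟩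
  tensorHom {X₁ Y₁ X₂ Y₂} f g := mkHom (f.hom ⊗ₘ g.hom) (by
    simp only [hact_tensor]
    calc
      _ = 𝟙 _ ⊗≫ slide H X₁.X ▷ X₂.X ⊗≫ X₁.X ◁ hact H X₂.X ⊗≫ (f.hom ▷ X₂.X ≫ Y₁.X ◁ g.hom) ⊗≫ 𝟙 _ := by
        rw [MonoidalCategory.tensorHom_def]; monoidal
      _ = 𝟙 _ ⊗≫ slide H X₁.X ▷ X₂.X ⊗≫ X₁.X ◁ (hact H X₂.X ≫ g.hom) ⊗≫ f.hom ▷ Y₂.X ⊗≫ 𝟙 _ := by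
        rw [← whisker_exchange]; monoidal
      _ = 𝟙 _ ⊗≫ slide H X₁.X ▷ X₂.X ⊗≫ X₁.X ◁ H ◁ g.hom ⊗≫ (X₁.X ◁ hact H Y₂.X ≫ f.hom ▷ Y₂.X) ⊗≫ 𝟙 _ := by
        rw [lin]; monoidal
      _ = 𝟙 _ ⊗≫ slide H X₁.X ▷ X₂.X ⊗≫ (X₁.X ◁ (H ◁ g.hom) ≫ f.hom ▷ (H ⊗ Y₂.X)) ⊗≫ Y₁.X ◁ hact H Y₂.X ⊗≫ 𝟙 _ := by
        rw [whisker_exchange]; monoidal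
      _ = 𝟙 _ ⊗≫ (slide H X₁.X ≫ f.hom ▷ H) ▷ X₂.X ⊗≫ (Y₁.X ⊗ H) ◁ g.hom ⊗≫ Y₁.X ◁ hact H Y₂.X ⊗≫ 𝟙 _ := by
        rw [whisker_exchange]; monoidal
      _ = 𝟙 _ ⊗≫ H ◁ f.hom ▷ X₂.X ⊗≫ (slide H Y₁.X ▷ X₂.X ≫ (Y₁.X ⊗ H) ◁ g.hom) ⊗≫ Y₁.X ◁ hact H Y₂.X ⊗≫ 𝟙 _ := by
        rw [slide_natural _ (lin f)]; monoidal
      _ = _ := by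
        rw [← whisker_exchange, MonoidalCategory.tensorHom_def]; monoidal)
  whiskerLeft X Y₁ Y₂ g := mkHom (X.X ◁ g.hom) (by
    simp only [hact_tensor]
    calc
      _ = 𝟙 _ ⊗≫ slide H X.X ▷ Y₁.X ⊗≫ X.X ◁ (hact H Y₁.X ≫ g.hom) ⊗≫ 𝟙 _ := by monoidal
      _ = 𝟙 _ ⊗≫ (slide H X.X ▷ Y₁.X ≫ (X.X ⊗ H) ◁ g.hom) ⊗≫ X.X ◁ hact H Y₂.X ⊗≫ 𝟙 _ := by
        rw [lin]; monoidal
      _ = _ := by rw [← whisker_exchange]; monoidal)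
  whiskerRight {X₁ X₂} f Y := mkHom (f.hom ▷ Y.X) (by
    simp only [hact_tensor]
    calc
      _ = 𝟙 _ ⊗≫ slide H X₁.X ▷ Y.X ⊗≫ (X₁.X ◁ hact H Y.X ≫ f.hom ▷ Y.X) ⊗≫ 𝟙 _ := by monoidal
      _ = 𝟙 _ ⊗≫ (slide H X₁.X ≫ f.hom ▷ H) ▷ Y.X ⊗≫ X₂.X ◁ hact H Y.X ⊗≫ 𝟙 _ := by
        rw [whisker_exchange]; monoidal
      _ = _ := by rw [slide_natural _ (lin f)]; monoidal)
  associator X Y Z := mkIso (α_ X.X Y.X Z.X) (by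
    simp only [hact_tensor, slide_tensor]
    monoidal)
  leftUnitor X := mkIso (λ_ X.X) (by
    simp only [hact_tensor, slide_triv, braiding_tensorUnit_right]
    monoidal)
  rightUnitor X := mkIso (ρ_ X.X) (by
    simp only [hact_tensor, hact_triv]
    calc
      _ = 𝟙 _ ⊗≫ (slide H X.X ≫ X.X ◁ ε[H]) ⊗≫ 𝟙 _ := by monoidal
      _ = _ := by rw [slide_counit]; monoidal)

@[simp] lemma tensor_X (X Y : Mod C H) : (X ⊗ Y).X = X.X ⊗ Y.X := rfl

@[simp] lemma tensorHom_hom {X₁ Y₁ X₂ Y₂ : Mod C H} (f : X₁ ⟶ Y₁) (g : X₂ ⟶ Y₂) :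
    (f ⊗ₘ g).hom = f.hom ⊗ₘ g.hom := rfl

@[simp] lemma whiskerLeft_hom (X : Mod C H) {Y₁ Y₂ : Mod C H} (g : Y₁ ⟶ Y₂) :
    (X ◁ g).hom = X.X ◁ g.hom := rfl

@[simp] lemma whiskerRight_hom {X₁ X₂ : Mod C H} (f : X₁ ⟶ X₂) (Y : Mod C H) :
    (f ▷ Y).hom = f.hom ▷ Y.X := rfl

@[simp] lemma associator_hom_hom (X Y Z : Mod C H) :
    (α_ X Y Z).hom.hom = (α_ X.X Y.X Z.X).hom := rfl

@[simp] lemma associator_inv_hom (X Y Z : Mod C H) :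
    (α_ X Y Z).inv.hom = (α_ X.X Y.X Z.X).inv := rfl

@[simp] lemma leftUnitor_hom_hom (X : Mod C H) : (λ_ X).hom.hom = (λ_ X.X).hom := rfl

@[simp] lemma leftUnitor_inv_hom (X : Mod C H) : (λ_ X).inv.hom = (λ_ X.X).inv := rfl

@[simp] lemma rightUnitor_hom_hom (X : Mod C H) : (ρ_ X).hom.hom = (ρ_ X.X).hom := rfl

@[simp] lemma rightUnitor_inv_hom (X : Mod C H) : (ρ_ X).inv.hom = (ρ_ X.X).inv := rfl

/-- Left `H`-modules with the diagonal action. -/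
instance : MonoidalCategory (Mod C H) where
  tensorHom_def f g := by
    apply Mod.hom_ext; exact MonoidalCategory.tensorHom_def f.hom g.hom
  id_tensorHom_id X Y := by
    apply Mod.hom_ext; exact MonoidalCategory.id_tensorHom_id X.X Y.X
  tensorHom_comp_tensorHom f₁ f₂ g₁ g₂ := by
    apply Mod.hom_ext
    exact MonoidalCategory.tensorHom_comp_tensorHom f₁.hom f₂.hom g₁.hom g₂.hom
  whiskerLeft_id X Y := by
    apply Mod.hom_ext; exact MonoidalCategory.whiskerLeft_id X.X Y.X
  id_whiskerRight X Y := by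
    apply Mod.hom_ext; exact MonoidalCategory.id_whiskerRight X.X Y.X
  associator_naturality f₁ f₂ f₃ := by
    apply Mod.hom_ext; exact MonoidalCategory.associator_naturality f₁.hom f₂.hom f₃.hom
  leftUnitor_naturality f := by
    apply Mod.hom_ext; exact MonoidalCategory.leftUnitor_naturality f.hom
  rightUnitor_naturality f := by
    apply Mod.hom_ext; exact MonoidalCategory.rightUnitor_naturality f.hom
  pentagon W X Y Z := by
    apply Mod.hom_ext; exact MonoidalCategory.pentagon W.X X.X Y.X Z.X
  triangle X Y := by
    apply Mod.hom_ext; exact MonoidalCategory.triangle X.X Y.X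

end Modules

section Closed

variable {C : Type u} [Category.{v} C] [MonoidalCategory C] [BraidedCategory C]

/-- The braiding of `C` is `H`-linear: for all left `H`-modules `X` and `Y`, the braiding
`X ⊗ Y ⟶ Y ⊗ X` is a morphism of `H`-modules for the diagonal actions. -/
class BraidingLinear (H : C) [HopfObj H] : Prop where
  braiding_linear : ∀ X Y : Mod C H,
    hact H (X.X ⊗ Y.X) ≫ (β_ X.X Y.X).hom = H ◁ (β_ X.X Y.X).hom ≫ hact H (Y.X ⊗ X.X)

variable {H : C} [HopfObj H] [BraidingLinear H]

/-- The category of left `H`-modules with the braiding of `C`. -/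
instance : BraidedCategory (Mod C H) where
  braiding X Y := mkIso (β_ X.X Y.X) (BraidingLinear.braiding_linear X Y)
  braiding_naturality_right X Y Z f := by
    apply Mod.hom_ext; exact BraidedCategory.braiding_naturality_right X.X f.hom
  braiding_naturality_left f Z := by
    apply Mod.hom_ext; exact BraidedCategory.braiding_naturality_left f.hom Z.X
  hexagon_forward X Y Z := by
    apply Mod.hom_ext; exact BraidedCategory.hexagon_forward X.X Y.X Z.X
  hexagon_reverse X Y Z := by
    apply Mod.hom_ext; exact BraidedCategory.hexagon_reverse X.X Y.X Z.X

@[simp] lemma braiding_hom_hom (X Y : Mod C H) : (β_ X Y).hom.hom = (β_ X.X Y.X).hom := rfl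

/-- `h ⊗ x ↦ h₁ ⊗ h₂ x`. -/
def fusion (H : C) [HopfObj H] (X : C) [ModObj H X] : H ⊗ X ≅ H ⊗ X where
  hom := Δ[H] ▷ X ≫ (α_ H H X).hom ≫ H ◁ hact H X
  inv := Δ[H] ▷ X ≫ (α_ H H X).hom ≫ H ◁ (𝒮[H] ▷ X ≫ hact H X)
  hom_inv_id := by
    calc
      _ = 𝟙 _ ⊗≫ Δ[H] ▷ X ⊗≫ (H ◁ hact H X ≫ Δ[H] ▷ X) ⊗≫ H ◁ (𝒮[H] ▷ X) ⊗≫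
          H ◁ hact H X := by monoidal
      _ = 𝟙 _ ⊗≫ (Δ[H] ≫ Δ[H] ▷ H) ▷ X ⊗≫ H ◁ (H ◁ hact H X ≫ 𝒮[H] ▷ X) ⊗≫
          H ◁ hact H X := by
        rw [whisker_exchange Δ[H] (hact H X)]; monoidal
      _ = 𝟙 _ ⊗≫ (Δ[H] ≫ Δ[H] ▷ H) ▷ X ⊗≫ H ◁ (𝒮[H] ▷ (H ⊗ X)) ⊗≫ H ◁ (H ◁ hact H X ≫
          hact H X) ⊗≫ 𝟙 _ := by
        rw [whisker_exchange]; monoidal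
      _ = 𝟙 _ ⊗≫ (Δ[H] ≫ Δ[H] ▷ H ≫ (α_ H H H).hom) ▷ X ⊗≫ H ◁ (𝒮[H] ▷ (H ⊗ X)) ⊗≫
          H ◁ (μ[H] ▷ X ≫ hact H X) ⊗≫ 𝟙 _ := by
        rw [mul_hact]; monoidal
      _ = 𝟙 _ ⊗≫ Δ[H] ▷ X ⊗≫ H ◁ (Δ[H] ≫ 𝒮[H] ▷ H ≫ μ[H]) ▷ X ⊗≫
          H ◁ hact H X ⊗≫ 𝟙 _ := by
        rw [← ComonObj.comul_assoc]; monoidal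
      _ = 𝟙 _ ⊗≫ (Δ[H] ≫ H ◁ ε[H]) ▷ X ⊗≫ H ◁ (η[H] ▷ X ≫ hact H X) ⊗≫ 𝟙 _ := by
        rw [HopfObj.antipode_left]; monoidal
      _ = _ := by
        rw [one_hact, ComonObj.comul_counit]; monoidal
  inv_hom_id := by
    calc
      _ = 𝟙 _ ⊗≫ Δ[H] ▷ X ⊗≫ (H ◁ (𝒮[H] ▷ X ≫ hact H X) ≫ Δ[H] ▷ X) ⊗≫
          H ◁ hact H X := by monoidal
      _ = 𝟙 _ ⊗≫ (Δ[H] ≫ Δ[H] ▷ H) ▷ X ⊗≫ H ◁ (H ◁ (𝒮[H] ▷ X)) ⊗≫ H ◁ (H ◁ hact H X ≫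
          hact H X) ⊗≫ 𝟙 _ := by
        rw [whisker_exchange Δ[H]]; monoidal
      _ = 𝟙 _ ⊗≫ (Δ[H] ≫ Δ[H] ▷ H ≫ (α_ H H H).hom) ▷ X ⊗≫ H ◁ (H ◁ (𝒮[H] ▷ X)) ⊗≫
          H ◁ (μ[H] ▷ X ≫ hact H X) ⊗≫ 𝟙 _ := by
        rw [mul_hact]; monoidal
      _ = 𝟙 _ ⊗≫ Δ[H] ▷ X ⊗≫ H ◁ (Δ[H] ≫ H ◁ 𝒮[H] ≫ μ[H]) ▷ X ⊗≫
          H ◁ hact H X ⊗≫ 𝟙 _ := by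
        rw [← ComonObj.comul_assoc]; monoidal
      _ = 𝟙 _ ⊗≫ (Δ[H] ≫ H ◁ ε[H]) ▷ X ⊗≫ H ◁ (η[H] ▷ X ≫ hact H X) ⊗≫ 𝟙 _ := by
        rw [HopfObj.antipode_right]; monoidal
      _ = _ := by
        rw [one_hact, ComonObj.comul_counit]; monoidal

lemma slide_regular_one (H : C) [HopfObj H] :
    letI := ModObj.regular H
    H ◁ η[H] ≫ slide H H = (ρ_ H).hom ≫ Δ[H] := by
  let := ModObj.regular H
  have e : hact H H = μ[H] := rfl
  calc
    _ = 𝟙 _ ⊗≫ (H ◁ η[H] ≫ Δ[H] ▷ H) ⊗≫ H ◁ (β_ H H).hom ⊗≫ μ[H] ▷ H ⊗≫ 𝟙 _ := by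
      simp only [slide, e]; monoidal
    _ = 𝟙 _ ⊗≫ Δ[H] ▷ (𝟙_ C) ⊗≫ H ◁ (H ◁ η[H] ≫ (β_ H H).hom) ⊗≫ μ[H] ▷ H ⊗≫ 𝟙 _ := by
      rw [whisker_exchange]; monoidal
    _ = 𝟙 _ ⊗≫ Δ[H] ⊗≫ (H ◁ η[H] ≫ μ[H]) ▷ H ⊗≫ 𝟙 _ := by
      rw [BraidedCategory.braiding_naturality_right, braiding_tensorUnit_right]; monoidal
    _ = _ := by
      rw [MonObj.mul_one]; monoidal

lemma slide_eq (X : C) [ModObj H X] :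
    slide H X = (fusion H X).hom ≫ (β_ H X).hom := by
  let := ModObj.regular H
  have e : hact H H = μ[H] := rfl
  have h : ((α_ H H X).inv ≫ slide H H ▷ X ≫ (α_ H H X).hom ≫ H ◁ hact H X) ≫ (β_ H X).hom =
      H ◁ (β_ H X).hom ≫ (α_ H X H).inv ≫ slide H X ▷ H ≫ (α_ X H H).hom ≫ X ◁ hact H H :=
    BraidingLinear.braiding_linear (H := H) (Mod.regular H) ⟨X⟩
  symm
  calc
    _ = 𝟙 _ ⊗≫ ((ρ_ H).hom ≫ Δ[H]) ▷ X ⊗≫ H ◁ hact H X ⊗≫ (β_ H X).hom ⊗≫ 𝟙 _ := by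
      simp only [fusion]; monoidal
    _ = 𝟙 _ ⊗≫ H ◁ η[H] ▷ X ⊗≫ (((α_ H H X).inv ≫ slide H H ▷ X ≫ (α_ H H X).hom ≫
          H ◁ hact H X) ≫ (β_ H X).hom) ⊗≫ 𝟙 _ := by
      rw [← slide_regular_one]; monoidal
    _ = 𝟙 _ ⊗≫ H ◁ (η[H] ▷ X ≫ (β_ H X).hom) ⊗≫ slide H X ▷ H ⊗≫ X ◁ μ[H] ⊗≫ 𝟙 _ := by
      rw [h, e]; monoidal
    _ = 𝟙 _ ⊗≫ ((H ⊗ X) ◁ η[H] ≫ slide H X ▷ H) ⊗≫ X ◁ μ[H] ⊗≫ 𝟙 _ := by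
      rw [BraidedCategory.braiding_naturality_left, braiding_tensorUnit_left]; monoidal
    _ = 𝟙 _ ⊗≫ slide H X ⊗≫ X ◁ (H ◁ η[H] ≫ μ[H]) ⊗≫ 𝟙 _ := by
      rw [whisker_exchange]; monoidal
    _ = _ := by
      rw [MonObj.mul_one]; monoidal

/-- `slide` as an isomorphism. -/
def slideIso (H : C) [HopfObj H] [BraidingLinear H] (X : C) [ModObj H X] : H ⊗ X ≅ X ⊗ H :=
  fusion H X ≪≫ β_ H X

@[simp] lemma slideIso_hom (X : C) [ModObj H X] : (slideIso H X).hom = slide H X :=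
  (slide_eq X).symm

variable [MonoidalClosed C]

open MonoidalClosed

/-- The evaluation `P ⊗ [P, Q] ⟶ Q`. -/
def evHom (P Q : C) : P ⊗ (ihom P).obj Q ⟶ Q := (ihom.ev P).app Q

lemma uncurry_eq' {X P Q : C} (g : X ⟶ (ihom P).obj Q) : uncurry g = P ◁ g ≫ evHom P Q :=
  uncurry_eq g

/-- The action of `H` on the inner hom `[P, Q]`, characterised by the `H`-linearity of the
evaluation `P ⊗ [P, Q] ⟶ Q`. -/
def ihomSmul (H : C) [HopfObj H] [BraidingLinear H] (P Q : C) [ModObj H P] [ModObj H Q] :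
    H ⊗ (ihom P).obj Q ⟶ (ihom P).obj Q :=
  curry ((α_ P H _).inv ≫ (slideIso H P).inv ▷ _ ≫ (α_ H P _).hom ≫
    H ◁ evHom P Q ≫ hact H Q)

lemma ihomSmul_ev (P Q : C) [ModObj H P] [ModObj H Q] :
    slide H P ▷ (ihom P).obj Q ≫ (α_ _ _ _).hom ≫ P ◁ ihomSmul H P Q ≫ evHom P Q =
      (α_ _ _ _).hom ≫ H ◁ evHom P Q ≫ hact H Q := by
  rw [← uncurry_eq', ihomSmul, uncurry_curry, Iso.hom_inv_id_assoc, ← slideIso_hom,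
    ← comp_whiskerRight_assoc, Iso.hom_inv_id]
  simp

lemma ihom_hom_ext {P Q X : C} (f g : X ⟶ (ihom P).obj Q)
    (h : P ◁ f ≫ evHom P Q = P ◁ g ≫ evHom P Q) : f = g :=
  uncurry_injective (by rw [uncurry_eq', uncurry_eq', h])

lemma slide_cancel {P X Y : C} [ModObj H P] {f g : P ⊗ (H ⊗ X) ⟶ Y}
    (h : slide H P ▷ X ≫ (α_ _ _ _).hom ≫ f = slide H P ▷ X ≫ (α_ _ _ _).hom ≫ g) : f = g := by
  rw [← slideIso_hom] at h
  rwa [cancel_epi, cancel_epi] at h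

/-- The `H`-module structure on the inner hom. -/
@[reducible]
def ihomMod (H : C) [HopfObj H] [BraidingLinear H] (P Q : C) [ModObj H P] [ModObj H Q] :
    ModObj H ((ihom P).obj Q) where
  smul := ihomSmul H P Q
  one_smul := by
    change η[H] ▷ (ihom P).obj Q ≫ ihomSmul H P Q = (λ_ _).hom
    apply ihom_hom_ext
    calc
      _ = 𝟙 _ ⊗≫ ((λ_ P).hom ≫ (ρ_ P).inv ≫ P ◁ η[H]) ▷ (ihom P).obj Q ⊗≫
          P ◁ ihomSmul H P Q ≫ evHom P Q := by monoidal
      _ = 𝟙 _ ⊗≫ η[H] ▷ P ▷ (ihom P).obj Q ⊗≫ (slide H P ▷ (ihom P).obj Q ≫ (α_ _ _ _).hom ≫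
          P ◁ ihomSmul H P Q ≫ evHom P Q) := by rw [← slide_one]; monoidal
      _ = 𝟙 _ ⊗≫ (η[H] ▷ (P ⊗ (ihom P).obj Q) ≫ H ◁ evHom P Q) ⊗≫ hact H Q := by
        rw [ihomSmul_ev]; monoidal
      _ = 𝟙 _ ⊗≫ evHom P Q ⊗≫ η[H] ▷ Q ≫ hact H Q := by
        rw [← whisker_exchange]; monoidal
      _ = _ := by rw [one_hact]; monoidal
  mul_smul := by
    change μ[H] ▷ (ihom P).obj Q ≫ ihomSmul H P Q =
      (α_ _ _ _).hom ≫ H ◁ ihomSmul H P Q ≫ ihomSmul H P Q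
    apply ihom_hom_ext
    let E := (ihom P).obj Q
    have key : (H ◁ slide H P ≫ (α_ H P H).inv ≫ slide H P ▷ H ≫ (α_ P H H).hom) ▷ E ≫
        (α_ _ _ _).hom ≫ P ◁ (μ[H] ▷ E ≫ ihomSmul H P Q) ≫ evHom P Q =
        (H ◁ slide H P ≫ (α_ H P H).inv ≫ slide H P ▷ H ≫ (α_ P H H).hom) ▷ E ≫
        (α_ _ _ _).hom ≫ P ◁ ((α_ _ _ _).hom ≫ H ◁ ihomSmul H P Q ≫ ihomSmul H P Q) ≫
          evHom P Q := by
      trans 𝟙 _ ⊗≫ H ◁ H ◁ evHom P Q ⊗≫ H ◁ hact H Q ⊗≫ hact H Q ⊗≫ 𝟙 _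
      · calc
          _ = 𝟙 _ ⊗≫ ((α_ _ _ _).hom ≫ H ◁ slide H P ≫ (α_ H P H).inv ≫ slide H P ▷ H ≫
              (α_ P H H).hom ≫ P ◁ μ[H]) ▷ E ⊗≫ P ◁ ihomSmul H P Q ⊗≫ evHom P Q := by
            monoidal
          _ = 𝟙 _ ⊗≫ μ[H] ▷ P ▷ E ⊗≫ (slide H P ▷ E ≫ (α_ _ _ _).hom ≫
              P ◁ ihomSmul H P Q ≫ evHom P Q) := by
            rw [← slide_mul]; monoidal
          _ = 𝟙 _ ⊗≫ (μ[H] ▷ (P ⊗ E) ≫ H ◁ evHom P Q) ⊗≫ hact H Q := by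
            rw [ihomSmul_ev]; monoidal
          _ = 𝟙 _ ⊗≫ (H ⊗ H) ◁ evHom P Q ⊗≫ μ[H] ▷ Q ≫ hact H Q := by
            rw [← whisker_exchange]; monoidal
          _ = _ := by rw [mul_hact]; monoidal
      · symm
        calc
          _ = 𝟙 _ ⊗≫ H ◁ slide H P ▷ E ⊗≫ (slide H P ▷ (H ⊗ E) ≫ (P ⊗ H) ◁ ihomSmul H P Q) ⊗≫
              P ◁ ihomSmul H P Q ⊗≫ evHom P Q := by monoidal
          _ = 𝟙 _ ⊗≫ H ◁ slide H P ▷ E ⊗≫ H ◁ (P ◁ ihomSmul H P Q) ⊗≫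
              (slide H P ▷ E ≫ (α_ _ _ _).hom ≫ P ◁ ihomSmul H P Q ≫ evHom P Q) := by
            rw [← whisker_exchange]; monoidal
          _ = 𝟙 _ ⊗≫ H ◁ (slide H P ▷ E ≫ (α_ _ _ _).hom ≫ P ◁ ihomSmul H P Q ≫
              evHom P Q) ⊗≫ hact H Q := by
            conv_lhs => rw [ihomSmul_ev]
            monoidal
          _ = _ := by
            rw [ihomSmul_ev]; monoidal
    simpa only [← slideIso_hom, cancel_epi] using key

lemma curry_lin {X P Q : C} [ModObj H X] [ModObj H P] [ModObj H Q] (f : P ⊗ X ⟶ Q)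
    (hf : letI := tensorMod (H := H) P X; hact H (P ⊗ X) ≫ f = H ◁ f ≫ hact H Q) :
    hact H X ≫ curry f = H ◁ curry f ≫ ihomSmul H P Q := by
  have hf' : ((α_ H P X).inv ≫ slide H P ▷ X ≫ (α_ P H X).hom ≫ P ◁ hact H X) ≫ f =
    H ◁ f ≫ hact H Q := hf
  have hc : P ◁ curry f ≫ evHom P Q = f := by rw [← uncurry_eq', uncurry_curry]
  apply ihom_hom_ext
  apply slide_cancel
  calc
    _ = 𝟙 _ ⊗≫ slide H P ▷ X ⊗≫ P ◁ hact H X ⊗≫ (P ◁ curry f ≫ evHom P Q) := by monoidal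
    _ = 𝟙 _ ⊗≫ (((α_ H P X).inv ≫ slide H P ▷ X ≫ (α_ P H X).hom ≫ P ◁ hact H X) ≫ f) := by
      rw [hc]; monoidal
    _ = 𝟙 _ ⊗≫ H ◁ (P ◁ curry f ≫ evHom P Q) ⊗≫ hact H Q := by
      rw [hf', hc]; monoidal
    _ = 𝟙 _ ⊗≫ (H ⊗ P) ◁ curry f ⊗≫ (slide H P ▷ _ ≫ (α_ _ _ _).hom ≫
        P ◁ ihomSmul H P Q ≫ evHom P Q) := by
      rw [ihomSmul_ev]; monoidal
    _ = 𝟙 _ ⊗≫ ((H ⊗ P) ◁ curry f ≫ slide H P ▷ _) ⊗≫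
        P ◁ ihomSmul H P Q ≫ evHom P Q := by monoidal
    _ = _ := by rw [whisker_exchange]; monoidal

lemma uncurry_lin {X P Q : C} [ModObj H X] [ModObj H P] [ModObj H Q] (g : X ⟶ (ihom P).obj Q)
    (hg : hact H X ≫ g = H ◁ g ≫ ihomSmul H P Q) :
    letI := tensorMod (H := H) P X
    hact H (P ⊗ X) ≫ uncurry g = H ◁ uncurry g ≫ hact H Q := by
  let := tensorMod (H := H) P X
  rw [hact_tensor, uncurry_eq']
  calc
    _ = 𝟙 _ ⊗≫ slide H P ▷ X ⊗≫ P ◁ (hact H X ≫ g) ⊗≫ evHom P Q := by monoidal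
    _ = 𝟙 _ ⊗≫ (slide H P ▷ X ≫ (P ⊗ H) ◁ g) ⊗≫
        P ◁ ihomSmul H P Q ⊗≫ evHom P Q := by
      rw [hg]; monoidal
    _ = 𝟙 _ ⊗≫ (H ⊗ P) ◁ g ⊗≫ (slide H P ▷ _ ≫ (α_ _ _ _).hom ≫
        P ◁ ihomSmul H P Q ≫ evHom P Q) := by
      rw [← whisker_exchange]; monoidal
    _ = _ := by rw [ihomSmul_ev]; monoidal

/-- The inner hom of two left `H`-modules. -/
def ihomObj (P Q : Mod C H) : Mod C H :=
  letI := ihomMod H P.X Q.X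
  ⟨(ihom P.X).obj Q.X⟩

/-- `H`-linear morphisms `P ⊗ X ⟶ Q` correspond to `H`-linear morphisms `X ⟶ [P, Q]`. -/
def ihomEquiv (P X Q : Mod C H) : (P ⊗ X ⟶ Q) ≃ (X ⟶ ihomObj P Q) where
  toFun f := mkHom (Y := ihomObj P Q) (curry f.hom) (curry_lin f.hom (lin f))
  invFun g := mkHom (X := P ⊗ X) (uncurry (A := P.X) g.hom)
    (uncurry_lin (P := P.X) (Q := Q.X) g.hom (lin g))
  left_inv f := by apply Mod.hom_ext; exact uncurry_curry f.hom
  right_inv g := by apply Mod.hom_ext; exact curry_uncurry (A := P.X) (X := X.X) (Y := Q.X) g.hom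

instance : MonoidalClosed (Mod C H) where
  closed P :=
    { rightAdj := Adjunction.rightAdjointOfEquiv (F := tensorLeft P) (ihomEquiv P) (by
        intro X' X Y f g
        apply Mod.hom_ext
        exact curry_natural_left f.hom g.hom)
      adj := Adjunction.adjunctionOfEquivRight _ _ }

end Closed

section Brauer

variable {D : Type u} [Category.{v} D] [MonoidalCategory D] [BraidedCategory D]
  [MonoidalClosed D]

open MonoidalClosed

/-- The evaluation `[P, Q] ⊗ P ⟶ Q`, exhibiting `[P, -]` as a right adjoint of `- ⊗ P`. -/
def lev (P Q : D) : (ihom P).obj Q ⊗ P ⟶ Q := (β_ _ P).hom ≫ evHom P Q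

/-- The morphism `X ⟶ [P, Q]` corresponding to a morphism `X ⊗ P ⟶ Q`. -/
def lcurry {X P Q : D} (f : X ⊗ P ⟶ Q) : X ⟶ (ihom P).obj Q := curry ((β_ X P).inv ≫ f)

lemma lcurry_lev {X P Q : D} (f : X ⊗ P ⟶ Q) : lcurry f ▷ P ≫ lev P Q = f := by
  rw [lev, BraidedCategory.braiding_naturality_left_assoc, ← uncurry_eq', lcurry, uncurry_curry,
    Iso.hom_inv_id_assoc]

lemma lev_ext {X P Q : D} {f g : X ⟶ (ihom P).obj Q} (h : f ▷ P ≫ lev P Q = g ▷ P ≫ lev P Q) :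
    f = g := by
  apply uncurry_injective
  rw [uncurry_eq', uncurry_eq', ← cancel_epi (β_ X P).hom]
  simpa [lev, BraidedCategory.braiding_naturality_left_assoc] using h

/-- Composition `[Q, R] ⊗ [P, Q] ⟶ [P, R]`. -/
def icomp (P Q R : D) : (ihom Q).obj R ⊗ (ihom P).obj Q ⟶ (ihom P).obj R :=
  lcurry ((α_ _ _ _).hom ≫ (ihom Q).obj R ◁ lev P Q ≫ lev Q R)

lemma icomp_lev (P Q R : D) : icomp P Q R ▷ P ≫ lev P R =
    (α_ _ _ _).hom ≫ (ihom Q).obj R ◁ lev P Q ≫ lev Q R := lcurry_lev _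

/-- The algebra `[P, P]` of inner endomorphisms of `P`. -/
def iEnd (P : D) : Mon D where
  X := (ihom P).obj P
  mon :=
    { one := lcurry (λ_ P).hom
      mul := icomp P P P
      one_mul := by
        apply lev_ext
        calc
          _ = 𝟙 _ ⊗≫ lcurry (λ_ P).hom ▷ (ihom P).obj P ▷ P ⊗≫ icomp P P P ▷ P ≫ lev P P := by
            monoidal
          _ = 𝟙 _ ⊗≫ (lcurry (λ_ P).hom ▷ ((ihom P).obj P ⊗ P) ≫ (ihom P).obj P ◁ lev P P) ⊗≫
              lev P P := by rw [icomp_lev]; monoidal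
          _ = 𝟙 _ ⊗≫ lev P P ⊗≫ lcurry (λ_ P).hom ▷ P ≫ lev P P := by
            rw [← whisker_exchange]; monoidal
          _ = _ := by rw [lcurry_lev]; monoidal
      mul_one := by
        apply lev_ext
        calc
          _ = 𝟙 _ ⊗≫ (ihom P).obj P ◁ lcurry (λ_ P).hom ▷ P ⊗≫ icomp P P P ▷ P ≫ lev P P := by
            monoidal
          _ = 𝟙 _ ⊗≫ (ihom P).obj P ◁ (lcurry (λ_ P).hom ▷ P ≫ lev P P) ⊗≫ lev P P := by
            rw [icomp_lev]; monoidal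
          _ = _ := by rw [lcurry_lev]; monoidal
      mul_assoc := by
        apply lev_ext
        trans 𝟙 _ ⊗≫ (ihom P).obj P ◁ (ihom P).obj P ◁ lev P P ⊗≫ (ihom P).obj P ◁ lev P P ⊗≫
          lev P P
        · calc
            _ = 𝟙 _ ⊗≫ icomp P P P ▷ (ihom P).obj P ▷ P ⊗≫ (icomp P P P ▷ P ≫ lev P P) := by
              monoidal
            _ = 𝟙 _ ⊗≫ (icomp P P P ▷ ((ihom P).obj P ⊗ P) ≫ (ihom P).obj P ◁ lev P P) ⊗≫
                lev P P := by rw [icomp_lev]; monoidal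
            _ = 𝟙 _ ⊗≫ ((ihom P).obj P ⊗ (ihom P).obj P) ◁ lev P P ⊗≫
                (icomp P P P ▷ P ≫ lev P P) := by rw [← whisker_exchange]; monoidal
            _ = _ := by rw [icomp_lev]; monoidal
        · symm
          calc
            _ = 𝟙 _ ⊗≫ (ihom P).obj P ◁ icomp P P P ▷ P ⊗≫ (icomp P P P ▷ P ≫ lev P P) := by
              monoidal
            _ = 𝟙 _ ⊗≫ (ihom P).obj P ◁ (icomp P P P ▷ P ≫ lev P P) ⊗≫ lev P P := by
              conv_lhs => rw [icomp_lev]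
              monoidal
            _ = _ := by rw [icomp_lev]; monoidal }

/-- `P` is finite if the canonical morphism `P ⊗ [P, I] ⟶ [P, P]` is an isomorphism. -/
def IsFinite (P : D) : Prop :=
  IsIso (lcurry ((α_ _ _ _).hom ≫ P ◁ lev P (𝟙_ D) ≫ (ρ_ P).hom) :
    P ⊗ (ihom P).obj (𝟙_ D) ⟶ (ihom P).obj P)

/-- `P` is faithfully projective if it is finite and evaluation induces an isomorphism
`[P, I] ⊗_{[P, P]} P ≅ I`, that is, `[P, I] ⊗ P ⟶ I` is the coequalizer of the actions of `[P, P]`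
on `[P, I]` and on `P`. -/
def FaithfullyProjective (P : D) : Prop :=
  IsFinite P ∧
    ∃ w : icomp P P (𝟙_ D) ▷ P ≫ lev P (𝟙_ D) =
        ((α_ _ _ _).hom ≫ (ihom P).obj (𝟙_ D) ◁ lev P P) ≫ lev P (𝟙_ D),
      Nonempty (IsColimit (Cofork.ofπ (lev P (𝟙_ D)) w))

/-- The morphism `A ⊗ Ā ⟶ [A, A]` sending `a ⊗ b` to `c ↦ a (b ·ᵒᵖ c)`, where `·ᵒᵖ` is the
multiplication of the opposite algebra `Ā`. -/
def azumayaF (A : D) [MonObj A] : A ⊗ A ⟶ (ihom A).obj A :=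
  lcurry ((α_ A A A).hom ≫ A ◁ ((β_ A A).hom ≫ μ[A]) ≫ μ[A])

/-- The morphism `Ā ⊗ A ⟶ {A, A}` sending `a ⊗ b` to `c ↦ (c ·ᵒᵖ a) b`, where `{A, -}` is right
adjoint to `A ⊗ -` and `·ᵒᵖ` is the multiplication of the opposite algebra `Ā`. -/
def azumayaG (A : D) [MonObj A] : A ⊗ A ⟶ (ihom A).obj A :=
  curry ((α_ A A A).inv ≫ ((β_ A A).hom ≫ μ[A]) ▷ A ≫ μ[A])

/-- `A` is an Azumaya algebra. -/
def IsAzumaya (A : Mon D) : Prop :=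
  FaithfullyProjective A.X ∧ IsIso (azumayaF A.X) ∧ IsIso (azumayaG A.X)

variable (D) in
/-- The Azumaya algebras of `D`. -/
def Azumaya : Type (max u v) := {A : Mon D // IsAzumaya A}

/-- Brauer equivalence: `A ⊗ [P, P] ≅ B ⊗ [Q, Q]` for some faithfully projective `P`, `Q`. -/
def BrauerEquiv (A B : Azumaya D) : Prop :=
  ∃ P Q : D, FaithfullyProjective P ∧ FaithfullyProjective Q ∧
    Nonempty (A.1 ⊗ iEnd P ≅ B.1 ⊗ iEnd Q)

variable (D) in
/-- The underlying set of the Brauer group of `D`. -/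
def Br : Type (max u v) := Quot (BrauerEquiv (D := D))

/-- The Brauer class of an Azumaya algebra. -/
def Br.mk (A : Azumaya D) : Br D := Quot.mk _ A

end Brauer

section HBrauer

variable {C : Type u} [Category.{v} C] [MonoidalCategory C] [BraidedCategory C]
variable {H : C} [HopfObj H]

/-- An algebra of `C` with the trivial action of `H`. -/
def trivAlg (H : C) [HopfObj H] (A : Mon C) : Mon (Mod C H) :=
  letI := trivMod H A.X
  { X := ⟨A.X⟩
    mon :=
      { one := mkHom (X := 𝟙_ (Mod C H)) η[A.X] (by
          change (ε[H] ▷ 𝟙_ C ≫ (λ_ _).hom) ≫ η[A.X] = H ◁ η[A.X] ≫ ε[H] ▷ A.X ≫ (λ_ _).hom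
          rw [whisker_exchange_assoc]; simp)
        mul := mkHom (X := (⟨A.X⟩ : Mod C H) ⊗ ⟨A.X⟩) μ[A.X] (by
          change ((α_ _ _ _).inv ≫ slide H A.X ▷ A.X ≫ (α_ _ _ _).hom ≫
            A.X ◁ (ε[H] ▷ A.X ≫ (λ_ A.X).hom)) ≫ μ[A.X] = H ◁ μ[A.X] ≫ ε[H] ▷ A.X ≫ (λ_ _).hom
          calc
            _ = 𝟙 _ ⊗≫ ((β_ H A.X).hom ≫ A.X ◁ ε[H]) ▷ A.X ⊗≫ μ[A.X] := by
              rw [slide_triv]; monoidal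
            _ = 𝟙 _ ⊗≫ ε[H] ▷ (A.X ⊗ A.X) ≫ (𝟙_ C) ◁ μ[A.X] ⊗≫ 𝟙 _ := by
              rw [← BraidedCategory.braiding_naturality_left, braiding_tensorUnit_left]; monoidal
            _ = _ := by rw [whisker_exchange_assoc]; monoidal)
        one_mul := by apply Mod.hom_ext; exact MonObj.one_mul A.X
        mul_one := by apply Mod.hom_ext; exact MonObj.mul_one A.X
        mul_assoc := by apply Mod.hom_ext; exact MonObj.mul_assoc A.X } }

/-- The unit of the underlying algebra. -/
def uone (A : Mon (Mod C H)) : 𝟙_ C ⟶ A.X.X := (η[A.X] : 𝟙_ (Mod C H) ⟶ A.X).hom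

/-- The multiplication of the underlying algebra. -/
def umul (A : Mon (Mod C H)) : A.X.X ⊗ A.X.X ⟶ A.X.X := (μ[A.X] : A.X ⊗ A.X ⟶ A.X).hom

/-- The underlying algebra of an `H`-module algebra. -/
def underlying (A : Mon (Mod C H)) : Mon C where
  X := A.X.X
  mon :=
    { one := uone A
      mul := umul A
      one_mul := congrArg Mod.Hom.hom (MonObj.one_mul A.X)
      mul_one := congrArg Mod.Hom.hom (MonObj.mul_one A.X)
      mul_assoc := congrArg Mod.Hom.hom (MonObj.mul_assoc A.X) }

/-- The action of `H` on `A` is inner: there is a convolution invertible `f : H ⟶ A`, with inverse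
`g`, such that `h · a = f(h₁) a g(h₂)`. -/
def IsInner (A : Mon (Mod C H)) : Prop :=
  ∃ f g : H ⟶ A.X.X,
    Δ[H] ≫ (f ⊗ₘ g) ≫ umul A = ε[H] ≫ uone A ∧
    Δ[H] ≫ (g ⊗ₘ f) ≫ umul A = ε[H] ≫ uone A ∧
    hact H A.X.X = Δ[H] ▷ A.X.X ≫ (α_ H H A.X.X).hom ≫ H ◁ (β_ H A.X.X).hom ≫
      (f ⊗ₘ (A.X.X ◁ g)) ≫ A.X.X ◁ umul A ≫ umul A

/-- The multiplication of the smash product: `(a # h)(b # k) = a (h₁ b) # h₂ k`. -/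
def smashMul (A : Mon (Mod C H)) : (A.X.X ⊗ H) ⊗ (A.X.X ⊗ H) ⟶ A.X.X ⊗ H :=
  (α_ _ _ _).hom ≫ A.X.X ◁ ((α_ _ _ _).inv ≫ slide H A.X.X ▷ H ≫ (α_ _ _ _).hom) ≫
    (α_ _ _ _).inv ≫ (umul A ⊗ₘ μ[H])

lemma umul_assoc (A : Mon (Mod C H)) : umul A ▷ A.X.X ≫ umul A =
    (α_ _ _ _).hom ≫ A.X.X ◁ umul A ≫ umul A :=
  congrArg Mod.Hom.hom (MonObj.mul_assoc A.X)

lemma slide_uone (A : Mon (Mod C H)) : H ◁ uone A ≫ slide H A.X.X =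
    (β_ H (𝟙_ C)).hom ≫ uone A ▷ H := by
  have h := slide_natural (X := (𝟙_ (Mod C H)).X) (Y := A.X.X) (H := H) (uone A) (lin _)
  rw [← slide_triv (H := H)]
  exact h.symm

lemma slide_umul (A : Mon (Mod C H)) : H ◁ umul A ≫ slide H A.X.X =
    (α_ _ _ _).inv ≫ slide H A.X.X ▷ A.X.X ≫ (α_ _ _ _).hom ≫ A.X.X ◁ slide H A.X.X ≫
      (α_ _ _ _).inv ≫ umul A ▷ H := by
  have h := slide_natural (X := (A.X ⊗ A.X).X) (Y := A.X.X) (H := H) (umul A) (lin _)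
  have h2 := slide_tensor (H := H) A.X.X A.X.X
  rw [← h]
  simp only [← Category.assoc] at h2 ⊢
  exact congrArg (· ≫ umul A ▷ H) h2

lemma smashMul_eq (A : Mon (Mod C H)) : smashMul A = 𝟙 _ ⊗≫ A.X.X ◁ slide H A.X.X ▷ H ⊗≫
    umul A ▷ (H ⊗ H) ⊗≫ A.X.X ◁ μ[H] := by
  rw [smashMul, MonoidalCategory.tensorHom_def]; monoidal

lemma smashMul_assoc (A : Mon (Mod C H)) : smashMul A ▷ (A.X.X ⊗ H) ≫ smashMul A =
    (α_ _ _ _).hom ≫ (A.X.X ⊗ H) ◁ smashMul A ≫ smashMul A := by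
  trans 𝟙 _ ⊗≫ A.X.X ◁ (H ⊗ A.X.X) ◁ slide H A.X.X ▷ H ⊗≫
      A.X.X ◁ slide H A.X.X ▷ (A.X.X ⊗ H ⊗ H) ⊗≫
      (A.X.X ⊗ A.X.X) ◁ slide H A.X.X ▷ (H ⊗ H) ⊗≫
      (A.X.X ◁ umul A ≫ umul A) ▷ (H ⊗ H ⊗ H) ⊗≫ A.X.X ◁ (H ◁ μ[H] ≫ μ[H])
  · calc
      _ = 𝟙 _ ⊗≫ A.X.X ◁ slide H A.X.X ▷ (H ⊗ A.X.X ⊗ H) ⊗≫ umul A ▷ (H ⊗ H ⊗ A.X.X ⊗ H) ⊗≫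
          A.X.X ◁ (μ[H] ▷ A.X.X ≫ slide H A.X.X) ▷ H ⊗≫ umul A ▷ (H ⊗ H) ⊗≫ A.X.X ◁ μ[H] := by
        rw [smashMul_eq]; monoidal
      _ = 𝟙 _ ⊗≫ A.X.X ◁ slide H A.X.X ▷ (H ⊗ A.X.X ⊗ H) ⊗≫
          (umul A ▷ (H ⊗ (H ⊗ A.X.X) ⊗ H) ≫ A.X.X ◁ (H ◁ (slide H A.X.X ▷ H))) ⊗≫
          A.X.X ◁ slide H A.X.X ▷ (H ⊗ H) ⊗≫
          ((A.X.X ⊗ A.X.X) ◁ (μ[H] ▷ H) ≫ umul A ▷ (H ⊗ H)) ⊗≫ A.X.X ◁ μ[H] := by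
        rw [slide_mul]; monoidal
      _ = 𝟙 _ ⊗≫ A.X.X ◁ (slide H A.X.X ▷ ((H ⊗ A.X.X) ⊗ H) ≫
            (A.X.X ⊗ H) ◁ (slide H A.X.X ▷ H)) ⊗≫
          (umul A ▷ (H ⊗ (A.X.X ⊗ (H ⊗ H))) ≫ A.X.X ◁ ((α_ _ _ _).inv ≫
            slide H A.X.X ▷ (H ⊗ H))) ⊗≫
          umul A ▷ ((H ⊗ H) ⊗ H) ⊗≫ A.X.X ◁ (μ[H] ▷ H ≫ μ[H]) := by
        rw [← whisker_exchange, whisker_exchange (umul A) (μ[H] ▷ H)]; monoidal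
      _ = 𝟙 _ ⊗≫ A.X.X ◁ (H ⊗ A.X.X) ◁ slide H A.X.X ▷ H ⊗≫
          A.X.X ◁ slide H A.X.X ▷ (A.X.X ⊗ H ⊗ H) ⊗≫
          (A.X.X ⊗ A.X.X) ◁ slide H A.X.X ▷ (H ⊗ H) ⊗≫
          (umul A ▷ A.X.X ≫ umul A) ▷ (H ⊗ H ⊗ H) ⊗≫ A.X.X ◁ (μ[H] ▷ H ≫ μ[H]) := by
        rw [← whisker_exchange (slide H A.X.X) (slide H A.X.X ▷ H),
          ← whisker_exchange (umul A) ((α_ _ _ _).inv ≫ slide H A.X.X ▷ (H ⊗ H))]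
        monoidal
      _ = _ := by
        rw [umul_assoc, MonObj.mul_assoc]; monoidal
  · symm
    calc
      _ = 𝟙 _ ⊗≫ A.X.X ◁ (H ⊗ A.X.X) ◁ slide H A.X.X ▷ H ⊗≫
          A.X.X ◁ H ◁ umul A ▷ (H ⊗ H) ⊗≫
          A.X.X ◁ ((H ⊗ A.X.X) ◁ μ[H] ≫ slide H A.X.X ▷ H) ⊗≫ umul A ▷ (H ⊗ H) ⊗≫
          A.X.X ◁ μ[H] := by
        rw [smashMul_eq]; monoidal
      _ = 𝟙 _ ⊗≫ A.X.X ◁ (H ⊗ A.X.X) ◁ slide H A.X.X ▷ H ⊗≫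
          A.X.X ◁ (H ◁ umul A ≫ slide H A.X.X) ▷ (H ⊗ H) ⊗≫
          ((A.X.X ⊗ A.X.X) ◁ (H ◁ μ[H]) ≫ umul A ▷ (H ⊗ H)) ⊗≫ A.X.X ◁ μ[H] := by
        rw [whisker_exchange]; monoidal
      _ = _ := by
        rw [slide_umul, whisker_exchange (umul A)]; monoidal

/-- The smash product `A # H`. -/
def smash (A : Mon (Mod C H)) : Mon C where
  X := A.X.X ⊗ H
  mon :=
    { one := (λ_ _).inv ≫ (uone A ⊗ₘ η[H])
      mul := smashMul A
      one_mul := by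
        have h1 : uone A ▷ A.X.X ≫ umul A = (λ_ _).hom := congrArg Mod.Hom.hom (MonObj.one_mul A.X)
        calc
          _ = 𝟙 _ ⊗≫ (uone A ▷ (𝟙_ C) ≫ A.X.X ◁ η[H]) ▷ (A.X.X ⊗ H) ⊗≫
              A.X.X ◁ slide H A.X.X ▷ H ⊗≫ (umul A ▷ (H ⊗ H) ≫ A.X.X ◁ μ[H]) := by
            rw [smashMul, MonoidalCategory.tensorHom_def, MonoidalCategory.tensorHom_def]; monoidal
          _ = 𝟙 _ ⊗≫ uone A ▷ (A.X.X ⊗ H) ⊗≫ A.X.X ◁ (η[H] ▷ A.X.X ≫ slide H A.X.X) ▷ H ⊗≫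
              umul A ▷ (H ⊗ H) ≫ A.X.X ◁ μ[H] := by monoidal
          _ = 𝟙 _ ⊗≫ uone A ▷ (A.X.X ⊗ H) ⊗≫ ((A.X.X ⊗ A.X.X) ◁ η[H] ▷ H ≫
              umul A ▷ (H ⊗ H)) ⊗≫ A.X.X ◁ μ[H] := by rw [slide_one]; monoidal
          _ = 𝟙 _ ⊗≫ (uone A ▷ A.X.X ≫ umul A) ▷ H ⊗≫ A.X.X ◁ (η[H] ▷ H ≫ μ[H]) := by
            rw [whisker_exchange]; monoidal
          _ = _ := by rw [h1, MonObj.one_mul]; monoidal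
      mul_one := by
        have h1 : A.X.X ◁ uone A ≫ umul A = (ρ_ _).hom := congrArg Mod.Hom.hom (MonObj.mul_one A.X)
        calc
          _ = 𝟙 _ ⊗≫ A.X.X ◁ H ◁ (uone A ▷ (𝟙_ C) ≫ A.X.X ◁ η[H]) ⊗≫
              A.X.X ◁ slide H A.X.X ▷ H ⊗≫ (umul A ▷ (H ⊗ H) ≫ A.X.X ◁ μ[H]) := by
            rw [smashMul, MonoidalCategory.tensorHom_def, MonoidalCategory.tensorHom_def]; monoidal
          _ = 𝟙 _ ⊗≫ A.X.X ◁ H ◁ uone A ⊗≫ A.X.X ◁ ((H ⊗ A.X.X) ◁ η[H] ≫ slide H A.X.X ▷ H) ⊗≫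
              umul A ▷ (H ⊗ H) ≫ A.X.X ◁ μ[H] := by monoidal
          _ = 𝟙 _ ⊗≫ A.X.X ◁ (H ◁ uone A ≫ slide H A.X.X) ⊗≫ ((A.X.X ⊗ A.X.X) ◁ H ◁ η[H] ≫
              umul A ▷ (H ⊗ H)) ⊗≫ A.X.X ◁ μ[H] := by rw [whisker_exchange]; monoidal
          _ = 𝟙 _ ⊗≫ (A.X.X ◁ uone A ≫ umul A) ▷ H ⊗≫ A.X.X ◁ (H ◁ η[H] ≫ μ[H]) := by
            rw [slide_uone, braiding_tensorUnit_right, whisker_exchange]; monoidal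
          _ = _ := by rw [h1, MonObj.mul_one]; monoidal
      mul_assoc := smashMul_assoc A }

end HBrauer

section Galois

variable {C : Type u} [Category.{v} C] [MonoidalCategory C] [BraidedCategory C]

/-- A right `H`-comodule algebra. -/
structure ComodAlg (H : C) [HopfObj H] where
  /-- the algebra -/
  alg : Mon C
  /-- the coaction -/
  coact : alg.X ⟶ alg.X ⊗ H
  coact_counit : coact ≫ alg.X ◁ ε[H] = (ρ_ alg.X).inv
  coact_comul : coact ≫ alg.X ◁ Δ[H] = coact ≫ coact ▷ H ≫ (α_ _ _ _).hom
  one_coact : η[alg.X] ≫ coact = (λ_ (𝟙_ C)).inv ≫ (η[alg.X] ⊗ₘ η[H])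
  mul_coact : μ[alg.X] ≫ coact =
    (coact ⊗ₘ coact) ≫ tensorμ alg.X H alg.X H ≫ (μ[alg.X] ⊗ₘ μ[H])

variable {H : C} [HopfObj H]

/-- `A` is faithfully flat: `A ⊗ -` preserves and reflects equalizers. -/
def FaithfullyFlat (A : C) : Prop :=
  PreservesLimitsOfShape WalkingParallelPair (tensorLeft A) ∧
    ReflectsLimitsOfShape WalkingParallelPair (tensorLeft A)

/-- An `H`-Galois object: `T` is faithfully flat and
`T ⊗ T ⟶ T ⊗ H`, `x ⊗ y ↦ x y₀ ⊗ y₁`, is an isomorphism. -/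
def IsGalois (T : ComodAlg H) : Prop :=
  FaithfullyFlat T.alg.X ∧
    IsIso (T.alg.X ◁ T.coact ≫ (α_ _ _ _).inv ≫ μ[T.alg.X] ▷ H)

/-- `T` has a normal basis: it is isomorphic to `H` as a right `H`-comodule. -/
def HasNormalBasis (T : ComodAlg H) : Prop :=
  ∃ e : T.alg.X ≅ H, T.coact ≫ e.hom ▷ H = e.hom ≫ Δ[H]

/-- Isomorphism of right `H`-comodule algebras. -/
def ComodAlg.Iso (T T' : ComodAlg H) : Prop :=
  ∃ e : T.alg ≅ T'.alg, T.coact ≫ e.hom.hom ▷ H = e.hom.hom ≫ T'.coact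

variable (H) in
/-- `H`-Galois objects with a normal basis. -/
def GaloisNB : Type (max u v) := {T : ComodAlg H // IsGalois T ∧ HasNormalBasis T}

variable (H) in
instance galoisSetoid : Setoid (GaloisNB H) where
  r T T' := T.1.Iso T'.1
  iseqv :=
    { refl := fun T => ⟨Iso.refl _, by simp⟩
      symm := by
        rintro T T' ⟨e, he⟩
        refine ⟨e.symm, ?_⟩
        have h1 : e.inv.hom ≫ e.hom.hom = 𝟙 _ := congrArg Mon.Hom.hom e.inv_hom_id
        have h2 : e.hom.hom ≫ e.inv.hom = 𝟙 _ := congrArg Mon.Hom.hom e.hom_inv_id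
        calc
          T'.1.coact ≫ e.inv.hom ▷ H
            = (e.inv.hom ≫ e.hom.hom) ≫ T'.1.coact ≫ e.inv.hom ▷ H := by rw [h1]; simp
          _ = e.inv.hom ≫ T.1.coact ≫ (e.hom.hom ≫ e.inv.hom) ▷ H := by
            rw [Category.assoc, ← reassoc_of% he, comp_whiskerRight]
          _ = _ := by rw [h2]; simp
      trans := by
        rintro T T' T'' ⟨e, he⟩ ⟨f, hf⟩
        exact ⟨e ≪≫ f, by simp [reassoc_of% he, hf]⟩ }

variable (H) in
/-- The set of isomorphism classes of `H`-Galois objects with a normal basis. -/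
def GalNB : Type (max u v) := Quotient (galoisSetoid H)

/-- The class of an `H`-Galois object with a normal basis. -/
def GalNB.mk (T : GaloisNB H) : GalNB H := Quotient.mk _ T

/-- `e : E ⟶ T ⊗ T'` exhibits the right `H`-comodule algebra `E` as the cotensor product
`T □ T'` over `H`: a subalgebra of `T ⊗ T'`, with coaction induced by that of `T'`. Here `T'` is
a left `H`-comodule through its coaction followed by the braiding. -/
structure IsCotensor (T T' E : ComodAlg H) (e : E.alg ⟶ T.alg ⊗ T'.alg) : Prop where
  coact_comp : E.coact ≫ e.hom ▷ H = e.hom ≫ T.alg.X ◁ T'.coact ≫ (α_ _ _ _).inv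
  isEqualizer : ∃ w : e.hom ≫ T.coact ▷ T'.alg.X ≫ (α_ _ _ _).hom =
      e.hom ≫ T.alg.X ◁ (T'.coact ≫ (β_ _ _).hom),
    Nonempty (IsLimit (Fork.ofι e.hom w))

/-- The inclusion `A ⟶ A # H`. -/
def smashIncl (A : Mon (Mod C H)) : A.X.X ⟶ (smash A).X := (ρ_ _).inv ≫ A.X.X ◁ η[H]

/-- The right coaction `A # H ⟶ (A # H) ⊗ H`. -/
def smashCoact (A : Mon (Mod C H)) : (smash A).X ⟶ (smash A).X ⊗ H :=
  A.X.X ◁ Δ[H] ≫ (α_ _ _ _).inv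

/-- `j : T ⟶ A # H` exhibits the right `H`-comodule algebra `T` as the subalgebra `(A # H)^A` of
those `x` in `A # H` such that `a x = x a` for all `a` in `A`, where `a` is moved past `x` by the
braiding. -/
structure IsSmashInvariants [MonoidalClosed C] (A : Mon (Mod C H)) (T : ComodAlg H)
    (j : T.alg ⟶ smash A) : Prop where
  coact_comp : T.coact ≫ j.hom ▷ H = j.hom ≫ smashCoact A
  isEqualizer :
    ∃ w : j.hom ≫ MonoidalClosed.curry (smashIncl A ▷ (smash A).X ≫ μ[(smash A).X]) =
        j.hom ≫ MonoidalClosed.curry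
          ((β_ A.X.X (smash A).X).hom ≫ (smash A).X ◁ smashIncl A ≫ μ[(smash A).X]),
      Nonempty (IsLimit (Fork.ofι j.hom w))

end Galois

section Cohomology

variable {C : Type u} [Category.{v} C] [MonoidalCategory C] [BraidedCategory C]

lemma conv_comm (X : C) [ComonObj X] [IsCommComonObj X] (f g : Conv X (𝟙_ C)) :
    f * g = g * f := by
  have key : ∀ f g : X ⟶ 𝟙_ C, Δ[X] ≫ f ▷ X ≫ (𝟙_ C) ◁ g ≫ μ[𝟙_ C] =
      Δ[X] ≫ g ▷ X ≫ (𝟙_ C) ◁ f ≫ μ[𝟙_ C] := by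
    intro f g
    have h : (β_ (𝟙_ C) (𝟙_ C)).hom ≫ μ[𝟙_ C] = μ[𝟙_ C] := IsCommMonObj.mul_comm (𝟙_ C)
    calc
      _ = Δ[X] ≫ f ▷ X ≫ (𝟙_ C) ◁ g ≫ (β_ (𝟙_ C) (𝟙_ C)).hom ≫ μ[𝟙_ C] := by rw [h]
      _ = (Δ[X] ≫ (β_ X X).hom) ≫ X ◁ f ≫ g ▷ (𝟙_ C) ≫ μ[𝟙_ C] := by
        rw [BraidedCategory.braiding_naturality_right_assoc,
          BraidedCategory.braiding_naturality_left_assoc, Category.assoc]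
      _ = _ := by rw [IsCommComonObj.comul_comm, whisker_exchange_assoc]
  exact key f g

instance (X : C) [ComonObj X] [IsCommComonObj X] : CommMonoid (Conv X (𝟙_ C)) :=
  { (inferInstance : Monoid (Conv X (𝟙_ C))) with mul_comm := conv_comm X }

lemma comul_comm_tensor (X Y : C) [ComonObj X] [ComonObj Y] [IsCommComonObj X]
    [IsCommComonObj Y] (h : (β_ X Y).hom ≫ (β_ Y X).hom = 𝟙 _) : IsCommComonObj (X ⊗ Y) where
  comul_comm := by
    rw [Comon.tensorObj_comul]
    calc
      _ = 𝟙 _ ⊗≫ (Δ[X] ▷ Y ≫ (X ⊗ X) ◁ Δ[Y]) ⊗≫ X ◁ ((β_ X Y).hom ≫ (β_ Y X).hom) ▷ Y ⊗≫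
          ((β_ X X).hom ▷ (Y ⊗ Y) ≫ (X ⊗ X) ◁ (β_ Y Y).hom) ⊗≫ X ◁ (β_ X Y).hom ▷ Y ⊗≫ 𝟙 _ := by
        rw [MonoidalCategory.tensorHom_def, tensorμ, BraidedCategory.braiding_tensor_left_hom,
          BraidedCategory.braiding_tensor_right_hom, BraidedCategory.braiding_tensor_right_hom]
        rw [← whisker_exchange (β_ X X).hom (β_ Y Y).hom]
        monoidal
      _ = 𝟙 _ ⊗≫ Δ[X] ▷ Y ⊗≫ ((X ⊗ X) ◁ Δ[Y] ≫ (β_ X X).hom ▷ (Y ⊗ Y)) ⊗≫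
          (X ⊗ X) ◁ (β_ Y Y).hom ⊗≫ X ◁ (β_ X Y).hom ▷ Y ⊗≫ 𝟙 _ := by
        rw [h]; monoidal
      _ = 𝟙 _ ⊗≫ (Δ[X] ≫ (β_ X X).hom) ▷ Y ⊗≫ (X ⊗ X) ◁ (Δ[Y] ≫ (β_ Y Y).hom) ⊗≫
          X ◁ (β_ X Y).hom ▷ Y ⊗≫ 𝟙 _ := by
        rw [whisker_exchange]; monoidal
      _ = _ := by
        rw [IsCommComonObj.comul_comm, IsCommComonObj.comul_comm,
          MonoidalCategory.tensorHom_def, tensorμ]; monoidal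

variable {H : C} [HopfObj H] [BraidingLinear H]

/-- `H` is transparent. -/
lemma double_braiding (X : C) : (β_ H X).hom ≫ (β_ X H).hom = 𝟙 _ := by
  let := ModObj.regular H
  let := trivMod H X
  have e : hact H H = μ[H] := rfl
  have h : ((α_ H X H).inv ≫ slide H X ▷ H ≫ (α_ X H H).hom ≫ X ◁ hact H H) ≫ (β_ X H).hom =
      H ◁ (β_ X H).hom ≫ (α_ H H X).inv ≫ slide H H ▷ X ≫ (α_ H H X).hom ≫ H ◁ hact H X :=
    BraidingLinear.braiding_linear (H := H) ⟨X⟩ (Mod.regular H)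
  rw [slide_triv, e, hact_triv] at h
  have h2 : slide H H ≫ H ◁ ε[H] = μ[H] ≫ (ρ_ H).inv := by rw [slide_counit, e]
  symm
  calc
    _ = 𝟙 _ ⊗≫ (H ◁ η[H] ≫ μ[H]) ▷ X ⊗≫ 𝟙 _ := by
      rw [MonObj.mul_one]; monoidal
    _ = 𝟙 _ ⊗≫ H ◁ ((β_ X (𝟙_ C)).hom ≫ η[H] ▷ X) ⊗≫ (μ[H] ≫ (ρ_ H).inv) ▷ X ⊗≫ 𝟙 _ := by
      rw [braiding_tensorUnit_right]; monoidal
    _ = 𝟙 _ ⊗≫ H ◁ X ◁ η[H] ⊗≫ (H ◁ (β_ X H).hom ≫ (α_ H H X).inv ≫ slide H H ▷ X ≫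
          (α_ H H X).hom ≫ H ◁ (ε[H] ▷ X ≫ (λ_ X).hom)) ⊗≫ 𝟙 _ := by
      rw [← BraidedCategory.braiding_naturality_right, ← h2]; monoidal
    _ = 𝟙 _ ⊗≫ ((H ⊗ X) ◁ η[H] ≫ (β_ H X).hom ▷ H) ⊗≫ X ◁ μ[H] ⊗≫ (β_ X H).hom ⊗≫ 𝟙 _ := by
      rw [← h]; monoidal
    _ = 𝟙 _ ⊗≫ (β_ H X).hom ⊗≫ X ◁ (H ◁ η[H] ≫ μ[H]) ⊗≫ (β_ X H).hom ⊗≫ 𝟙 _ := by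
      rw [whisker_exchange]; monoidal
    _ = _ := by
      rw [MonObj.mul_one]; monoidal

instance cocomm : IsCommComonObj H where
  comul_comm := by
    let := ModObj.regular H
    have e : hact H H = μ[H] := rfl
    have h := slide_regular_one H
    rw [slide_eq] at h
    have h2 : H ◁ η[H] ≫ (fusion H H).hom = (ρ_ H).hom ≫ Δ[H] := by
      calc
        _ = 𝟙 _ ⊗≫ (H ◁ η[H] ≫ Δ[H] ▷ H) ⊗≫ H ◁ μ[H] := by
          simp only [fusion, e]; monoidal
        _ = 𝟙 _ ⊗≫ Δ[H] ⊗≫ H ◁ (H ◁ η[H] ≫ μ[H]) := by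
          rw [whisker_exchange]; monoidal
        _ = _ := by rw [MonObj.mul_one]; monoidal
    rw [reassoc_of% h2] at h
    exact (cancel_epi _).1 h

instance cocomm₂ : IsCommComonObj (H ⊗ H) := comul_comm_tensor H H (double_braiding H)

instance cocomm₃ : IsCommComonObj (H ⊗ (H ⊗ H)) :=
  comul_comm_tensor H (H ⊗ H) (double_braiding (H ⊗ H))

/-- The group of convolution invertible morphisms `X ⟶ I`. -/
abbrev Reg (X : C) [ComonObj X] : Type v := (Conv X (𝟙_ C))ˣ

/-- Precomposition with a morphism of coalgebras. -/
def pull {X Y : Comon C} (f : X ⟶ Y) : Reg Y.X →* Reg X.X :=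
  Units.map
    { toFun := fun g => (f.hom ≫ (show Y.X ⟶ 𝟙_ C from g) : X.X ⟶ 𝟙_ C)
      map_one' := by
        change f.hom ≫ ε[Y.X] ≫ η[𝟙_ C] = ε[X.X] ≫ η[𝟙_ C]
        rw [IsComonHom.hom_counit_assoc]
      map_mul' := by
        have key : ∀ a b : Y.X ⟶ 𝟙_ C, f.hom ≫ Δ[Y.X] ≫ a ▷ Y.X ≫ (𝟙_ C) ◁ b ≫ μ[𝟙_ C] =
          Δ[X.X] ≫ (f.hom ≫ a) ▷ X.X ≫ (𝟙_ C) ◁ (f.hom ≫ b) ≫ μ[𝟙_ C] := by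
          intro a b
          rw [IsComonHom.hom_comul_assoc, MonoidalCategory.tensorHom_def]
          simp only [Category.assoc, comp_whiskerRight, MonoidalCategory.whiskerLeft_comp]
          rw [whisker_exchange_assoc a]
        exact key }

/-- The coalgebra `H`. -/
abbrev coalg (H : C) [HopfObj H] : Comon C := ⟨H⟩

/-- The multiplication of `H` as a morphism of coalgebras. -/
def mulHom (H : C) [HopfObj H] : coalg H ⊗ coalg H ⟶ coalg H :=
  Comon.Hom.mk' (M := coalg H ⊗ coalg H) (N := coalg H) μ[H]
    (BimonObj.mul_counit (M := H)) (by
      change μ[H] ≫ Δ[H] = Δ[H ⊗ H] ≫ (μ[H] ⊗ₘ μ[H])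
      rw [Comon.tensorObj_comul, BimonObj.mul_comul, Category.assoc])

/-- The counit of `H` as a morphism of coalgebras. -/
def counitHom (H : C) [HopfObj H] : coalg H ⟶ 𝟙_ (Comon C) :=
  Comon.Hom.mk' (M := coalg H) (N := 𝟙_ (Comon C)) ε[H]
    (by
      have h : ε[(𝟙_ (Comon C)).X] = 𝟙 (𝟙_ C) := Comon.monoidal_tensorUnit_comon_counit C
      exact (congrArg (ε[H] ≫ ·) h).trans (Category.comp_id _))
    (by
      have h : Δ[(𝟙_ (Comon C)).X] = (λ_ (𝟙_ C)).inv := Comon.monoidal_tensorUnit_comon_comul C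
      refine (congrArg (ε[H] ≫ ·) h).trans ?_
      change ε[H] ≫ (λ_ (𝟙_ C)).inv = Δ[H] ≫ (ε[H] ⊗ₘ ε[H])
      rw [MonoidalCategory.tensorHom_def, ComonObj.counit_comul_assoc, leftUnitor_inv_naturality])

/-- `pull` for the coalgebras `H` and `H ⊗ H`. -/
def pull₁ (f : coalg H ⊗ coalg H ⟶ coalg H) : Reg H →* Reg (H ⊗ H) := pull f

/-- `pull` for the coalgebras `H ⊗ H` and `H ⊗ (H ⊗ H)`. -/
def pull₂ (f : coalg H ⊗ (coalg H ⊗ coalg H) ⟶ coalg H ⊗ coalg H) :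
    Reg (H ⊗ H) →* Reg (H ⊗ (H ⊗ H)) := pull f

variable (H) in
/-- The coboundary `Reg(H, I) ⟶ Reg(H ⊗ H, I)`,
`(d₁ f)(h, k) = f(k₁) f⁻¹(h₁ k₂) f(h₂)`. -/
def d₁ : Reg H →* Reg (H ⊗ H) :=
  pull₁ (counitHom H ▷ coalg H ≫ (λ_ (coalg H)).hom) *
    (pull₁ (mulHom H))⁻¹ *
    pull₁ (coalg H ◁ counitHom H ≫ (ρ_ (coalg H)).hom)

variable (H) in
/-- The coboundary `Reg(H ⊗ H, I) ⟶ Reg(H ⊗ H ⊗ H, I)`,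
`(d₂ σ)(h, k, l) = σ(k₁, l₁) σ⁻¹(h₁ k₂, l₂) σ(h₂, k₃ l₃) σ⁻¹(h₃, k₄)`. -/
def d₂ : Reg (H ⊗ H) →* Reg (H ⊗ (H ⊗ H)) :=
  pull₂ (counitHom H ▷ (coalg H ⊗ coalg H) ≫ (λ_ (coalg H ⊗ coalg H)).hom) *
    (pull₂ ((α_ (coalg H) (coalg H) (coalg H)).inv ≫ mulHom H ▷ coalg H))⁻¹ *
    pull₂ (coalg H ◁ mulHom H) *
    (pull₂ ((α_ (coalg H) (coalg H) (coalg H)).inv ≫ (coalg H ⊗ coalg H) ◁ counitHom H ≫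
      (ρ_ (coalg H ⊗ coalg H)).hom))⁻¹

variable (H) in
/-- The second Sweedler cohomology group `H²(C; H, I)`. -/
def H2 : Type v := (d₂ H).ker ⧸ (d₁ H).range.subgroupOf (d₂ H).ker

instance : Group (H2 H) :=
  inferInstanceAs (Group ((d₂ H).ker ⧸ (d₁ H).range.subgroupOf (d₂ H).ker))

end Cohomology
section Summary

variable {C : Type u} [Category.{v} C] [MonoidalCategory C] [BraidedCategory C]
  [MonoidalClosed C]

/-- The group structure on `Br D` is that of the Brauer group: two Azumaya algebras have the same
class exactly when they are Brauer equivalent, and classes are multiplied by `[A] [B] = [A ⊗ B]`. -/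
structure IsBrauerGroup (D : Type u) [Category.{v} D] [MonoidalCategory D] [BraidedCategory D]
    [MonoidalClosed D] [Group (Br D)] : Prop where
  mk_eq_mk_iff : ∀ A B : Azumaya D, Br.mk A = Br.mk B ↔ BrauerEquiv A B
  mk_mul_mk : ∀ A B : Azumaya D, ∃ h : IsAzumaya (A.1 ⊗ B.1),
    Br.mk A * Br.mk B = Br.mk ⟨A.1 ⊗ B.1, h⟩

/-- The group structure on `GalNB H` is that given by the cotensor product over `H`. -/
def IsGaloisGroup (H : C) [HopfObj H] [Group (GalNB H)] : Prop :=
  ∀ T T' : GaloisNB H, ∃ (E : GaloisNB H) (e : E.1.alg ⟶ T.1.alg ⊗ T'.1.alg),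
    IsCotensor T.1 T'.1 E.1 e ∧ GalNB.mk T * GalNB.mk T' = GalNB.mk E

/-- The Brauer group `BM(C; H)` of `H`-Azumaya algebras: the Brauer group of the braided monoidal
category of left `H`-modules. -/
abbrev BM (H : C) [HopfObj H] [BraidingLinear H] : Type (max u v) := Br (Mod C H)

/-- The classes of `BM(C; H)` which contain an `H`-Azumaya algebra with inner action. -/
def innerClasses (H : C) [HopfObj H] [BraidingLinear H] : Set (BM H) :=
  {x | ∃ A : Azumaya (Mod C H), IsInner A.1 ∧ Br.mk A = x}

end Summary

end

end HopfBrauer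

/-! The proof rests on one invariant. Suppose that the action on an Azumaya algebra `A` is inner,
given by a convolution invertible `F : H ⟶ A`. Because `(hk)·a = h·(k·a)`, the elements `F(hk)` and
`F(h)F(k)` conjugate `A` in the same way. The centralizer of an Azumaya algebra consists of scalars,
so `F(hk) = F(h)F(k)σ(h,k)` for a unique invertible `σ : H ⊗ H ⟶ I` (`Implements.exists_isTwist`).
Expanding `F(hkl)` in two ways shows that `σ` is a cocycle. Another choice of `F` differs by a
scalar function on `H` and changes `σ` by a coboundary. The class of `σ` is multiplicative in `A`.
It is trivial for `[P, P]`, where `F` can be taken to be the algebra morphism `H ⟶ [P, P]`. Hence it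
depends only on the Brauer class and gives a homomorphism `twistHom` from the inner classes to `H²`.

Linearity of the braiding enters twice: it makes `H` cocommutative (`cocomm`) and makes the double
braiding of `H` with any object trivial (`double_braiding`). Morphisms from tensor powers of `H` to
an algebra can then be handled as elements of a convolution monoid in which braidings disappear and
scalars are central. Most identities become computations in groups of units.

Kernel: if the twist is trivial, then `F` is a morphism of algebras, and `A` becomes an `H`-module
`P` by left multiplication through `F`. With the trivial action on the opposite algebra, two-sided
multiplication is an `H`-linear isomorphism `A ⊗ Ā ≅ [P, P]`, so `A` has the class of the same
algebra with trivial action (`Azumaya.mk_eq_of_hasTwist_one`). Surjectivity: let `T` be `H` with its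
multiplication twisted by a cocycle. The identity `H ⟶ T` is convolution invertible and has the
inverse cocycle as its twist; composing it with left multiplication gives an inner action on `[T,
T]` with the same twist (`exists_azumaya_hasTwist`). Forgetting the action splits the inclusion of
`Br(C)`, so the middle group is a product.

Galois side: a Galois object with a normal basis is `H` with the product `σ(h₁,k₁) h₂k₂` for a
cocycle `σ`, unique up to coboundaries, and the comultiplication of `H` exhibits the cotensor
product as multiplication of cocycles. In `A # H` the elements `F⁻¹(h₁) # h₂` commute with `A` and
multiply by this same rule, and `A ⊗ H ≅ A # H` then shows that they fill the whole centralizer. So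
the invariants of the smash product realize the twist class.

The Brauer group itself is built in a closed braided category without symmetry. Two reformulations
make this manageable. Invertibility of a morphism to `[P, Q]` is replaced by universality of an
action `A ⊗ P ⟶ Q` (`IsUniversal`), which is stable under tensoring and composition. Faithful
projectivity is replaced by finiteness together with effective descent along the evaluation `[P, I]
⊗ P ⟶ I` (`IsDescent`). Both transfer between `C` and `H`-modules, whose braiding and inner homs are
those of `C`. -/

namespace HopfBrauer

noncomputable section

set_option linter.unusedSectionVars false

/-! ### Universal actions and dualizable objects. -/

section Universal

variable {D : Type u} [Category.{v} D] [MonoidalCategory D]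

/-- A morphism `X ⟶ Z ⊗ A` acts on `P` through `a : A ⊗ P ⟶ Q`. -/
def actOn {A P Q : D} (a : A ⊗ P ⟶ Q) {X Z : D} (f : X ⟶ Z ⊗ A) : X ⊗ P ⟶ Z ⊗ Q :=
  f ▷ P ≫ (α_ Z A P).hom ≫ Z ◁ a

/-- `a : A ⊗ P ⟶ Q` is universal if, for all `X` and `Z`, morphisms `X ⟶ Z ⊗ A` correspond to
morphisms `X ⊗ P ⟶ Z ⊗ Q`. -/
def IsUniversal {A P Q : D} (a : A ⊗ P ⟶ Q) : Prop :=
  ∀ X Z : D, Function.Bijective (actOn a : (X ⟶ Z ⊗ A) → (X ⊗ P ⟶ Z ⊗ Q))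

namespace IsUniversal

variable {A P Q : D} {a : A ⊗ P ⟶ Q}

lemma iso_left (h : IsUniversal a) {A' : D} (e : A' ≅ A) : IsUniversal (e.hom ▷ P ≫ a) := by
  intro X Z
  have : (actOn (e.hom ▷ P ≫ a) : (X ⟶ Z ⊗ A') → _) =
      actOn a ∘ (Iso.homToEquiv (whiskerLeftIso Z e)) := by
    funext f; simp [actOn, Iso.homToEquiv]
  rw [this]
  exact (h X Z).comp (Equiv.bijective _)

lemma iso_mid (h : IsUniversal a) {P' : D} (e : P' ≅ P) : IsUniversal (A ◁ e.hom ≫ a) := by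
  intro X Z
  have : (actOn (A ◁ e.hom ≫ a) : (X ⟶ Z ⊗ A) → _) =
      (Iso.homFromEquiv (whiskerLeftIso X e.symm)) ∘ actOn a := by
    funext f
    simp only [actOn, Iso.homFromEquiv, Function.comp, Equiv.coe_fn_mk, whiskerLeftIso_inv,
      Iso.symm_inv, whisker_exchange_assoc]
    simp
  rw [this]
  exact (Equiv.bijective _).comp (h X Z)

lemma iso_right (h : IsUniversal a) {Q' : D} (e : Q ≅ Q') : IsUniversal (a ≫ e.hom) := by
  intro X Z
  have : (actOn (a ≫ e.hom) : (X ⟶ Z ⊗ A) → _) =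
      (Iso.homToEquiv (whiskerLeftIso Z e)) ∘ actOn a := by
    funext f; simp [actOn, Iso.homToEquiv]
  rw [this]
  exact (Equiv.bijective _).comp (h X Z)

/-- The parameter `Z` in the definition of universality is there for this: it absorbs `W` by
reassociation. -/
lemma left (h : IsUniversal a) (W : D) : IsUniversal ((α_ W A P).hom ≫ W ◁ a) := by
  intro X Z
  have : (actOn ((α_ W A P).hom ≫ W ◁ a) : (X ⟶ Z ⊗ (W ⊗ A)) → _) =
      (Iso.homToEquiv (α_ Z W Q)) ∘ actOn a ∘ (Iso.homToEquiv (α_ Z W A).symm) := by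
    funext f
    simp only [actOn, Iso.homToEquiv, Function.comp, Equiv.coe_fn_mk, Iso.symm_hom]
    monoidal
  rw [this]
  exact (Equiv.bijective _).comp ((h _ _).comp (Equiv.bijective _))

/-- The two bijections are applied in turn, which is iterated currying: `P` is moved to the
right-hand side after `P'`. -/
lemma trans (h : IsUniversal a) {P' R : D} {b : Q ⊗ P' ⟶ R} (h' : IsUniversal b) :
    IsUniversal ((α_ A P P').inv ≫ a ▷ P' ≫ b) := by
  intro X Z
  have : (actOn ((α_ A P P').inv ≫ a ▷ P' ≫ b) : (X ⟶ Z ⊗ A) → _) =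
      (Iso.homFromEquiv (α_ X P P')) ∘ actOn b ∘ actOn a := by
    funext f
    simp only [actOn, Iso.homFromEquiv, Function.comp, Equiv.coe_fn_mk]
    monoidal
  rw [this]
  exact (Equiv.bijective _).comp ((h' _ _).comp (h _ _))

/-- This is the case `Z = I`, where `A` represents the functor that `[P, Q]` represents. -/
lemma existsUnique (h : IsUniversal a) {X : D} (t : X ⊗ P ⟶ Q) : ∃! g : X ⟶ A, g ▷ P ≫ a = t := by
  have e : ∀ g : X ⟶ A, g ▷ P ≫ a = actOn a (g ≫ (λ_ A).inv) ≫ (λ_ Q).hom := by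
    intro g; simp only [actOn]; monoidal
  obtain ⟨f, hf⟩ := (h X (𝟙_ D)).2 (t ≫ (λ_ Q).inv)
  refine ⟨f ≫ (λ_ A).hom, ?_, ?_⟩
  · change (f ≫ (λ_ A).hom) ▷ P ≫ a = t
    rw [e]; simp [hf]
  · intro g hg
    rw [← Iso.comp_inv_eq]
    apply (h X (𝟙_ D)).1
    rw [hf, ← hg, e]
    simp

lemma ext (h : IsUniversal a) {X : D} {f g : X ⟶ A} (w : f ▷ P ≫ a = g ▷ P ≫ a) : f = g :=
  (h.existsUnique (g ▷ P ≫ a)).unique w rfl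

/-- Universal objects are unique. -/
lemma exists_iso (h : IsUniversal a) {A' : D} {a' : A' ⊗ P ⟶ Q} (h' : IsUniversal a') :
    ∃ e : A' ≅ A, e.hom ▷ P ≫ a = a' := by
  obtain ⟨f, hf, -⟩ := h.existsUnique a'
  obtain ⟨g, hg, -⟩ := h'.existsUnique a
  exact ⟨⟨f, g, h'.ext (by simp [hf, hg]), h.ext (by simp [hf, hg])⟩, hf⟩

end IsUniversal

/-- The bijection is the adjunction attached to the duality. All other universal actions of
dualizable objects are derived from this one. -/
lemma isUniversal_evaluation (P P' : D) [ExactPairing P P'] : IsUniversal (ε_ P P') := by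
  intro X Z
  have : (actOn (ε_ P P') : (X ⟶ Z ⊗ P') → _) =
      (Iso.homToEquiv (ρ_ Z).symm) ∘ (tensorRightHomEquiv X P P' Z).symm := by
    funext f
    simp [actOn, Iso.homToEquiv, tensorRightHomEquiv]
  rw [this]
  exact (Equiv.bijective _).comp (Equiv.bijective _)

variable [BraidedCategory D]

namespace IsUniversal

variable {A P Q : D} {a : A ⊗ P ⟶ Q}

lemma right (h : IsUniversal a) (W : D) :
    IsUniversal ((α_ A W P).hom ≫ A ◁ (β_ W P).hom ≫ (α_ A P W).inv ≫ a ▷ W) := by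
  have key : (α_ A W P).hom ≫ A ◁ (β_ W P).hom ≫ (α_ A P W).inv ≫ a ▷ W =
      (β_ W A).symm.hom ▷ P ≫ ((α_ W A P).hom ≫ W ◁ a) ≫ (β_ W Q).hom := by
    rw [Category.assoc, BraidedCategory.braiding_naturality_right,
      BraidedCategory.braiding_tensor_right_hom]
    simp [← comp_whiskerRight_assoc]
  rw [key]
  exact ((h.left W).iso_right (β_ W Q)).iso_left (β_ W A).symm

/-- The tensor product of two actions is a composite: `A` acts on `P` with `B` carried along to the
right, and then `B` acts on `P'` with `Q` standing on the left. -/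
lemma tensor (h : IsUniversal a) {B P' Q' : D} {b : B ⊗ P' ⟶ Q'} (h' : IsUniversal b) :
    IsUniversal (tensorμ A B P P' ≫ (a ⊗ₘ b)) := by
  have := (h.right B).trans (h'.left Q)
  convert this using 1
  rw [tensorμ, MonoidalCategory.tensorHom_def]
  monoidal

end IsUniversal

variable [MonoidalClosed D]

lemma IsUniversal.isIso_lcurry {A P Q : D} {a : A ⊗ P ⟶ Q} (h : IsUniversal a) :
    IsIso (lcurry a) := by
  obtain ⟨g, hg, -⟩ := h.existsUnique (lev P Q)
  exact ⟨g, h.ext (by rw [comp_whiskerRight, Category.assoc, hg, lcurry_lev]; simp),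
    lev_ext (by rw [comp_whiskerRight, Category.assoc, lcurry_lev, hg]; simp)⟩

lemma isUniversal_coev (P P' Q : D) [ExactPairing P P'] :
    IsUniversal ((α_ Q P' P).hom ≫ Q ◁ ε_ P P' ≫ (ρ_ Q).hom) := by
  simpa using ((isUniversal_evaluation P P').left Q).iso_right (ρ_ Q)

/-- For dualizable `P` the object `Q ⊗ P'` acts universally, so it is a model of `[P, Q]`, and
universality of any other action amounts to being isomorphic to this model. -/
lemma isUniversal_iff_isIso (P' : D) {A P Q : D} [ExactPairing P P'] (a : A ⊗ P ⟶ Q) :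
    IsUniversal a ↔ IsIso (lcurry a) := by
  refine ⟨fun h => h.isIso_lcurry, fun h => ?_⟩
  obtain ⟨b, h1⟩ : ∃ b : (Q ⊗ P') ⊗ P ⟶ Q, IsUniversal b := ⟨_, isUniversal_coev P P' Q⟩
  have := h1.isIso_lcurry
  have h2 := h1.iso_left (asIso (lcurry a) ≪≫ (asIso (lcurry b)).symm)
  convert h2 using 1
  have : inv (lcurry b) ▷ P ≫ b = lev P Q := by
    calc
      _ = inv (lcurry b) ▷ P ≫ lcurry b ▷ P ≫ lev P Q := by rw [lcurry_lev]
      _ = _ := by rw [← comp_whiskerRight_assoc]; simp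
  simp [this, lcurry_lev]

lemma isFinite_of_exactPairing (P P' : D) [ExactPairing P P'] : IsFinite P := by
  obtain ⟨e, he⟩ := (isUniversal_evaluation P P').exists_iso
    ((isUniversal_iff_isIso P' (lev P (𝟙_ D))).2 (by
      have : lcurry (lev P (𝟙_ D)) = 𝟙 _ := lev_ext (by rw [lcurry_lev]; simp)
      rw [this]; infer_instance))
  have h := ((isUniversal_coev P P' P).iso_left (whiskerLeftIso P e)).isIso_lcurry
  have h2 : (whiskerLeftIso P e).hom ▷ P ≫ (α_ P P' P).hom ≫ P ◁ ε_ P P' ≫ (ρ_ P).hom =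
      (α_ _ _ _).hom ≫ P ◁ lev P (𝟙_ D) ≫ (ρ_ P).hom := by
    rw [← he]; simp
  rw [h2] at h
  exact h

/-- A finite object is dualizable, with dual `[P, I]`. -/
@[reducible]
def IsFinite.exactPairing {P : D} (h : IsFinite P) : ExactPairing P ((ihom P).obj (𝟙_ D)) :=
  let φ := lcurry ((α_ _ _ _).hom ≫ P ◁ lev P (𝟙_ D) ≫ (ρ_ P).hom)
  have : IsIso φ := h
  -- The coevaluation is the identity of `P`, pulled back from `[P, P]` along `φ`. This triangle
  -- identity therefore holds by construction, and the other one follows from it by evaluating on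
  -- `P`.
  have h1 : (lcurry (λ_ P).hom ≫ inv φ) ▷ P ≫ (α_ _ _ _).hom ≫ P ◁ lev P (𝟙_ D) =
      (λ_ P).hom ≫ (ρ_ P).inv := by
    have : inv φ ▷ P ≫ (α_ _ _ _).hom ≫ P ◁ lev P (𝟙_ D) ≫ (ρ_ P).hom = lev P P := by
      rw [← lcurry_lev ((α_ _ _ _).hom ≫ P ◁ lev P (𝟙_ D) ≫ (ρ_ P).hom)]
      change inv φ ▷ P ≫ φ ▷ P ≫ _ = _
      rw [← comp_whiskerRight_assoc]; simp
    rw [Iso.eq_comp_inv]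
    simp only [comp_whiskerRight, Category.assoc]
    rw [this, lcurry_lev]
  { coevaluation' := lcurry (λ_ P).hom ≫ inv φ
    evaluation' := lev P (𝟙_ D)
    evaluation_coevaluation' := h1
    coevaluation_evaluation' := by
      rw [Iso.eq_comp_inv]
      apply lev_ext
      set c := lcurry (λ_ P).hom ≫ inv φ
      calc
        _ = 𝟙 _ ⊗≫ (ihom P).obj (𝟙_ D) ◁ c ▷ P ⊗≫
            (lev P (𝟙_ D) ▷ ((ihom P).obj (𝟙_ D) ⊗ P) ≫ (𝟙_ D) ◁ lev P (𝟙_ D)) ⊗≫ 𝟙 _ := by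
          monoidal
        _ = 𝟙 _ ⊗≫ (ihom P).obj (𝟙_ D) ◁ (c ▷ P ≫ (α_ _ _ _).hom ≫ P ◁ lev P (𝟙_ D)) ⊗≫
            lev P (𝟙_ D) ⊗≫ 𝟙 _ := by
          rw [← whisker_exchange]; monoidal
        _ = _ := by
          rw [h1]; monoidal }

end Universal

/-! ### Effective descent along the evaluation and faithful projectivity. -/

section Descent

variable {D : Type u} [Category.{v} D] [MonoidalCategory D]

/-- `e : E ⟶ I` is of effective descent: it is the coequalizer of the two morphisms
`E ⊗ E ⟶ E` that it induces. -/
def IsDescent {E : D} (e : E ⟶ 𝟙_ D) : Prop :=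
  ∀ (Z : D) (f : E ⟶ Z), (E ◁ e ≫ (ρ_ E).hom) ≫ f = (e ▷ E ≫ (λ_ E).hom) ≫ f →
    ∃! g : 𝟙_ D ⟶ Z, e ≫ g = f

/-- Both sides are `e ⊗ e`. -/
lemma scalar_comm {E : D} (e : E ⟶ 𝟙_ D) :
    (E ◁ e ≫ (ρ_ E).hom) ≫ e = (e ▷ E ≫ (λ_ E).hom) ≫ e := by
  calc
    _ = (E ◁ e ≫ e ▷ (𝟙_ D)) ≫ (ρ_ _).hom := by simp
    _ = _ := by rw [whisker_exchange]; monoidal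

namespace IsDescent

variable {E : D} {e : E ⟶ 𝟙_ D}

lemma epi (h : IsDescent e) : Epi e where
  left_cancellation g₁ g₂ w := (h _ (e ≫ g₁) (by
    rw [← Category.assoc, ← Category.assoc _ e g₁, scalar_comm])).unique rfl w.symm

lemma of_iso (h : IsDescent e) {E' : D} (i : E' ≅ E) : IsDescent (i.hom ≫ e) := by
  intro Z f hf
  obtain ⟨g, hg, hu⟩ := h Z (i.inv ≫ f) (by
    have := congrArg (fun t => (i.inv ⊗ₘ i.inv) ≫ t) hf
    calc
      _ = (i.inv ⊗ₘ i.inv) ≫ (E' ◁ (i.hom ≫ e) ≫ (ρ_ E').hom) ≫ f := by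
        rw [MonoidalCategory.tensorHom_def']
        simp only [MonoidalCategory.whiskerLeft_comp, Category.assoc]
        rw [← whisker_exchange_assoc, ← whisker_exchange_assoc, whiskerLeft_inv_hom_assoc]
        monoidal
      _ = (i.inv ⊗ₘ i.inv) ≫ ((i.hom ≫ e) ▷ E' ≫ (λ_ E').hom) ≫ f := by rw [hf]
      _ = _ := by
        rw [MonoidalCategory.tensorHom_def']
        simp [whisker_exchange_assoc])
  refine ⟨g, ?_, fun g' hg' => hu g' ?_⟩
  · simp [hg]
  · simp [← hg']

variable [MonoidalClosed D]

instance epi_whiskerLeft (X : D) {Y Z : D} (f : Y ⟶ Z) [Epi f] : Epi (X ◁ f) :=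
  inferInstanceAs (Epi ((tensorLeft X).map f))

/-- Descent with parameters. -/
lemma param (h : IsDescent e) {X Z : D} (f : X ⊗ E ⟶ Z)
    (hf : X ◁ (E ◁ e ≫ (ρ_ E).hom) ≫ f = X ◁ (e ▷ E ≫ (λ_ E).hom) ≫ f) :
    ∃! g : X ⟶ Z, X ◁ e ≫ (ρ_ X).hom ≫ g = f := by
  obtain ⟨g, hg, -⟩ := h _ (MonoidalClosed.curry f) (by
    rw [← MonoidalClosed.curry_natural_left, ← MonoidalClosed.curry_natural_left, hf])
  have hg : e ≫ g = MonoidalClosed.curry f := hg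
  have := h.epi
  refine ⟨(ρ_ X).inv ≫ MonoidalClosed.uncurry g, ?_, ?_⟩
  · change X ◁ e ≫ (ρ_ X).hom ≫ (ρ_ X).inv ≫ MonoidalClosed.uncurry g = f
    rw [Iso.hom_inv_id_assoc, ← MonoidalClosed.uncurry_natural_left, hg,
      MonoidalClosed.uncurry_curry]
  · intro g' hg'
    rw [Iso.eq_inv_comp, ← cancel_epi (X ◁ e), hg', ← MonoidalClosed.uncurry_natural_left, hg,
      MonoidalClosed.uncurry_curry]

lemma epi_whiskerRight [BraidedCategory D] {Y Z : D} (f : Y ⟶ Z) [Epi f] (X : D) :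
    Epi (f ▷ X) := by
  have : f ▷ X = (β_ Y X).hom ≫ X ◁ f ≫ (β_ Z X).inv := by
    rw [← BraidedCategory.braiding_naturality_left_assoc]; simp
  rw [this]
  infer_instance

/-- Descend along `e'` with `E` as a parameter, and then along `e`. The joint condition on `f`
yields each separate condition after precomposition with an epimorphism that supplies the missing
tensor factors. -/
lemma tensor [BraidedCategory D] (h : IsDescent e) {E' : D} {e' : E' ⟶ 𝟙_ D} (h' : IsDescent e') :
    IsDescent ((e ⊗ₘ e') ≫ (λ_ (𝟙_ D)).hom) := by
  intro Z f hf
  have := h.epi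
  have := h'.epi
  have epi_s : ∀ W : D, Epi (W ◁ ((e ⊗ₘ e') ≫ (λ_ (𝟙_ D)).hom)) := by
    intro W
    rw [MonoidalCategory.tensorHom_def]
    have := epi_whiskerRight e E'
    infer_instance
  have c1 : E ◁ (E' ◁ e' ≫ (ρ_ E').hom) ≫ f = E ◁ (e' ▷ E' ≫ (λ_ E').hom) ≫ f := by
    have := epi_s (E ⊗ (E' ⊗ E'))
    -- A spare copy of `E ⊗ E'` is introduced on the right. The hypothesis `hf` trades it for the
    -- original factors, after which only scalars remain and both sides coincide.
    apply (cancel_epi ((E ⊗ (E' ⊗ E')) ◁ ((e ⊗ₘ e') ≫ (λ_ (𝟙_ D)).hom) ≫ (ρ_ _).hom)).1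
    trans 𝟙 _ ⊗≫ e ▷ (E' ⊗ E' ⊗ (E ⊗ E')) ⊗≫ e' ▷ (E' ⊗ (E ⊗ E')) ⊗≫ e' ▷ (E ⊗ E') ⊗≫ f
    · calc
        _ = 𝟙 _ ⊗≫ ((E ⊗ E' ⊗ E') ◁ ((e ⊗ₘ e') ≫ (λ_ (𝟙_ D)).hom) ≫ (E ◁ E' ◁ e') ▷ (𝟙_ D)) ⊗≫
            f := by monoidal
        _ = 𝟙 _ ⊗≫ E ◁ E' ◁ e' ▷ (E ⊗ E') ⊗≫
            (((E ⊗ E') ◁ ((e ⊗ₘ e') ≫ (λ_ (𝟙_ D)).hom) ≫ (ρ_ (E ⊗ E')).hom) ≫ f) := by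
          rw [whisker_exchange]; monoidal
        _ = 𝟙 _ ⊗≫ ((E ⊗ E') ◁ (e' ▷ (E ⊗ E')) ≫ (e ▷ E') ▷ ((𝟙_ D) ⊗ (E ⊗ E'))) ⊗≫
            e' ▷ (E ⊗ E') ⊗≫ f := by
          rw [hf, MonoidalCategory.tensorHom_def]; monoidal
        _ = 𝟙 _ ⊗≫ e ▷ (E' ⊗ E' ⊗ (E ⊗ E')) ⊗≫ (E' ◁ (e' ▷ (E ⊗ E')) ≫
              e' ▷ ((𝟙_ D) ⊗ (E ⊗ E'))) ⊗≫ f := by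
          rw [whisker_exchange]; monoidal
        _ = _ := by
          rw [whisker_exchange]; monoidal
    · symm
      calc
        _ = 𝟙 _ ⊗≫ ((E ⊗ E' ⊗ E') ◁ ((e ⊗ₘ e') ≫ (λ_ (𝟙_ D)).hom) ≫ (E ◁ e' ▷ E') ▷ (𝟙_ D)) ⊗≫
            f := by monoidal
        _ = 𝟙 _ ⊗≫ E ◁ e' ▷ E' ▷ (E ⊗ E') ⊗≫
            (((E ⊗ E') ◁ ((e ⊗ₘ e') ≫ (λ_ (𝟙_ D)).hom) ≫ (ρ_ (E ⊗ E')).hom) ≫ f) := by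
          rw [whisker_exchange]; monoidal
        _ = 𝟙 _ ⊗≫ (E ◁ (e' ▷ (E' ⊗ (E ⊗ E'))) ≫ e ▷ ((𝟙_ D) ⊗ (E' ⊗ (E ⊗ E')))) ⊗≫
            e' ▷ (E ⊗ E') ⊗≫ f := by
          rw [hf, MonoidalCategory.tensorHom_def]; monoidal
        _ = _ := by
          rw [whisker_exchange]; monoidal
  obtain ⟨g, hg, -⟩ := h'.param f c1
  have hg : E ◁ e' ≫ (ρ_ E).hom ≫ g = f := hg
  have epi_f : Epi (E ◁ e' ≫ (ρ_ E).hom) := inferInstance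
  have c2 : (E ◁ e ≫ (ρ_ E).hom) ≫ g = (e ▷ E ≫ (λ_ E).hom) ≫ g := by
    have := epi_whiskerRight (E ◁ e' ≫ (ρ_ E).hom) (E ⊗ E')
    apply (cancel_epi ((E ◁ e' ≫ (ρ_ E).hom) ▷ (E ⊗ E') ≫ E ◁ (E ◁ e' ≫ (ρ_ E).hom))).1
    rw [← hg] at hf
    calc
      _ = 𝟙 _ ⊗≫ E ◁ ((e' ▷ (E ⊗ E')) ≫ (𝟙_ D) ◁ (E ◁ e')) ⊗≫ E ◁ e ⊗≫ g := by monoidal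
      _ = 𝟙 _ ⊗≫ E ◁ E' ◁ (E ◁ e') ⊗≫ E ◁ (e' ▷ E ≫ (𝟙_ D) ◁ e) ⊗≫ g := by
        rw [← whisker_exchange]; monoidal
      _ = (E ⊗ E') ◁ (E ◁ e') ⊗≫ (E ⊗ E') ◁ e ⊗≫ E ◁ e' ⊗≫ g := by
        rw [← whisker_exchange]; monoidal
      _ = ((E ⊗ E') ◁ ((e ⊗ₘ e') ≫ (λ_ (𝟙_ D)).hom) ≫ (ρ_ (E ⊗ E')).hom) ≫
          E ◁ e' ≫ (ρ_ E).hom ≫ g := by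
        rw [MonoidalCategory.tensorHom_def']; monoidal
      _ = _ := hf
      _ = 𝟙 _ ⊗≫ (e ▷ (E' ⊗ (E ⊗ E'))) ⊗≫ (e' ▷ (E ⊗ E') ≫ (𝟙_ D) ◁ E ◁ e') ⊗≫ g := by
        rw [MonoidalCategory.tensorHom_def]; monoidal
      _ = 𝟙 _ ⊗≫ (e ▷ (E' ⊗ (E ⊗ E')) ≫ (𝟙_ D) ◁ (E' ◁ E ◁ e')) ⊗≫ e' ▷ E ⊗≫ g := by
        rw [← whisker_exchange]; monoidal
      _ = 𝟙 _ ⊗≫ E ◁ (E' ◁ E ◁ e') ⊗≫ (e ▷ (E' ⊗ E) ≫ (𝟙_ D) ◁ (e' ▷ E)) ⊗≫ g := by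
        rw [← whisker_exchange]; monoidal
      _ = 𝟙 _ ⊗≫ E ◁ (E' ◁ E ◁ e' ≫ e' ▷ (E ⊗ (𝟙_ D))) ⊗≫ e ▷ E ⊗≫ g := by
        rw [← whisker_exchange]; monoidal
      _ = _ := by
        rw [whisker_exchange]; monoidal
  obtain ⟨g', hg', -⟩ := h Z g c2
  have hg' : e ≫ g' = g := hg'
  have e_s : (e ⊗ₘ e') ≫ (λ_ (𝟙_ D)).hom = (E ◁ e' ≫ (ρ_ E).hom) ≫ e := by
    rw [MonoidalCategory.tensorHom_def']; monoidal
  refine ⟨g', ?_, fun g'' h'' => ?_⟩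
  · change ((e ⊗ₘ e') ≫ (λ_ (𝟙_ D)).hom) ≫ g' = f
    rw [e_s, Category.assoc, hg', Category.assoc, hg]
  · have h'' : ((e ⊗ₘ e') ≫ (λ_ (𝟙_ D)).hom) ≫ g'' = f := h''
    rw [e_s, Category.assoc, Category.assoc] at h''
    rw [← cancel_epi e, hg', ← cancel_epi (E ◁ e' ≫ (ρ_ E).hom), Category.assoc, Category.assoc,
      hg, h'']

end IsDescent

variable [BraidedCategory D] [MonoidalClosed D]

/-- Finiteness gives `[P, P] ≅ P ⊗ [P, I]`. Under this isomorphism (`j` below) the actions of `[P,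
P]` on `[P, I]` and on `P` become the two morphisms `E ⊗ E ⟶ E` induced by the evaluation of `E =
[P, I] ⊗ P`, so the two coequalizer conditions are the same. -/
lemma faithfullyProjective_iff_isDescent {P : D} (hP : IsFinite P) :
    FaithfullyProjective P ↔ IsDescent (lev P (𝟙_ D)) := by
  let φ := lcurry ((α_ _ _ _).hom ≫ P ◁ lev P (𝟙_ D) ≫ (ρ_ P).hom)
  have : IsIso φ := hP
  let P' := (ihom P).obj (𝟙_ D)
  have hφ : φ ▷ P ≫ lev P P = (α_ _ _ _).hom ≫ P ◁ lev P (𝟙_ D) ≫ (ρ_ P).hom := lcurry_lev _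
  let j : (P' ⊗ P) ⊗ (P' ⊗ P) ⟶ (P' ⊗ (ihom P).obj P) ⊗ P := 𝟙 _ ⊗≫ P' ◁ φ ▷ P ⊗≫ 𝟙 _
  have hj : IsIso j := by
    have : j = (α_ P' P (P' ⊗ P)).hom ≫ P' ◁ (α_ P P' P).inv ≫ (α_ P' (P ⊗ P') P).inv ≫
      (P' ◁ φ) ▷ P := by simp only [j]; monoidal
    rw [this]; infer_instance
  have j1 : j ≫ (α_ _ _ _).hom ≫ P' ◁ lev P P = (P' ⊗ P) ◁ lev P (𝟙_ D) ≫ (ρ_ (P' ⊗ P)).hom := by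
    calc
      _ = 𝟙 _ ⊗≫ P' ◁ (φ ▷ P ≫ lev P P) := by simp only [j]; monoidal
      _ = _ := by rw [hφ]; monoidal
  have e1 : P' ◁ φ ≫ icomp P P (𝟙_ D) =
      (α_ _ _ _).inv ≫ lev P (𝟙_ D) ▷ P' ≫ (λ_ P').hom := by
    apply lev_ext
    calc
      _ = 𝟙 _ ⊗≫ P' ◁ φ ▷ P ⊗≫ icomp P P (𝟙_ D) ▷ P ≫ lev P (𝟙_ D) := by monoidal
      _ = 𝟙 _ ⊗≫ P' ◁ (φ ▷ P ≫ lev P P) ≫ lev P (𝟙_ D) := by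
        rw [icomp_lev]; monoidal
      _ = 𝟙 _ ⊗≫ ((P' ⊗ P) ◁ lev P (𝟙_ D) ≫ lev P (𝟙_ D) ▷ (𝟙_ D)) ⊗≫ 𝟙 _ := by
        rw [hφ]; monoidal
      _ = _ := by
        rw [whisker_exchange]; monoidal
  have j2 : j ≫ icomp P P (𝟙_ D) ▷ P = lev P (𝟙_ D) ▷ (P' ⊗ P) ≫ (λ_ (P' ⊗ P)).hom := by
    calc
      _ = 𝟙 _ ⊗≫ (P' ◁ φ ≫ icomp P P (𝟙_ D)) ▷ P := by simp only [j]; monoidal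
      _ = _ := by rw [e1]; monoidal
  constructor
  · rintro ⟨-, w, ⟨hc⟩⟩ Z f hf
    refine ⟨hc.desc (Cofork.ofπ f ?_), hc.fac _ WalkingParallelPair.one, ?_⟩
    · rw [← cancel_epi j, ← Category.assoc, j2, ← Category.assoc, j1, hf]
    · intro g hg
      apply Cofork.IsColimit.hom_ext hc
      exact hg.trans (hc.fac (Cofork.ofπ f _) WalkingParallelPair.one).symm
  · intro h
    have w : icomp P P (𝟙_ D) ▷ P ≫ lev P (𝟙_ D) =
        ((α_ _ _ _).hom ≫ (ihom P).obj (𝟙_ D) ◁ lev P P) ≫ lev P (𝟙_ D) := by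
      rw [icomp_lev]; simp
    have key : ∀ s : Cofork (icomp P P (𝟙_ D) ▷ P)
        ((α_ _ _ _).hom ≫ (ihom P).obj (𝟙_ D) ◁ lev P P),
        ((P' ⊗ P) ◁ lev P (𝟙_ D) ≫ (ρ_ (P' ⊗ P)).hom) ≫ s.π =
          (lev P (𝟙_ D) ▷ (P' ⊗ P) ≫ (λ_ (P' ⊗ P)).hom) ≫ s.π := by
      intro s
      rw [← j1, ← j2]
      simp only [Category.assoc]
      rw [s.condition]
      simp only [Category.assoc]
      rfl
    exact ⟨hP, w, ⟨Cofork.IsColimit.mk _ (fun s => (h _ s.π (key s)).choose)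
      (fun s => (h _ s.π (key s)).choose_spec.1)
      (fun s m hm => (h _ s.π (key s)).choose_spec.2 m hm)⟩⟩

lemma FaithfullyProjective.isDescent {P : D} (h : FaithfullyProjective P) :
    IsDescent (lev P (𝟙_ D)) := (faithfullyProjective_iff_isDescent h.1).1 h

/-- Duals are unique up to an isomorphism compatible with the evaluations, so descent may be checked
for any dual in place of `[P, I]`. -/
lemma faithfullyProjective_of_isDescent (P P' : D) [ExactPairing P P'] (h : IsDescent (ε_ P P')) :
    FaithfullyProjective P := by
  have hP := isFinite_of_exactPairing P P'
  rw [faithfullyProjective_iff_isDescent hP]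
  let := hP.exactPairing
  obtain ⟨i, hi⟩ := (isUniversal_evaluation P P').exists_iso
    (isUniversal_evaluation P ((ihom P).obj (𝟙_ D)))
  change IsDescent (ε_ P ((ihom P).obj (𝟙_ D)))
  rw [← hi]
  exact h.of_iso (whiskerRightIso i P)

/-- A faithfully projective object is dualizable, and evaluation is of effective descent. -/
lemma FaithfullyProjective.exists_exactPairing {P : D} (h : FaithfullyProjective P) :
    ∃ (P' : D) (_ : ExactPairing P P'), IsDescent (ε_ P P') :=
  ⟨_, h.1.exactPairing, h.isDescent⟩

lemma faithfullyProjective_unit : FaithfullyProjective (𝟙_ D) := by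
  refine faithfullyProjective_of_isDescent (𝟙_ D) (𝟙_ D) ?_
  change IsDescent (ρ_ (𝟙_ D)).hom
  intro Z f _
  refine ⟨(ρ_ _).inv ≫ f, by simp, fun g hg => by simp [← hg]⟩

/-- Up to a braiding of `Q'` past `P' ⊗ P`, the evaluation of `P ⊗ Q` is the product of the two
evaluations. -/
lemma FaithfullyProjective.tensor {P Q : D} (hP : FaithfullyProjective P)
    (hQ : FaithfullyProjective Q) : FaithfullyProjective (P ⊗ Q) := by
  obtain ⟨P', _, h1⟩ := hP.exists_exactPairing
  obtain ⟨Q', _, h2⟩ := hQ.exists_exactPairing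
  apply faithfullyProjective_of_isDescent (P ⊗ Q) (Q' ⊗ P')
  let E := P' ⊗ P
  have := (h1.tensor h2).of_iso (α_ Q' P' (P ⊗ Q) ≪≫ whiskerLeftIso Q' (α_ P' P Q).symm ≪≫
    (α_ Q' E Q).symm ≪≫ whiskerRightIso (β_ Q' E) Q ≪≫ α_ E Q' Q)
  convert this using 1
  rw [ExactPairing.tensor_evaluation]
  symm
  calc
    _ = 𝟙 _ ⊗≫ ((β_ Q' (P' ⊗ P)).hom ≫ ε_ P P' ▷ Q') ▷ Q ⊗≫ ε_ Q Q' := by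
      simp only [Iso.trans_hom, whiskerLeftIso_hom, whiskerRightIso_hom, Iso.symm_hom,
        MonoidalCategory.tensorHom_def, E]
      monoidal
    _ = _ := by
      rw [← BraidedCategory.braiding_naturality_right, braiding_tensorUnit_right]; monoidal

lemma FaithfullyProjective.of_iso {P Q : D} (hP : FaithfullyProjective P) (i : Q ≅ P) :
    FaithfullyProjective Q := by
  obtain ⟨P', _, h1⟩ := hP.exists_exactPairing
  let := exactPairingCongrLeft (Y := P') i
  apply faithfullyProjective_of_isDescent Q P'
  have := h1.of_iso (whiskerLeftIso P' i)
  exact this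

lemma faithfullyProjective_dual {P P' : D} [ExactPairing P P'] (hP : IsDescent (ε_ P P')) :
    FaithfullyProjective P' := by
  let := BraidedCategory.exactPairing_swap P P'
  apply faithfullyProjective_of_isDescent P' P
  exact hP.of_iso (β_ P P')

end Descent

/-! ### Opposite algebras, endomorphism algebras and the Azumaya condition as universality. -/

section Algebras

variable {D : Type u} [Category.{v} D] [MonoidalCategory D] [BraidedCategory D]

/-- The opposite algebra, with multiplication `β ≫ μ`. -/
def opAlg (A : Mon D) : Mon D where
  X := A.X
  mon :=
    { one := η[A.X]
      mul := (β_ A.X A.X).hom ≫ μ[A.X]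
      one_mul := by
        rw [BraidedCategory.braiding_naturality_left_assoc, MonObj.mul_one]; simp
      mul_one := by
        rw [BraidedCategory.braiding_naturality_right_assoc, MonObj.one_mul]; simp
      mul_assoc := by
        calc
          _ = (β_ A.X A.X).hom ▷ A.X ≫ (β_ (A.X ⊗ A.X) A.X).hom ≫ A.X ◁ μ[A.X] ≫ μ[A.X] := by
            rw [← BraidedCategory.braiding_naturality_left_assoc]; simp
          _ = ((β_ A.X A.X).hom ▷ A.X ≫ (α_ _ _ _).hom ≫ A.X ◁ (β_ A.X A.X).hom ≫ (α_ _ _ _).inv ≫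
              (β_ A.X A.X).hom ▷ A.X ≫ (α_ _ _ _).hom) ≫ A.X ◁ μ[A.X] ≫ μ[A.X] := by
            rw [BraidedCategory.braiding_tensor_left_hom]; simp
          _ = (α_ _ _ _).hom ≫ A.X ◁ (β_ A.X A.X).hom ≫ (β_ A.X (A.X ⊗ A.X)).hom ≫
              (α_ _ _ _).hom ≫ A.X ◁ μ[A.X] ≫ μ[A.X] := by
            have yb := BraidedCategory.yang_baxter A.X A.X A.X
            rw [Iso.inv_comp_eq] at yb
            rw [yb, BraidedCategory.braiding_tensor_right_hom]
            simp
          _ = _ := by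
            rw [← MonObj.mul_assoc, ← BraidedCategory.braiding_naturality_right_assoc]; simp }

section Combine

variable {A B P Q : D} [MonObj A] [MonObj B]

lemma tensor_act_one {a : A ⊗ P ⟶ P} {b : B ⊗ Q ⟶ Q} (ha : η[A] ▷ P ≫ a = (λ_ P).hom)
    (hb : η[B] ▷ Q ≫ b = (λ_ Q).hom) :
    η[A ⊗ B] ▷ (P ⊗ Q) ≫ tensorμ A B P Q ≫ (a ⊗ₘ b) = (λ_ (P ⊗ Q)).hom := by
  rw [MonObj.tensorObj.one_def, comp_whiskerRight, Category.assoc, tensorμ_natural_left_assoc,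
    tensorHom_comp_tensorHom, ha, hb, tensor_left_unitality]

lemma tensor_act_mul {a : A ⊗ P ⟶ P} {b : B ⊗ Q ⟶ Q}
    (ha : μ[A] ▷ P ≫ a = (α_ A A P).hom ≫ A ◁ a ≫ a)
    (hb : μ[B] ▷ Q ≫ b = (α_ B B Q).hom ≫ B ◁ b ≫ b) :
    μ[A ⊗ B] ▷ (P ⊗ Q) ≫ tensorμ A B P Q ≫ (a ⊗ₘ b) = (α_ _ _ _).hom ≫
      (A ⊗ B) ◁ (tensorμ A B P Q ≫ (a ⊗ₘ b)) ≫ tensorμ A B P Q ≫ (a ⊗ₘ b) := by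
  rw [MonObj.tensorObj.mul_def, comp_whiskerRight, Category.assoc, tensorμ_natural_left_assoc,
    tensorHom_comp_tensorHom, ha, hb, MonoidalCategory.whiskerLeft_comp, Category.assoc,
    tensorμ_natural_right_assoc, ← tensorHom_comp_tensorHom, ← tensorHom_comp_tensorHom,
    ← tensor_associativity_assoc]

/-- Two actions on `P` which commute up to the braiding. -/
def combineAct (a : A ⊗ P ⟶ P) (b : B ⊗ P ⟶ P) : (A ⊗ B) ⊗ P ⟶ P :=
  (α_ A B P).hom ≫ A ◁ b ≫ a

lemma combineAct_one {a : A ⊗ P ⟶ P} {b : B ⊗ P ⟶ P} (ha : η[A] ▷ P ≫ a = (λ_ P).hom)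
    (hb : η[B] ▷ P ≫ b = (λ_ P).hom) : η[A ⊗ B] ▷ P ≫ combineAct a b = (λ_ P).hom := by
  calc
    _ = 𝟙 _ ⊗≫ η[A] ▷ (𝟙_ D) ▷ P ⊗≫ A ◁ (η[B] ▷ P ≫ b) ≫ a := by
      rw [MonObj.tensorObj.one_def, combineAct, MonoidalCategory.tensorHom_def]; monoidal
    _ = 𝟙 _ ⊗≫ η[A] ▷ P ≫ a := by rw [hb]; monoidal
    _ = _ := by rw [ha]; monoidal

/-- The hypothesis `hab` moves the action of `B` past that of `A` with exactly the braiding `B ⊗ A ⟶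
A ⊗ B` occurring in the multiplication of `A ⊗ B`. -/
lemma combineAct_mul {a : A ⊗ P ⟶ P} {b : B ⊗ P ⟶ P}
    (ha : μ[A] ▷ P ≫ a = (α_ A A P).hom ≫ A ◁ a ≫ a)
    (hb : μ[B] ▷ P ≫ b = (α_ B B P).hom ≫ B ◁ b ≫ b)
    (hab : (α_ B A P).hom ≫ B ◁ a ≫ b = (β_ B A).hom ▷ P ≫ (α_ A B P).hom ≫ A ◁ b ≫ a) :
    μ[A ⊗ B] ▷ P ≫ combineAct a b =
      (α_ _ _ _).hom ≫ (A ⊗ B) ◁ combineAct a b ≫ combineAct a b := by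
  calc
    _ = 𝟙 _ ⊗≫ A ◁ (β_ B A).hom ▷ B ▷ P ⊗≫ (μ[A] ▷ (B ⊗ B) ≫ A ◁ μ[B]) ▷ P ⊗≫ A ◁ b ≫ a := by
      rw [MonObj.tensorObj.mul_def, combineAct, tensorμ, MonoidalCategory.tensorHom_def]
      monoidal
    _ = 𝟙 _ ⊗≫ A ◁ (β_ B A).hom ▷ B ▷ P ⊗≫ (A ⊗ A) ◁ (μ[B] ▷ P ≫ b) ⊗≫ A ◁ a ≫ a := by
      have h : (A ⊗ A) ◁ (μ[B] ▷ P ≫ b) ≫ μ[A] ▷ P ≫ a =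
        𝟙 _ ⊗≫ (A ⊗ A) ◁ (μ[B] ▷ P ≫ b) ⊗≫ A ◁ a ≫ a := by rw [ha]; monoidal
      rw [← whisker_exchange]
      calc
        _ = 𝟙 _ ⊗≫ A ◁ (β_ B A).hom ▷ B ▷ P ⊗≫ (A ⊗ A) ◁ μ[B] ▷ P ⊗≫
            (μ[A] ▷ (B ⊗ P) ≫ A ◁ b) ⊗≫ a := by monoidal
        _ = 𝟙 _ ⊗≫ A ◁ (β_ B A).hom ▷ B ▷ P ⊗≫ ((A ⊗ A) ◁ (μ[B] ▷ P ≫ b) ≫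
            μ[A] ▷ P ≫ a) := by rw [← whisker_exchange]; monoidal
        _ = _ := by rw [h]; monoidal
    _ = 𝟙 _ ⊗≫ A ◁ ((β_ B A).hom ▷ (B ⊗ P) ≫ (A ⊗ B) ◁ b) ⊗≫ A ◁ (A ◁ b ≫ a) ≫ a := by
      rw [hb]; monoidal
    _ = 𝟙 _ ⊗≫ (A ⊗ B ⊗ A) ◁ b ⊗≫ A ◁ ((β_ B A).hom ▷ P ≫ (α_ A B P).hom ≫ A ◁ b ≫ a) ≫ a := by
      rw [← whisker_exchange]; monoidal
    _ = _ := by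
      rw [← hab, combineAct]; monoidal

end Combine

section Multiplications

variable (A : D) [MonObj A]

/-- The action of the opposite algebra by right multiplication. -/
def rmul : A ⊗ A ⟶ A := (β_ A A).hom ≫ μ[A]

/-- Associativity of `A` and the hexagon. This is the commutation hypothesis of `combineAct_mul` for
left and right multiplication. -/
lemma rmul_comm : (α_ A A A).hom ≫ A ◁ μ[A] ≫ rmul A =
    (β_ A A).hom ▷ A ≫ (α_ A A A).hom ≫ A ◁ rmul A ≫ μ[A] := by
  rw [rmul, BraidedCategory.braiding_naturality_right_assoc, MonObj.mul_assoc,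
    BraidedCategory.braiding_tensor_right_hom]
  simp

/-- The action of `A ⊗ Ā` on `A`. -/
def biact : (A ⊗ A) ⊗ A ⟶ A := combineAct μ[A] (rmul A)

end Multiplications

section Universality

/-- Two-sided multiplication by `A` is universal. -/
def IsAzF (A : Mon D) : Prop := IsUniversal (biact A.X)

lemma biact_naturality {A B : D} [MonObj A] [MonObj B] (f : A ⟶ B) [IsMonHom f] :
    biact A ≫ f = ((f ⊗ₘ f) ⊗ₘ f) ≫ biact B := by
  have hr : rmul A ≫ f = (f ⊗ₘ f) ≫ rmul B := by
    rw [rmul, rmul, BraidedCategory.braiding_naturality_assoc, Category.assoc,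
      IsMonHom.mul_hom f]
  rw [biact, biact, combineAct, combineAct, Category.assoc, Category.assoc, IsMonHom.mul_hom f,
    ← id_tensorHom, tensorHom_comp_tensorHom_assoc, Category.id_comp, hr,
    associator_naturality_assoc, ← id_tensorHom, tensorHom_comp_tensorHom_assoc, Category.comp_id]

lemma IsAzF.of_iso {A B : Mon D} (h : IsAzF B) (i : A ≅ B) : IsAzF A := by
  let e : A.X ≅ B.X := (Mon.forget D).mapIso i
  have he : IsMonHom e.hom := inferInstanceAs (IsMonHom i.hom.hom)
  have := ((h.iso_left (e ⊗ᵢ e)).iso_mid e).iso_right e.symm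
  unfold IsAzF
  convert this using 1
  simp only [Iso.symm_hom]
  rw [Iso.eq_comp_inv, biact_naturality e.hom, MonoidalCategory.tensorHom_def', Category.assoc]
  rfl

end Universality

variable [MonoidalClosed D]

/-- The action of `[P, P]` on `P`. -/
def elev (P : D) : (iEnd P).X ⊗ P ⟶ P := lev P P

/-- The morphism `X ⟶ [P, P]` corresponding to a morphism `X ⊗ P ⟶ P`. -/
def ecurry {X P : D} (f : X ⊗ P ⟶ P) : X ⟶ (iEnd P).X := lcurry f

lemma ecurry_elev {X P : D} (f : X ⊗ P ⟶ P) : ecurry f ▷ P ≫ elev P = f := lcurry_lev f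

lemma elev_ext {X P : D} {f g : X ⟶ (iEnd P).X} (h : f ▷ P ≫ elev P = g ▷ P ≫ elev P) : f = g :=
  lev_ext h

lemma elev_one (P : D) : η[(iEnd P).X] ▷ P ≫ elev P = (λ_ P).hom := lcurry_lev _

lemma elev_mul (P : D) : μ[(iEnd P).X] ▷ P ≫ elev P =
    (α_ _ _ _).hom ≫ (iEnd P).X ◁ elev P ≫ elev P := icomp_lev P P P

lemma isUniversal_elev {P : D} (hP : IsFinite P) : IsUniversal (elev P) := by
  let := hP.exactPairing
  have : lcurry (lev P P) = 𝟙 _ := lev_ext (by rw [lcurry_lev]; simp)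
  exact (isUniversal_iff_isIso ((ihom P).obj (𝟙_ D)) (lev P P)).2 (by
    rw [this]; infer_instance)

/-- The algebra homomorphism `A ⟶ [P, P]` of an `A`-module `P`. -/
lemma isMonHom_ecurry {A P : D} [MonObj A] (a : A ⊗ P ⟶ P) (h1 : η[A] ▷ P ≫ a = (λ_ P).hom)
    (h2 : μ[A] ▷ P ≫ a = (α_ A A P).hom ≫ A ◁ a ≫ a) : IsMonHom (ecurry a) where
  one_hom := elev_ext (by rw [comp_whiskerRight, Category.assoc, ecurry_elev, h1, elev_one])
  mul_hom := elev_ext (by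
      rw [comp_whiskerRight, Category.assoc, ecurry_elev, h2, comp_whiskerRight, Category.assoc,
        elev_mul]
      calc
        _ = 𝟙 _ ⊗≫ A ◁ (ecurry a ▷ P ≫ elev P) ⊗≫ ecurry a ▷ P ≫ elev P := by
          rw [ecurry_elev]; monoidal
        _ = 𝟙 _ ⊗≫ A ◁ (ecurry a ▷ P) ⊗≫ (A ◁ elev P ≫ ecurry a ▷ P) ≫ elev P := by
          monoidal
        _ = _ := by
          rw [whisker_exchange, MonoidalCategory.tensorHom_def']; monoidal)

/-- A universal action exhibits an algebra as the endomorphism algebra. -/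
lemma nonempty_iso_iEnd (A : Mon D) {P : D} {a : A.X ⊗ P ⟶ P}
    (h1 : η[A.X] ▷ P ≫ a = (λ_ P).hom) (h2 : μ[A.X] ▷ P ≫ a = (α_ A.X A.X P).hom ≫ A.X ◁ a ≫ a)
    (h : IsUniversal a) : Nonempty (A ≅ iEnd P) := by
  have := isMonHom_ecurry a h1 h2
  have hi : IsIso (ecurry a) := h.isIso_lcurry
  let e : A.X ≅ (iEnd P).X := @asIso _ _ _ _ (ecurry a) hi
  have : IsMonHom e.hom := isMonHom_ecurry a h1 h2
  exact ⟨(Mon.mkIso' e : Mon.mk A.X ≅ Mon.mk (iEnd P).X)⟩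

lemma iEnd_iso_of_iso {P Q : D} (e : P ≅ Q) (hP : IsFinite P) : Nonempty (iEnd P ≅ iEnd Q) := by
  refine nonempty_iso_iEnd (iEnd P) (a := (iEnd P).X ◁ e.inv ≫ elev P ≫ e.hom) ?_ ?_
    (((isUniversal_elev hP).iso_right e).iso_mid e.symm)
  · rw [← whisker_exchange_assoc, reassoc_of% (elev_one P)]; simp
  · rw [← whisker_exchange_assoc, reassoc_of% (elev_mul P)]; simp

lemma iEnd_tensor_iso {P Q : D} (hP : IsFinite P) (hQ : IsFinite Q) :
    Nonempty (iEnd P ⊗ iEnd Q ≅ iEnd (P ⊗ Q)) :=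
  nonempty_iso_iEnd (iEnd P ⊗ iEnd Q) (tensor_act_one (elev_one P) (elev_one Q))
    (tensor_act_mul (elev_mul P) (elev_mul Q)) ((isUniversal_elev hP).tensor (isUniversal_elev hQ))

lemma tensor_op_iso_iEnd {A : Mon D} (h : IsAzF A) : Nonempty (A ⊗ opAlg A ≅ iEnd A.X) :=
  nonempty_iso_iEnd (A ⊗ opAlg A) (a := biact A.X)
    (combineAct_one (B := (opAlg A).X) (MonObj.one_mul A.X) (MonObj.one_mul (opAlg A).X))
    (combineAct_mul (B := (opAlg A).X) (MonObj.mul_assoc A.X) (MonObj.mul_assoc (opAlg A).X)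
      (rmul_comm A.X)) h

/-- Since `A` is dualizable, universality is invertibility of the curried action. The Yang–Baxter
equation identifies the second canonical morphism, up to a braiding, with the first one for the
opposite algebra, so the other inner hom `{A, -}` need not be considered separately. -/
lemma isAzumaya_iff (A : Mon D) :
    IsAzumaya A ↔ FaithfullyProjective A.X ∧ IsAzF A ∧ IsAzF (opAlg A) := by
  refine and_congr_right fun hA => ?_
  obtain ⟨A', _, h1⟩ := hA.exists_exactPairing
  unfold IsAzF
  refine and_congr ?_ ?_
  · exact (isUniversal_iff_isIso A' (biact A.X)).symm
  · refine Iff.trans ?_ (isUniversal_iff_isIso (P := A.X) A' (biact (opAlg A).X)).symm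
    have : lcurry (P := A.X) (biact (opAlg A).X) = (β_ A.X A.X).hom ≫ azumayaG A.X := by
      have yb := BraidedCategory.yang_baxter A.X A.X A.X
      have key : biact (opAlg A).X = (β_ (A.X ⊗ A.X) A.X).hom ≫ A.X ◁ (β_ A.X A.X).hom ≫
          (α_ _ _ _).inv ≫ ((β_ A.X A.X).hom ≫ μ[A.X]) ▷ A.X ≫ μ[A.X] := by
        calc
          _ = (α_ _ _ _).hom ≫ A.X ◁ (β_ A.X A.X).hom ≫ (A.X ◁ (β_ A.X A.X).hom ≫
                (α_ _ _ _).inv ≫ (β_ A.X A.X).hom ▷ A.X ≫ (α_ _ _ _).hom ≫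
                A.X ◁ (β_ A.X A.X).hom) ≫ (α_ _ _ _).inv ≫ μ[A.X] ▷ A.X ≫ μ[A.X] := by
            change (α_ _ _ _).hom ≫ A.X ◁ ((β_ A.X A.X).hom ≫ (β_ A.X A.X).hom ≫ μ[A.X]) ≫
              (β_ A.X A.X).hom ≫ μ[A.X] = _
            simp only [MonoidalCategory.whiskerLeft_comp, Category.assoc]
            rw [BraidedCategory.braiding_naturality_right_assoc,
              BraidedCategory.braiding_tensor_right_hom]
            simp
          _ = ((α_ _ _ _).hom ≫ (A.X ◁ (β_ A.X A.X).hom ≫ (α_ _ _ _).inv ≫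
                (β_ A.X A.X).hom ▷ A.X ≫ (α_ _ _ _).hom ≫ A.X ◁ (β_ A.X A.X).hom) ≫
                (α_ _ _ _).inv) ≫ ((β_ A.X A.X).hom ≫ μ[A.X]) ▷ A.X ≫ μ[A.X] := by
            conv_lhs => rw [← yb]
            simp
          _ = _ := by
            rw [← yb, ← BraidedCategory.braiding_naturality_left_assoc,
              BraidedCategory.braiding_tensor_left_hom]
            simp
      rw [key]
      unfold azumayaG
      rw [← MonoidalClosed.curry_natural_left]
      exact congrArg MonoidalClosed.curry (Iso.inv_hom_id_assoc _ _)
    rw [this]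
    exact (isIso_comp_left_iff (β_ A.X A.X).hom (azumayaG A.X)).symm

end Algebras

/-! ### Tensor products of Azumaya algebras. -/

section TensorAzumaya

variable {D : Type u} [Category.{v} D] [MonoidalCategory D] [BraidedCategory D]

lemma braiding_tensor_tensor (X Y Z W : D) : (β_ (X ⊗ Y) (Z ⊗ W)).hom =
    tensorμ X Y Z W ≫ ((β_ X Z).hom ⊗ₘ (β_ Y W).hom) ≫ tensorμ Z X W Y := by
  rw [BraidedCategory.braiding_tensor_left_hom, BraidedCategory.braiding_tensor_right_hom,
    BraidedCategory.braiding_tensor_right_hom, tensorμ, tensorμ]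
  calc
    _ = 𝟙 _ ⊗≫ X ◁ (β_ Y Z).hom ▷ W ⊗≫ ((X ⊗ Z) ◁ (β_ Y W).hom ≫ (β_ X Z).hom ▷ (W ⊗ Y)) ⊗≫
        Z ◁ (β_ X W).hom ▷ Y ⊗≫ 𝟙 _ := by monoidal
    _ = _ := by
      rw [← MonoidalCategory.tensorHom_def']; monoidal

/-- `braiding_tensor_tensor` is used twice: forwards, to split off the braidings of the two opposite
multiplications, and backwards, to gather what remains into a single braiding, which is natural with
respect to the multiplications. -/
lemma op_tensor_mul (A B : D) [MonObj A] [MonObj B] :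
    ((β_ B A).hom ⊗ₘ (β_ B A).hom) ≫ rmul (A ⊗ B) =
      tensorμ B A B A ≫ (rmul B ⊗ₘ rmul A) ≫ (β_ B A).hom := by
  rw [rmul, MonObj.tensorObj.mul_def, BraidedCategory.braiding_naturality_assoc,
    braiding_tensor_tensor B A B A]
  simp only [Category.assoc]
  rw [← reassoc_of% (braiding_tensor_tensor B B A A)]
  rw [← BraidedCategory.braiding_naturality, tensorHom_comp_tensorHom_assoc, rmul, rmul]

/-- The opposite of a tensor product of algebras. -/
def opTensorIso (A B : Mon D) : opAlg B ⊗ opAlg A ≅ opAlg (A ⊗ B) :=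
  letI e : (opAlg B ⊗ opAlg A).X ≅ (opAlg (A ⊗ B)).X := β_ B.X A.X
  have : IsMonHom e.hom :=
    { one_hom := by
        change ((λ_ (𝟙_ D)).inv ≫ (η[B.X] ⊗ₘ η[A.X])) ≫ (β_ B.X A.X).hom =
          (λ_ (𝟙_ D)).inv ≫ (η[A.X] ⊗ₘ η[B.X])
        rw [Category.assoc, BraidedCategory.braiding_naturality]
        simp [unitors_inv_equal]
      mul_hom := by
        change (tensorμ B.X A.X B.X A.X ≫ (rmul B.X ⊗ₘ rmul A.X)) ≫ (β_ B.X A.X).hom =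
          ((β_ B.X A.X).hom ⊗ₘ (β_ B.X A.X).hom) ≫ rmul (A.X ⊗ B.X)
        rw [op_tensor_mul, Category.assoc] }
  (Mon.mkIso' e : Mon.mk _ ≅ Mon.mk _)

/-- Through the braiding, the opposite of `A ⊗ B` is `B̄ ⊗ Ā`. Two-sided multiplication by `A ⊗ B`
is then a nesting: `B ⊗ B̄` acts on `B` first and `A ⊗ Ā` acts on `A` around it. Both actions are
universal, hence so is their composite. -/
lemma IsAzF.tensor {A B : Mon D} (hA : IsAzF A) (hB : IsAzF B) : IsAzF (A ⊗ B) := by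
  obtain ⟨A⟩ := A
  obtain ⟨B⟩ := B
  change IsUniversal (biact A) at hA
  change IsUniversal (biact B) at hB
  have h1 := (IsUniversal.right hB A).left A
  have h2 := (IsUniversal.right hA B).iso_left (whiskerLeftIso A (β_ B A) ≪≫ (α_ A A B).symm)
  have h3 := ((h1.trans h2).iso_left (whiskerLeftIso (A ⊗ B) (β_ B A).symm ≪≫ α_ A B (B ⊗ A) ≪≫
    whiskerLeftIso A (α_ B B A).symm)).iso_mid (β_ B A).symm
  have key := op_tensor_mul A B
  change IsUniversal (biact (A ⊗ B))
  convert h3 using 1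
  · rw [← cancel_epi (((A ⊗ B) ◁ (β_ B A).hom) ▷ (A ⊗ B)),
      ← cancel_epi (((A ⊗ B) ⊗ (B ⊗ A)) ◁ (β_ B A).hom)]
    calc
      _ = (α_ _ _ _).hom ≫ (A ⊗ B) ◁ (((β_ B A).hom ⊗ₘ (β_ B A).hom) ≫ rmul (A ⊗ B)) ≫
            μ[A ⊗ B] := by
        rw [biact, combineAct, MonoidalCategory.tensorHom_def']; monoidal
      _ = 𝟙 _ ⊗≫ (A ⊗ B ⊗ B) ◁ (β_ A B).hom ▷ A ⊗≫ (A ⊗ B) ◁ rmul B ▷ (A ⊗ A) ⊗≫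
          (A ⊗ B ⊗ B) ◁ rmul A ⊗≫ A ◁ (B ◁ (β_ B A).hom ⊗≫ (β_ B A).hom ▷ B ⊗≫ A ◁ μ[B]) ⊗≫
          μ[A] ▷ B := by
        rw [key, MonObj.tensorObj.mul_def, tensorμ, tensorμ, MonoidalCategory.tensorHom_def' μ[A],
          MonoidalCategory.tensorHom_def (rmul B)]
        monoidal
      _ = 𝟙 _ ⊗≫ (A ⊗ B ⊗ B) ◁ (β_ A B).hom ▷ A ⊗≫ (A ⊗ B) ◁ rmul B ▷ (A ⊗ A) ⊗≫
          A ◁ ((B ⊗ B) ◁ rmul A ≫ μ[B] ▷ A) ⊗≫ A ◁ (β_ B A).hom ⊗≫ μ[A] ▷ B := by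
        have h := BraidedCategory.braiding_naturality_left μ[B] A
        rw [BraidedCategory.braiding_tensor_left_hom] at h
        calc
          _ = 𝟙 _ ⊗≫ (A ⊗ B ⊗ B) ◁ (β_ A B).hom ▷ A ⊗≫ (A ⊗ B) ◁ rmul B ▷ (A ⊗ A) ⊗≫
            (A ⊗ B ⊗ B) ◁ rmul A ⊗≫ A ◁ (((α_ B B A).hom ≫ B ◁ (β_ B A).hom ≫ (α_ B A B).inv ≫
              (β_ B A).hom ▷ B ≫ (α_ A B B).hom) ≫ A ◁ μ[B]) ⊗≫ μ[A] ▷ B := by monoidal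
          _ = _ := by rw [← h]; monoidal
      _ = 𝟙 _ ⊗≫ (A ⊗ B ⊗ B) ◁ (β_ A B).hom ▷ A ⊗≫ A ◁ biact B ▷ (A ⊗ A) ⊗≫
          A ◁ (B ◁ rmul A ≫ (β_ B A).hom) ⊗≫ μ[A] ▷ B := by
        rw [whisker_exchange μ[B] (rmul A), biact, combineAct]; monoidal
      _ = 𝟙 _ ⊗≫ (A ⊗ B ⊗ B) ◁ (β_ A B).hom ▷ A ⊗≫ A ◁ biact B ▷ (A ⊗ A) ⊗≫
          A ◁ (β_ B A).hom ▷ A ⊗≫ (A ⊗ A) ◁ (β_ B A).hom ⊗≫ biact A ▷ B := by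
        rw [BraidedCategory.braiding_naturality_right, BraidedCategory.braiding_tensor_right_hom,
          show biact A = (α_ A A A).hom ≫ A ◁ rmul A ≫ μ[A] from rfl]
        monoidal
      _ = _ := by
        simp only [Iso.symm_hom, Iso.trans_hom, whiskerLeftIso_hom]
        rw [← whisker_exchange_assoc ((A ⊗ B) ◁ (β_ B A).hom) (β_ B A).inv]
        rw [← MonoidalCategory.whiskerLeft_comp_assoc, Iso.hom_inv_id, comp_whiskerRight_assoc,
          ← comp_whiskerRight_assoc ((A ⊗ B) ◁ (β_ B A).hom), ← MonoidalCategory.whiskerLeft_comp,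
          Iso.hom_inv_id]
        monoidal

end TensorAzumaya

/-! ### Moving an endomorphism algebra past another algebra. -/

section Swap

variable {D : Type u} [Category.{v} D] [MonoidalCategory D] [BraidedCategory D]

/-- An action of `E` on `P` followed by the free right action of `B`. -/
def rightAct {E P : D} (B : D) (x : E ⊗ P ⟶ P) : (E ⊗ B) ⊗ P ⟶ P ⊗ B :=
  (α_ E B P).hom ≫ E ◁ (β_ B P).hom ≫ (α_ E P B).inv ≫ x ▷ B

/-- The variant of `rightAct` in which `B` comes before `E`. -/
def leftAct {E P : D} (B : D) (x : E ⊗ P ⟶ P) : (B ⊗ E) ⊗ P ⟶ P ⊗ B :=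
  (α_ B E P).hom ≫ B ◁ x ≫ (β_ P B).inv

variable {E B P : D} [MonObj E] [MonObj B]

lemma right_act_one {x : E ⊗ P ⟶ P} (hx : η[E] ▷ P ≫ x = (λ_ P).hom) :
    η[E ⊗ B] ▷ P ≫ rightAct B x = (λ_ P).hom ≫ (ρ_ P).inv ≫ P ◁ η[B] := by
  rw [MonObj.tensorObj.one_def, MonoidalCategory.tensorHom_def, rightAct]
  calc
    _ = 𝟙 _ ⊗≫ η[E] ▷ (𝟙_ D) ▷ P ⊗≫ E ◁ (η[B] ▷ P ≫ (β_ B P).hom) ⊗≫ x ▷ B := by monoidal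
    _ = 𝟙 _ ⊗≫ η[E] ▷ P ⊗≫ ((E ⊗ P) ◁ η[B] ≫ x ▷ B) := by
      rw [BraidedCategory.braiding_naturality_left, braiding_tensorUnit_left]; monoidal
    _ = 𝟙 _ ⊗≫ (η[E] ▷ P ≫ x) ⊗≫ P ◁ η[B] := by rw [whisker_exchange]; monoidal
    _ = _ := by rw [hx]; monoidal

lemma left_act_one {x : E ⊗ P ⟶ P} (hx : η[E] ▷ P ≫ x = (λ_ P).hom) :
    η[B ⊗ E] ▷ P ≫ leftAct B x = (λ_ P).hom ≫ (ρ_ P).inv ≫ P ◁ η[B] := by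
  rw [MonObj.tensorObj.one_def, MonoidalCategory.tensorHom_def, leftAct]
  calc
    _ = 𝟙 _ ⊗≫ η[B] ▷ (𝟙_ D) ▷ P ⊗≫ B ◁ (η[E] ▷ P ≫ x) ⊗≫ (β_ P B).inv := by monoidal
    _ = 𝟙 _ ⊗≫ (η[B] ▷ P ≫ (β_ P B).inv) := by rw [hx]; monoidal
    _ = _ := by
      rw [BraidedCategory.braiding_inv_naturality_left, braiding_inv_tensorUnit_right]; monoidal

lemma right_act_mul {x : E ⊗ P ⟶ P} (hx : μ[E] ▷ P ≫ x = (α_ E E P).hom ≫ E ◁ x ≫ x) :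
    μ[E ⊗ B] ▷ P ≫ rightAct B x = (α_ _ _ _).hom ≫ (E ⊗ B) ◁ rightAct B x ≫ (α_ _ _ _).inv ≫
      rightAct B x ▷ B ≫ (α_ _ _ _).hom ≫ P ◁ μ[B] := by
  rw [rightAct, MonObj.tensorObj.mul_def, tensorμ, MonoidalCategory.tensorHom_def']
  trans 𝟙 _ ⊗≫ E ◁ (β_ B E).hom ▷ B ▷ P ⊗≫ (E ⊗ E) ◁ (B ◁ (β_ B P).hom ⊗≫ (β_ B P).hom ▷ B) ⊗≫
      E ◁ x ▷ (B ⊗ B) ⊗≫ x ▷ (B ⊗ B) ⊗≫ P ◁ μ[B]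
  · calc
      _ = 𝟙 _ ⊗≫ E ◁ (β_ B E).hom ▷ B ▷ P ⊗≫ (E ⊗ E) ◁ μ[B] ▷ P ⊗≫
          (μ[E] ▷ (B ⊗ P) ≫ E ◁ (β_ B P).hom) ⊗≫ x ▷ B := by monoidal
      _ = 𝟙 _ ⊗≫ E ◁ (β_ B E).hom ▷ B ▷ P ⊗≫ (E ⊗ E) ◁ (μ[B] ▷ P ≫ (β_ B P).hom) ⊗≫
          (μ[E] ▷ P ≫ x) ▷ B := by rw [← whisker_exchange]; monoidal
      _ = 𝟙 _ ⊗≫ E ◁ (β_ B E).hom ▷ B ▷ P ⊗≫ (E ⊗ E) ◁ (β_ (B ⊗ B) P).hom ⊗≫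
          E ◁ (E ⊗ P) ◁ μ[B] ⊗≫ (E ◁ x ≫ x) ▷ B := by
        rw [BraidedCategory.braiding_naturality_left, hx]; monoidal
      _ = 𝟙 _ ⊗≫ E ◁ (β_ B E).hom ▷ B ▷ P ⊗≫ (E ⊗ E) ◁ (β_ (B ⊗ B) P).hom ⊗≫
          E ◁ ((E ⊗ P) ◁ μ[B] ≫ x ▷ B) ⊗≫ x ▷ B := by monoidal
      _ = 𝟙 _ ⊗≫ E ◁ (β_ B E).hom ▷ B ▷ P ⊗≫ (E ⊗ E) ◁ (β_ (B ⊗ B) P).hom ⊗≫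
          E ◁ x ▷ (B ⊗ B) ⊗≫ ((E ⊗ P) ◁ μ[B] ≫ x ▷ B) := by
        conv_lhs => rw [whisker_exchange x μ[B]]
        monoidal
      _ = _ := by
        rw [whisker_exchange x μ[B], BraidedCategory.braiding_tensor_left_hom]; monoidal
  · symm
    calc
      _ = 𝟙 _ ⊗≫ (E ⊗ B ⊗ E) ◁ (β_ B P).hom ⊗≫ E ◁ (B ◁ x ≫ (β_ B P).hom) ▷ B ⊗≫
          x ▷ (B ⊗ B) ⊗≫ P ◁ μ[B] := by monoidal
      _ = 𝟙 _ ⊗≫ E ◁ ((B ⊗ E) ◁ (β_ B P).hom ≫ (β_ B E).hom ▷ (P ⊗ B)) ⊗≫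
          (E ⊗ E) ◁ (β_ B P).hom ▷ B ⊗≫ E ◁ x ▷ (B ⊗ B) ⊗≫ x ▷ (B ⊗ B) ⊗≫ P ◁ μ[B] := by
        rw [BraidedCategory.braiding_naturality_right, BraidedCategory.braiding_tensor_right_hom]
        monoidal
      _ = _ := by
        rw [whisker_exchange]; monoidal

lemma left_act_mul {x : E ⊗ P ⟶ P} (hx : μ[E] ▷ P ≫ x = (α_ E E P).hom ≫ E ◁ x ≫ x) :
    μ[B ⊗ E] ▷ P ≫ leftAct B x = (α_ _ _ _).hom ≫ (B ⊗ E) ◁ leftAct B x ≫ (α_ _ _ _).inv ≫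
      leftAct B x ▷ B ≫ (α_ _ _ _).hom ≫ P ◁ μ[B] := by
  rw [leftAct, MonObj.tensorObj.mul_def, tensorμ, MonoidalCategory.tensorHom_def']
  trans 𝟙 _ ⊗≫ B ◁ (β_ E B).hom ▷ E ▷ P ⊗≫ (B ⊗ B) ◁ (E ◁ x ≫ x) ⊗≫ B ◁ (β_ P B).inv ⊗≫
      (β_ P B).inv ▷ B ⊗≫ P ◁ μ[B]
  · calc
      _ = 𝟙 _ ⊗≫ B ◁ (β_ E B).hom ▷ E ▷ P ⊗≫ (B ⊗ B) ◁ μ[E] ▷ P ⊗≫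
          (μ[B] ▷ (E ⊗ P) ≫ B ◁ x) ⊗≫ (β_ P B).inv := by monoidal
      _ = 𝟙 _ ⊗≫ B ◁ (β_ E B).hom ▷ E ▷ P ⊗≫ (B ⊗ B) ◁ (μ[E] ▷ P ≫ x) ⊗≫
          (μ[B] ▷ P ≫ (β_ P B).inv) := by rw [← whisker_exchange]; monoidal
      _ = _ := by
        rw [hx, BraidedCategory.braiding_inv_naturality_left,
          BraidedCategory.braiding_tensor_right_inv]
        monoidal
  · symm
    calc
      _ = 𝟙 _ ⊗≫ (B ⊗ E ⊗ B) ◁ x ⊗≫ B ◁ (E ◁ (β_ P B).inv ⊗≫ x ▷ B) ⊗≫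
          (β_ P B).inv ▷ B ⊗≫ P ◁ μ[B] := by monoidal
      _ = 𝟙 _ ⊗≫ (B ⊗ E ⊗ B) ◁ x ⊗≫ B ◁ ((β_ E B).hom ▷ P ⊗≫ ((β_ (E ⊗ P) B).inv ≫ x ▷ B)) ⊗≫
          (β_ P B).inv ▷ B ⊗≫ P ◁ μ[B] := by
        rw [BraidedCategory.braiding_tensor_left_inv]
        calc
          _ = 𝟙 _ ⊗≫ (B ⊗ E ⊗ B) ◁ x ⊗≫ B ◁ (((β_ E B).hom ≫ (β_ E B).inv) ▷ P ⊗≫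
              E ◁ (β_ P B).inv ⊗≫ x ▷ B) ⊗≫ (β_ P B).inv ▷ B ⊗≫ P ◁ μ[B] := by
            rw [Iso.hom_inv_id]; monoidal
          _ = _ := by monoidal
      _ = 𝟙 _ ⊗≫ B ◁ ((E ⊗ B) ◁ x ≫ (β_ E B).hom ▷ P) ⊗≫ B ◁ B ◁ x ⊗≫ B ◁ (β_ P B).inv ⊗≫
          (β_ P B).inv ▷ B ⊗≫ P ◁ μ[B] := by
        rw [← BraidedCategory.braiding_inv_naturality_right]; monoidal
      _ = _ := by
        rw [whisker_exchange]; monoidal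

variable [MonoidalClosed D]

/-- The braiding is in general not multiplicative, so it cannot serve here. Instead both algebras
act universally from `P` to `P ⊗ B`, and comparing the two universal actions gives an isomorphism
which respects units and products because both actions do. -/
lemma iEnd_swap_iso {P : D} (hP : IsFinite P) (B : Mon D) :
    Nonempty (B ⊗ iEnd P ≅ iEnd P ⊗ B) := by
  have hv : IsUniversal (rightAct B.X (elev P)) := (isUniversal_elev hP).right B.X
  have hv' : IsUniversal (leftAct B.X (elev P)) := by
    have := ((isUniversal_elev hP).left B.X).iso_right (β_ P B.X).symm
    rwa [Category.assoc] at this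
  obtain ⟨e, he⟩ := hv.exists_iso hv'
  have h1 : η[B.X ⊗ (iEnd P).X] ≫ e.hom = η[(iEnd P).X ⊗ B.X] := by
    apply hv.ext
    rw [comp_whiskerRight, Category.assoc, he, left_act_one (elev_one P),
      right_act_one (elev_one P)]
  have : IsMonHom e.hom := ⟨h1, by
    apply hv.ext
    rw [comp_whiskerRight, Category.assoc, he, comp_whiskerRight, Category.assoc,
      right_act_mul (elev_mul P), left_act_mul (elev_mul P), ← he, MonoidalCategory.tensorHom_def']
    generalize rightAct B.X (elev P) = v
    calc
      _ = 𝟙 _ ⊗≫ (B.X ⊗ (iEnd P).X) ◁ e.hom ▷ P ⊗≫ ((B.X ⊗ (iEnd P).X) ◁ v ≫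
          e.hom ▷ (P ⊗ B.X)) ⊗≫ v ▷ B.X ⊗≫ P ◁ μ[B.X] := by monoidal
      _ = _ := by rw [whisker_exchange]; monoidal⟩
  exact ⟨(Mon.mkIso' e : Mon.mk _ ≅ Mon.mk _)⟩

end Swap

/-! ### The opposite of an Azumaya algebra. -/

section Opposite

/-- An identity between two words in the braid group on three strands. It rearranges the braidings
hidden in the multiplications of a twice-opposite algebra. -/
lemma braid_full_twist {M : Type*} [Monoid M] {s t : M} (h : s * t * s = t * s * t) :
    t * t * t * s * t * t * s = s * s * t * s * s * t * t := by
  have h1 : t * (s * t * s) = s * t * s * s := by rw [← mul_assoc, ← mul_assoc, ← h]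
  have h2 : s * (s * t * s) = s * t * s * t := by rw [h]; simp only [← mul_assoc]; rw [h]
  calc
    _ = t * t * (t * s * t) * t * s := by simp only [mul_assoc]
    _ = t * (t * s * t) * (s * t * s) := by conv_lhs => rw [← h]
                                            simp only [mul_assoc]
    _ = t * (s * t * s) * (s * t * s) := by rw [← h]
    _ = s * t * s * (s * (s * t * s)) := by rw [h1]; simp only [mul_assoc]
    _ = (s * t * s) * (s * t * s) * t := by rw [h2]; simp only [mul_assoc]
    _ = (s * t * s) * (t * s * t) * t := by rw [h]
    _ = s * (t * s * t) * s * t * t := by simp only [mul_assoc]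
    _ = s * (s * t * s) * s * t * t := by rw [h]
    _ = _ := by simp only [mul_assoc]

variable {D : Type u} [Category.{v} D] [MonoidalCategory D] [BraidedCategory D]

lemma biact_op_op (A : Mon D) : (biact (opAlg (opAlg A)).X : (A.X ⊗ A.X) ⊗ A.X ⟶ A.X) =
    ((β_ A.X A.X).hom ≫ (β_ A.X A.X).hom) ▷ A.X ≫ (β_ (A.X ⊗ A.X) A.X).hom ≫
      (β_ A.X (A.X ⊗ A.X)).hom ≫ biact A.X := by
  obtain ⟨A⟩ := A
  change (α_ A A A).hom ≫ A ◁ ((β_ A A).hom ≫ (β_ A A).hom ≫ (β_ A A).hom ≫ μ[A]) ≫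
    (β_ A A).hom ≫ (β_ A A).hom ≫ μ[A] = _ ≫ _ ≫ _ ≫ (α_ A A A).hom ≫
      A ◁ ((β_ A A).hom ≫ μ[A]) ≫ μ[A]
  -- The two generators of the braid group on three strands. The word identity is applied in the
  -- opposite monoid because multiplication in `End` reverses the order of composition.
  let s : End (A ⊗ (A ⊗ A)) := (α_ A A A).inv ≫ (β_ A A).hom ▷ A ≫ (α_ A A A).hom
  let t : End (A ⊗ (A ⊗ A)) := A ◁ (β_ A A).hom
  have hst : s * t * s = t * s * t := by
    change s ≫ t ≫ s = t ≫ s ≫ t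
    simpa [s, t] using BraidedCategory.yang_baxter A A A
  have key2 : t ≫ t ≫ t ≫ s ≫ t ≫ t ≫ s = s ≫ s ≫ t ≫ s ≫ s ≫ t ≫ t := by
    have := congrArg MulOpposite.unop (braid_full_twist (M := (End (A ⊗ (A ⊗ A)))ᵐᵒᵖ)
      (s := .op s) (t := .op t) (MulOpposite.unop_injective (by
        simpa [mul_assoc] using hst)))
    simp only [MulOpposite.unop_mul, MulOpposite.unop_op, End.mul_def, Category.assoc] at this
    exact this
  simp only [MonoidalCategory.whiskerLeft_comp, Category.assoc]
  rw [BraidedCategory.braiding_naturality_right_assoc,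
    BraidedCategory.braiding_naturality_left_assoc,
    BraidedCategory.braiding_tensor_left_hom, BraidedCategory.braiding_tensor_right_hom]
  have := congrArg (fun w => (α_ A A A).hom ≫ w ≫ A ◁ μ[A] ≫ μ[A]) key2
  simpa [s, t] using this

variable [MonoidalClosed D]

/-- Inserting the double braiding with `P` is a natural automorphism of `X ↦ Hom(X ⊗ P, Q)`. By the
Yoneda argument it comes from an automorphism `d` of `[P, Q]`. -/
lemma isIso_lcurry_double_braiding {A P Q : D} (a : A ⊗ P ⟶ Q) [IsIso (lcurry a)] :
    IsIso (lcurry ((β_ A P).hom ≫ (β_ P A).hom ≫ a)) := by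
  let d : (ihom P).obj Q ⟶ (ihom P).obj Q := lcurry ((β_ _ P).hom ≫ (β_ P _).hom ≫ lev P Q)
  let d' : (ihom P).obj Q ⟶ (ihom P).obj Q := lcurry ((β_ P _).inv ≫ (β_ _ P).inv ≫ lev P Q)
  have nat {X : D} (f : X ⟶ (ihom P).obj Q) :
      lcurry ((β_ X P).hom ≫ (β_ P X).hom ≫ f ▷ P ≫ lev P Q) =
      f ≫ d := lev_ext (by
    rw [lcurry_lev, comp_whiskerRight, Category.assoc, lcurry_lev,
      BraidedCategory.braiding_naturality_left_assoc,
      BraidedCategory.braiding_naturality_right_assoc])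
  have nat' {X : D} (f : X ⟶ (ihom P).obj Q) :
      lcurry ((β_ P X).inv ≫ (β_ X P).inv ≫ f ▷ P ≫ lev P Q) = f ≫ d' := lev_ext (by
    rw [lcurry_lev, comp_whiskerRight, Category.assoc, lcurry_lev,
      BraidedCategory.braiding_inv_naturality_left_assoc,
      BraidedCategory.braiding_inv_naturality_right_assoc])
  have : IsIso d := ⟨d', by rw [← nat' d, lcurry_lev]; exact lev_ext (by rw [lcurry_lev]; simp),
    by rw [← nat d', lcurry_lev]; exact lev_ext (by rw [lcurry_lev]; simp)⟩
  have h := nat (lcurry a)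
  rw [lcurry_lev] at h
  rw [h]
  infer_instance

/-- Without symmetry the double opposite need not be the original algebra, so the condition on
`opAlg (opAlg A)` needs an argument. By `biact_op_op` its two-sided multiplication is that of `A` up
to double braidings, and these preserve universality. -/
lemma IsAzumaya.op {A : Mon D} (h : IsAzumaya A) : IsAzumaya (opAlg A) := by
  obtain ⟨hP, h1, h2⟩ := (isAzumaya_iff A).1 h
  refine (isAzumaya_iff (opAlg A)).2 ⟨hP, h2, ?_⟩
  obtain ⟨A', _, -⟩ := hP.exists_exactPairing
  have : IsIso (lcurry (P := A.X) (biact A.X)) := h1.isIso_lcurry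
  have h3 := (isUniversal_iff_isIso A' _).2 (isIso_lcurry_double_braiding (P := A.X) (biact A.X))
  change IsUniversal (P := A.X) (biact (opAlg (opAlg A)).X)
  rw [biact_op_op]
  exact h3.iso_left (β_ A.X A.X ≪≫ β_ A.X A.X)

lemma IsAzumaya.tensor {A B : Mon D} (hA : IsAzumaya A) (hB : IsAzumaya B) :
    IsAzumaya (A ⊗ B) := by
  obtain ⟨hP, h1, h2⟩ := (isAzumaya_iff A).1 hA
  obtain ⟨hQ, h3, h4⟩ := (isAzumaya_iff B).1 hB
  exact (isAzumaya_iff (A ⊗ B)).2 ⟨hP.tensor hQ, h1.tensor h3,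
    (h4.tensor h2).of_iso (opTensorIso A B).symm⟩

end Opposite

/-! ### Endomorphism algebras of faithfully projective objects are Azumaya. -/

section EndAzumaya

section

variable {D : Type u} [Category.{v} D] [MonoidalCategory D] [BraidedCategory D]

variable {E P P' : D} {x : E ⊗ P ⟶ P} {y : P' ⊗ E ⟶ P'}

/-- Left and right multiplication in an endomorphism algebra. -/
lemma biact_of_mul [MonObj E] (e : E ≅ P ⊗ P')
    (h1 : μ[E] ≫ e.hom = E ◁ e.hom ≫ (α_ E P P').inv ≫ x ▷ P')
    (h2 : μ[E] ≫ e.hom = e.hom ▷ E ≫ (α_ P P' E).hom ≫ P ◁ y) :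
    biact E ≫ e.hom = (E ⊗ E) ◁ e.hom ≫ tensorμ E E P P' ≫ (x ⊗ₘ ((β_ E P').hom ≫ y)) := by
  rw [biact, combineAct, Category.assoc, Category.assoc, h1]
  calc
    _ = (α_ E E E).hom ≫ E ◁ ((β_ E E).hom ≫ μ[E] ≫ e.hom) ≫ (α_ E P P').inv ≫ x ▷ P' := by
      rw [rmul]; simp
    _ = (α_ E E E).hom ≫ E ◁ (E ◁ e.hom ≫ (β_ E (P ⊗ P')).hom ≫ (α_ P P' E).hom ≫ P ◁ y) ≫
          (α_ E P P').inv ≫ x ▷ P' := by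
      rw [h2, BraidedCategory.braiding_naturality_right_assoc]
    _ = 𝟙 _ ⊗≫ (E ⊗ E) ◁ e.hom ⊗≫ E ◁ (β_ E P).hom ▷ P' ⊗≫ ((E ⊗ P) ◁ ((β_ E P').hom ≫ y) ≫
          x ▷ P') := by
      rw [BraidedCategory.braiding_tensor_right_hom]; monoidal
    _ = _ := by
      rw [← MonoidalCategory.tensorHom_def', tensorμ]; monoidal

end

variable {D : Type u} [Category.{v} D] [MonoidalCategory D]

variable {E P P' : D} [ExactPairing P P'] {x : E ⊗ P ⟶ P}

/-- The action of `P ⊗ P'` on `P`. -/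
def coevAct (P P' : D) [ExactPairing P P'] : (P ⊗ P') ⊗ P ⟶ P :=
  (α_ P P' P).hom ≫ P ◁ ε_ P P' ≫ (ρ_ P).hom

/-- This is the transposed right action of `E` on the dual of `P`. -/
lemma exists_dualAct (P' : D) [ExactPairing P P'] (x : E ⊗ P ⟶ P) :
    ∃ y : P' ⊗ E ⟶ P', y ▷ P ≫ ε_ P P' = (α_ P' E P).hom ≫ P' ◁ x ≫ ε_ P P' :=
  (isUniversal_evaluation P P').existsUnique _ |>.exists

section

variable {y : P' ⊗ E ⟶ P'}

lemma dualAct_one [MonObj E]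
    (hy : y ▷ P ≫ ε_ P P' = (α_ P' E P).hom ≫ P' ◁ x ≫ ε_ P P')
    (h : η[E] ▷ P ≫ x = (λ_ P).hom) : P' ◁ η[E] ≫ y = (ρ_ P').hom := by
  apply (isUniversal_evaluation P P').ext
  calc
    _ = 𝟙 _ ⊗≫ P' ◁ (η[E] ▷ P ≫ x) ≫ ε_ P P' := by
      rw [comp_whiskerRight, Category.assoc, hy]; monoidal
    _ = _ := by rw [h]; monoidal

lemma dualAct_mul [MonObj E]
    (hy : y ▷ P ≫ ε_ P P' = (α_ P' E P).hom ≫ P' ◁ x ≫ ε_ P P')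
    (h : μ[E] ▷ P ≫ x = (α_ E E P).hom ≫ E ◁ x ≫ x) :
    P' ◁ μ[E] ≫ y = (α_ P' E E).inv ≫ y ▷ E ≫ y := by
  apply (isUniversal_evaluation P P').ext
  calc
    _ = 𝟙 _ ⊗≫ P' ◁ (μ[E] ▷ P ≫ x) ≫ ε_ P P' := by
      rw [comp_whiskerRight, Category.assoc, hy]; monoidal
    _ = 𝟙 _ ⊗≫ (P' ⊗ E) ◁ x ⊗≫ ((α_ P' E P).hom ≫ P' ◁ x ≫ ε_ P P') := by rw [h]; monoidal
    _ = 𝟙 _ ⊗≫ ((P' ⊗ E) ◁ x ≫ y ▷ P) ≫ ε_ P P' := by rw [← hy]; monoidal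
    _ = 𝟙 _ ⊗≫ y ▷ (E ⊗ P) ⊗≫ (P' ◁ x ≫ ε_ P P') := by rw [whisker_exchange]; monoidal
    _ = 𝟙 _ ⊗≫ y ▷ (E ⊗ P) ⊗≫ (y ▷ P ≫ ε_ P P') := by rw [hy]; monoidal
    _ = _ := by monoidal

lemma dualAct_eq
    (hy : y ▷ P ≫ ε_ P P' = (α_ P' E P).hom ≫ P' ◁ x ≫ ε_ P P')
    (e : E ⟶ P ⊗ P') (he : e ▷ P ≫ coevAct P P' = x) :
    y = P' ◁ e ≫ (α_ P' P P').inv ≫ ε_ P P' ▷ P' ≫ (λ_ P').hom := by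
  apply (isUniversal_evaluation P P').ext
  rw [hy, ← he, coevAct]
  calc
    _ = 𝟙 _ ⊗≫ P' ◁ e ▷ P ⊗≫ ((P' ⊗ P) ◁ ε_ P P' ≫ ε_ P P' ▷ (𝟙_ D)) ⊗≫ 𝟙 _ := by monoidal
    _ = _ := by rw [whisker_exchange]; monoidal

lemma coevAct_isUniversal : IsUniversal (coevAct P P') := by
  simpa [coevAct] using ((isUniversal_evaluation P P').left P).iso_right (ρ_ P)

/-- Under `E ⟶ P ⊗ P'` left multiplication only moves the factor `P`. Both sides are compared
through their effect on `P`, which determines them by universality. -/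
lemma mul_left_of_universal [MonObj E] (h : μ[E] ▷ P ≫ x = (α_ E E P).hom ≫ E ◁ x ≫ x)
    (e : E ⟶ P ⊗ P') (he : e ▷ P ≫ coevAct P P' = x) :
    μ[E] ≫ e = E ◁ e ≫ (α_ E P P').inv ≫ x ▷ P' := by
  apply coevAct_isUniversal.ext
  rw [comp_whiskerRight, Category.assoc, he, h]
  calc
    _ = 𝟙 _ ⊗≫ E ◁ (e ▷ P ≫ coevAct P P') ≫ x := by rw [he]; monoidal
    _ = 𝟙 _ ⊗≫ E ◁ e ▷ P ⊗≫ ((E ⊗ P) ◁ ε_ P P' ≫ x ▷ (𝟙_ D)) ⊗≫ 𝟙 _ := by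
      rw [coevAct]; monoidal
    _ = _ := by rw [whisker_exchange, coevAct]; monoidal

/-- Right multiplication only moves the factor `P'`, through the transposed action `y`. -/
lemma mul_right_of_universal [MonObj E]
    (hy : y ▷ P ≫ ε_ P P' = (α_ P' E P).hom ≫ P' ◁ x ≫ ε_ P P')
    (h : μ[E] ▷ P ≫ x = (α_ E E P).hom ≫ E ◁ x ≫ x)
    (e : E ⟶ P ⊗ P') (he : e ▷ P ≫ coevAct P P' = x) :
    μ[E] ≫ e = e ▷ E ≫ (α_ P P' E).hom ≫ P ◁ y := by
  apply coevAct_isUniversal.ext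
  rw [comp_whiskerRight, Category.assoc, he, h]
  symm
  calc
    _ = 𝟙 _ ⊗≫ e ▷ E ▷ P ⊗≫ P ◁ (y ▷ P ≫ ε_ P P') ⊗≫ 𝟙 _ := by rw [coevAct]; monoidal
    _ = 𝟙 _ ⊗≫ (e ▷ (E ⊗ P) ≫ (P ⊗ P') ◁ x) ⊗≫ P ◁ ε_ P P' ⊗≫ 𝟙 _ := by rw [hy]; monoidal
    _ = 𝟙 _ ⊗≫ E ◁ x ⊗≫ (e ▷ P ≫ coevAct P P') := by
      rw [← whisker_exchange, coevAct]; monoidal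
    _ = _ := by rw [he]; monoidal

variable [BraidedCategory D]

/-- The braiding makes `P` a dual of `P'`. Under `E ≅ P ⊗ P'` the transposed action is the
evaluation of this swapped duality with `P'` carried along. -/
lemma dualAct_isUniversal (e : E ≅ P ⊗ P')
    (h : y = P' ◁ e.hom ≫ (α_ P' P P').inv ≫ ε_ P P' ▷ P' ≫ (λ_ P').hom) :
    IsUniversal ((β_ E P').hom ≫ y) := by
  let := BraidedCategory.exactPairing_swap P P'
  have := ((isUniversal_evaluation P' P).right P').iso_right (λ_ P')
  have h2 := this.iso_left e
  convert h2 using 1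
  rw [h, ← BraidedCategory.braiding_naturality_left_assoc,
    BraidedCategory.braiding_tensor_left_hom]
  change _ = _ ≫ (_ ≫ _ ≫ _ ≫ ((β_ _ _).hom ≫ ε_ P P') ▷ _) ≫ _
  simp

lemma dualAct_op_one [MonObj E] (h : P' ◁ η[E] ≫ y = (ρ_ P').hom) :
    η[E] ▷ P' ≫ (β_ E P').hom ≫ y = (λ_ P').hom := by
  rw [BraidedCategory.braiding_naturality_left_assoc, h]; simp

lemma dualAct_op_mul [MonObj E] (h : P' ◁ μ[E] ≫ y = (α_ P' E E).inv ≫ y ▷ E ≫ y) :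
    rmul E ▷ P' ≫ (β_ E P').hom ≫ y =
      (α_ E E P').hom ≫ E ◁ ((β_ E P').hom ≫ y) ≫ (β_ E P').hom ≫ y := by
  rw [rmul, BraidedCategory.braiding_naturality_left_assoc, MonoidalCategory.whiskerLeft_comp,
    Category.assoc, h, MonoidalCategory.whiskerLeft_comp, Category.assoc,
    BraidedCategory.braiding_naturality_right_assoc, BraidedCategory.braiding_tensor_left_hom,
    BraidedCategory.braiding_tensor_right_hom]
  simp

end

variable [BraidedCategory D] [MonoidalClosed D]

/-- For `E = [P, P] ≅ P ⊗ P'` two-sided multiplication splits into the tensor product of the action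
on `P` and the transposed action on `P'`, both of which are universal. -/
lemma FaithfullyProjective.isAzF_iEnd {P : D} (hP : FaithfullyProjective P) : IsAzF (iEnd P) := by
  obtain ⟨P', _, hd⟩ := hP.exists_exactPairing
  have hE := isUniversal_elev hP.1
  obtain ⟨e, he⟩ := (coevAct_isUniversal (P := P) (P' := P')).exists_iso hE
  obtain ⟨y, hy⟩ := exists_dualAct P' (elev P)
  have hz := dualAct_isUniversal e (dualAct_eq hy e.hom he)
  have hb := biact_of_mul e (mul_left_of_universal (elev_mul P) e.hom he)
    (mul_right_of_universal hy (elev_mul P) e.hom he)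
  have h := ((hE.tensor hz).iso_mid e).iso_right e.symm
  change IsUniversal (biact (iEnd P).X)
  convert h using 1
  rw [Iso.symm_hom, Iso.eq_comp_inv, hb]

/-- The transposed action on `P'` is universal, so it exhibits the opposite of `[P, P]` as `[P',
P']`. This reduces the Azumaya condition on the opposite algebra to the one already known for
endomorphism algebras. -/
lemma FaithfullyProjective.op_iEnd_iso {P : D} (hP : FaithfullyProjective P) :
    ∃ P' : D, FaithfullyProjective P' ∧ Nonempty ((iEnd P).X ≅ P ⊗ P') ∧
      Nonempty (opAlg (iEnd P) ≅ iEnd P') := by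
  obtain ⟨P', _, hd⟩ := hP.exists_exactPairing
  have hE := isUniversal_elev hP.1
  obtain ⟨e, he⟩ := (coevAct_isUniversal (P := P) (P' := P')).exists_iso hE
  obtain ⟨y, hy⟩ := exists_dualAct P' (elev P)
  have hz := dualAct_isUniversal e (dualAct_eq hy e.hom he)
  have h1 := dualAct_op_one (dualAct_one hy (elev_one P))
  have h2 := dualAct_op_mul (dualAct_mul hy (elev_mul P))
  refine ⟨P', faithfullyProjective_dual hd, ⟨e⟩, nonempty_iso_iEnd (opAlg (iEnd P)) ?_ ?_ hz⟩
  · exact h1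
  · exact h2

lemma FaithfullyProjective.isAzumaya_iEnd {P : D} (hP : FaithfullyProjective P) :
    IsAzumaya (iEnd P) := by
  obtain ⟨P', hP', ⟨e⟩, ⟨i⟩⟩ := hP.op_iEnd_iso
  exact (isAzumaya_iff _).2 ⟨(hP.tensor hP').of_iso e, hP.isAzF_iEnd, hP'.isAzF_iEnd.of_iso i⟩

end EndAzumaya

/-! ### The Brauer group. -/

section BrauerGroup

variable {D : Type u} [Category.{v} D] [MonoidalCategory D] [BraidedCategory D]
  [MonoidalClosed D]

lemma iEnd_comm {P Q : D} (hP : IsFinite P) (hQ : IsFinite Q) (hPQ : IsFinite (P ⊗ Q)) :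
    Nonempty (iEnd P ⊗ iEnd Q ≅ iEnd Q ⊗ iEnd P) := by
  obtain ⟨i⟩ := iEnd_tensor_iso hP hQ
  obtain ⟨j⟩ := iEnd_tensor_iso hQ hP
  obtain ⟨k⟩ := iEnd_iso_of_iso (β_ P Q) hPQ
  exact ⟨i ≪≫ k ≪≫ j.symm⟩

lemma BrauerEquiv.of_iso {A B : Azumaya D} (i : A.1 ≅ B.1) : BrauerEquiv A B :=
  ⟨𝟙_ D, 𝟙_ D, faithfullyProjective_unit, faithfullyProjective_unit, ⟨whiskerRightIso i _⟩⟩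

lemma brauerEquiv_equivalence : Equivalence (BrauerEquiv (D := D)) where
  refl A := .of_iso (Iso.refl A.1)
  symm := by
    rintro A B ⟨P, Q, hP, hQ, ⟨i⟩⟩
    exact ⟨Q, P, hQ, hP, ⟨i.symm⟩⟩
  trans := by
    rintro A B C ⟨P, Q, hP, hQ, ⟨i⟩⟩ ⟨R, S, hR, hS, ⟨j⟩⟩
    obtain ⟨k⟩ := iEnd_tensor_iso hP.1 hR.1
    obtain ⟨l⟩ := iEnd_comm hQ.1 hR.1 (hQ.tensor hR).1
    obtain ⟨m⟩ := iEnd_tensor_iso hS.1 hQ.1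
    exact ⟨P ⊗ R, S ⊗ Q, hP.tensor hR, hS.tensor hQ,
      ⟨whiskerLeftIso A.1 k.symm ≪≫ (α_ A.1 (iEnd P) (iEnd R)).symm ≪≫
        whiskerRightIso i (iEnd R) ≪≫ α_ B.1 (iEnd Q) (iEnd R) ≪≫ whiskerLeftIso B.1 l ≪≫
        (α_ B.1 (iEnd R) (iEnd Q)).symm ≪≫ whiskerRightIso j (iEnd Q) ≪≫
        α_ C.1 (iEnd S) (iEnd Q) ≪≫ whiskerLeftIso C.1 m⟩⟩

lemma Br.mk_eq_mk_iff (A B : Azumaya D) : Br.mk A = Br.mk B ↔ BrauerEquiv A B :=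
  Quot.eq.trans brauerEquiv_equivalence.eqvGen_iff

/-- The tensor product of Azumaya algebras. -/
def Azumaya.mul (A B : Azumaya D) : Azumaya D := ⟨A.1 ⊗ B.1, A.2.tensor B.2⟩

lemma BrauerEquiv.mul_left (A : Azumaya D) {B B' : Azumaya D} (h : BrauerEquiv B B') :
    BrauerEquiv (A.mul B) (A.mul B') := by
  obtain ⟨P, Q, hP, hQ, ⟨i⟩⟩ := h
  exact ⟨P, Q, hP, hQ,
    ⟨α_ A.1 B.1 (iEnd P) ≪≫ whiskerLeftIso A.1 i ≪≫ (α_ A.1 B'.1 (iEnd Q)).symm⟩⟩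

/-- The endomorphism algebra has to be moved past `B` before the given isomorphism can be used, and
back afterwards. This is the purpose of `iEnd_swap_iso`. -/
lemma BrauerEquiv.mul_right {A A' : Azumaya D} (B : Azumaya D) (h : BrauerEquiv A A') :
    BrauerEquiv (A.mul B) (A'.mul B) := by
  obtain ⟨P, Q, hP, hQ, ⟨i⟩⟩ := h
  obtain ⟨k⟩ := iEnd_swap_iso hP.1 B.1
  obtain ⟨l⟩ := iEnd_swap_iso hQ.1 B.1
  exact ⟨P, Q, hP, hQ, ⟨α_ A.1 B.1 (iEnd P) ≪≫ whiskerLeftIso A.1 k ≪≫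
    (α_ A.1 (iEnd P) B.1).symm ≪≫ whiskerRightIso i B.1 ≪≫ α_ A'.1 (iEnd Q) B.1 ≪≫
    whiskerLeftIso A'.1 l.symm ≪≫ (α_ A'.1 B.1 (iEnd Q)).symm⟩⟩

/-- The endomorphism algebra of a faithfully projective object, as an Azumaya algebra. -/
def Azumaya.iEnd {P : D} (hP : FaithfullyProjective P) : Azumaya D :=
  ⟨HopfBrauer.iEnd P, hP.isAzumaya_iEnd⟩

lemma Azumaya.mk_iEnd {P Q : D} (hP : FaithfullyProjective P) (hQ : FaithfullyProjective Q) :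
    Br.mk (Azumaya.iEnd hP) = Br.mk (Azumaya.iEnd hQ) := by
  obtain ⟨l⟩ := iEnd_comm hP.1 hQ.1 (hP.tensor hQ).1
  exact (Br.mk_eq_mk_iff _ _).2 ⟨Q, P, hQ, hP, ⟨l⟩⟩

scoped instance : Mul (Br D) :=
  ⟨Quot.map₂ Azumaya.mul (fun A _ _ h => h.mul_left A) (fun _ _ B h => h.mul_right B)⟩

scoped instance : One (Br D) := ⟨Br.mk (Azumaya.iEnd faithfullyProjective_unit)⟩

lemma Br.mk_mul (A B : Azumaya D) : Br.mk A * Br.mk B = Br.mk (A.mul B) := rfl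

lemma Br.one_def : (1 : Br D) = Br.mk (Azumaya.iEnd faithfullyProjective_unit) := rfl

lemma Br.mk_iEnd {P : D} (hP : FaithfullyProjective P) : Br.mk (Azumaya.iEnd hP) = 1 :=
  Azumaya.mk_iEnd _ _

lemma Br.mk_mul_iEnd (A : Azumaya D) {P : D} (hP : FaithfullyProjective P) :
    Br.mk (A.mul (Azumaya.iEnd hP)) = Br.mk A := by
  obtain ⟨k⟩ := iEnd_tensor_iso hP.1 hP.1
  exact (Br.mk_eq_mk_iff _ _).2 ⟨P, P ⊗ P, hP, hP.tensor hP,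
    ⟨α_ A.1 (HopfBrauer.iEnd P) (HopfBrauer.iEnd P) ≪≫ whiskerLeftIso A.1 k⟩⟩

/-- The opposite of an Azumaya algebra. -/
def Azumaya.op (A : Azumaya D) : Azumaya D := ⟨opAlg A.1, A.2.op⟩

lemma Br.mk_mul_op (A : Azumaya D) : Br.mk A * Br.mk A.op = 1 := by
  obtain ⟨i⟩ := tensor_op_iso_iEnd ((isAzumaya_iff A.1).1 A.2).2.1
  rw [Br.mk_mul, ← Br.mk_iEnd A.2.1]
  exact Quot.sound (.of_iso i)

lemma Br.exists_inv (x : Br D) : ∃ y, x * y = 1 := by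
  induction x using Quot.ind with | _ A => exact ⟨_, Br.mk_mul_op A⟩

scoped instance : Inv (Br D) := ⟨fun x => (Br.exists_inv x).choose⟩

/-- The Brauer group of a closed braided monoidal category. -/
scoped instance brGroup : Group (Br D) :=
  Group.ofRightAxioms
    (by
      intro x y z
      induction x using Quot.ind with | _ A
      induction y using Quot.ind with | _ B
      induction z using Quot.ind with | _ C
      exact Quot.sound (.of_iso (α_ A.1 B.1 C.1)))
    (by
      intro x
      induction x using Quot.ind with | _ A
      exact Br.mk_mul_iEnd A faithfullyProjective_unit)
    (fun x => (Br.exists_inv x).choose_spec)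

lemma isBrauerGroup : IsBrauerGroup D where
  mk_eq_mk_iff := Br.mk_eq_mk_iff
  mk_mul_mk A B := ⟨A.2.tensor B.2, rfl⟩

end BrauerGroup

/-! ### The centre of an Azumaya algebra is trivial, with coefficients. -/

section Centre

variable {D : Type u} [Category.{v} D] [MonoidalCategory D]

/-- The morphism `z ↦ 1 ⊗ z`. -/
def unitTensor (A Z : D) [MonObj A] : Z ⟶ A ⊗ Z := (λ_ Z).inv ≫ η[A] ▷ Z

variable {A : D} [MonObj A]

lemma whiskerLeft_unitTensor (Z : D) :
    A ◁ unitTensor A Z ≫ (α_ A A Z).inv ≫ μ[A] ▷ Z = 𝟙 _ := by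
  calc
    _ = 𝟙 _ ⊗≫ (A ◁ η[A] ≫ μ[A]) ▷ Z := by rw [unitTensor]; monoidal
    _ = _ := by rw [MonObj.mul_one]; monoidal

variable [BraidedCategory D] [MonoidalClosed D]

/-- The evaluation `P' ⊗ P ⟶ I` is an epimorphism and stays one after tensoring, so `f` is recovered
from `P' ⊗ P ⊗ f`. -/
lemma FaithfullyProjective.whiskerLeft_injective {P : D} (hP : FaithfullyProjective P) {Y Z : D}
    {f g : Y ⟶ Z} (h : P ◁ f = P ◁ g) : f = g := by
  obtain ⟨P', _, hd⟩ := hP.exists_exactPairing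
  have := hd.epi
  have := IsDescent.epi_whiskerRight (ε_ P P') Y
  have key (f : Y ⟶ Z) : ε_ P P' ▷ Y ≫ (λ_ Y).hom ≫ f =
      (α_ _ _ _).hom ≫ P' ◁ P ◁ f ≫ (α_ _ _ _).inv ≫ ε_ P P' ▷ Z ≫ (λ_ Z).hom := by
    calc
      _ = 𝟙 _ ⊗≫ (ε_ P P' ▷ Y ≫ (𝟙_ D) ◁ f) ⊗≫ 𝟙 _ := by monoidal
      _ = _ := by rw [← whisker_exchange]; monoidal
  have h2 := key f
  rw [h, ← key g, cancel_epi, cancel_epi] at h2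
  exact h2

/-- After tensoring with `A` the multiplication is a retraction of the unit, and tensoring with `A`
is faithful. -/
lemma unitTensor_injective (hA : FaithfullyProjective A) {Y Z : D} {f g : Y ⟶ Z}
    (h : f ≫ unitTensor A Z = g ≫ unitTensor A Z) : f = g := by
  apply hA.whiskerLeft_injective
  have h2 := congrArg (fun t => A ◁ t ≫ (α_ A A Z).inv ≫ μ[A] ▷ Z) h
  simpa [whiskerLeft_unitTensor] using h2

lemma unit_injective (hA : FaithfullyProjective A) {Y : D} {f g : Y ⟶ 𝟙_ D}
    (h : f ≫ η[A] = g ≫ η[A]) : f = g := by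
  apply unitTensor_injective hA
  have e : unitTensor A (𝟙_ D) = η[A] ≫ (ρ_ A).inv := by rw [unitTensor]; simp [unitors_inv_equal]
  rw [e, reassoc_of% h]

/-- An element of `A ⊗ Z` on which left and right multiplication by `A` agree lies in `Z`. -/
lemma existsUnique_of_central (hA : FaithfullyProjective A) (hu : IsUniversal (biact A)) {X Z : D}
    (w : X ⟶ A ⊗ Z)
    (hw : A ◁ w ≫ (α_ A A Z).inv ≫ μ[A] ▷ Z = A ◁ w ≫ (α_ A A Z).inv ≫ rmul A ▷ Z) :
    ∃! y : X ⟶ Z, y ≫ unitTensor A Z = w := by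
  -- Every `t` is two-sided multiplication by some `g`. Since left and right multiplication agree on
  -- `w`, the effect of `t` on the `A`-leg of `w` is left multiplication by `t(1)`.
  have key (Y : D) (t : Y ⊗ A ⟶ A) : Y ◁ w ≫ (α_ Y A Z).inv ≫ t ▷ Z =
      ((ρ_ Y).inv ≫ Y ◁ η[A] ≫ t) ▷ X ≫ A ◁ w ≫ (α_ A A Z).inv ≫ μ[A] ▷ Z := by
    obtain ⟨g, hg, -⟩ := hu.existsUnique t
    have h1 : (ρ_ Y).inv ≫ Y ◁ η[A] ≫ t = g ≫ μ[A] := by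
      have h0 : A ◁ η[A] ≫ rmul A = (ρ_ A).hom := by
        rw [rmul, BraidedCategory.braiding_naturality_right_assoc, MonObj.one_mul]; simp
      calc
        _ = (ρ_ Y).inv ≫ (Y ◁ η[A] ≫ g ▷ A) ≫ biact A := by rw [← hg]; simp
        _ = 𝟙 _ ⊗≫ g ⊗≫ A ◁ (A ◁ η[A] ≫ rmul A) ≫ μ[A] := by
          rw [whisker_exchange, biact, combineAct]; monoidal
        _ = _ := by rw [h0]; monoidal
    rw [h1, ← hg]
    calc
      _ = 𝟙 _ ⊗≫ (Y ◁ w ≫ g ▷ (A ⊗ Z)) ⊗≫ biact A ▷ Z := by monoidal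
      _ = 𝟙 _ ⊗≫ g ▷ X ⊗≫ A ◁ (A ◁ w ≫ (α_ A A Z).inv ≫ rmul A ▷ Z) ⊗≫ μ[A] ▷ Z := by
        rw [whisker_exchange, biact, combineAct]; monoidal
      _ = 𝟙 _ ⊗≫ g ▷ X ⊗≫ (A ⊗ A) ◁ w ⊗≫ ((α_ A A A).hom ≫ A ◁ μ[A] ≫ μ[A]) ▷ Z := by
        rw [← hw]; monoidal
      _ = 𝟙 _ ⊗≫ g ▷ X ⊗≫ ((A ⊗ A) ◁ w ≫ μ[A] ▷ (A ⊗ Z)) ⊗≫ μ[A] ▷ Z := by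
        rw [← MonObj.mul_assoc]; monoidal
      _ = _ := by rw [whisker_exchange]; monoidal
  obtain ⟨A', _, hd⟩ := hA.exists_exactPairing
  -- The functional `x ↦ ⟨a', a x⟩` is applied to the `A`-leg of `w`. Followed by the unit of `A` it
  -- becomes an endomorphism of `A` sending `1` to the scalar `⟨a', a⟩`, so `key` gives `1 ⊗ k =
  -- ⟨a', a⟩ w`.
  let k : (A' ⊗ A) ⊗ X ⟶ Z := (A' ⊗ A) ◁ w ≫ (α_ _ _ _).inv ≫
    ((α_ A' A A).hom ≫ A' ◁ μ[A] ≫ ε_ A A') ▷ Z ≫ (λ_ Z).hom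
  have hk : k ≫ unitTensor A Z = ε_ A A' ▷ X ≫ (λ_ X).hom ≫ w := by
    have h := key (A' ⊗ A) ((α_ A' A A).hom ≫ A' ◁ μ[A] ≫ ε_ A A' ≫ η[A])
    have h2 : (ρ_ (A' ⊗ A)).inv ≫ (A' ⊗ A) ◁ η[A] ≫ (α_ A' A A).hom ≫ A' ◁ μ[A] ≫ ε_ A A' ≫ η[A] =
        ε_ A A' ≫ η[A] := by
      calc
        _ = 𝟙 _ ⊗≫ A' ◁ (A ◁ η[A] ≫ μ[A]) ≫ ε_ A A' ≫ η[A] := by monoidal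
        _ = _ := by rw [MonObj.mul_one]; monoidal
    rw [h2] at h
    calc
      _ = _ := by
        trans (A' ⊗ A) ◁ w ≫ (α_ _ _ _).inv ≫
          ((α_ A' A A).hom ≫ A' ◁ μ[A] ≫ ε_ A A' ≫ η[A]) ▷ Z
        · simp only [k, unitTensor, comp_whiskerRight]; simp
        · exact h
      _ = 𝟙 _ ⊗≫ ε_ A A' ▷ X ⊗≫ (η[A] ▷ X ≫ A ◁ w) ⊗≫ μ[A] ▷ Z := by monoidal
      _ = 𝟙 _ ⊗≫ ε_ A A' ▷ X ⊗≫ w ⊗≫ (η[A] ▷ A ≫ μ[A]) ▷ Z := by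
        rw [← whisker_exchange]; monoidal
      _ = _ := by rw [MonObj.one_mul]; monoidal
  have hs (x : X ⟶ A ⊗ Z) : (β_ X (A' ⊗ A)).hom ≫ ε_ A A' ▷ X ≫ (λ_ X).hom ≫ x =
      X ◁ ε_ A A' ≫ (ρ_ X).hom ≫ x := by
    rw [← BraidedCategory.braiding_naturality_right_assoc]; simp
  -- Descent along the evaluation divides by the scalar `⟨a', a⟩`. The compatibility condition can
  -- be checked after embedding `Z` into `A ⊗ Z`, where it concerns two scalars in front of `w`.
  obtain ⟨y, hy, -⟩ := hd.param ((β_ X (A' ⊗ A)).hom ≫ k) (by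
    apply unitTensor_injective hA
    simp only [Category.assoc, hk, hs]
    have := congrArg (fun t => X ◁ t ≫ (ρ_ X).hom ≫ w) (scalar_comm (ε_ A A'))
    simpa using this)
  have := hd.epi
  have := IsDescent.epi_whiskerLeft X (ε_ A A')
  have h3 : y ≫ unitTensor A Z = w := by
    rw [← cancel_epi (ρ_ X).hom, ← cancel_epi (X ◁ ε_ A A'), ← hs w, ← hk, ← Category.assoc,
      ← Category.assoc, Category.assoc (X ◁ _), hy, Category.assoc]
  exact ⟨y, h3, fun y' h' => unitTensor_injective hA (h'.trans h3.symm)⟩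

end Centre

lemma curry_ev {D : Type u} [Category.{v} D] [MonoidalCategory D] [MonoidalClosed D] (P Q : D) :
    MonoidalClosed.curry (A := P) ((ihom.ev P).app Q) = 𝟙 ((ihom P).obj Q) := by
  rw [MonoidalClosed.curry_eq_iff]
  exact (MonoidalClosed.uncurry_id_eq_ev P Q).symm

/-! ### Comparison of modules with the underlying category. -/

section Forget

variable {C : Type u} [Category.{v} C] [MonoidalCategory C] [BraidedCategory C]
variable {H : C} [HopfObj H]

lemma isIso_hom_iff {X Y : Mod C H} (f : X ⟶ Y) : IsIso f.hom ↔ IsIso f := by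
  constructor
  · intro h
    exact inferInstanceAs (IsIso (mkIso (asIso f.hom) (lin f)).hom)
  · rintro ⟨g, h1, h2⟩
    exact ⟨g.hom, congrArg Mod.Hom.hom h1, congrArg Mod.Hom.hom h2⟩

/-- The trivial module. -/
@[reducible]
def trivObj (H : C) [HopfObj H] (X : C) : Mod C H := letI := trivMod H X; ⟨X⟩

variable [MonoidalClosed C]

/-- The factorization found in `C` is automatically `H`-linear: this can be tested after the
epimorphism `H ⊗ e`. -/
lemma IsDescent.of_hom {E : Mod C H} {e : E ⟶ 𝟙_ (Mod C H)}
    (h : IsDescent (D := C) (E := E.X) e.hom) : IsDescent e := by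
  intro Z f hf
  obtain ⟨g, hg, hu⟩ := h Z.X f.hom (congrArg Mod.Hom.hom hf)
  have hg : e.hom ≫ g = f.hom := hg
  have := h.epi
  have hl : hact H (𝟙_ (Mod C H)).X ≫ g = H ◁ g ≫ hact H Z.X := by
    rw [← cancel_epi (H ◁ e.hom)]
    have h1 := lin e
    have h2 := lin f
    rw [← hg] at h2
    rw [← MonoidalCategory.whiskerLeft_comp_assoc, ← h2, reassoc_of% h1]
  refine ⟨mkHom g hl, Mod.hom_ext _ _ hg, fun g' hg' => Mod.hom_ext _ _ (hu g'.hom ?_)⟩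
  exact congrArg Mod.Hom.hom hg'

/-- The coequalizer of the two morphisms, formed in `C`, carries an `H`-action because `H ⊗ -` has a
right adjoint. Descent for modules maps the unit object to it, and this map is inverse to the
canonical morphism from the coequalizer to the unit. -/
lemma IsDescent.hom [HasCoequalizers C] {E : Mod C H} {e : E ⟶ 𝟙_ (Mod C H)} (h : IsDescent e) :
    IsDescent (D := C) (E := E.X) e.hom := by
  let a := E ◁ e ≫ (ρ_ E).hom
  let b := e ▷ E ≫ (λ_ E).hom
  let π := coequalizer.π a.hom b.hom
  have hw : a.hom ≫ π = b.hom ≫ π := coequalizer.condition _ _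
  let hc := isColimitCoforkMapOfIsColimit (tensorLeft H) hw (coequalizerIsCoequalizer a.hom b.hom)
  obtain ⟨s, hs⟩ := Cofork.IsColimit.desc' hc (hact H E.X ≫ π) (by
    change H ◁ a.hom ≫ hact H E.X ≫ π = H ◁ b.hom ≫ hact H E.X ≫ π
    rw [← reassoc_of% (lin a), ← reassoc_of% (lin b), hw])
  have hs : H ◁ π ≫ s = hact H E.X ≫ π := hs
  let : ModObj H (coequalizer a.hom b.hom) :=
    { smul := s
      one_smul := by
        change η[H] ▷ _ ≫ s = _
        rw [← cancel_epi ((𝟙_ C) ◁ π), whisker_exchange_assoc, hs, reassoc_of% (one_hact E.X)]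
        simp
      mul_smul := by
        change μ[H] ▷ _ ≫ s = (α_ _ _ _).hom ≫ H ◁ s ≫ s
        rw [← cancel_epi ((H ⊗ H) ◁ π), whisker_exchange_assoc, hs, reassoc_of% (mul_hact E.X)]
        simp [hs, ← MonoidalCategory.whiskerLeft_comp_assoc] }
  let πm : E ⟶ (⟨coequalizer a.hom b.hom⟩ : Mod C H) := mkHom π hs.symm
  obtain ⟨g, hg, -⟩ := h _ πm (Mod.hom_ext _ _ hw)
  have hg : e ≫ g = πm := hg
  have hgm : e.hom ≫ g.hom = π := congrArg Mod.Hom.hom hg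
  have : Epi π := inferInstance
  have hwe : a.hom ≫ e.hom = b.hom ≫ e.hom := congrArg Mod.Hom.hom (scalar_comm e)
  have he : π ≫ coequalizer.desc e.hom hwe = e.hom := coequalizer.π_desc _ _
  have hid : coequalizer.desc e.hom hwe ≫ g.hom = 𝟙 _ := by
    rw [← cancel_epi π, reassoc_of% he, hgm]; simp
  have hid' : g.hom ≫ coequalizer.desc e.hom hwe = 𝟙 (𝟙_ C) := by
    have h2 : e.hom ≫ g.hom ≫ coequalizer.desc e.hom hwe = e.hom := by
      rw [reassoc_of% hgm]; exact he
    -- At this point `e` is only known to be an epimorphism of modules. The endomorphism of the unit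
    -- object must therefore be shown to be `H`-linear before `e` can be cancelled.
    have hlin : hact H (𝟙_ (Mod C H)).X ≫ g.hom ≫ coequalizer.desc e.hom hwe =
        H ◁ (g.hom ≫ coequalizer.desc e.hom hwe) ≫ hact H (𝟙_ (Mod C H)).X := by
      have hp : Epi (H ◁ π) := inferInstanceAs (Epi ((tensorLeft H).map π))
      have hl : s ≫ coequalizer.desc e.hom hwe =
          H ◁ coequalizer.desc e.hom hwe ≫ hact H (𝟙_ (Mod C H)).X := by
        rw [← cancel_epi (H ◁ π), reassoc_of% hs, he, lin e, ← whiskerLeft_comp_assoc, he]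
      have hg2 : hact H (𝟙_ (Mod C H)).X ≫ g.hom = H ◁ g.hom ≫ s := lin g
      rw [reassoc_of% hg2, hl]
      simp
    have := h.epi
    have h3 : mkHom (X := 𝟙_ (Mod C H)) (Y := 𝟙_ (Mod C H)) _ hlin = 𝟙 _ := by
      rw [← cancel_epi e]
      exact (Mod.hom_ext _ _ h2).trans (Category.comp_id e).symm
    exact congrArg Mod.Hom.hom h3
  have hepi : Epi e.hom := by
    rw [← he]
    have : IsIso (coequalizer.desc e.hom hwe) := ⟨g.hom, hid, hid'⟩
    exact epi_comp _ _
  intro Z f hf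
  refine ⟨g.hom ≫ coequalizer.desc f hf, ?_, fun g' hg' => ?_⟩
  · change e.hom ≫ _ = _
    rw [reassoc_of% hgm]
    exact coequalizer.π_desc _ _
  · rw [← cancel_epi e.hom]
    refine Eq.trans hg' ?_
    rw [reassoc_of% hgm]
    exact (coequalizer.π_desc _ _).symm

variable [BraidingLinear H]

/-- The adjunction on modules was built from `ihomEquiv`, which curries in `C`. All comparisons of
inner homs go back to this. -/
lemma curry_hom {P X Q : Mod C H} (f : P ⊗ X ⟶ Q) :
    (MonoidalClosed.curry f).hom = MonoidalClosed.curry f.hom := by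
  have h : MonoidalClosed.curry f = ihomEquiv P X Q f := by
    have : (ihom.adjunction P).homEquiv = ihomEquiv P := Adjunction.mkOfHomEquiv_homEquiv _
    exact congrArg (fun e : ∀ X Y, ((tensorLeft P).obj X ⟶ Y) ≃ (X ⟶ ihomObj P Y) => e X Q f) this
  rw [h]
  rfl

lemma evHom_hom (P Q : Mod C H) : (evHom P Q).hom = evHom P.X Q.X := by
  exact MonoidalClosed.curry_injective (A := P.X) (((curry_hom _).symm.trans
    (congrArg Mod.Hom.hom (curry_ev P Q))).trans (curry_ev P.X Q.X).symm)

lemma lev_hom (P Q : Mod C H) : (lev P Q).hom = lev P.X Q.X := by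
  rw [lev, lev, ← evHom_hom]; rfl

lemma lcurry_hom {P X Q : Mod C H} (f : X ⊗ P ⟶ Q) : (lcurry f).hom = lcurry f.hom := by
  rw [lcurry, curry_hom]; rfl

lemma isFinite_iff (P : Mod C H) : IsFinite P ↔ IsFinite P.X := by
  rw [IsFinite, ← isIso_hom_iff]
  have h := congrArg (fun t : (ihom P.X).obj (𝟙_ C) ⊗ P.X ⟶ 𝟙_ C => lcurry (P := P.X) (Q := P.X)
    ((α_ P.X _ P.X).hom ≫ P.X ◁ t ≫ (ρ_ P.X).hom)) (lev_hom P (𝟙_ (Mod C H)))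
  exact iff_of_eq (congrArg (fun f : P.X ⊗ (ihom P.X).obj (𝟙_ C) ⟶ (ihom P.X).obj P.X => IsIso f)
    ((lcurry_hom _).trans h))

lemma isAzumayaF_iff (A : Mon (Mod C H)) :
    IsIso (azumayaF A.X) ↔ IsIso (azumayaF (underlying A).X) := by
  rw [← isIso_hom_iff]
  exact iff_of_eq (congrArg (fun f : A.X.X ⊗ A.X.X ⟶ (ihom A.X.X).obj A.X.X => IsIso f)
    (lcurry_hom _))

lemma isAzumayaG_iff (A : Mon (Mod C H)) :
    IsIso (azumayaG A.X) ↔ IsIso (azumayaG (underlying A).X) := by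
  rw [← isIso_hom_iff]
  exact iff_of_eq (congrArg (fun f : A.X.X ⊗ A.X.X ⟶ (ihom A.X.X).obj A.X.X => IsIso f)
    (curry_hom _))

lemma faithfullyProjective_hom_iff [HasCoequalizers C] (P : Mod C H) :
    FaithfullyProjective P ↔ FaithfullyProjective P.X := by
  have key : IsDescent (lev P (𝟙_ (Mod C H))) ↔ IsDescent (lev P.X (𝟙_ C)) := by
    have h : IsDescent (D := C) (E := (ihom P.X).obj (𝟙_ C) ⊗ P.X) (lev P (𝟙_ (Mod C H))).hom ↔
        IsDescent (lev P.X (𝟙_ C)) := iff_of_eq (congrArg _ (lev_hom P (𝟙_ (Mod C H))))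
    exact ⟨fun h' => h.1 h'.hom, fun h' => .of_hom (h.2 h')⟩
  constructor
  · intro h
    have h1 := (isFinite_iff P).1 h.1
    exact (faithfullyProjective_iff_isDescent h1).2
      (key.1 ((faithfullyProjective_iff_isDescent h.1).1 h))
  · intro h
    have h1 := (isFinite_iff P).2 h.1
    exact (faithfullyProjective_iff_isDescent h1).2
      (key.2 ((faithfullyProjective_iff_isDescent h.1).1 h))

/-- The forgetful functor reflects isomorphisms and carries the two canonical morphisms to those of
`C`. Only faithful projectivity needs the comparison of descent conditions. -/
lemma isAzumaya_underlying_iff [HasCoequalizers C] (A : Mon (Mod C H)) :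
    IsAzumaya A ↔ IsAzumaya (underlying A) :=
  and_congr (faithfullyProjective_hom_iff A.X) (and_congr (isAzumayaF_iff A) (isAzumayaG_iff A))

end Forget

lemma comp_id_eq_id_tensor {D : Type u} [Category.{v} D] [MonoidalCategory D] {X : D}
    (m : X ⊗ X ⟶ X) : m ≫ 𝟙 X = (𝟙 X ⊗ₘ 𝟙 X) ≫ m := by simp

/-! ### Forgetting the action and the trivial action on Brauer groups. -/

section MonIso

variable {C : Type u} [Category.{v} C] [MonoidalCategory C] [BraidedCategory C]
variable {H : C} [HopfObj H]

lemma nonempty_mon_iso {D : Type u} [Category.{v} D] [MonoidalCategory D] {A B : Mon D}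
    (e : A.X ≅ B.X) (h1 : η[A.X] ≫ e.hom = η[B.X])
    (h2 : μ[A.X] ≫ e.hom = (e.hom ⊗ₘ e.hom) ≫ μ[B.X]) :
    ∃ i : A ≅ B, i.hom.hom = e.hom := by
  have : IsMonHom e.hom := ⟨h1, h2⟩
  exact ⟨Mon.mkIso' e, rfl⟩

lemma mod_mon_iso {A B : Mon (Mod C H)} (e : A.X.X ≅ B.X.X)
    (hl : hact H A.X.X ≫ e.hom = H ◁ e.hom ≫ hact H B.X.X) (h1 : uone A ≫ e.hom = uone B)
    (h2 : umul A ≫ e.hom = (e.hom ⊗ₘ e.hom) ≫ umul B) : ∃ i : A ≅ B, i.hom.hom.hom = e.hom := by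
  obtain ⟨i, hi⟩ := nonempty_mon_iso (A := A) (B := B) (mkIso e hl) (Mod.hom_ext _ _ h1)
    (Mod.hom_ext _ _ h2)
  exact ⟨i, congrArg Mod.Hom.hom hi⟩

lemma underlying_iso {A B : Mon (Mod C H)} (i : A ≅ B) :
    ∃ j : underlying A ≅ underlying B, j.hom.hom = i.hom.hom.hom := by
  let e : A.X ≅ B.X := (Mon.forget _).mapIso i
  have he : IsMonHom e.hom := inferInstanceAs (IsMonHom i.hom.hom)
  let e' : A.X.X ≅ B.X.X := (Mod.forget H).mapIso e
  exact nonempty_mon_iso (A := underlying A) (B := underlying B) e'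
    (congrArg Mod.Hom.hom he.one_hom) (congrArg Mod.Hom.hom he.mul_hom)

lemma trivAlg_iso {A B : Mon C} (i : A ≅ B) : Nonempty (trivAlg H A ≅ trivAlg H B) := by
  let e : A.X ≅ B.X := (Mon.forget C).mapIso i
  have he : IsMonHom e.hom := inferInstanceAs (IsMonHom i.hom.hom)
  obtain ⟨j, -⟩ := mod_mon_iso (A := trivAlg H A) (B := trivAlg H B) e (by
    change (ε[H] ▷ A.X ≫ (λ_ A.X).hom) ≫ e.hom = H ◁ e.hom ≫ ε[H] ▷ B.X ≫ (λ_ B.X).hom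
    rw [whisker_exchange_assoc]; simp) he.one_hom he.mul_hom
  exact ⟨j⟩

variable [BraidingLinear H]

lemma underlying_tensor (A B : Mon (Mod C H)) :
    Nonempty (underlying (A ⊗ B) ≅ underlying A ⊗ underlying B) := by
  obtain ⟨i, -⟩ := nonempty_mon_iso (A := underlying (A ⊗ B)) (B := underlying A ⊗ underlying B)
    (Iso.refl (A.X.X ⊗ B.X.X)) ((Category.comp_id _).trans rfl)
    (comp_id_eq_id_tensor (X := A.X.X ⊗ B.X.X) _)
  exact ⟨i⟩

lemma trivAlg_tensor (A B : Mon C) :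
    Nonempty (trivAlg H (A ⊗ B) ≅ trivAlg H A ⊗ trivAlg H B) := by
  obtain ⟨i, -⟩ := mod_mon_iso (A := trivAlg H (A ⊗ B)) (B := trivAlg H A ⊗ trivAlg H B)
    (Iso.refl (A.X ⊗ B.X)) (by
      let := trivMod H A.X
      let := trivMod H B.X
      change (ε[H] ▷ (A.X ⊗ B.X) ≫ (λ_ (A.X ⊗ B.X)).hom) ≫ 𝟙 _ = H ◁ 𝟙 (A.X ⊗ B.X) ≫
        (α_ H A.X B.X).inv ≫ slide H A.X ▷ B.X ≫ (α_ A.X H B.X).hom ≫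
          A.X ◁ (ε[H] ▷ B.X ≫ (λ_ B.X).hom)
      rw [slide_triv]
      symm
      calc
        _ = 𝟙 _ ⊗≫ ((β_ H A.X).hom ≫ A.X ◁ ε[H]) ▷ B.X ⊗≫ 𝟙 _ := by simp; monoidal
        _ = _ := by
          rw [← BraidedCategory.braiding_naturality_left, braiding_tensorUnit_left]; monoidal)
    ((Category.comp_id _).trans rfl) (comp_id_eq_id_tensor (X := A.X ⊗ B.X) _)
  exact ⟨i⟩

variable [MonoidalClosed C]

lemma one_iEnd_hom (P : Mod C H) : uone (iEnd P) = η[(iEnd P.X).X] := lcurry_hom _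

lemma mul_iEnd_hom (P : Mod C H) : umul (iEnd P) = μ[(iEnd P.X).X] :=
  (lcurry_hom _).trans (congrArg (fun t : (ihom P.X).obj P.X ⊗ P.X ⟶ P.X => lcurry
    ((α_ _ _ P.X).hom ≫ (ihom P.X).obj P.X ◁ t ≫ t)) (lev_hom P P))

lemma underlying_iEnd (P : Mod C H) : Nonempty (underlying (iEnd P) ≅ iEnd P.X) := by
  obtain ⟨i, -⟩ := nonempty_mon_iso (A := underlying (iEnd P)) (B := iEnd P.X)
    (Iso.refl ((ihom P.X).obj P.X)) ((Category.comp_id _).trans (one_iEnd_hom P))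
    ((congrArg (fun t : (iEnd P.X).X ⊗ (iEnd P.X).X ⟶ (iEnd P.X).X => t ≫ 𝟙 _)
      (mul_iEnd_hom P)).trans (comp_id_eq_id_tensor (X := (ihom P.X).obj P.X) _))
  exact ⟨i⟩

/-- The action on the inner hom is determined by linearity of the evaluation, and the trivial action
has this property. -/
lemma ihomSmul_triv (P Q : C) : letI := trivMod H P; letI := trivMod H Q
    ihomSmul H P Q = ε[H] ▷ (ihom P).obj Q ≫ (λ_ _).hom := by
  let := trivMod H P
  let := trivMod H Q
  apply ihom_hom_ext
  apply slide_cancel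
  have h := ihomSmul_ev (H := H) P Q
  simp only [Category.assoc, MonoidalCategory.whiskerLeft_comp]
  rw [h, slide_triv, hact_triv]
  symm
  calc
    _ = 𝟙 _ ⊗≫ ((β_ H P).hom ≫ P ◁ ε[H]) ▷ (ihom P).obj Q ⊗≫ evHom P Q := by monoidal
    _ = 𝟙 _ ⊗≫ (ε[H] ▷ (P ⊗ (ihom P).obj Q) ≫ (𝟙_ C) ◁ evHom P Q) ⊗≫ 𝟙 _ := by
      rw [← BraidedCategory.braiding_naturality_left, braiding_tensorUnit_left]; monoidal
    _ = _ := by rw [← whisker_exchange]; monoidal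

lemma trivAlg_iEnd (P : C) : Nonempty (trivAlg H (iEnd P) ≅ iEnd (trivObj H P)) := by
  obtain ⟨i, -⟩ := mod_mon_iso (A := trivAlg H (iEnd P)) (B := iEnd (trivObj H P))
    (Iso.refl ((ihom P).obj P)) (by
      let := trivMod H P
      change (ε[H] ▷ (ihom P).obj P ≫ (λ_ _).hom) ≫ 𝟙 _ = H ◁ 𝟙 _ ≫ ihomSmul H P P
      rw [ihomSmul_triv]; simp)
    ((Category.comp_id _).trans (one_iEnd_hom (trivObj H P)).symm)
    ((comp_id_eq_id_tensor (X := (ihom P).obj P) _).trans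
      (congrArg (fun t : (iEnd P).X ⊗ (iEnd P).X ⟶ (iEnd P).X => (𝟙 _ ⊗ₘ 𝟙 _) ≫ t)
        (mul_iEnd_hom (trivObj H P)).symm))
  exact ⟨i⟩

/-- Forgetting the `H`-action. -/
def Azumaya.forget [HasCoequalizers C] (A : Azumaya (Mod C H)) : Azumaya C :=
  ⟨underlying A.1, (isAzumaya_underlying_iff A.1).1 A.2⟩

lemma isAzumaya_trivAlg [HasCoequalizers C] {A : Mon C} (h : IsAzumaya A) :
    IsAzumaya (trivAlg H A) :=
  (isAzumaya_underlying_iff _).2 h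

/-- An Azumaya algebra with the trivial action. -/
def Azumaya.triv (H : C) [HopfObj H] [BraidingLinear H] [HasCoequalizers C] (A : Azumaya C) :
    Azumaya (Mod C H) :=
  ⟨trivAlg H A.1, isAzumaya_trivAlg A.2⟩

lemma BrauerEquiv.forget [HasCoequalizers C] {A B : Azumaya (Mod C H)} (h : BrauerEquiv A B) :
    BrauerEquiv A.forget B.forget := by
  obtain ⟨P, Q, hP, hQ, ⟨i⟩⟩ := h
  obtain ⟨j, -⟩ := underlying_iso i
  obtain ⟨a⟩ := underlying_tensor A.1 (iEnd P)
  obtain ⟨b⟩ := underlying_tensor B.1 (iEnd Q)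
  obtain ⟨k⟩ := underlying_iEnd P
  obtain ⟨l⟩ := underlying_iEnd Q
  exact ⟨P.X, Q.X, (faithfullyProjective_hom_iff P).1 hP, (faithfullyProjective_hom_iff Q).1 hQ,
    ⟨whiskerLeftIso _ k.symm ≪≫ a.symm ≪≫ j ≪≫ b ≪≫ whiskerLeftIso _ l⟩⟩

lemma BrauerEquiv.triv [HasCoequalizers C] {A B : Azumaya C} (h : BrauerEquiv A B) :
    BrauerEquiv (A.triv H) (B.triv H) := by
  obtain ⟨P, Q, hP, hQ, ⟨i⟩⟩ := h
  obtain ⟨j⟩ := trivAlg_iso (H := H) i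
  obtain ⟨a⟩ := trivAlg_tensor (H := H) A.1 (iEnd P)
  obtain ⟨b⟩ := trivAlg_tensor (H := H) B.1 (iEnd Q)
  obtain ⟨k⟩ := trivAlg_iEnd (H := H) P
  obtain ⟨l⟩ := trivAlg_iEnd (H := H) Q
  exact ⟨trivObj H P, trivObj H Q, (faithfullyProjective_hom_iff (trivObj H P)).2 hP,
    (faithfullyProjective_hom_iff (trivObj H Q)).2 hQ,
    ⟨whiskerLeftIso _ k.symm ≪≫ a.symm ≪≫ j ≪≫ b ≪≫ whiskerLeftIso _ l⟩⟩

variable (H) in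
/-- The homomorphism `BM(C; H) ⟶ Br(C)` forgetting the action. -/
def forgetBr [HasCoequalizers C] : BM H →* Br C :=
  MonoidHom.mk' (Quot.map Azumaya.forget fun _ _ h => h.forget) (by
    intro x y
    induction x using Quot.ind with | _ A
    induction y using Quot.ind with | _ B
    obtain ⟨i⟩ := underlying_tensor A.1 B.1
    exact Quot.sound (.of_iso (A := (A.mul B).forget) (B := A.forget.mul B.forget) i))

variable (H) in
/-- The homomorphism `Br(C) ⟶ BM(C; H)` given by the trivial action. -/
def trivBr [HasCoequalizers C] : Br C →* BM H :=
  MonoidHom.mk' (Quot.map (Azumaya.triv H) fun _ _ h => h.triv) (by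
    intro x y
    induction x using Quot.ind with | _ A
    induction y using Quot.ind with | _ B
    obtain ⟨i⟩ := trivAlg_tensor (H := H) A.1 B.1
    exact Quot.sound (.of_iso (A := (A.mul B).triv H) (B := (A.triv H).mul (B.triv H)) i))

lemma forgetBr_trivBr [HasCoequalizers C] (x : Br C) : forgetBr H (trivBr H x) = x := by
  induction x using Quot.ind with | _ A
  rfl

end MonIso

/-! ### Convolution monoids and conjugation. -/

section Convolution

variable {C : Type u} [Category.{v} C] [MonoidalCategory C]

/-- The underlying morphism of an element of the convolution monoid. -/
def toHom {X A : C} (f : Conv X A) : X ⟶ A := f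

/-- A morphism as an element of the convolution monoid. -/
def ofHom {X A : C} (f : X ⟶ A) : Conv X A := f

@[simp] lemma toHom_ofHom {X A : C} (f : X ⟶ A) : toHom (ofHom f) = f := rfl

lemma toHom_injective {X A : C} {f g : Conv X A} (h : toHom f = toHom g) : f = g := h

lemma toHom_mul {X A : C} [ComonObj X] [MonObj A] (f g : Conv X A) :
    toHom (f * g) = Δ[X] ≫ (toHom f ⊗ₘ toHom g) ≫ μ[A] := by
  rw [MonoidalCategory.tensorHom_def, Category.assoc]; rfl

lemma toHom_one {X A : C} [ComonObj X] [MonObj A] : toHom (1 : Conv X A) = ε[X] ≫ η[A] := rfl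

/-- Postcomposition with a morphism of algebras. -/
def cmap (X : C) [ComonObj X] {A B : C} [MonObj A] [MonObj B] (φ : A ⟶ B) [IsMonHom φ] :
    Conv X A →* Conv X B where
  toFun f := ofHom (toHom f ≫ φ)
  map_one' := toHom_injective (by simp [toHom_one])
  map_mul' f g := toHom_injective (by
    simp only [toHom_mul, toHom_ofHom, Category.assoc, IsMonHom.mul_hom,
      ← tensorHom_comp_tensorHom])

lemma toHom_cmap {X : C} [ComonObj X] {A B : C} [MonObj A] [MonObj B] (φ : A ⟶ B) [IsMonHom φ]
    (f : Conv X A) : toHom (cmap X φ f) = toHom f ≫ φ := rfl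

instance isMonHom_unit (A : C) [MonObj A] : IsMonHom η[A] where
  one_hom := Category.id_comp _
  mul_hom := by
    change (λ_ (𝟙_ C)).hom ≫ η[A] = (η[A] ⊗ₘ η[A]) ≫ μ[A]
    rw [MonoidalCategory.tensorHom_def', Category.assoc, MonObj.one_mul]
    simp

/-- Scalars in the convolution monoid. -/
def cscal (X A : C) [ComonObj X] [MonObj A] : Conv X (𝟙_ C) →* Conv X A := cmap X η[A]

lemma toHom_cscal {X A : C} [ComonObj X] [MonObj A] (s : Conv X (𝟙_ C)) :
    toHom (cscal X A s) = toHom s ≫ η[A] := rfl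

lemma cmap_cscal {X A B : C} [ComonObj X] [MonObj A] [MonObj B] (φ : A ⟶ B) [IsMonHom φ]
    (s : Conv X (𝟙_ C)) : cmap X φ (cscal X A s) = cscal X B s :=
  toHom_injective (by simp [toHom_cmap, toHom_cscal])

lemma toHom_cscal_mul {X A : C} [ComonObj X] [MonObj A] (s : Conv X (𝟙_ C)) (f : Conv X A) :
    toHom (cscal X A s * f) = Δ[X] ≫ (toHom s ⊗ₘ toHom f) ≫ (λ_ A).hom := by
  rw [toHom_mul, toHom_cscal, MonoidalCategory.tensorHom_def', comp_whiskerRight, Category.assoc,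
    Category.assoc, MonObj.one_mul, MonoidalCategory.tensorHom_def', Category.assoc]

/-- The action on `P` of a morphism to `[P, P]`. -/
def cact [BraidedCategory C] [MonoidalClosed C] {X P : C} (f : Conv X (iEnd P).X) : X ⊗ P ⟶ P :=
  toHom f ▷ P ≫ elev P

/-- The group of convolution invertible morphisms. -/
abbrev CU (X A : C) [ComonObj X] [MonObj A] : Type v := (Conv X A)ˣ

section Comon

variable [BraidedCategory C]

/-- Precomposition with a morphism of coalgebras. -/
def cpull (A : C) [MonObj A] {X Y : Comon C} (c : X ⟶ Y) : Conv Y.X A →* Conv X.X A where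
  toFun g := ofHom (c.hom ≫ toHom g)
  map_one' := toHom_injective (by simp [toHom_one])
  map_mul' f g := toHom_injective (by
    simp only [toHom_mul, toHom_ofHom, IsComonHom.hom_comul_assoc,
      tensorHom_comp_tensorHom_assoc])

lemma toHom_cpull {A : C} [MonObj A] {X Y : Comon C} (c : X ⟶ Y) (f : Conv Y.X A) :
    toHom (cpull A c f) = c.hom ≫ toHom f := rfl

lemma cpull_comp (A : C) [MonObj A] {X Y Z : Comon C} (c : X ⟶ Y) (d : Y ⟶ Z) (f : Conv Z.X A) :
    cpull A c (cpull A d f) = cpull A (c ≫ d) f :=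
  toHom_injective (by simp [toHom_cpull])

lemma cmap_cpull {A B : C} [MonObj A] [MonObj B] (φ : A ⟶ B) [IsMonHom φ] {X Y : Comon C}
    (c : X ⟶ Y) (f : Conv Y.X A) : cmap X.X φ (cpull A c f) = cpull B c (cmap Y.X φ f) :=
  toHom_injective (by simp [toHom_cpull, toHom_cmap])

lemma cpull_cscal (A : C) [MonObj A] {X Y : Comon C} (c : X ⟶ Y) (s : Conv Y.X (𝟙_ C)) :
    cpull A c (cscal Y.X A s) = cscal X.X A (cpull (𝟙_ C) c s) := (cmap_cpull _ _ _).symm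

end Comon

section Commutation

variable [BraidedCategory C] {X : C} [ComonObj X] [IsCommComonObj X]

/-- Elements which commute up to the braiding commute in the convolution monoid. -/
lemma conv_commute {A B E : C} [MonObj E] (φ : A ⟶ E) (ψ : B ⟶ E)
    (h : (ψ ⊗ₘ φ) ≫ μ[E] = (β_ B A).hom ≫ (φ ⊗ₘ ψ) ≫ μ[E]) (f : X ⟶ A) (g : X ⟶ B) :
    ofHom (f ≫ φ) * ofHom (g ≫ ψ) = ofHom (g ≫ ψ) * ofHom (f ≫ φ) := by
  apply toHom_injective
  simp only [toHom_mul, toHom_ofHom, ← tensorHom_comp_tensorHom, Category.assoc, h]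
  rw [BraidedCategory.braiding_naturality_assoc, IsCommComonObj.comul_comm_assoc]

lemma cscal_commute {A : C} [MonObj A] (s : Conv X (𝟙_ C)) (f : Conv X A) :
    cscal X A s * f = f * cscal X A s := by
  have := conv_commute η[A] (𝟙 A) (by
    rw [MonoidalCategory.tensorHom_def', Category.assoc]
    simp) (toHom s) (toHom f)
  rw [Category.comp_id] at this
  exact this

end Commutation

section Multiplication

variable [BraidedCategory C] [MonoidalClosed C]

lemma cact_injective {X P : C} {f g : Conv X (iEnd P).X} (h : cact f = cact g) : f = g :=
  elev_ext h

lemma tensorHom_mul_elev {X Y P : C} (f : X ⟶ (iEnd P).X) (g : Y ⟶ (iEnd P).X) :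
    ((f ⊗ₘ g) ≫ μ[(iEnd P).X]) ▷ P ≫ elev P =
      (α_ X Y P).hom ≫ X ◁ (g ▷ P ≫ elev P) ≫ f ▷ P ≫ elev P := by
  rw [comp_whiskerRight, Category.assoc, elev_mul, MonoidalCategory.tensorHom_def']
  calc
    _ = 𝟙 _ ⊗≫ X ◁ g ▷ P ⊗≫ (f ▷ ((iEnd P).X ⊗ P) ≫ (iEnd P).X ◁ elev P) ⊗≫ elev P := by monoidal
    _ = _ := by rw [← whisker_exchange]; monoidal

lemma cact_mul {X P : C} [ComonObj X] (f g : Conv X (iEnd P).X) :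
    cact (f * g) = Δ[X] ▷ P ≫ (α_ X X P).hom ≫ X ◁ cact g ≫ cact f := by
  rw [cact, toHom_mul, comp_whiskerRight, Category.assoc, tensorHom_mul_elev]; rfl

lemma cact_one {X P : C} [ComonObj X] :
    cact (1 : Conv X (iEnd P).X) = ε[X] ▷ P ≫ (λ_ P).hom := by
  rw [cact, toHom_one, comp_whiskerRight, Category.assoc, elev_one]

variable (A : C) [MonObj A]

/-- Left multiplication `A ⟶ [A, A]`. -/
def lmulHom : A ⟶ (iEnd A).X := ecurry μ[A]

/-- Right multiplication `A ⟶ [A, A]`. -/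
def rmulHom : A ⟶ (iEnd A).X := ecurry (rmul A)

instance : IsMonHom (lmulHom A) := isMonHom_ecurry _ (MonObj.one_mul A) (MonObj.mul_assoc A)

lemma one_rmulHom : η[A] ≫ rmulHom A = η[(iEnd A).X] :=
  (isMonHom_ecurry (A := (opAlg (Mon.mk A)).X) (rmul A) (MonObj.one_mul (opAlg (Mon.mk A)).X)
    (MonObj.mul_assoc (opAlg (Mon.mk A)).X)).one_hom

lemma mul_rmulHom : rmul A ≫ rmulHom A = (rmulHom A ⊗ₘ rmulHom A) ≫ μ[(iEnd A).X] :=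
  (isMonHom_ecurry (A := (opAlg (Mon.mk A)).X) (rmul A) (MonObj.one_mul (opAlg (Mon.mk A)).X)
    (MonObj.mul_assoc (opAlg (Mon.mk A)).X)).mul_hom

lemma lmulHom_elev : lmulHom A ▷ A ≫ elev A = μ[A] := ecurry_elev _

lemma rmulHom_elev : rmulHom A ▷ A ≫ elev A = rmul A := ecurry_elev _

lemma rmulHom_lmulHom : (rmulHom A ⊗ₘ lmulHom A) ≫ μ[(iEnd A).X] =
    (β_ A A).hom ≫ (lmulHom A ⊗ₘ rmulHom A) ≫ μ[(iEnd A).X] := by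
  apply elev_ext
  rw [tensorHom_mul_elev, comp_whiskerRight, Category.assoc, tensorHom_mul_elev, lmulHom_elev,
    rmulHom_elev, rmul_comm]

variable {A} {X : C} [ComonObj X]

/-- Right multiplication by an element of the convolution monoid. -/
def cright (f : Conv X A) : Conv X (iEnd A).X := ofHom (toHom f ≫ rmulHom A)

lemma cright_one : cright (1 : Conv X A) = 1 :=
  toHom_injective (by simp [cright, toHom_one, one_rmulHom])

lemma cact_cleft (f : Conv X A) : cact (cmap X (lmulHom A) f) = toHom f ▷ A ≫ μ[A] := by
  rw [cact, toHom_cmap, comp_whiskerRight, Category.assoc, lmulHom_elev]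

lemma cact_cright (f : Conv X A) : cact (cright f) = toHom f ▷ A ≫ rmul A := by
  rw [cact, cright, toHom_ofHom, comp_whiskerRight, Category.assoc, rmulHom_elev]

variable [IsCommComonObj X]

/-- Composing right multiplications is multiplication in the opposite algebra, and cocommutativity
of `X` absorbs the braiding in it. So right multiplication reverses the order of convolution
products. -/
lemma cright_mul (f g : Conv X A) : cright f * cright g = cright (g * f) := by
  apply toHom_injective
  simp only [toHom_mul, cright, toHom_ofHom, ← tensorHom_comp_tensorHom, Category.assoc,
    ← mul_rmulHom, rmul]
  rw [BraidedCategory.braiding_naturality_assoc, IsCommComonObj.comul_comm_assoc]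

lemma cleft_cright (f g : Conv X A) :
    cmap X (lmulHom A) f * cright g = cright g * cmap X (lmulHom A) f :=
  conv_commute (lmulHom A) (rmulHom A) (rmulHom_lmulHom A) (toHom f) (toHom g)

/-- Conjugation by an invertible element of the convolution monoid. -/
def conj (X A : C) [ComonObj X] [MonObj A] [IsCommComonObj X] : CU X A →* Conv X (iEnd A).X where
  toFun F := cmap X (lmulHom A) F * cright (↑F⁻¹ : Conv X A)
  map_one' := by simp [cright_one]
  -- Inversion and right multiplication both reverse products, and left and right multiplications
  -- commute.
  map_mul' F G := by
    rw [Units.val_mul, map_mul, mul_inv_rev, Units.val_mul, ← cright_mul]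
    simp only [mul_assoc]
    rw [← mul_assoc (cright _) (cmap X (lmulHom A) _) (cright _), ← cleft_cright]
    simp only [mul_assoc]

lemma conj_apply (F : CU X A) :
    conj X A F = cmap X (lmulHom A) F * cright (↑F⁻¹ : Conv X A) := rfl

lemma cact_conj (F : CU X A) : cact (conj X A F) = Δ[X] ▷ A ≫ (α_ X X A).hom ≫
    X ◁ (toHom (↑F⁻¹ : Conv X A) ▷ A ≫ rmul A) ≫ toHom (F : Conv X A) ▷ A ≫ μ[A] := by
  rw [conj_apply, cact_mul, cact_cleft, cact_cright]

lemma cpull_conj {X Y : Comon C} [IsCommComonObj X.X] [IsCommComonObj Y.X] (c : X ⟶ Y)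
    (F : CU Y.X A) :
    cpull _ c (conj Y.X A F) = conj X.X A (Units.map (cpull A c) F) := by
  have h (f : Conv Y.X A) : cpull _ c (cright f) = cright (cpull A c f) :=
    toHom_injective (by simp [toHom_cpull, cright])
  rw [conj_apply, map_mul, ← cmap_cpull, h]
  rfl

lemma left_eq_right_of_conj_eq_one {F : CU X A} (h : conj X A F = 1) :
    toHom (F : Conv X A) ▷ A ≫ μ[A] = toHom (F : Conv X A) ▷ A ≫ rmul A := by
  rw [← cact_cleft, ← cact_cright]
  congr 1
  have h2 := congrArg (· * cright (F : Conv X A)) h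
  simpa [conj_apply, mul_assoc, cright_mul, cright_one] using h2

/-- An object which braids trivially with all objects. -/
def Transparent (X : C) : Prop := ∀ Y : C, (β_ X Y).hom ≫ (β_ Y X).hom = 𝟙 _

lemma Transparent.symm {X : C} (h : Transparent X) (Y : C) :
    (β_ Y X).hom ≫ (β_ X Y).hom = 𝟙 _ := by
  rw [← cancel_mono (β_ Y X).hom, Category.assoc, h Y]; simp

/-- Transparency of `X` turns the hypothesis, in which `x` stands on the left of `A`, into
centrality with `x` on the right, as required for `existsUnique_of_central` with `Z = I`. -/
lemma exists_scalar (hA : FaithfullyProjective A) (hu : IsUniversal (biact A)) {X : C}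
    (hX : Transparent X) {x : X ⟶ A} (h : x ▷ A ≫ μ[A] = x ▷ A ≫ rmul A) :
    ∃ s : X ⟶ 𝟙_ C, s ≫ η[A] = x := by
  have h2 : A ◁ x ≫ μ[A] = A ◁ x ≫ rmul A := by
    have := congrArg (fun t => (β_ A X).hom ≫ t) h
    simp only [rmul, BraidedCategory.braiding_naturality_left_assoc] at this
    rw [← Category.assoc (β_ A X).hom (β_ X A).hom, hX.symm, Category.id_comp] at this
    rw [rmul, BraidedCategory.braiding_naturality_right_assoc, this]
  obtain ⟨s, hs, -⟩ := existsUnique_of_central hA hu (x ≫ (ρ_ A).inv) (by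
    have := congrArg (fun t => t ≫ (ρ_ A).inv) h2
    simp only [Category.assoc] at this
    calc
      _ = (A ◁ x ≫ μ[A]) ≫ (ρ_ A).inv := by monoidal
      _ = (A ◁ x ≫ rmul A) ≫ (ρ_ A).inv := by rw [h2]
      _ = _ := by monoidal)
  refine ⟨s, ?_⟩
  rw [← cancel_mono (ρ_ A).inv, ← hs, unitTensor]
  simp [unitors_inv_equal]

/-- The scalars among the invertible elements. -/
def uscal (X A : C) [ComonObj X] [MonObj A] : CU X (𝟙_ C) →* CU X A := Units.map (cscal X A)

lemma uscal_injective (hA : FaithfullyProjective A) : Function.Injective (uscal X A) := by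
  intro s t h
  apply Units.ext
  exact toHom_injective (unit_injective hA (congrArg (fun F : CU X A => toHom (F : Conv X A)) h))

lemma uscal_commute (s : CU X (𝟙_ C)) (F : CU X A) : uscal X A s * F = F * uscal X A s :=
  Units.ext (cscal_commute _ _)

lemma conj_uscal (s : CU X (𝟙_ C)) : conj X A (uscal X A s) = 1 := by
  have h : ∀ t : Conv X (𝟙_ C), cright (cscal X A t) = cscal X _ t := fun t =>
    toHom_injective (by simp [cright, toHom_cscal, one_rmulHom])
  have e : (↑(uscal X A s)⁻¹ : Conv X A) = cscal X A ↑s⁻¹ := rfl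
  rw [conj_apply, e, h, uscal, Units.coe_map, cmap_cscal, ← map_mul]
  simp

/-- The centralizer of an Azumaya algebra consists of the scalars. -/
lemma exists_uscal_of_conj_eq_one (hA : FaithfullyProjective A) (hu : IsUniversal (biact A))
    (hX : Transparent X) {F : CU X A} (h : conj X A F = 1) : ∃ s, uscal X A s = F := by
  obtain ⟨s, hs⟩ := exists_scalar hA hu hX (left_eq_right_of_conj_eq_one h)
  -- The inverse of `F` is a scalar as well, which makes the scalar of `F` invertible.
  have h' : conj X A F⁻¹ = 1 := by
    have := map_mul (conj X A) F F⁻¹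
    rw [mul_inv_cancel, map_one, h, one_mul] at this
    exact this.symm
  obtain ⟨t, ht⟩ := exists_scalar hA hu hX (left_eq_right_of_conj_eq_one h')
  have hs : cscal X A (ofHom s) = F := toHom_injective hs
  have ht : cscal X A (ofHom t) = (↑F⁻¹ : Conv X A) := toHom_injective ht
  have inj : ∀ s t, cscal X A s = cscal X A t → s = t := fun s t h =>
    toHom_injective (unit_injective hA (congrArg toHom h))
  exact ⟨⟨ofHom s, ofHom t, inj _ _ (by rw [map_mul, hs, ht]; simp),
    inj _ _ (by rw [map_mul, hs, ht]; simp)⟩, Units.ext hs⟩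

end Multiplication

end Convolution

/-! ### Morphisms that are multiplicative up to a scalar cocycle. -/

section Twist

variable {C : Type u} [Category.{v} C] [MonoidalCategory C] [BraidedCategory C]

/-- Precomposition of invertible elements with a morphism of coalgebras. -/
def upull (A : C) [MonObj A] {X Y : Comon C} (c : X ⟶ Y) : CU Y.X A →* CU X.X A :=
  Units.map (cpull A c)

lemma upull_comp (A : C) [MonObj A] {X Y Z : Comon C} (c : X ⟶ Y) (d : Y ⟶ Z) (f : CU Z.X A) :
    upull A c (upull A d f) = upull A (c ≫ d) f := Units.ext (cpull_comp A c d f)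

/-- Postcomposition of invertible elements with a morphism of algebras. -/
def umap (X : C) [ComonObj X] {A B : C} [MonObj A] [MonObj B] (φ : A ⟶ B) [IsMonHom φ] :
    CU X A →* CU X B := Units.map (cmap X φ)

lemma umap_upull {A B : C} [MonObj A] [MonObj B] (φ : A ⟶ B) [IsMonHom φ] {X Y : Comon C}
    (c : X ⟶ Y) (f : CU Y.X A) : umap X.X φ (upull A c f) = upull B c (umap Y.X φ f) :=
  Units.ext (cmap_cpull φ c f)

lemma upull_uscal (A : C) [MonObj A] {X Y : Comon C} (c : X ⟶ Y) (s : CU Y.X (𝟙_ C)) :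
    upull A c (uscal Y.X A s) = uscal X.X A (upull (𝟙_ C) c s) := Units.ext (cpull_cscal A c s)

lemma umap_uscal {X A B : C} [ComonObj X] [MonObj A] [MonObj B] (φ : A ⟶ B) [IsMonHom φ]
    (s : CU X (𝟙_ C)) : umap X φ (uscal X A s) = uscal X B s := Units.ext (cmap_cscal φ _)

lemma comon_leftUnitor (X : Comon C) : (λ_ X).hom.hom = (λ_ X.X).hom :=
  (Comon.monoidal_leftUnitor_hom_hom C X).trans (by
    change 𝟙 (𝟙_ C) ▷ X.X ≫ (λ_ X.X).hom = _
    simp)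

lemma comon_rightUnitor (X : Comon C) : (ρ_ X).hom.hom = (ρ_ X.X).hom :=
  (Comon.monoidal_rightUnitor_hom_hom C X).trans (by
    change X.X ◁ 𝟙 (𝟙_ C) ≫ (ρ_ X.X).hom = _
    simp)

lemma comon_associator_inv (X Y Z : Comon C) : (α_ X Y Z).inv.hom = (α_ X.X Y.X Z.X).inv :=
  (Comon.monoidal_associator_inv_hom C X Y Z).trans (by
    change X.X ◁ 𝟙 (Y.X ⊗ Z.X) ≫ (α_ X.X Y.X Z.X).inv ≫ 𝟙 (X.X ⊗ Y.X) ▷ Z.X = _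
    simp)

variable (H : C) [HopfObj H]

/-- `h ⊗ k ↦ h ε(k)`. -/
def fstHom : coalg H ⊗ coalg H ⟶ coalg H := coalg H ◁ counitHom H ≫ (ρ_ (coalg H)).hom

/-- `h ⊗ k ↦ ε(h) k`. -/
def sndHom : coalg H ⊗ coalg H ⟶ coalg H := counitHom H ▷ coalg H ≫ (λ_ (coalg H)).hom

/-- `h ⊗ k ⊗ l ↦ ε(h) k ⊗ l`. -/
def tailHom : coalg H ⊗ (coalg H ⊗ coalg H) ⟶ coalg H ⊗ coalg H :=
  counitHom H ▷ (coalg H ⊗ coalg H) ≫ (λ_ (coalg H ⊗ coalg H)).hom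

/-- `h ⊗ k ⊗ l ↦ h ⊗ k ε(l)`. -/
def initHom : coalg H ⊗ (coalg H ⊗ coalg H) ⟶ coalg H ⊗ coalg H :=
  (α_ (coalg H) (coalg H) (coalg H)).inv ≫ (coalg H ⊗ coalg H) ◁ counitHom H ≫
      (ρ_ (coalg H ⊗ coalg H)).hom

/-- `h ⊗ k ⊗ l ↦ h k ⊗ l`. -/
def mulLeftHom : coalg H ⊗ (coalg H ⊗ coalg H) ⟶ coalg H ⊗ coalg H :=
  (α_ (coalg H) (coalg H) (coalg H)).inv ≫ mulHom H ▷ coalg H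

/-- `h ⊗ k ⊗ l ↦ h ⊗ k l`. -/
def mulRightHom : coalg H ⊗ (coalg H ⊗ coalg H) ⟶ coalg H ⊗ coalg H := coalg H ◁ mulHom H

/-- The counit is the only coalgebra morphism to the unit object. -/
lemma comon_unit_ext {X : Comon C} (f g : X ⟶ 𝟙_ (Comon C)) : f = g := by
  have key : ∀ f : X ⟶ 𝟙_ (Comon C), f.hom = ε[X.X] := fun f => by
    have h : ε[(𝟙_ (Comon C)).X] = 𝟙 (𝟙_ C) := Comon.monoidal_tensorUnit_comon_counit C
    rw [← IsComonHom.hom_counit f.hom]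
    exact ((congrArg (f.hom ≫ ·) h).trans (Category.comp_id _)).symm
  exact Comon.Hom.ext ((key f).trans (key g).symm)

/-- One of several identities between coalgebra morphisms of tensor powers of `H`. They reduce the
cocycle condition to a computation in a group. -/
lemma mulLeftHom_fst : mulLeftHom H ≫ fstHom H = initHom H ≫ mulHom H := by
  simp [mulLeftHom, fstHom, initHom, ← whisker_exchange_assoc]

lemma mulRightHom_snd : mulRightHom H ≫ sndHom H = tailHom H ≫ mulHom H := by
  simp [mulRightHom, sndHom, tailHom, whisker_exchange_assoc]

lemma mulLeftHom_snd : mulLeftHom H ≫ sndHom H = tailHom H ≫ sndHom H := by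
  rw [mulLeftHom, sndHom, Category.assoc, ← comp_whiskerRight_assoc,
    comon_unit_ext (mulHom H ≫ counitHom H) (counitHom H ▷ _ ≫ (λ_ _).hom ≫ counitHom H), tailHom]
  simp

lemma mulRightHom_fst : mulRightHom H ≫ fstHom H = initHom H ≫ fstHom H := by
  rw [mulRightHom, fstHom, ← MonoidalCategory.whiskerLeft_comp_assoc,
    comon_unit_ext (mulHom H ≫ counitHom H) (_ ◁ counitHom H ≫ (ρ_ _).hom ≫ counitHom H), initHom]
  simp

lemma initHom_snd : initHom H ≫ sndHom H = tailHom H ≫ fstHom H := by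
  simp only [initHom, sndHom, tailHom, fstHom, Category.assoc]
  rw [← MonoidalCategory.leftUnitor_naturality_assoc, ← rightUnitor_naturality_assoc,
    whisker_exchange_assoc]
  have e := whiskerLeft_rightUnitor_assoc (𝟙_ (Comon C)) (coalg H) (λ_ (coalg H)).hom
  rw [leftUnitor_naturality] at e
  simp [← e]

lemma fstHom_hom : (fstHom H).hom = H ◁ ε[H] ≫ (ρ_ H).hom :=
  congrArg₂ (fun (f : H ⊗ H ⟶ H ⊗ 𝟙_ C) (g : H ⊗ 𝟙_ C ⟶ H) => f ≫ g)
    (Comon.monoidal_whiskerLeft_hom C (coalg H) _ _ (counitHom H)) (comon_rightUnitor (coalg H))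

lemma sndHom_hom : (sndHom H).hom = ε[H] ▷ H ≫ (λ_ H).hom :=
  congrArg₂ (fun (f : H ⊗ H ⟶ 𝟙_ C ⊗ H) (g : 𝟙_ C ⊗ H ⟶ H) => f ≫ g)
    (Comon.monoidal_whiskerRight_hom C (counitHom H) (coalg H)) (comon_leftUnitor (coalg H))

lemma mulLeftHom_hom : (mulLeftHom H).hom = (α_ H H H).inv ≫ μ[H] ▷ H :=
  congrArg₂ (fun (f : H ⊗ (H ⊗ H) ⟶ (H ⊗ H) ⊗ H) (g : (H ⊗ H) ⊗ H ⟶ H ⊗ H) => f ≫ g)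
    (comon_associator_inv (coalg H) (coalg H) (coalg H))
    (Comon.monoidal_whiskerRight_hom C (mulHom H) (coalg H))

lemma mulRightHom_hom : (mulRightHom H).hom = H ◁ μ[H] :=
  Comon.monoidal_whiskerLeft_hom C (coalg H) _ _ (mulHom H)

lemma tailHom_hom : (tailHom H).hom = ε[H] ▷ (H ⊗ H) ≫ (λ_ (H ⊗ H)).hom :=
  congrArg₂ (fun (f : H ⊗ (H ⊗ H) ⟶ 𝟙_ C ⊗ (H ⊗ H)) (g : 𝟙_ C ⊗ (H ⊗ H) ⟶ H ⊗ H) => f ≫ g)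
    (Comon.monoidal_whiskerRight_hom C (counitHom H) (coalg H ⊗ coalg H))
    (comon_leftUnitor (coalg H ⊗ coalg H))

lemma initHom_hom : (initHom H).hom = (α_ H H H).inv ≫ (H ⊗ H) ◁ ε[H] ≫ (ρ_ (H ⊗ H)).hom :=
  congrArg₂ (fun (f : H ⊗ (H ⊗ H) ⟶ (H ⊗ H) ⊗ H) (g : (H ⊗ H) ⊗ H ⟶ H ⊗ H) => f ≫ g)
    (comon_associator_inv (coalg H) (coalg H) (coalg H))
    (congrArg₂ (fun (f : (H ⊗ H) ⊗ H ⟶ (H ⊗ H) ⊗ 𝟙_ C) (g : (H ⊗ H) ⊗ 𝟙_ C ⟶ H ⊗ H) => f ≫ g)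
      (Comon.monoidal_whiskerLeft_hom C (coalg H ⊗ coalg H) _ _ (counitHom H))
      (comon_rightUnitor (coalg H ⊗ coalg H)))

lemma mulHom_assoc : mulLeftHom H ≫ mulHom H = mulRightHom H ≫ mulHom H := by
  apply Comon.Hom.ext
  have h : ((α_ H H H).inv ≫ μ[H] ▷ H) ≫ μ[H] = H ◁ μ[H] ≫ μ[H] := by
    rw [Category.assoc, MonObj.mul_assoc, Iso.inv_hom_id_assoc]
  exact ((congrArg (fun t : H ⊗ (H ⊗ H) ⟶ H ⊗ H => t ≫ μ[H]) (mulLeftHom_hom H)).trans h).trans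
    (congrArg (fun t : H ⊗ (H ⊗ H) ⟶ H ⊗ H => t ≫ μ[H]) (mulRightHom_hom H)).symm

variable {H}

/-- `cpull` for the coalgebras `H` and `H ⊗ H`. -/
def cpull₁ (A : C) [MonObj A] (f : coalg H ⊗ coalg H ⟶ coalg H) :
    Conv H A →* Conv (H ⊗ H) A := cpull A f

/-- `upull` for the coalgebras `H` and `H ⊗ H`. -/
def upull₁ (A : C) [MonObj A] (f : coalg H ⊗ coalg H ⟶ coalg H) :
    CU H A →* CU (H ⊗ H) A := upull A f

/-- `upull` for the coalgebras `H ⊗ H` and `H ⊗ (H ⊗ H)`. -/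
def upull₂ (A : C) [MonObj A] (f : coalg H ⊗ (coalg H ⊗ coalg H) ⟶ coalg H ⊗ coalg H) :
    CU (H ⊗ H) A →* CU (H ⊗ (H ⊗ H)) A := upull A f

/-- `upull` for the coalgebras `H` and `H ⊗ (H ⊗ H)`. -/
def upull₃ (A : C) [MonObj A] (f : coalg H ⊗ (coalg H ⊗ coalg H) ⟶ coalg H) :
    CU H A →* CU (H ⊗ (H ⊗ H)) A := upull A f

lemma upull₂_upull₁ (A : C) [MonObj A]
    (f : coalg H ⊗ (coalg H ⊗ coalg H) ⟶ coalg H ⊗ coalg H)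
    (g : coalg H ⊗ coalg H ⟶ coalg H) (F : CU H A) :
    upull₂ A f (upull₁ A g F) = upull₃ A (f ≫ g) F := upull_comp A f g F

lemma upull₂_uscal (A : C) [MonObj A]
    (f : coalg H ⊗ (coalg H ⊗ coalg H) ⟶ coalg H ⊗ coalg H) (s : Reg (H ⊗ H)) :
    upull₂ A f (uscal (H ⊗ H) A s) = uscal _ A (upull₂ (𝟙_ C) f s) := upull_uscal A f s

lemma upull₁_uscal (A : C) [MonObj A] (f : coalg H ⊗ coalg H ⟶ coalg H) (s : Reg H) :
    upull₁ A f (uscal H A s) = uscal _ A (upull₁ (𝟙_ C) f s) := upull_uscal A f s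

lemma umap_upull₁ {A B : C} [MonObj A] [MonObj B] (φ : A ⟶ B) [IsMonHom φ]
    (f : coalg H ⊗ coalg H ⟶ coalg H) (F : CU H A) :
    umap (H ⊗ H) φ (upull₁ A f F) = upull₁ B f (umap H φ F) := umap_upull φ f F

lemma upull₁_val {A : C} [MonObj A] (f : coalg H ⊗ coalg H ⟶ coalg H) (F : CU H A) :
    (upull₁ A f F : Conv (H ⊗ H) A) = cpull₁ A f F := rfl

lemma toHom_fst {A : C} [MonObj A] (F : Conv H A) :
    toHom (cpull₁ A (fstHom H) F) = H ◁ ε[H] ≫ (ρ_ H).hom ≫ toHom F :=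
  (congrArg (fun t : H ⊗ H ⟶ H => t ≫ toHom F) (fstHom_hom H)).trans (Category.assoc _ _ _)

lemma toHom_snd {A : C} [MonObj A] (F : Conv H A) :
    toHom (cpull₁ A (sndHom H) F) = ε[H] ▷ H ≫ (λ_ H).hom ≫ toHom F :=
  (congrArg (fun t : H ⊗ H ⟶ H => t ≫ toHom F) (sndHom_hom H)).trans (Category.assoc _ _ _)

lemma toHom_cpull_mulHom {A : C} [MonObj A] (F : Conv H A) :
    toHom (cpull₁ A (mulHom H) F) = μ[H] ≫ toHom F := rfl

/-- Comultiplying `h ⊗ k` and keeping `h` from one copy and `k` from the other gives back `h ⊗ k`,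
so the product `F(h)G(k)` is a convolution product on `H ⊗ H`. -/
lemma toHom_fst_mul_snd {A : C} [MonObj A] (F G : Conv H A) :
    toHom (cpull₁ A (fstHom H) F * cpull₁ A (sndHom H) G) = (toHom F ⊗ₘ toHom G) ≫ μ[A] := by
  have h : Δ[H ⊗ H] ≫ ((H ◁ ε[H] ≫ (ρ_ H).hom) ⊗ₘ (ε[H] ▷ H ≫ (λ_ H).hom)) = 𝟙 _ := by
    rw [Comon.tensorObj_comul, MonoidalCategory.tensorHom_def Δ[H],
      MonoidalCategory.tensorHom_def' (H ◁ ε[H] ≫ _),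
      tensorμ]
    calc
      _ = 𝟙 _ ⊗≫ Δ[H] ▷ H ⊗≫ (H ⊗ H) ◁ Δ[H] ⊗≫ H ◁ ((β_ H H).hom ≫ H ◁ ε[H]) ▷ H ⊗≫
          H ◁ (ε[H] ▷ H) ⊗≫ 𝟙 _ := by monoidal
      _ = 𝟙 _ ⊗≫ Δ[H] ▷ H ⊗≫ (H ⊗ H) ◁ Δ[H] ⊗≫ H ◁ (ε[H] ▷ (H ⊗ H) ≫ (𝟙_ C) ◁ (ε[H] ▷ H)) ⊗≫
          𝟙 _ := by
        rw [← BraidedCategory.braiding_naturality_left, braiding_tensorUnit_left]; monoidal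
      _ = 𝟙 _ ⊗≫ Δ[H] ▷ H ⊗≫ (H ⊗ H) ◁ (Δ[H] ≫ ε[H] ▷ H) ⊗≫ H ◁ ε[H] ▷ H ⊗≫ 𝟙 _ := by
        rw [← whisker_exchange ε[H] (ε[H] ▷ H)]; monoidal
      _ = 𝟙 _ ⊗≫ (Δ[H] ≫ H ◁ ε[H]) ▷ H ⊗≫ 𝟙 _ := by
        rw [ComonObj.counit_comul]; monoidal
      _ = _ := by rw [ComonObj.comul_counit]; monoidal
  rw [toHom_mul, toHom_fst, toHom_snd, ← Category.assoc (H ◁ ε[H]), ← Category.assoc (ε[H] ▷ H),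
    ← tensorHom_comp_tensorHom_assoc, reassoc_of% h]

/-- A morphism of algebras is multiplicative for convolution. -/
lemma cpull_mulHom_of_isMonHom {A : C} [MonObj A] (f : H ⟶ A) [IsMonHom f] :
    cpull₁ A (mulHom H) (ofHom f) =
      cpull₁ A (fstHom H) (ofHom f) * cpull₁ A (sndHom H) (ofHom f) := by
  apply toHom_injective
  rw [toHom_fst_mul_snd, toHom_cpull_mulHom, toHom_ofHom, IsMonHom.mul_hom]

/-- `F(h k) = F(h) F(k) σ(h, k)`, where the arguments are comultiplied. -/
def IsTwist {A : C} [MonObj A] (F : CU H A) (σ : Reg (H ⊗ H)) : Prop :=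
  upull₁ A (mulHom H) F = upull₁ A (fstHom H) F * upull₁ A (sndHom H) F * uscal (H ⊗ H) A σ

lemma IsTwist.map {A B : C} [MonObj A] [MonObj B] (φ : A ⟶ B) [IsMonHom φ] {F : CU H A}
    {σ : Reg (H ⊗ H)} (h : IsTwist F σ) : IsTwist (umap H φ F) σ := by
  have h2 := congrArg (umap (H ⊗ H) φ) h
  rwa [map_mul, map_mul, umap_uscal, umap_upull₁, umap_upull₁, umap_upull₁] at h2

lemma isTwist_one_of_isMonHom {A : C} [MonObj A] (F : CU H A)
    [IsMonHom (toHom (F : Conv H A))] : IsTwist F 1 := by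
  apply Units.ext
  rw [map_one, mul_one]
  exact cpull_mulHom_of_isMonHom (toHom (F : Conv H A))

variable [BraidingLinear H] [MonoidalClosed C]

lemma d₁_apply (s : Reg H) : d₁ H s = upull₁ (𝟙_ C) (sndHom H) s *
    (upull₁ (𝟙_ C) (mulHom H) s)⁻¹ * upull₁ (𝟙_ C) (fstHom H) s := rfl

lemma d₂_apply (s : Reg (H ⊗ H)) : d₂ H s = upull₂ (𝟙_ C) (tailHom H) s *
    (upull₂ (𝟙_ C) (mulLeftHom H) s)⁻¹ * upull₂ (𝟙_ C) (mulRightHom H) s *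
      (upull₂ (𝟙_ C) (initHom H) s)⁻¹ := rfl

lemma d₂_eq_one_iff (s : Reg (H ⊗ H)) : d₂ H s = 1 ↔
    upull₂ (𝟙_ C) (tailHom H) s * upull₂ (𝟙_ C) (mulRightHom H) s =
      upull₂ (𝟙_ C) (initHom H) s * upull₂ (𝟙_ C) (mulLeftHom H) s := by
  rw [d₂_apply, mul_inv_eq_one, mul_right_comm, mul_inv_eq_iff_eq_mul]

variable {A : C} [MonObj A]

/-- The twist is a cocycle. -/
lemma IsTwist.d₂_eq_one (hu : Function.Injective (uscal (H ⊗ (H ⊗ H)) A)) {F : CU H A}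
    {σ : Reg (H ⊗ H)} (h : IsTwist F σ) : d₂ H σ = 1 := by
  rw [d₂_eq_one_iff]
  apply hu
  -- The value `F(hkl)` is expanded along `(hk)l` and along `h(kl)`. After moving one central scalar
  -- to the right, `F(h)F(k)F(l)` cancels and the cocycle identity remains.
  have h1 := congrArg (upull₂ A (mulLeftHom H)) h
  have h2 := congrArg (upull₂ A (mulRightHom H)) h
  have h3 := congrArg (upull₂ A (initHom H)) h
  have h4 := congrArg (upull₂ A (tailHom H)) h
  simp only [map_mul, upull₂_upull₁, upull₂_uscal] at h1 h2 h3 h4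
  rw [mulLeftHom_fst, mulLeftHom_snd, h3, mulHom_assoc] at h1
  rw [mulRightHom_snd, h4, mulRightHom_fst, h1, initHom_snd] at h2
  rw [map_mul, map_mul]
  have c := uscal_commute (upull₂ (𝟙_ C) (initHom H) σ) (upull₃ A (tailHom H ≫ sndHom H) F)
  simp only [mul_assoc] at h2
  rw [← mul_assoc (uscal _ A _) (upull₃ A _ F), c] at h2
  simp only [mul_assoc, mul_left_cancel_iff] at h2
  exact h2.symm

/-- Scalars are central, so the twist is multiplied by `s(hk) s(h)⁻¹ s(k)⁻¹`, which is `(d₁ s)⁻¹`.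
-/
lemma IsTwist.mul_uscal {F : CU H A} {σ : Reg (H ⊗ H)} (h : IsTwist F σ) (s : Reg H) :
    IsTwist (F * uscal H A s) (σ * (d₁ H s)⁻¹) := by
  have g : ∀ {G : Type v} [CommGroup G] (a b c t : G), a * (b * (t * (b * c⁻¹ * a)⁻¹)) = t * c := by
    intro G _ a b c t
    rw [mul_inv_rev, mul_inv_rev, inv_inv, mul_left_comm b, mul_left_comm b, mul_left_comm b,
      mul_inv_cancel, mul_one, mul_left_comm, mul_inv_cancel_left]
  have e : upull₁ (𝟙_ C) (fstHom H) s * (upull₁ (𝟙_ C) (sndHom H) s * (σ * (d₁ H s)⁻¹)) =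
      σ * upull₁ (𝟙_ C) (mulHom H) s := g _ _ _ _
  rw [IsTwist, map_mul, map_mul, map_mul, upull₁_uscal, upull₁_uscal, upull₁_uscal, h,
    mul_assoc, ← map_mul, ← e, map_mul, map_mul]
  have c := uscal_commute (upull₁ (𝟙_ C) (fstHom H) s) (upull₁ A (sndHom H) F)
  simp only [mul_assoc]
  rw [← mul_assoc (uscal _ A _) (upull₁ A _ F), c, mul_assoc]

lemma IsTwist.unique (hu : Function.Injective (uscal (H ⊗ H) A)) {F : CU H A}
    {σ τ : Reg (H ⊗ H)} (h : IsTwist F σ) (h' : IsTwist F τ) : σ = τ :=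
  hu (mul_left_cancel (h.symm.trans h'))

lemma IsTwist.mul {F G : CU H A} {σ τ : Reg (H ⊗ H)} (h : IsTwist F σ) (h' : IsTwist G τ)
    (hc : upull₁ A (sndHom H) F * upull₁ A (fstHom H) G =
      upull₁ A (fstHom H) G * upull₁ A (sndHom H) F) : IsTwist (F * G) (σ * τ) := by
  rw [IsTwist, map_mul, map_mul, map_mul, map_mul, h, h']
  have c := uscal_commute σ (upull₁ A (fstHom H) G * upull₁ A (sndHom H) G)
  simp only [mul_assoc] at c hc ⊢
  rw [mul_left_cancel_iff, ← mul_assoc (upull₁ A (fstHom H) G), ← mul_assoc (uscal _ A σ), c]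
  simp only [mul_assoc]
  rw [← mul_assoc, hc, mul_assoc]

end Twist

/-! ### Inner actions, their twists, and inner actions on tensor products. -/

section Inner

variable {C : Type u} [Category.{v} C] [MonoidalCategory C] [BraidedCategory C]
  [MonoidalClosed C] {H : C} [HopfObj H] [BraidingLinear H]

lemma transparent : Transparent H := double_braiding

lemma Transparent.tensor {X Y : C} (hX : Transparent X) (hY : Transparent Y) :
    Transparent (X ⊗ Y) := by
  intro Z
  rw [BraidedCategory.braiding_tensor_left_hom, BraidedCategory.braiding_tensor_right_hom]
  calc
    _ = 𝟙 _ ⊗≫ X ◁ (β_ Y Z).hom ⊗≫ ((β_ X Z).hom ≫ (β_ Z X).hom) ▷ Y ⊗≫ X ◁ (β_ Z Y).hom ⊗≫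
        𝟙 _ := by monoidal
    _ = 𝟙 _ ⊗≫ X ◁ ((β_ Y Z).hom ≫ (β_ Z Y).hom) ⊗≫ 𝟙 _ := by rw [hX]; monoidal
    _ = _ := by rw [hY]; monoidal

/-- The identity of `H`, with convolution inverse the antipode. -/
def idUnit (H : C) [HopfObj H] : CU H H where
  val := ofHom (𝟙 H)
  inv := ofHom 𝒮[H]
  val_inv := toHom_injective (by
    rw [toHom_mul, toHom_one, toHom_ofHom, toHom_ofHom, id_tensorHom, HopfObj.antipode_right])
  inv_val := toHom_injective (by
    rw [toHom_mul, toHom_one, toHom_ofHom, toHom_ofHom, tensorHom_id, HopfObj.antipode_left])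

section

variable {A : C} [MonObj A] [ModObj H A]

/-- `F(h) a = (h₁ · a) F(h₂)`. -/
def Implements (F : CU H A) : Prop :=
  toHom (F : Conv H A) ▷ A ≫ μ[A] = slide H A ≫ A ◁ toHom (F : Conv H A) ≫ μ[A]

variable (H) in
/-- The action as a morphism to the endomorphism algebra. -/
def actHom (A : C) [ModObj H A] : Conv H (iEnd A).X := ofHom (ecurry (hact H A))

lemma cact_actHom (A : C) [ModObj H A] : cact (actHom H A) = hact H A := ecurry_elev _

instance isMonHom_actHom (A : C) [ModObj H A] : IsMonHom (ecurry (hact H A)) :=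
  isMonHom_ecurry _ (one_hact A) (mul_hact A)

lemma cright_inv_mul (F : CU H A) :
    cright (↑F⁻¹ : Conv H A) * cright (F : Conv H A) = 1 := by
  rw [cright_mul, Units.mul_inv, cright_one]

lemma cright_mul_inv (F : CU H A) :
    cright (F : Conv H A) * cright (↑F⁻¹ : Conv H A) = 1 := by
  rw [cright_mul, Units.inv_mul, cright_one]

lemma cright_mul_conj (F : CU H A) :
    cright (F : Conv H A) * conj H A F = cmap H (lmulHom A) F := by
  rw [conj_apply, ← mul_assoc, ← cleft_cright, mul_assoc, cright_mul_inv, mul_one]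

lemma conj_eq' (F : CU H A) :
    conj H A F = cright (↑F⁻¹ : Conv H A) * cmap H (lmulHom A) F := by
  rw [conj_apply, cleft_cright]

lemma cact_cright_mul_actHom (F : CU H A) : cact (cright (F : Conv H A) * actHom H A) =
    slide H A ≫ A ◁ toHom (F : Conv H A) ≫ μ[A] := by
  rw [cact_mul, cact_cright, cact_actHom, slide_eq, fusion, rmul,
    BraidedCategory.braiding_naturality_left_assoc]
  simp

/-- Multiplying `F(h) a = (h₁·a) F(h₂)` by `F⁻¹` on the right gives `h·a = F(h₁) a F⁻¹(h₂)`. Right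
multiplication by `F` is invertible for convolution, so nothing is lost. -/
lemma implements_iff {F : CU H A} : Implements F ↔ conj H A F = actHom H A := by
  rw [Implements, ← cact_cleft, ← cact_cright_mul_actHom]
  constructor
  · intro h
    rw [conj_eq', cact_injective h, ← mul_assoc, cright_inv_mul, one_mul]
  · intro h
    rw [← h, cright_mul_conj]

lemma exists_implements_iff : (∃ F : CU H A, Implements F) ↔ ∃ f g : H ⟶ A,
    Δ[H] ≫ (f ⊗ₘ g) ≫ μ[A] = ε[H] ≫ η[A] ∧ Δ[H] ≫ (g ⊗ₘ f) ≫ μ[A] = ε[H] ≫ η[A] ∧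
    hact H A = Δ[H] ▷ A ≫ (α_ H H A).hom ≫ H ◁ (β_ H A).hom ≫
      (f ⊗ₘ (A ◁ g)) ≫ A ◁ μ[A] ≫ μ[A] := by
  have key (F : CU H A) : Implements F ↔
      hact H A = Δ[H] ▷ A ≫ (α_ H H A).hom ≫ H ◁ (β_ H A).hom ≫
      (toHom (F : Conv H A) ⊗ₘ (A ◁ toHom (↑F⁻¹ : Conv H A))) ≫ A ◁ μ[A] ≫ μ[A] := by
    have e : cact (conj H A F) = Δ[H] ▷ A ≫ (α_ H H A).hom ≫ H ◁ (β_ H A).hom ≫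
        (toHom (F : Conv H A) ⊗ₘ (A ◁ toHom (↑F⁻¹ : Conv H A))) ≫ A ◁ μ[A] ≫ μ[A] := by
      rw [cact_conj, rmul, BraidedCategory.braiding_naturality_left_assoc,
        MonoidalCategory.tensorHom_def']
      simp only [Category.assoc, MonoidalCategory.whiskerLeft_comp]
      rw [← whisker_exchange_assoc]
    rw [implements_iff, ← e, ← cact_actHom]
    exact ⟨fun h => by rw [h], fun h => (cact_injective h).symm⟩
  constructor
  · rintro ⟨F, hF⟩
    refine ⟨toHom (F : Conv H A), toHom (↑F⁻¹ : Conv H A), ?_, ?_, (key F).1 hF⟩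
    · rw [← toHom_mul, Units.mul_inv, toHom_one]
    · rw [← toHom_mul, Units.inv_mul, toHom_one]
  · rintro ⟨f, g, h1, h2, h3⟩
    let F : CU H A := ⟨ofHom f, ofHom g, toHom_injective (by rw [toHom_mul]; exact h1),
      toHom_injective (by rw [toHom_mul]; exact h2)⟩
    exact ⟨F, (key F).2 h3⟩

lemma conj_mul_eq_of_implements {F : CU H A} (h : Implements F) :
    conj (H ⊗ H) A (upull₁ A (mulHom H) F) =
      conj (H ⊗ H) A (upull₁ A (fstHom H) F * upull₁ A (sndHom H) F) := by
  have : IsCommComonObj (coalg H ⊗ coalg H).X := cocomm₂ (H := H)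
  have e (f : coalg H ⊗ coalg H ⟶ coalg H) : conj (H ⊗ H) A (upull₁ A f F) =
      cpull₁ _ f (actHom H A) :=
    (cpull_conj f F).symm.trans (congrArg (cpull₁ (iEnd A).X f) (implements_iff.1 h))
  rw [map_mul, e, e, e]
  exact cpull_mulHom_of_isMonHom (ecurry (hact H A))

/-- `F(hk)` and `F(h)F(k)` have the same conjugation because the action is multiplicative. Their
quotient is therefore a scalar on `H ⊗ H`. -/
lemma Implements.exists_isTwist (hA : FaithfullyProjective A) (hu : IsUniversal (biact A))
    {F : CU H A} (h : Implements F) : ∃ σ, IsTwist F σ := by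
  have e := conj_mul_eq_of_implements h
  obtain ⟨s, hs⟩ := exists_uscal_of_conj_eq_one hA hu (transparent.tensor transparent)
    (F := (upull₁ A (fstHom H) F * upull₁ A (sndHom H) F)⁻¹ * upull₁ A (mulHom H) F) (by
      rw [map_mul, e, ← map_mul, inv_mul_cancel, map_one])
  exact ⟨s, by rw [IsTwist, hs, mul_inv_cancel_left]⟩

/-- The quotient `F⁻¹ G` conjugates trivially, hence is a scalar. -/
lemma Implements.exists_eq_mul_uscal (hA : FaithfullyProjective A) (hu : IsUniversal (biact A))
    {F G : CU H A} (hF : Implements F) (hG : Implements G) : ∃ s, G = F * uscal H A s := by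
  rw [implements_iff] at hF hG
  obtain ⟨s, hs⟩ := exists_uscal_of_conj_eq_one hA hu transparent (F := F⁻¹ * G) (by
      rw [map_mul, hG, ← hF, ← map_mul, inv_mul_cancel, map_one])
  exact ⟨s, by rw [hs, mul_inv_cancel_left]⟩

lemma Implements.mul_uscal {F : CU H A} (h : Implements F) (s : Reg H) :
    Implements (F * uscal H A s) := by
  rw [implements_iff] at h ⊢
  rw [map_mul, h, conj_uscal, mul_one]

end

/-- `φ` intertwines the actions `c` and `d`. -/
def Intertwines {X P Q : C} (φ : P ⟶ Q) (c : Conv X (iEnd P).X) (d : Conv X (iEnd Q).X) : Prop :=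
  X ◁ φ ≫ cact d = cact c ≫ φ

section

variable {X P Q : C} [ComonObj X] {φ : P ⟶ Q}

lemma Intertwines.mul {c c' : Conv X (iEnd P).X} {d d' : Conv X (iEnd Q).X}
    (h : Intertwines φ c d) (h' : Intertwines φ c' d') : Intertwines φ (c * c') (d * d') := by
  rw [Intertwines] at *
  rw [cact_mul, cact_mul, whisker_exchange_assoc]
  simp only [Category.assoc, ← h]
  rw [← MonoidalCategory.whiskerLeft_comp_assoc, ← h', tensor_whiskerLeft]
  simp

lemma Intertwines.one : Intertwines φ (1 : Conv X (iEnd P).X) (1 : Conv X (iEnd Q).X) := by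
  rw [Intertwines, cact_one, cact_one, whisker_exchange_assoc]
  simp

variable {A E : C} [MonObj A] [MonObj E] (ψ : A ⟶ E) [IsMonHom ψ]

lemma intertwines_cleft (f : Conv X A) :
    Intertwines ψ (cmap X (lmulHom A) f) (cmap X (lmulHom E) (cmap X ψ f)) := by
  rw [Intertwines, cact_cleft, cact_cleft, Category.assoc, IsMonHom.mul_hom, toHom_cmap,
    MonoidalCategory.tensorHom_def', comp_whiskerRight, Category.assoc, whisker_exchange_assoc,
    Category.assoc]

lemma intertwines_cright (f : Conv X A) : Intertwines ψ (cright f) (cright (cmap X ψ f)) := by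
  rw [Intertwines, cact_cright, cact_cright, Category.assoc, rmul, rmul, Category.assoc,
    IsMonHom.mul_hom, toHom_cmap, BraidedCategory.braiding_naturality_left_assoc,
    BraidedCategory.braiding_naturality_left_assoc,
    BraidedCategory.braiding_naturality_right_assoc, MonoidalCategory.tensorHom_def,
    MonoidalCategory.whiskerLeft_comp, Category.assoc, Category.assoc, whisker_exchange_assoc]

lemma intertwines_conj [IsCommComonObj X] (F : CU X A) :
    Intertwines ψ (conj X A F) (conj X E (umap X ψ F)) :=
  (intertwines_cleft ψ _).mul (intertwines_cright ψ _)

lemma Intertwines.of_implements [ModObj H A] [ModObj H E] {F : CU H A} (h : Implements F)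
    (hl : hact H A ≫ ψ = H ◁ ψ ≫ hact H E) :
    Intertwines ψ (conj H A F) (actHom H E) := by
  rw [implements_iff] at h
  rw [h, Intertwines, cact_actHom, cact_actHom, hl]

/-- Conjugation by `K` fixes the image of `φ` exactly when `K` commutes with it. -/
lemma intertwines_one_conj_iff [IsCommComonObj X] (φ : P ⟶ E) (K : CU X E) :
    Intertwines φ 1 (conj X E K) ↔
      X ◁ φ ≫ toHom (K : Conv X E) ▷ E ≫ μ[E] = X ◁ φ ≫ toHom (K : Conv X E) ▷ E ≫ rmul E := by
  have h1 : cright (↑K⁻¹ : Conv X E) * cright (K : Conv X E) = 1 := by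
    rw [cright_mul, Units.mul_inv, cright_one]
  have h2 : cright (K : Conv X E) * cright (↑K⁻¹ : Conv X E) = 1 := by
    rw [cright_mul, Units.inv_mul, cright_one]
  have key (b : Conv X (iEnd E).X) {c d : Conv X (iEnd E).X}
      (h : X ◁ φ ≫ cact c = X ◁ φ ≫ cact d) : X ◁ φ ≫ cact (b * c) = X ◁ φ ≫ cact (b * d) := by
    have e (c : Conv X (iEnd E).X) : X ◁ φ ≫ cact (b * c) =
        Δ[X] ▷ P ≫ (α_ X X P).hom ≫ X ◁ (X ◁ φ ≫ cact c) ≫ cact b := by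
      rw [cact_mul, whisker_exchange_assoc, tensor_whiskerLeft]
      simp
    rw [e, e, h]
  rw [Intertwines, ← Intertwines.one (φ := φ), ← cact_cleft, ← cact_cright]
  constructor
  · intro h
    have := key (cright (K : Conv X E)) h
    rwa [mul_one, conj_apply, ← mul_assoc, ← cleft_cright, mul_assoc, h2, mul_one] at this
  · intro h
    have := key (cright (↑K⁻¹ : Conv X E)) h
    rwa [h1, ← cleft_cright, ← conj_apply] at this

/-- On the image of `φ` the conjugations by `K` and `L` are the same, so `K⁻¹L` fixes this image. -/
lemma Intertwines.inv_mul {φ : P ⟶ E} [IsCommComonObj X] {c : Conv X (iEnd P).X} {K L : CU X E}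
    (h : Intertwines φ c (conj X E K)) (h' : Intertwines φ c (conj X E L)) :
    Intertwines φ 1 (conj X E (K⁻¹ * L)) := by
  have key (b : Conv X (iEnd E).X) {c d : Conv X (iEnd E).X}
      (h : X ◁ φ ≫ cact c = X ◁ φ ≫ cact d) : X ◁ φ ≫ cact (b * c) = X ◁ φ ≫ cact (b * d) := by
    have e (c : Conv X (iEnd E).X) : X ◁ φ ≫ cact (b * c) =
        Δ[X] ▷ P ≫ (α_ X X P).hom ≫ X ◁ (X ◁ φ ≫ cact c) ≫ cact b := by
      rw [cact_mul, whisker_exchange_assoc, tensor_whiskerLeft]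
      simp
    rw [e, e, h]
  have := key (conj X E K⁻¹) (h'.trans h.symm)
  rw [← map_mul, ← map_mul, inv_mul_cancel, map_one] at this
  exact this.trans Intertwines.one

end

section Tensor

variable {A B : C} [MonObj A] [MonObj B]

/-- The inclusion `A ⟶ A ⊗ B`. -/
def inlHom (A B : C) [MonObj B] : A ⟶ A ⊗ B := (ρ_ A).inv ≫ A ◁ η[B]

/-- The inclusion `B ⟶ A ⊗ B`. -/
def inrHom (A B : C) [MonObj A] : B ⟶ A ⊗ B := (λ_ B).inv ≫ η[A] ▷ B

instance : IsMonHom (inlHom A B) := inferInstanceAs (IsMonHom ((ρ_ A).inv ≫ A ◁ η[B]))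

instance : IsMonHom (inrHom A B) := inferInstanceAs (IsMonHom ((λ_ B).inv ≫ η[A] ▷ B))

lemma mul_inrHom : (A ⊗ B) ◁ inrHom A B ≫ μ[A ⊗ B] = (α_ A B B).hom ≫ A ◁ μ[B] := by
  rw [MonObj.tensorObj.mul_def, tensorμ, MonoidalCategory.tensorHom_def, inrHom]
  calc
    _ = 𝟙 _ ⊗≫ A ◁ (B ◁ η[A] ≫ (β_ B A).hom) ▷ B ⊗≫ μ[A] ▷ (B ⊗ B) ≫ A ◁ μ[B] := by monoidal
    _ = 𝟙 _ ⊗≫ (A ◁ η[A] ≫ μ[A]) ▷ (B ⊗ B) ⊗≫ A ◁ μ[B] := by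
      rw [BraidedCategory.braiding_naturality_right, braiding_tensorUnit_right]; monoidal
    _ = _ := by rw [MonObj.mul_one]; monoidal

lemma inrHom_mul : inrHom A B ▷ (A ⊗ B) ≫ μ[A ⊗ B] =
    (α_ B A B).inv ≫ (β_ B A).hom ▷ B ≫ (α_ A B B).hom ≫ A ◁ μ[B] := by
  rw [MonObj.tensorObj.mul_def, tensorμ, MonoidalCategory.tensorHom_def, inrHom]
  calc
    _ = 𝟙 _ ⊗≫ (η[A] ▷ ((B ⊗ A) ⊗ B) ≫ A ◁ ((β_ B A).hom ▷ B)) ⊗≫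
        μ[A] ▷ (B ⊗ B) ≫ A ◁ μ[B] := by monoidal
    _ = 𝟙 _ ⊗≫ (β_ B A).hom ▷ B ⊗≫ (η[A] ▷ A ≫ μ[A]) ▷ (B ⊗ B) ⊗≫ A ◁ μ[B] := by
      rw [← whisker_exchange]; monoidal
    _ = _ := by rw [MonObj.one_mul]; monoidal

lemma inlHom_mul : inlHom A B ▷ (A ⊗ B) ≫ μ[A ⊗ B] = (α_ A A B).inv ≫ μ[A] ▷ B := by
  rw [MonObj.tensorObj.mul_def, tensorμ, MonoidalCategory.tensorHom_def', inlHom]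
  calc
    _ = 𝟙 _ ⊗≫ A ◁ (η[B] ▷ A ≫ (β_ B A).hom) ▷ B ⊗≫ (A ⊗ A) ◁ μ[B] ≫ μ[A] ▷ B := by monoidal
    _ = 𝟙 _ ⊗≫ (A ⊗ A) ◁ (η[B] ▷ B ≫ μ[B]) ⊗≫ μ[A] ▷ B := by
      rw [BraidedCategory.braiding_naturality_left, braiding_tensorUnit_left]; monoidal
    _ = _ := by rw [MonObj.one_mul]; monoidal

lemma inlHom_inrHom_mul : (inlHom A B ⊗ₘ inrHom A B) ≫ μ[A ⊗ B] = 𝟙 (A ⊗ B) := by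
  rw [MonoidalCategory.tensorHom_def', Category.assoc, inlHom_mul, inrHom]
  calc
    _ = 𝟙 _ ⊗≫ (A ◁ η[A] ≫ μ[A]) ▷ B ⊗≫ 𝟙 _ := by monoidal
    _ = _ := by rw [MonObj.mul_one]; monoidal

lemma inrHom_inlHom_mul : (inrHom A B ⊗ₘ inlHom A B) ≫ μ[A ⊗ B] = (β_ B A).hom := by
  rw [MonoidalCategory.tensorHom_def', Category.assoc, inrHom_mul, inlHom]
  calc
    _ = 𝟙 _ ⊗≫ ((B ⊗ A) ◁ η[B] ≫ (β_ B A).hom ▷ B) ⊗≫ A ◁ μ[B] := by monoidal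
    _ = 𝟙 _ ⊗≫ (β_ B A).hom ⊗≫ A ◁ (B ◁ η[B] ≫ μ[B]) := by rw [whisker_exchange]; monoidal
    _ = _ := by rw [MonObj.mul_one]; monoidal

lemma inrHom_inlHom_comm : (inrHom A B ⊗ₘ inlHom A B) ≫ μ[A ⊗ B] =
    (β_ B A).hom ≫ (inlHom A B ⊗ₘ inrHom A B) ≫ μ[A ⊗ B] := by
  rw [inlHom_inrHom_mul, inrHom_inlHom_mul, Category.comp_id]

lemma umap_inl_inr_comm {X : C} [ComonObj X] [IsCommComonObj X] (F : CU X A) (G : CU X B) :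
    umap X (inlHom A B) F * umap X (inrHom A B) G =
      umap X (inrHom A B) G * umap X (inlHom A B) F :=
  Units.ext (conv_commute (inlHom A B) (inrHom A B) inrHom_inlHom_comm (toHom (F : Conv X A))
    (toHom (G : Conv X B)))

/-- `h ↦ F(h₁) ⊗ G(h₂)`. -/
def tensorUnits (F : CU H A) (G : CU H B) : CU H (A ⊗ B) :=
  umap H (inlHom A B) F * umap H (inrHom A B) G

lemma toHom_tensorUnits (F : CU H A) (G : CU H B) : toHom (tensorUnits F G : Conv H (A ⊗ B)) =
    Δ[H] ≫ (toHom (F : Conv H A) ⊗ₘ toHom (G : Conv H B)) := by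
  have e : (tensorUnits F G : Conv H (A ⊗ B)) =
    cmap H (inlHom A B) F * cmap H (inrHom A B) G := rfl
  rw [e, toHom_mul, toHom_cmap, toHom_cmap, ← tensorHom_comp_tensorHom, Category.assoc,
    inlHom_inrHom_mul, Category.comp_id]

lemma isTwist_tensorUnits {F : CU H A} {G : CU H B} {σ τ : Reg (H ⊗ H)} (hF : IsTwist F σ)
    (hG : IsTwist G τ) : IsTwist (tensorUnits F G) (σ * τ) := by
  refine (hF.map (inlHom A B)).mul (hG.map (inrHom A B)) ?_
  rw [← umap_upull₁, ← umap_upull₁, umap_inl_inr_comm]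

lemma slide_comul' (B : C) [ModObj H B] : slide H B ≫ B ◁ Δ[H] ≫ (α_ B H H).inv ≫
    (β_ B H).hom ▷ H ≫ (α_ H B H).hom = Δ[H] ▷ B ≫ (α_ H H B).hom ≫ H ◁ slide H B := by
  rw [slide_eq, Category.assoc, ← BraidedCategory.braiding_naturality_left_assoc, fusion]
  calc
    _ = 𝟙 _ ⊗≫ Δ[H] ▷ B ⊗≫ (H ◁ hact H B ≫ Δ[H] ▷ B) ⊗≫ H ◁ (β_ H B).hom ⊗≫
        ((β_ H B).hom ≫ (β_ B H).hom) ▷ H ⊗≫ 𝟙 _ := by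
      rw [BraidedCategory.braiding_tensor_left_hom]; monoidal
    _ = 𝟙 _ ⊗≫ (Δ[H] ≫ Δ[H] ▷ H ≫ (α_ H H H).hom) ▷ B ⊗≫ H ◁ H ◁ hact H B ⊗≫
        H ◁ (β_ H B).hom ⊗≫ 𝟙 _ := by
      rw [double_braiding, whisker_exchange]; monoidal
    _ = _ := by rw [← ComonObj.comul_assoc]; monoidal

/-- Braid `a` past `G(h₂)`, use the hypotheses on `F` and `G` separately, and collect the copies of
`H` by the compatibility of `slide` with the comultiplication. The last part needs the transparency
of `H`. -/
lemma implements_tensorUnits [ModObj H A] [ModObj H B] {F : CU H A} {G : CU H B}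
    (hF : Implements F) (hG : Implements G) :
    letI := tensorMod (H := H) A B
    Implements (tensorUnits F G) := by
  let := tensorMod (H := H) A B
  rw [Implements] at *
  rw [toHom_tensorUnits, slide_tensor]
  generalize toHom (F : Conv H A) = f at *
  generalize toHom (G : Conv H B) = g at *
  rw [MonObj.tensorObj.mul_def, tensorμ, MonoidalCategory.tensorHom_def μ[A]]
  have h2 : Δ[H] ▷ A ≫ (α_ H H A).hom ≫ H ◁ (β_ H A).hom ≫ (α_ H A H).inv ≫
      slide H A ▷ H = slide H A ≫ A ◁ Δ[H] ≫ (α_ A H H).inv := by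
    rw [reassoc_of% (slide_comul (H := H) A)]; simp
  calc
    _ = 𝟙 _ ⊗≫ Δ[H] ▷ (A ⊗ B) ⊗≫ f ▷ (H ⊗ A ⊗ B) ⊗≫ A ◁ (g ▷ A ≫ (β_ B A).hom) ▷ B ⊗≫
        μ[A] ▷ (B ⊗ B) ⊗≫ A ◁ μ[B] := by
      rw [MonoidalCategory.tensorHom_def]; monoidal
    _ = 𝟙 _ ⊗≫ Δ[H] ▷ (A ⊗ B) ⊗≫ (f ▷ ((H ⊗ A) ⊗ B) ≫ A ◁ ((β_ H A).hom ▷ B)) ⊗≫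
        ((A ⊗ A) ◁ (g ▷ B) ≫ μ[A] ▷ (B ⊗ B)) ⊗≫ A ◁ μ[B] := by
      rw [BraidedCategory.braiding_naturality_left]; monoidal
    _ = 𝟙 _ ⊗≫ Δ[H] ▷ (A ⊗ B) ⊗≫ H ◁ (β_ H A).hom ▷ B ⊗≫ (f ▷ A ≫ μ[A]) ▷ (H ⊗ B) ⊗≫
        A ◁ (g ▷ B ≫ μ[B]) := by
      rw [← whisker_exchange, whisker_exchange μ[A]]; monoidal
    _ = 𝟙 _ ⊗≫ (Δ[H] ▷ A ≫ (α_ H H A).hom ≫ H ◁ (β_ H A).hom ≫ (α_ H A H).inv ≫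
          slide H A ▷ H) ▷ B ⊗≫ (A ◁ f ≫ μ[A]) ▷ (H ⊗ B) ⊗≫
        A ◁ (slide H B ≫ B ◁ g ≫ μ[B]) := by
      rw [hF, hG]; monoidal
    _ = 𝟙 _ ⊗≫ slide H A ▷ B ⊗≫ A ◁ Δ[H] ▷ B ⊗≫ ((A ◁ f ≫ μ[A]) ▷ (H ⊗ B) ≫
        A ◁ slide H B) ⊗≫ A ◁ (B ◁ g ≫ μ[B]) := by
      rw [h2]; monoidal
    _ = 𝟙 _ ⊗≫ slide H A ▷ B ⊗≫ A ◁ (Δ[H] ▷ B ≫ (α_ H H B).hom ≫ H ◁ slide H B) ⊗≫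
        A ◁ f ▷ (B ⊗ H) ⊗≫ (μ[A] ▷ (B ⊗ H) ≫ A ◁ (B ◁ g)) ⊗≫ A ◁ μ[B] := by
      rw [← whisker_exchange]; monoidal
    _ = 𝟙 _ ⊗≫ slide H A ▷ B ⊗≫ A ◁ slide H B ⊗≫ (A ⊗ B) ◁ Δ[H] ⊗≫
        A ◁ ((β_ B H).hom ≫ f ▷ B) ▷ H ⊗≫ (A ⊗ A ⊗ B) ◁ g ⊗≫ μ[A] ▷ (B ⊗ B) ⊗≫ A ◁ μ[B] := by
      rw [← slide_comul', ← whisker_exchange]; monoidal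
    _ = 𝟙 _ ⊗≫ slide H A ▷ B ⊗≫ A ◁ slide H B ⊗≫ (A ⊗ B) ◁ Δ[H] ⊗≫
        A ◁ (B ◁ f) ▷ H ⊗≫ A ◁ ((β_ B A).hom ▷ H ≫ (A ⊗ B) ◁ g) ⊗≫ μ[A] ▷ (B ⊗ B) ⊗≫
          A ◁ μ[B] := by
      rw [← BraidedCategory.braiding_naturality_right]; monoidal
    _ = _ := by
      rw [← whisker_exchange, MonoidalCategory.tensorHom_def f g]; monoidal

/-- An element of `Z ⊗ B` which commutes with `B` lies in `Z`. -/
lemma existsUnique_of_central_right (hB : FaithfullyProjective B) (hu : IsUniversal (biact B))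
    {X Z : C} (w : X ⟶ Z ⊗ B) (hw : w ▷ B ≫ (α_ Z B B).hom ≫ Z ◁ μ[B] =
      w ▷ B ≫ (α_ Z B B).hom ≫ Z ◁ ((β_ B B).inv ≫ μ[B])) :
    ∃! y : X ⟶ Z, y ≫ inlHom Z B = w := by
  have e1 : unitTensor B Z ≫ (β_ B Z).hom = inlHom Z B := by
    rw [unitTensor, Category.assoc, BraidedCategory.braiding_naturality_left,
      braiding_tensorUnit_left, inlHom]
    simp
  have e (t : B ⊗ B ⟶ B) : (B ◁ (β_ B Z).inv ≫ (α_ B B Z).inv ≫ t ▷ Z) ≫ (β_ B Z).hom =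
      (α_ B Z B).inv ≫ (β_ B Z).hom ▷ B ≫ (α_ Z B B).hom ≫ Z ◁ t := by
    simp only [Category.assoc]
    rw [BraidedCategory.braiding_naturality_left, BraidedCategory.braiding_tensor_left_hom]
    calc
      _ = 𝟙 _ ⊗≫ B ◁ ((β_ B Z).inv ≫ (β_ B Z).hom) ⊗≫ (β_ B Z).hom ▷ B ⊗≫ Z ◁ t := by monoidal
      _ = _ := by rw [Iso.inv_hom_id]; monoidal
  have hw' (t : B ⊗ B ⟶ B) : B ◁ (w ≫ (β_ B Z).inv) ≫ (α_ B B Z).inv ≫ ((β_ B B).hom ≫ t) ▷ Z =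
      (β_ B X).hom ≫ (w ▷ B ≫ (α_ Z B B).hom ≫ Z ◁ t) ≫ (β_ B Z).inv := by
    rw [← Category.assoc, ← Category.assoc, Iso.eq_comp_inv]
    simp only [Category.assoc, MonoidalCategory.whiskerLeft_comp]
    have := e ((β_ B B).hom ≫ t)
    simp only [Category.assoc] at this
    rw [this, ← BraidedCategory.braiding_naturality_right_assoc,
      BraidedCategory.braiding_tensor_right_hom]
    simp
  obtain ⟨y, hy, hy'⟩ := existsUnique_of_central hB hu (w ≫ (β_ B Z).inv) (by
    rw [rmul, hw']
    have := hw' ((β_ B B).inv ≫ μ[B])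
    rw [Iso.hom_inv_id_assoc] at this
    rw [this, hw])
  refine ⟨y, ?_, fun y' h => hy' y' ?_⟩
  · beta_reduce at hy ⊢
    rw [← e1, reassoc_of% hy]; simp
  · beta_reduce
    rw [Iso.eq_comp_inv, Category.assoc, e1, h]

lemma inlHom_injective (hB : FaithfullyProjective B) {X Z : C} {f g : X ⟶ Z}
    (h : f ≫ inlHom Z B = g ≫ inlHom Z B) : f = g := by
  have e1 : unitTensor B Z ≫ (β_ B Z).hom = inlHom Z B := by
    rw [unitTensor, Category.assoc, BraidedCategory.braiding_naturality_left,
      braiding_tensorUnit_left, inlHom]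
    simp
  apply unitTensor_injective hB
  rw [← cancel_mono (β_ B Z).hom, Category.assoc, Category.assoc, e1, h]

/-- An element of `A ⊗ B` which commutes with `B` lies in `A`. -/
lemma exists_of_intertwines_one (hB : FaithfullyProjective B) (hu : IsUniversal (biact B))
    {K : CU H (A ⊗ B)} (h : Intertwines (inrHom A B) 1 (conj H (A ⊗ B) K)) :
    ∃ F : CU H A, umap H (inlHom A B) F = K := by
  have key {K : CU H (A ⊗ B)} (h : Intertwines (inrHom A B) 1 (conj H (A ⊗ B) K)) :
      ∃ y : H ⟶ A, y ≫ inlHom A B = toHom (K : Conv H (A ⊗ B)) := by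
    rw [intertwines_one_conj_iff] at h
    obtain ⟨y, hy, -⟩ := existsUnique_of_central_right (Z := A) hB hu
      (toHom (K : Conv H (A ⊗ B))) (by
        -- Transparency of `H` exchanges the braiding for its inverse. The centrality criterion for
        -- the right-hand tensor factor is phrased with the inverse braiding.
        have hb : (β_ H B).hom = (β_ B H).inv := by
          rw [← cancel_mono (β_ B H).hom, double_braiding, Iso.inv_hom_id]
        have hb' : toHom (K : Conv H (A ⊗ B)) ▷ B ≫ (β_ (A ⊗ B) B).hom =
            toHom (K : Conv H (A ⊗ B)) ▷ B ≫ (β_ B (A ⊗ B)).inv := by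
          rw [BraidedCategory.braiding_naturality_left, hb,
            BraidedCategory.braiding_inv_naturality_left]
        rw [whisker_exchange_assoc, whisker_exchange_assoc, mul_inrHom, rmul,
          BraidedCategory.braiding_naturality_right_assoc, inrHom_mul, reassoc_of% hb',
          BraidedCategory.braiding_tensor_right_inv] at h
        rw [h]
        simp only [Category.assoc, MonoidalCategory.whiskerLeft_comp, Iso.hom_inv_id_assoc,
          inv_hom_whiskerRight_assoc, Iso.inv_hom_id_assoc])
    exact ⟨y, hy⟩
  obtain ⟨f, hf⟩ := key h
  have h' : Intertwines (inrHom A B) 1 (conj H (A ⊗ B) K⁻¹) := by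
    have := h.inv_mul (L := 1) (by rw [map_one]; exact Intertwines.one)
    rwa [mul_one] at this
  obtain ⟨g, hg⟩ := key h'
  have inj : Function.Injective (cmap H (inlHom A B)) := fun x y hxy =>
    toHom_injective (inlHom_injective hB (congrArg toHom hxy))
  have hf : cmap H (inlHom A B) (ofHom f) = K := toHom_injective hf
  have hg : cmap H (inlHom A B) (ofHom g) = (↑K⁻¹ : Conv H (A ⊗ B)) := toHom_injective hg
  exact ⟨⟨ofHom f, ofHom g, inj (by rw [map_mul, hf, hg]; simp),
    inj (by rw [map_mul, hf, hg]; simp)⟩, Units.ext hf⟩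

variable (H) in
/-- The unit of `A` is `H`-linear. -/
def UnitLinear (A : C) [MonObj A] [ModObj H A] : Prop :=
  H ◁ η[A] ≫ slide H A = (β_ H (𝟙_ C)).hom ≫ η[A] ▷ H

lemma UnitLinear.hact [ModObj H A] (h : UnitLinear H A) :
    H ◁ η[A] ≫ hact H A = (ρ_ H).hom ≫ ε[H] ≫ η[A] := by
  have e : HopfBrauer.hact H A = slide H A ≫ A ◁ ε[H] ≫ (ρ_ A).hom := by
    rw [reassoc_of% (slide_counit (H := H) A)]; simp
  rw [e, reassoc_of% h, ← whisker_exchange_assoc, braiding_tensorUnit_right]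
  simp [unitors_inv_equal]

variable [ModObj H A] [ModObj H B]

lemma inrHom_linear (hA : UnitLinear H A) : letI := tensorMod (H := H) A B
    hact H B ≫ inrHom A B = H ◁ inrHom A B ≫ hact H (A ⊗ B) := by
  let := tensorMod (H := H) A B
  rw [hact_tensor, inrHom]
  symm
  calc
    _ = 𝟙 _ ⊗≫ (H ◁ η[A] ≫ slide H A) ▷ B ⊗≫ A ◁ hact H B := by monoidal
    _ = 𝟙 _ ⊗≫ (η[A] ▷ (H ⊗ B) ≫ A ◁ hact H B) := by
      rw [hA, braiding_tensorUnit_right]; monoidal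
    _ = _ := by rw [← whisker_exchange]; monoidal

lemma inlHom_linear (hB : UnitLinear H B) : letI := tensorMod (H := H) A B
    hact H A ≫ inlHom A B = H ◁ inlHom A B ≫ hact H (A ⊗ B) := by
  let := tensorMod (H := H) A B
  rw [hact_tensor, inlHom]
  symm
  calc
    _ = 𝟙 _ ⊗≫ ((H ⊗ A) ◁ η[B] ≫ slide H A ▷ B) ⊗≫ A ◁ hact H B := by monoidal
    _ = 𝟙 _ ⊗≫ slide H A ⊗≫ A ◁ (H ◁ η[B] ≫ hact H B) := by
      rw [whisker_exchange]; monoidal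
    _ = 𝟙 _ ⊗≫ (slide H A ≫ A ◁ ε[H]) ⊗≫ A ◁ η[B] := by rw [hB.hact]; monoidal
    _ = _ := by rw [slide_counit]; monoidal

/-- If the actions on `A ⊗ B` and on the Azumaya algebra `B` are inner, then so is that on `A`. -/
lemma exists_implements_of_tensor (hB : FaithfullyProjective B) (hu : IsUniversal (biact B))
    (hA1 : UnitLinear H A) (hB1 : UnitLinear H B) {G : CU H B} (hG : Implements G)
    {K : CU H (A ⊗ B)} (hK : letI := tensorMod (H := H) A B; Implements K) :
    ∃ F : CU H A, Implements F := by
  let := tensorMod (H := H) A B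
  have hK' : conj H (A ⊗ B) K = actHom H (A ⊗ B) := implements_iff.1 hK
  -- On `B` both `G` and `K` give the action of `H`, so `G⁻¹K` commutes with `B` and lies in `A`.
  obtain ⟨F, hF⟩ := exists_of_intertwines_one (A := A) (K := (umap H (inrHom A B) G)⁻¹ * K) hB hu
    ((intertwines_conj (inrHom A B) G).inv_mul
      (hK'.symm ▸ Intertwines.of_implements (inrHom A B) hG (inrHom_linear hA1)))
  -- The elements `G(h)` of `B` commute with `A`. Hence on `A` conjugation by `K = G F` is
  -- conjugation by `F`, and it is also the action of `H`.
  have h1 : Intertwines (inlHom A B) 1 (conj H (A ⊗ B) (umap H (inrHom A B) G)) := by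
    rw [intertwines_one_conj_iff]
    have e : toHom (umap H (inrHom A B) G : Conv H (A ⊗ B)) = toHom (G : Conv H B) ≫ inrHom A B :=
      rfl
    rw [e, comp_whiskerRight, Category.assoc, Category.assoc, rmul,
      BraidedCategory.braiding_naturality_left_assoc, whisker_exchange_assoc,
      whisker_exchange_assoc, whisker_exchange_assoc,
      BraidedCategory.braiding_naturality_right_assoc,
      ← MonoidalCategory.tensorHom_def_assoc, ← MonoidalCategory.tensorHom_def_assoc,
      inrHom_inlHom_mul, inlHom_inrHom_mul, Category.comp_id]
  have h2 := h1.mul (intertwines_conj (inlHom A B) F)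
  rw [← map_mul, hF, mul_inv_cancel_left, one_mul, hK', Intertwines, cact_actHom,
    ← inlHom_linear hB1] at h2
  refine ⟨F, implements_iff.2 (cact_injective ?_)⟩
  rw [cact_actHom]
  exact (inlHom_injective hB h2).symm

end Tensor

end Inner

/-! ### Transport of inner actions, and the inner action on endomorphism algebras. -/

section Model

variable {C : Type u} [Category.{v} C] [MonoidalCategory C] [BraidedCategory C]
  [MonoidalClosed C] {H : C} [HopfObj H] [BraidingLinear H]

/-- Inner actions are transported along isomorphisms. -/
lemma Implements.umap {A E : C} [MonObj A] [MonObj E] [ModObj H A] [ModObj H E] (φ : A ⟶ E)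
    [IsMonHom φ] [IsIso φ] (hl : hact H A ≫ φ = H ◁ φ ≫ hact H E) {F : CU H A}
    (h : Implements F) : Implements (umap H φ F) := by
  rw [implements_iff] at *
  have h2 := intertwines_conj φ F
  rw [Intertwines, h, cact_actHom, hl, cancel_epi, ← cact_actHom] at h2
  exact cact_injective h2

/-- The action of `H` on `[P, P]` is inner. -/
lemma implements_actHom (P : C) [ModObj H P] :
    letI : ModObj H (iEnd P).X := ihomMod H P P
    Implements (umap H (ecurry (hact H P)) (idUnit H)) := by
  let : ModObj H (iEnd P).X := ihomMod H P P
  have e : toHom (umap H (ecurry (hact H P)) (idUnit H) : Conv H (iEnd P).X) = ecurry (hact H P) :=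
    Category.id_comp _
  -- Linearity of the evaluation says `h f(p) = (h₁·f)(h₂ p)`, and this is the required relation
  -- evaluated at `p`.
  have hl : H ◁ elev P ≫ hact H P = ((α_ H (iEnd P).X P).inv ≫ slide H (iEnd P).X ▷ P ≫
      (α_ (iEnd P).X H P).hom ≫ (iEnd P).X ◁ hact H P) ≫ elev P := by
    have h1 := lin (H := H) (lev (⟨P⟩ : Mod C H) ⟨P⟩)
    rw [lev_hom] at h1
    exact h1.symm
  unfold Implements
  rw [e]
  apply elev_ext
  have h1 : (ecurry (hact H P) ▷ (iEnd P).X ≫ μ[(iEnd P).X]) ▷ P ≫ elev P =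
      (α_ _ _ _).hom ≫ H ◁ elev P ≫ hact H P := by
    have := tensorHom_mul_elev (ecurry (hact H P)) (𝟙 (iEnd P).X)
    rwa [ecurry_elev, id_whiskerRight, Category.id_comp, tensorHom_id] at this
  have h2 : (slide H (iEnd P).X ≫ (iEnd P).X ◁ ecurry (hact H P) ≫ μ[(iEnd P).X]) ▷ P ≫ elev P =
      slide H (iEnd P).X ▷ P ≫ (α_ _ _ _).hom ≫ (iEnd P).X ◁ hact H P ≫ elev P := by
    have := tensorHom_mul_elev (𝟙 (iEnd P).X) (ecurry (hact H P))
    rw [ecurry_elev, id_whiskerRight, Category.id_comp, id_tensorHom] at this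
    rw [comp_whiskerRight, Category.assoc, this]
  rw [h1, h2, hl]
  simp

end Model

/-! ### The twist class as an invariant of the Brauer class. -/

section Azumaya

variable {C : Type u} [Category.{v} C] [MonoidalCategory C] [BraidedCategory C]
  [MonoidalClosed C] {H : C} [HopfObj H] [BraidingLinear H]

instance (A : Mon (Mod C H)) : ModObj H (underlying A).X := inferInstanceAs (ModObj H A.X.X)

lemma unitLinear_underlying (A : Mon (Mod C H)) : UnitLinear H (underlying A).X := slide_uone A

lemma isInner_iff (A : Mon (Mod C H)) :
    IsInner A ↔ ∃ F : CU H (underlying A).X, Implements F :=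
  (exists_implements_iff (A := (underlying A).X)).symm

/-- The action on `A` is inner, given by a morphism with twist `σ`. -/
def HasTwist (A : Mon (Mod C H)) (σ : Reg (H ⊗ H)) : Prop :=
  ∃ F : CU H (underlying A).X, Implements F ∧ IsTwist F σ

lemma HasTwist.isInner {A : Mon (Mod C H)} {σ : Reg (H ⊗ H)} (h : HasTwist A σ) : IsInner A :=
  (isInner_iff A).2 ⟨h.choose, h.choose_spec.1⟩

lemma HasTwist.of_model {E : Mon C} [ModObj H E.X] {A : Mon (Mod C H)} (i : E ≅ underlying A)
    (hl : hact H E.X ≫ i.hom.hom = H ◁ i.hom.hom ≫ hact H (underlying A).X) {F : CU H E.X}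
    (hF : Implements F) {σ : Reg (H ⊗ H)} (hσ : IsTwist F σ) : HasTwist A σ := by
  have : IsIso i.hom.hom := inferInstanceAs (IsIso ((Mon.forget C).map i.hom))
  exact ⟨umap H i.hom.hom F, hF.umap i.hom.hom hl, hσ.map i.hom.hom⟩

lemma HasTwist.of_iso {A B : Mon (Mod C H)} (i : A ≅ B) {σ : Reg (H ⊗ H)} (h : HasTwist A σ) :
    HasTwist B σ := by
  obtain ⟨F, hF, hσ⟩ := h
  obtain ⟨j, hj⟩ := underlying_iso i
  exact .of_model j (by rw [hj]; exact lin i.hom.hom) hF hσ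

lemma underlying_tensor_model (A B : Mon (Mod C H)) :
    ∃ i : underlying A ⊗ underlying B ≅ underlying (A ⊗ B), i.hom.hom = 𝟙 (A.X.X ⊗ B.X.X) :=
  nonempty_mon_iso (A := underlying A ⊗ underlying B) (B := underlying (A ⊗ B))
    (Iso.refl (A.X.X ⊗ B.X.X)) ((Category.comp_id _).trans rfl)
    (comp_id_eq_id_tensor (X := A.X.X ⊗ B.X.X) _)

lemma underlying_tensor_linear (A B : Mon (Mod C H)) (i : A.X.X ⊗ B.X.X ⟶ A.X.X ⊗ B.X.X)
    (hi : i = 𝟙 (A.X.X ⊗ B.X.X)) :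
    letI := tensorMod (H := H) A.X.X B.X.X
    hact H (A.X.X ⊗ B.X.X) ≫ i = H ◁ i ≫ hact H (A ⊗ B).X.X := by
  subst hi
  simp

lemma HasTwist.tensor {A B : Mon (Mod C H)} {σ τ : Reg (H ⊗ H)} (hA : HasTwist A σ)
    (hB : HasTwist B τ) : HasTwist (A ⊗ B) (σ * τ) := by
  obtain ⟨F, hF, hσ⟩ := hA
  obtain ⟨G, hG, hτ⟩ := hB
  obtain ⟨i, hi⟩ := underlying_tensor_model A B
  let : ModObj H (underlying A ⊗ underlying B).X := tensorMod (H := H) A.X.X B.X.X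
  exact .of_model i (underlying_tensor_linear A B i.hom.hom hi) (implements_tensorUnits hF hG)
    (isTwist_tensorUnits hσ hτ)

/-- The action is implemented by the morphism of algebras `H ⟶ [P, P]`, and a morphism of algebras
has trivial twist. -/
lemma hasTwist_iEnd (P : Mod C H) : HasTwist (iEnd P) 1 := by
  obtain ⟨i, hi⟩ := nonempty_mon_iso (B := underlying (iEnd P)) (A := iEnd P.X)
    (Iso.refl ((ihom P.X).obj P.X)) ((Category.comp_id _).trans (one_iEnd_hom P).symm)
    ((comp_id_eq_id_tensor (X := (ihom P.X).obj P.X) _).trans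
      (congrArg (fun t : (iEnd P.X).X ⊗ (iEnd P.X).X ⟶ (iEnd P.X).X => (𝟙 _ ⊗ₘ 𝟙 _) ≫ t)
        (mul_iEnd_hom P).symm))
  let : ModObj H (iEnd P.X).X := ihomMod H P.X P.X
  have : IsMonHom (toHom (umap H (ecurry (hact H P.X)) (idUnit H) : Conv H (iEnd P.X).X)) := by
    have e : toHom (umap H (ecurry (hact H P.X)) (idUnit H) : Conv H (iEnd P.X).X) =
      ecurry (hact H P.X) := Category.id_comp _
    rw [e]; infer_instance
  refine .of_model i ?_ (implements_actHom P.X) (isTwist_one_of_isMonHom _)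
  rw [hi]
  exact (Category.comp_id _).trans ((congrArg (· ≫ _) (whiskerLeft_id H _)).trans
    (Category.id_comp _)).symm

lemma hasTwist_trivAlg (A : Mon C) : HasTwist (trivAlg H A) 1 := by
  let := trivMod H A.X
  refine .of_model (E := A) (A := trivAlg H A) (Iso.refl A) ?_ (F := 1) ?_ ?_
  · exact (Category.comp_id _).trans ((congrArg (· ≫ _) (whiskerLeft_id H _)).trans
      (Category.id_comp _)).symm
  · rw [implements_iff, map_one]
    apply cact_injective
    rw [cact_one, cact_actHom]
    rfl
  · rw [IsTwist]; simp

lemma exists_hasTwist_of_tensor {A B : Mon (Mod C H)} (hB : FaithfullyProjective B.X.X)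
    (hu : IsAzF (underlying B)) (h : IsInner (A ⊗ B)) (h' : IsInner B) : IsInner A := by
  obtain ⟨K, hK⟩ := (isInner_iff _).1 h
  obtain ⟨G, hG⟩ := (isInner_iff _).1 h'
  obtain ⟨i, hi⟩ := underlying_tensor_model A B
  let : ModObj H (underlying A ⊗ underlying B).X := tensorMod (H := H) A.X.X B.X.X
  have h1 := underlying_tensor_linear A B i.hom.hom hi
  have : IsIso i.symm.hom.hom := inferInstanceAs (IsIso ((Mon.forget C).map i.symm.hom))
  have hinv : i.inv.hom = 𝟙 _ := by
    have h2 : i.hom.hom ≫ i.inv.hom = 𝟙 _ := congrArg Mon.Hom.hom i.hom_inv_id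
    rw [hi] at h2
    exact (Category.id_comp _).symm.trans h2
  have hK' := hK.umap i.symm.hom.hom (by
    have e : i.symm.hom.hom = 𝟙 (A.X.X ⊗ B.X.X) := hinv
    rw [e]
    exact (Category.comp_id _).trans ((congrArg (· ≫ _) (whiskerLeft_id H _)).trans
      (Category.id_comp _)).symm)
  exact (isInner_iff A).2 (exists_implements_of_tensor (A := (underlying A).X)
    (B := (underlying B).X) hB hu (unitLinear_underlying A) (unitLinear_underlying B) hG hK')

variable [HasCoequalizers C]

lemma Azumaya.faithfullyProjective (A : Azumaya (Mod C H)) :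
    FaithfullyProjective (underlying A.1).X := A.forget.2.1

lemma Azumaya.isAzF (A : Azumaya (Mod C H)) : IsAzF (underlying A.1) :=
  ((isAzumaya_iff _).1 A.forget.2).2.1

lemma Azumaya.exists_hasTwist (A : Azumaya (Mod C H)) (h : IsInner A.1) :
    ∃ σ, HasTwist A.1 σ := by
  obtain ⟨F, hF⟩ := (isInner_iff _).1 h
  obtain ⟨σ, hσ⟩ := hF.exists_isTwist A.faithfullyProjective A.isAzF
  exact ⟨σ, F, hF, hσ⟩

lemma Azumaya.d₂_eq_one (A : Azumaya (Mod C H)) {σ : Reg (H ⊗ H)} (h : HasTwist A.1 σ) :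
    d₂ H σ = 1 := by
  obtain ⟨F, hF, hσ⟩ := h
  exact hσ.d₂_eq_one (uscal_injective A.faithfullyProjective)

lemma Azumaya.eq_mul_d₁ (A : Azumaya (Mod C H)) {σ τ : Reg (H ⊗ H)} (h : HasTwist A.1 σ)
    (h' : HasTwist A.1 τ) : ∃ s, τ = σ * (d₁ H s)⁻¹ := by
  obtain ⟨F, hF, hσ⟩ := h
  obtain ⟨G, hG, hτ⟩ := h'
  obtain ⟨s, rfl⟩ := hF.exists_eq_mul_uscal A.faithfullyProjective A.isAzF hG
  exact ⟨s, hτ.unique (uscal_injective A.faithfullyProjective) (hσ.mul_uscal s)⟩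

lemma HasTwist.mul_d₁ {A : Mon (Mod C H)} {σ : Reg (H ⊗ H)} (h : HasTwist A σ) (s : Reg H) :
    HasTwist A (σ * (d₁ H s)⁻¹) := by
  obtain ⟨F, hF, hσ⟩ := h
  exact ⟨_, hF.mul_uscal s, hσ.mul_uscal s⟩

/-- Brauer equivalent inner Azumaya algebras have the same twist. -/
lemma BrauerEquiv.hasTwist {A B : Azumaya (Mod C H)} (h : BrauerEquiv A B) {σ : Reg (H ⊗ H)}
    (hA : HasTwist A.1 σ) : HasTwist B.1 σ := by
  obtain ⟨P, Q, hP, hQ, ⟨i⟩⟩ := h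
  have h1 := (hA.tensor (hasTwist_iEnd P)).of_iso i
  rw [mul_one] at h1
  -- Both `B ⊗ [Q, Q]` and `[Q, Q]` have inner actions, and `[Q, Q]` is Azumaya, so the action on
  -- `B` is inner.
  have hB : IsInner B.1 := exists_hasTwist_of_tensor (Azumaya.iEnd hQ).faithfullyProjective
    (Azumaya.iEnd hQ).isAzF h1.isInner (hasTwist_iEnd Q).isInner
  obtain ⟨τ, hτ⟩ := B.exists_hasTwist hB
  -- Comparing on `B ⊗ [Q, Q]` shows that `σ` and `τ` differ by a coboundary. Rescaling the
  -- implementing morphism of `B` removes the difference.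
  obtain ⟨s, hs⟩ := (B.mul (Azumaya.iEnd hQ)).eq_mul_d₁ (hτ.tensor (hasTwist_iEnd Q)) h1
  rw [mul_one] at hs
  rw [hs]
  exact hτ.mul_d₁ s

lemma mem_innerClasses_iff (A : Azumaya (Mod C H)) :
    Br.mk A ∈ innerClasses H ↔ IsInner A.1 := by
  refine ⟨fun ⟨B, hB, h⟩ => ?_, fun h => ⟨A, h, rfl⟩⟩
  obtain ⟨σ, hσ⟩ := B.exists_hasTwist hB
  exact (((Br.mk_eq_mk_iff B A).1 h).hasTwist hσ).isInner

variable (H) in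
/-- The subgroup of the classes with inner action. -/
def BMinn : Subgroup (BM H) where
  carrier := innerClasses H
  mul_mem' := by
    rintro _ _ ⟨A, hA, rfl⟩ ⟨B, hB, rfl⟩
    obtain ⟨σ, hσ⟩ := A.exists_hasTwist hA
    obtain ⟨τ, hτ⟩ := B.exists_hasTwist hB
    exact ⟨A.mul B, (hσ.tensor hτ).isInner, rfl⟩
  one_mem' := ⟨_, (hasTwist_iEnd (𝟙_ (Mod C H))).isInner, Br.one_def.symm⟩
  inv_mem' := by
    rintro _ ⟨A, hA, rfl⟩
    have e : (Br.mk A)⁻¹ = Br.mk A.op := inv_eq_of_mul_eq_one_right (Br.mk_mul_op A)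
    rw [e, mem_innerClasses_iff]
    -- The product of the opposite algebra with `A` is Brauer equivalent to an endomorphism algebra,
    -- hence has an inner action. Since `A` does too, so does the opposite algebra.
    refine exists_hasTwist_of_tensor (B := A.1) A.faithfullyProjective A.isAzF ?_ hA
    have h1 : Br.mk (A.op.mul A) = Br.mk (Azumaya.iEnd faithfullyProjective_unit) := by
      rw [← Br.mk_mul, ← e, inv_mul_cancel, Br.one_def]
    exact (((Br.mk_eq_mk_iff _ _).1 h1.symm).hasTwist (hasTwist_iEnd _)).isInner

variable (H) in
/-- The class of a cocycle. -/
def H2.mk : (d₂ H).ker →* H2 H := QuotientGroup.mk' _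

lemma H2.mk_eq_mk_iff (σ τ : (d₂ H).ker) :
    H2.mk H σ = H2.mk H τ ↔ ∃ s, (τ : Reg (H ⊗ H)) = σ * (d₁ H s)⁻¹ := by
  refine (QuotientGroup.eq (s := (d₁ H).range.subgroupOf (d₂ H).ker)).trans ?_
  rw [Subgroup.mem_subgroupOf]
  constructor
  · rintro ⟨s, hs⟩
    exact ⟨s⁻¹, by rw [map_inv, inv_inv, hs]; simp⟩
  · rintro ⟨s, hs⟩
    exact ⟨s⁻¹, by rw [map_inv]; simp [hs]⟩

/-- The class of the twist of an inner Azumaya algebra. -/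
def twistClass (A : Azumaya (Mod C H)) (h : IsInner A.1) : H2 H :=
  H2.mk H ⟨(A.exists_hasTwist h).choose, A.d₂_eq_one (A.exists_hasTwist h).choose_spec⟩

lemma twistClass_eq (A : Azumaya (Mod C H)) {σ : Reg (H ⊗ H)} (h : HasTwist A.1 σ) :
    twistClass A h.isInner = H2.mk H ⟨σ, A.d₂_eq_one h⟩ :=
  (H2.mk_eq_mk_iff _ _).2 (A.eq_mul_d₁ (A.exists_hasTwist h.isInner).choose_spec h)

end Azumaya

/-! ### Trivial twist means Brauer equivalent to a trivial action. -/

section TrivialTwist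

variable {C : Type u} [Category.{v} C] [MonoidalCategory C] [BraidedCategory C]
  [MonoidalClosed C] {H : C} [HopfObj H] [BraidingLinear H]

/-- The unit of `H` as a morphism of coalgebras. -/
def unitHom (H : C) [HopfObj H] : 𝟙_ (Comon C) ⟶ coalg H :=
  Comon.Hom.mk' (M := 𝟙_ (Comon C)) (N := coalg H) η[H]
    (by
      have h : ε[(𝟙_ (Comon C)).X] = 𝟙 (𝟙_ C) := Comon.monoidal_tensorUnit_comon_counit C
      exact (BimonObj.one_counit (M := H)).trans h.symm)
    (by
      have h : Δ[(𝟙_ (Comon C)).X] = (λ_ (𝟙_ C)).inv := Comon.monoidal_tensorUnit_comon_comul C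
      refine Eq.trans ?_ (congrArg (fun t : 𝟙_ C ⟶ 𝟙_ C ⊗ 𝟙_ C => t ≫ (η[H] ⊗ₘ η[H])) h.symm)
      change η[H] ≫ Δ[H] = _
      rw [BimonObj.one_comul, MonObj.tensorObj.one_def])

/-- Multiplicativity makes `F(1)` idempotent for convolution, and an invertible idempotent is the
unit. -/
lemma one_of_isTwist_one {A : C} [MonObj A] {F : CU H A} (h : IsTwist F 1) :
    η[H] ≫ toHom (F : Conv H A) = η[A] := by
  have hm : μ[H] ≫ toHom (F : Conv H A) =
      (toHom (F : Conv H A) ⊗ₘ toHom (F : Conv H A)) ≫ μ[A] := by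
    rw [IsTwist, map_one, mul_one] at h
    have h2 := congrArg (fun K : CU (H ⊗ H) A => toHom (K : Conv (H ⊗ H) A)) h
    simp only [Units.val_mul, upull₁_val] at h2
    rwa [toHom_fst_mul_snd] at h2
  let F' : CU (𝟙_ (Comon C)).X A := upull A (unitHom H) F
  have e : F' * F' = F' := by
    apply Units.ext
    apply toHom_injective
    have hΔ : Δ[(𝟙_ (Comon C)).X] = (λ_ (𝟙_ C)).inv := Comon.monoidal_tensorUnit_comon_comul C
    rw [Units.val_mul, toHom_mul, hΔ]
    change (λ_ (𝟙_ C)).inv ≫ ((η[H] ≫ toHom (F : Conv H A)) ⊗ₘ (η[H] ≫ toHom (F : Conv H A))) ≫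
      μ[A] = η[H] ≫ toHom (F : Conv H A)
    rw [← tensorHom_comp_tensorHom, Category.assoc, ← hm, MonoidalCategory.tensorHom_def',
      Category.assoc, MonObj.one_mul_assoc]
    simp
  have h2 : F' = 1 := mul_eq_left.1 e
  have h3 := congrArg (fun K : CU (𝟙_ (Comon C)).X A => toHom (K : Conv (𝟙_ (Comon C)).X A)) h2
  have hε : ε[(𝟙_ (Comon C)).X] = 𝟙 (𝟙_ C) := Comon.monoidal_tensorUnit_comon_counit C
  exact h3.trans ((congrArg (fun t : 𝟙_ C ⟶ 𝟙_ C => t ≫ η[A]) hε).trans (Category.id_comp _))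

lemma isMonHom_of_isTwist_one {A : C} [MonObj A] {F : CU H A} (h : IsTwist F 1) :
    IsMonHom (toHom (F : Conv H A)) where
  one_hom := one_of_isTwist_one h
  mul_hom := by
    rw [IsTwist, map_one, mul_one] at h
    have h2 := congrArg (fun K : CU (H ⊗ H) A => toHom (K : Conv (H ⊗ H) A)) h
    simp only [Units.val_mul, upull₁_val] at h2
    rwa [toHom_fst_mul_snd] at h2

/-- `A` as an `H`-module through a morphism of algebras `f : H ⟶ A`. -/
@[reducible]
def leftMod {A : C} [MonObj A] (f : H ⟶ A) [IsMonHom f] : ModObj H A where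
  smul := f ▷ A ≫ μ[A]
  one_smul := by
    change η[H] ▷ A ≫ f ▷ A ≫ μ[A] = _
    rw [← comp_whiskerRight_assoc, IsMonHom.one_hom, MonObj.one_mul]
    rfl
  mul_smul := by
    change μ[H] ▷ A ≫ f ▷ A ≫ μ[A] = (α_ H H A).hom ≫ H ◁ (f ▷ A ≫ μ[A]) ≫ f ▷ A ≫ μ[A]
    rw [← comp_whiskerRight_assoc, IsMonHom.mul_hom, comp_whiskerRight, Category.assoc,
      MonObj.mul_assoc, MonoidalCategory.tensorHom_def']
    calc
      _ = 𝟙 _ ⊗≫ H ◁ f ▷ A ⊗≫ (f ▷ (A ⊗ A) ≫ A ◁ μ[A]) ≫ μ[A] := by monoidal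
      _ = _ := by rw [← whisker_exchange]; monoidal

lemma rmul_leftMul {A : C} [MonObj A] (f : H ⟶ A) :
    (β_ H A).hom ▷ A ≫ (α_ A H A).hom ≫ A ◁ (f ▷ A ≫ μ[A]) ≫ rmul A =
      (α_ H A A).hom ≫ H ◁ rmul A ≫ f ▷ A ≫ μ[A] := by
  calc
    _ = 𝟙 _ ⊗≫ (β_ H A).hom ▷ A ⊗≫ A ◁ f ▷ A ⊗≫ ((α_ A A A).hom ≫ A ◁ μ[A] ≫ rmul A) := by
      monoidal
    _ = 𝟙 _ ⊗≫ (β_ H A).hom ▷ A ⊗≫ (A ◁ f ≫ (β_ A A).hom) ▷ A ⊗≫ A ◁ rmul A ≫ μ[A] := by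
      rw [rmul_comm]; monoidal
    _ = 𝟙 _ ⊗≫ ((β_ H A).hom ≫ (β_ A H).hom) ▷ A ⊗≫ (f ▷ (A ⊗ A) ≫ A ◁ rmul A) ≫ μ[A] := by
      rw [BraidedCategory.braiding_naturality_right]; monoidal
    _ = _ := by rw [double_braiding, ← whisker_exchange]; monoidal

/-- Here `A ⊗ Ā` carries the given action on `A` and the trivial one on `Ā`, while the module `A`
carries left multiplication by `F(h)`. The relation `F(h) a = (h₁·a) F(h₂)` is then linearity of
left multiplication, and right multiplications commute with `F(h)` anyway. -/
lemma biact_linear {A : C} [MonObj A] [ModObj H A] {F : CU H A} (hF : Implements F) :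
    ((α_ H (A ⊗ A) A).inv ≫ ((α_ H A A).inv ≫ slide H A ▷ A ≫ (α_ A H A).hom ≫
      A ◁ (β_ H A).hom ≫ (α_ A A H).inv) ▷ A ≫ (α_ (A ⊗ A) H A).hom ≫
        (A ⊗ A) ◁ (toHom (F : Conv H A) ▷ A ≫ μ[A])) ≫ biact A =
      H ◁ biact A ≫ toHom (F : Conv H A) ▷ A ≫ μ[A] := by
  rw [Implements] at hF
  have h := rmul_leftMul (A := A) (toHom (F : Conv H A))
  generalize toHom (F : Conv H A) = f at *
  rw [biact, combineAct]
  calc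
    _ = 𝟙 _ ⊗≫ slide H A ▷ (A ⊗ A) ⊗≫ A ◁ ((β_ H A).hom ▷ A ≫ (α_ A H A).hom ≫
        A ◁ (f ▷ A ≫ μ[A]) ≫ rmul A) ⊗≫ μ[A] := by monoidal
    _ = 𝟙 _ ⊗≫ (slide H A ▷ (A ⊗ A) ≫ (A ⊗ H) ◁ rmul A) ⊗≫ A ◁ f ▷ A ⊗≫ A ◁ μ[A] ⊗≫ μ[A] := by
      rw [h]; monoidal
    _ = 𝟙 _ ⊗≫ (H ⊗ A) ◁ rmul A ⊗≫ slide H A ▷ A ⊗≫ A ◁ f ▷ A ⊗≫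
        ((α_ A A A).hom ≫ A ◁ μ[A] ≫ μ[A]) := by
      rw [← whisker_exchange]; monoidal
    _ = 𝟙 _ ⊗≫ (H ⊗ A) ◁ rmul A ⊗≫ (slide H A ≫ A ◁ f ≫ μ[A]) ▷ A ⊗≫ μ[A] := by
      rw [← MonObj.mul_assoc]; monoidal
    _ = 𝟙 _ ⊗≫ (H ⊗ A) ◁ rmul A ⊗≫ f ▷ A ▷ A ⊗≫ (μ[A] ▷ A ≫ μ[A]) := by
      rw [← hF]; monoidal
    _ = 𝟙 _ ⊗≫ (H ⊗ A) ◁ rmul A ⊗≫ (f ▷ (A ⊗ A) ≫ A ◁ μ[A]) ⊗≫ μ[A] := by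
      rw [MonObj.mul_assoc]; monoidal
    _ = _ := by rw [← whisker_exchange]; monoidal

variable [HasCoequalizers C]

/-- An inner Azumaya algebra with trivial twist is Brauer equivalent to an algebra with trivial
action. -/
lemma Azumaya.mk_eq_of_hasTwist_one (A : Azumaya (Mod C H)) (h : HasTwist A.1 1) :
    Br.mk A = trivBr H (forgetBr H (Br.mk A)) := by
  obtain ⟨F, hF, hσ⟩ := h
  let U := underlying A.1
  have := isMonHom_of_isTwist_one hσ
  -- The object underlying `A` with a different action: left multiplication through `F`, which is a
  -- morphism of algebras because the twist is trivial.
  let P : Mod C H := letI := leftMod (toHom (F : Conv H U.X)); ⟨U.X⟩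
  have hP : FaithfullyProjective P := (faithfullyProjective_hom_iff P).2 A.faithfullyProjective
  let B : Azumaya (Mod C H) := A.mul (A.forget.op.triv H)
  let a : B.1.X ⊗ P ⟶ P := mkHom (X := B.1.X ⊗ P) (Y := P) (biact U.X) (by
    have h1 := biact_linear hF
    have h2 := slide_tensor (H := H) A.1.X.X (A.forget.op.triv H).1.X.X
    have h3 := congrArg (fun t : H ⊗ U.X ⟶ U.X ⊗ H => (α_ H U.X U.X).inv ≫ slide H U.X ▷ U.X ≫
      (α_ U.X H U.X).hom ≫ U.X ◁ t ≫ (α_ U.X U.X H).inv) (slide_triv (H := H) U.X)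
    exact (congrArg (fun t : H ⊗ (U.X ⊗ U.X) ⟶ (U.X ⊗ U.X) ⊗ H =>
      ((α_ H (U.X ⊗ U.X) U.X).inv ≫ t ▷ U.X ≫ (α_ (U.X ⊗ U.X) H U.X).hom ≫
        (U.X ⊗ U.X) ◁ (toHom (F : Conv H U.X) ▷ U.X ≫ μ[U.X])) ≫ biact U.X)
      (h2.trans h3)).trans h1)
  have h1 : η[B.1.X] ▷ P ≫ a = (λ_ P).hom := Mod.hom_ext _ _
    (combineAct_one (B := (opAlg U).X) (MonObj.one_mul U.X) (MonObj.one_mul (opAlg U).X))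
  have h2 : μ[B.1.X] ▷ P ≫ a = (α_ B.1.X B.1.X P).hom ≫ B.1.X ◁ a ≫ a := Mod.hom_ext _ _
    (combineAct_mul (B := (opAlg U).X) (MonObj.mul_assoc U.X) (MonObj.mul_assoc (opAlg U).X)
      (rmul_comm U.X))
  have h3 : IsUniversal a := by
    obtain ⟨P', _, -⟩ := hP.exists_exactPairing
    refine (isUniversal_iff_isIso P' a).2 ((isIso_hom_iff _).1 ?_)
    have h4 : IsIso (lcurry (biact U.X)) := A.isAzF.isIso_lcurry
    exact (congrArg (fun f : U.X ⊗ U.X ⟶ (ihom U.X).obj U.X => IsIso f) (lcurry_hom a)).mpr h4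
  obtain ⟨i⟩ := nonempty_iso_iEnd B.1 h1 h2 h3
  have h5 : Br.mk A * trivBr H (forgetBr H (Br.mk A))⁻¹ = 1 := by
    have e : (forgetBr H (Br.mk A))⁻¹ = Br.mk A.forget.op :=
      inv_eq_of_mul_eq_one_right (Br.mk_mul_op A.forget)
    rw [e, ← Br.mk_iEnd hP]
    exact Quot.sound (BrauerEquiv.of_iso (A := B) (B := Azumaya.iEnd hP) i)
  rwa [map_inv, mul_inv_eq_one] at h5

end TrivialTwist

/-! ### Multiplying a morphism by a scalar function. -/

section Scal
variable {C : Type u} [Category.{v} C] [MonoidalCategory C] [BraidedCategory C]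

/-- `x ↦ s(x₁) f(x₂)`. -/
def sact {X Z : C} [ComonObj X] (s : Conv X (𝟙_ C)) (f : X ⟶ Z) : X ⟶ Z :=
  Δ[X] ≫ (toHom s ⊗ₘ f) ≫ (λ_ Z).hom

lemma sact_comp {X Z W : C} [ComonObj X] (s : Conv X (𝟙_ C)) (f : X ⟶ Z) (g : Z ⟶ W) :
    sact s f ≫ g = sact s (f ≫ g) := by
  simp [sact, MonoidalCategory.tensorHom_def]

lemma one_sact {X Z : C} [ComonObj X] (f : X ⟶ Z) : sact 1 f = f := by
  have e : toHom (1 : Conv X (𝟙_ C)) = ε[X] := Category.comp_id _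
  rw [sact, e, MonoidalCategory.tensorHom_def, Category.assoc, ComonObj.counit_comul_assoc]
  simp

lemma mul_sact {X Z : C} [ComonObj X] (s t : Conv X (𝟙_ C)) (f : X ⟶ Z) :
    sact (s * t) f = sact s (sact t f) := by
  have e : μ[𝟙_ C] = (λ_ (𝟙_ C)).hom := rfl
  rw [sact, sact, sact, toHom_mul, e]
  generalize toHom s = s
  generalize toHom t = t
  calc
    _ = 𝟙 _ ⊗≫ (Δ[X] ≫ Δ[X] ▷ X) ⊗≫ ((s ⊗ₘ t) ⊗ₘ f) ⊗≫ 𝟙 _ := by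
      rw [MonoidalCategory.tensorHom_def (Δ[X] ≫ _),
        MonoidalCategory.tensorHom_def (s ⊗ₘ t)]; monoidal
    _ = _ := by
      have h : Δ[X] ≫ Δ[X] ▷ X = Δ[X] ≫ X ◁ Δ[X] ≫ (α_ X X X).inv := by
        rw [ComonObj.comul_assoc_assoc]; simp
      rw [h]
      calc
        _ = 𝟙 _ ⊗≫ Δ[X] ⊗≫ X ◁ Δ[X] ⊗≫ X ◁ X ◁ f ⊗≫ X ◁ t ▷ Z ⊗≫ s ▷ Z ⊗≫ 𝟙 _ := by
          rw [MonoidalCategory.tensorHom_def' (s ⊗ₘ t), MonoidalCategory.tensorHom_def' s]; monoidal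
        _ = _ := by
          rw [MonoidalCategory.tensorHom_def' s, MonoidalCategory.tensorHom_def' t]; monoidal

lemma comp_sact {X Y Z : C} [ComonObj X] [ComonObj Y] (c : X ⟶ Y) [IsComonHom c]
    (s : Conv Y (𝟙_ C)) (f : Y ⟶ Z) : c ≫ sact s f = sact (ofHom (c ≫ toHom s)) (c ≫ f) := by
  rw [sact, sact, IsComonHom.hom_comul_assoc, tensorHom_comp_tensorHom_assoc]
  rfl

lemma sact_counit {X : C} [ComonObj X] (s : Conv X (𝟙_ C)) : sact s ε[X] = toHom s := by
  rw [sact, MonoidalCategory.tensorHom_def', Category.assoc, ComonObj.comul_counit_assoc]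
  simp [unitors_equal]

/-- Composing with the counit recovers `s`. -/
lemma sact_injective {X : C} [ComonObj X] {Z : C} {f : X ⟶ Z} [ComonObj Z] [IsComonHom f]
   {s t : Conv X (𝟙_ C)} (h : sact s f = sact t f) : s = t := by
  have := congrArg (· ≫ ε[Z]) h
  simp only [sact_comp, IsComonHom.hom_counit, sact_counit] at this
  exact this

lemma sact_whiskerRight {X Y Z : C} [ComonObj X] [ComonObj Y] (s : Conv X (𝟙_ C)) (f : X ⟶ Z) :
    sact s f ▷ Y = sact (ofHom (X ◁ ε[Y] ≫ (ρ_ X).hom ≫ toHom s)) (f ▷ Y) := by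
  rw [sact, sact, Comon.tensorObj_comul, toHom_ofHom]
  generalize toHom s = s
  symm
  calc
    _ = 𝟙 _ ⊗≫ Δ[X] ▷ Y ⊗≫ (X ⊗ X) ◁ Δ[Y] ⊗≫ X ◁ ((β_ X Y).hom ≫ ε[Y] ▷ X) ▷ Y ⊗≫
        (s ▷ (X ⊗ Y) ≫ (𝟙_ C) ◁ f ▷ Y) ⊗≫ 𝟙 _ := by
      rw [MonoidalCategory.tensorHom_def Δ[X], MonoidalCategory.tensorHom_def, tensorμ]; monoidal
    _ = 𝟙 _ ⊗≫ Δ[X] ▷ Y ⊗≫ (X ⊗ X) ◁ (Δ[Y] ≫ ε[Y] ▷ Y) ⊗≫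
        (s ▷ (X ⊗ Y) ≫ (𝟙_ C) ◁ f ▷ Y) ⊗≫ 𝟙 _ := by
      rw [← BraidedCategory.braiding_naturality_right, braiding_tensorUnit_right]; monoidal
    _ = _ := by
      rw [ComonObj.counit_comul, MonoidalCategory.tensorHom_def]; monoidal

lemma sact_whiskerLeft {X Y Z : C} [ComonObj X] [ComonObj Y] (s : Conv Y (𝟙_ C)) (f : Y ⟶ Z) :
    X ◁ sact s f = sact (ofHom (ε[X] ▷ Y ≫ (λ_ Y).hom ≫ toHom s)) (X ◁ f) := by
  rw [sact, sact, Comon.tensorObj_comul, toHom_ofHom]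
  generalize toHom s = s
  symm
  calc
    _ = 𝟙 _ ⊗≫ X ◁ Δ[Y] ⊗≫ (Δ[X] ≫ ε[X] ▷ X) ▷ (Y ⊗ Y) ⊗≫ ((β_ X Y).hom ≫ s ▷ X) ▷ Y ⊗≫
         X ◁ f ⊗≫ 𝟙 _ := by
      rw [MonoidalCategory.tensorHom_def' Δ[X], MonoidalCategory.tensorHom_def, tensorμ]
      calc
        _ = 𝟙 _ ⊗≫ X ◁ Δ[Y] ⊗≫ Δ[X] ▷ (Y ⊗ Y) ⊗≫ (X ◁ ((β_ X Y).hom ▷ Y) ≫ ε[X] ▷ ((Y ⊗ X) ⊗ Y)) ⊗≫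
            s ▷ (X ⊗ Y) ⊗≫ X ◁ f ⊗≫ 𝟙 _ := by monoidal
        _ = _ := by rw [whisker_exchange]; monoidal
    _ = _ := by
      rw [ComonObj.counit_comul, ← BraidedCategory.braiding_naturality_right,
        braiding_tensorUnit_right, MonoidalCategory.tensorHom_def]; monoidal

instance {X Y Z : C} [ComonObj X] [ComonObj Y] [ComonObj Z] : IsComonHom (α_ X Y Z).inv := by
  have h : IsComonHom (α_ (Comon.mk X) (Comon.mk Y) (Comon.mk Z)).inv.hom := inferInstance
  exact (congrArg (fun t : X ⊗ (Y ⊗ Z) ⟶ (X ⊗ Y) ⊗ Z => IsComonHom t)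
    (comon_associator_inv (Comon.mk X) (Comon.mk Y) (Comon.mk Z))).mp h

instance {X Y X' Y' : C} [ComonObj X] [ComonObj Y] [ComonObj X'] [ComonObj Y'] (f : X ⟶ Y)
    (g : X' ⟶ Y') [IsComonHom f] [IsComonHom g] : IsComonHom (f ⊗ₘ g) where
  hom_counit := by
    rw [Comon.tensorObj_counit, Comon.tensorObj_counit, tensorHom_comp_tensorHom_assoc,
      IsComonHom.hom_counit, IsComonHom.hom_counit]
  hom_comul := by
    rw [Comon.tensorObj_comul, Comon.tensorObj_comul, tensorHom_comp_tensorHom_assoc,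
      IsComonHom.hom_comul, IsComonHom.hom_comul, ← tensorHom_comp_tensorHom_assoc, Category.assoc,
      tensorμ_natural]

instance {X Y Z : C} [ComonObj X] [ComonObj Y] [ComonObj Z] (f : X ⟶ Y) [IsComonHom f] :
    IsComonHom (f ▷ Z) := by
  rw [← tensorHom_id]; infer_instance

instance {X Y Z : C} [ComonObj X] [ComonObj Y] [ComonObj Z] (f : X ⟶ Y) [IsComonHom f] :
    IsComonHom (Z ◁ f) := by
  rw [← id_tensorHom]; infer_instance

end Scal

/-! ### The multiplication of `H` twisted by a cocycle. -/

section Cocycle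

variable {C : Type u} [Category.{v} C] [MonoidalCategory C] [BraidedCategory C] {H : C} [HopfObj H]

instance isComonHom_mul : IsComonHom μ[H] := inferInstanceAs (IsComonHom (mulHom H).hom)

lemma one_comul_hopf : η[H] ≫ Δ[H] = (λ_ (𝟙_ C)).inv ≫ (η[H] ⊗ₘ η[H]) := by
  rw [BimonObj.one_comul, MonObj.tensorObj.one_def]

instance isComonHom_inrHom (X : C) [ComonObj X] : IsComonHom (inrHom H X) where
  hom_counit := by
    rw [Comon.tensorObj_counit, inrHom, MonoidalCategory.tensorHom_def, Category.assoc,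
      Category.assoc, ← comp_whiskerRight_assoc, BimonObj.one_counit]
    simp
  hom_comul := by
    rw [Comon.tensorObj_comul]
    calc
      _ = 𝟙 _ ⊗≫ (η[H] ≫ Δ[H]) ▷ X ⊗≫ (H ⊗ H) ◁ Δ[X] ⊗≫ H ◁ (β_ H X).hom ▷ X ⊗≫ 𝟙 _ := by
        rw [inrHom, tensorμ, MonoidalCategory.tensorHom_def]; monoidal
      _ = 𝟙 _ ⊗≫ η[H] ▷ X ⊗≫ H ◁ (η[H] ▷ X ≫ H ◁ Δ[X]) ⊗≫ H ◁ (β_ H X).hom ▷ X ⊗≫ 𝟙 _ := by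
        rw [one_comul_hopf, MonoidalCategory.tensorHom_def]; monoidal
      _ = 𝟙 _ ⊗≫ η[H] ▷ X ⊗≫ H ◁ (Δ[X] ⊗≫ (η[H] ▷ X ≫ (β_ H X).hom) ▷ X) ⊗≫ 𝟙 _ := by
        rw [← whisker_exchange]; monoidal
      _ = 𝟙 _ ⊗≫ (η[H] ▷ X ≫ H ◁ Δ[X]) ⊗≫ H ◁ X ◁ η[H] ▷ X ⊗≫ 𝟙 _ := by
        rw [BraidedCategory.braiding_naturality_left, braiding_tensorUnit_left]; monoidal
      _ = _ := by
        rw [← whisker_exchange, inrHom, MonoidalCategory.tensorHom_def]; monoidal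

instance isComonHom_inlHom (X : C) [ComonObj X] : IsComonHom (inlHom X H) where
  hom_counit := by
    rw [Comon.tensorObj_counit, inlHom, MonoidalCategory.tensorHom_def', Category.assoc,
      Category.assoc, ← MonoidalCategory.whiskerLeft_comp_assoc, BimonObj.one_counit]
    simp [unitors_equal]
  hom_comul := by
    rw [Comon.tensorObj_comul]
    calc
      _ = 𝟙 _ ⊗≫ (X ◁ (η[H] ≫ Δ[H]) ≫ Δ[X] ▷ (H ⊗ H)) ⊗≫ X ◁ (β_ X H).hom ▷ H ⊗≫ 𝟙 _ := by
        rw [inlHom, tensorμ, MonoidalCategory.tensorHom_def']; monoidal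
      _ = 𝟙 _ ⊗≫ Δ[X] ⊗≫ X ◁ X ◁ η[H] ⊗≫ X ◁ ((X ⊗ H) ◁ η[H] ≫ (β_ X H).hom ▷ H) ⊗≫ 𝟙 _ := by
        rw [whisker_exchange, one_comul_hopf, MonoidalCategory.tensorHom_def]; monoidal
      _ = 𝟙 _ ⊗≫ Δ[X] ⊗≫ X ◁ (X ◁ η[H] ≫ (β_ X H).hom) ⊗≫ X ◁ (H ⊗ X) ◁ η[H] ⊗≫ 𝟙 _ := by
        rw [whisker_exchange]; monoidal
      _ = _ := by
        rw [BraidedCategory.braiding_naturality_right, braiding_tensorUnit_right, inlHom,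
          MonoidalCategory.tensorHom_def]; monoidal

/-- Precomposition of invertible elements with a morphism of coalgebras. -/
def upre (A : C) [MonObj A] {X Y : C} [ComonObj X] [ComonObj Y] (c : X ⟶ Y) [IsComonHom c] :
    CU Y A →* CU X A := upull A (X := .mk X) (Y := .mk Y) (Comon.Hom.mk c)

lemma toHom_upre {A : C} [MonObj A] {X Y : C} [ComonObj X] [ComonObj Y] (c : X ⟶ Y)
    [IsComonHom c] (F : CU Y A) : toHom (upre A c F : Conv X A) = c ≫ toHom (F : Conv Y A) := rfl

lemma comp_sact' {X Y Z : C} [ComonObj X] [ComonObj Y] (c : X ⟶ Y) [IsComonHom c]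
    (s : Reg Y) (f : Y ⟶ Z) :
    c ≫ sact (s : Conv Y (𝟙_ C)) f = sact (upre (𝟙_ C) c s : Conv X (𝟙_ C)) (c ≫ f) :=
  comp_sact c _ f

lemma upull₁_eq {A : C} [MonObj A] {c : coalg H ⊗ coalg H ⟶ coalg H} {c' : H ⊗ H ⟶ H}
    [IsComonHom c'] (h : c.hom = c') (F : CU H A) : upull₁ A c F = upre A c' F := by
  subst h; rfl

lemma upull₂_eq {A : C} [MonObj A] {c : coalg H ⊗ (coalg H ⊗ coalg H) ⟶ coalg H ⊗ coalg H}
    {c' : H ⊗ (H ⊗ H) ⟶ H ⊗ H} [IsComonHom c'] (h : c.hom = c') (F : CU (H ⊗ H) A) :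
    upull₂ A c F = upre A c' F := by
  subst h; rfl

lemma upre_ext {A : C} [MonObj A] {X Y : C} [ComonObj X] [ComonObj Y] {c d : X ⟶ Y}
    [IsComonHom c] [IsComonHom d] (h : c = d) (F : CU Y A) : upre A c F = upre A d F := by
  subst h; rfl

lemma upre_upre {A : C} [MonObj A] {X Y Z : C} [ComonObj X] [ComonObj Y] [ComonObj Z] (c : X ⟶ Y)
    [IsComonHom c] (d : Y ⟶ Z) [IsComonHom d] (F : CU Z A) :
    upre A c (upre A d F) = upre A (c ≫ d) F :=
  Units.ext (toHom_injective (Category.assoc c d (toHom (F : Conv Z A))).symm)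

instance isComonHom_fst (X Y : C) [ComonObj X] [ComonObj Y] :
    IsComonHom (X ◁ ε[Y] ≫ (ρ_ X).hom) where
  hom_counit := by
    rw [Comon.tensorObj_counit, MonoidalCategory.tensorHom_def', Category.assoc,
      Category.assoc, unitors_equal, rightUnitor_naturality]
  hom_comul := by
    rw [Comon.tensorObj_comul]
    symm
    calc
      _ = 𝟙 _ ⊗≫ Δ[X] ▷ Y ⊗≫ (X ⊗ X) ◁ Δ[Y] ⊗≫ X ◁ ((β_ X Y).hom ≫ ε[Y] ▷ X) ▷ Y ⊗≫
          (X ⊗ X) ◁ ε[Y] ⊗≫ 𝟙 _ := by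
        rw [MonoidalCategory.tensorHom_def, MonoidalCategory.tensorHom_def, tensorμ]; monoidal
      _ = 𝟙 _ ⊗≫ Δ[X] ▷ Y ⊗≫ (X ⊗ X) ◁ (Δ[Y] ≫ ε[Y] ▷ Y) ⊗≫ (X ⊗ X) ◁ ε[Y] ⊗≫ 𝟙 _ := by
        rw [← BraidedCategory.braiding_naturality_right, braiding_tensorUnit_right]; monoidal
      _ = 𝟙 _ ⊗≫ (Δ[X] ▷ Y ≫ (X ⊗ X) ◁ ε[Y]) ⊗≫ 𝟙 _ := by
        rw [ComonObj.counit_comul]; monoidal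
      _ = _ := by rw [← whisker_exchange]; monoidal

instance isComonHom_snd (X Y : C) [ComonObj X] [ComonObj Y] :
    IsComonHom (ε[X] ▷ Y ≫ (λ_ Y).hom) where
  hom_counit := by
    rw [Comon.tensorObj_counit, MonoidalCategory.tensorHom_def, Category.assoc, Category.assoc,
      leftUnitor_naturality]
  hom_comul := by
    rw [Comon.tensorObj_comul]
    symm
    calc
      _ = 𝟙 _ ⊗≫ X ◁ Δ[Y] ⊗≫ Δ[X] ▷ (Y ⊗ Y) ⊗≫ X ◁ ((β_ X Y).hom ≫ Y ◁ ε[X]) ▷ Y ⊗≫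
          ε[X] ▷ (Y ⊗ Y) ⊗≫ 𝟙 _ := by
        rw [MonoidalCategory.tensorHom_def', MonoidalCategory.tensorHom_def', tensorμ]; monoidal
      _ = 𝟙 _ ⊗≫ X ◁ Δ[Y] ⊗≫ (Δ[X] ≫ X ◁ ε[X]) ▷ (Y ⊗ Y) ⊗≫ ε[X] ▷ (Y ⊗ Y) ⊗≫ 𝟙 _ := by
        rw [← BraidedCategory.braiding_naturality_left, braiding_tensorUnit_left]; monoidal
      _ = 𝟙 _ ⊗≫ (X ◁ Δ[Y] ≫ ε[X] ▷ (Y ⊗ Y)) ⊗≫ 𝟙 _ := by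
        rw [ComonObj.comul_counit]; monoidal
      _ = _ := by rw [whisker_exchange]; monoidal

lemma sact_whiskerRight' {X Z : C} [ComonObj X] (Y : C) [ComonObj Y] (s : Reg X) (f : X ⟶ Z) :
    sact (s : Conv X (𝟙_ C)) f ▷ Y =
      sact (upre (𝟙_ C) (X ◁ ε[Y] ≫ (ρ_ X).hom) s : Conv (X ⊗ Y) (𝟙_ C)) (f ▷ Y) := by
  rw [sact_whiskerRight]
  congr 1
  exact toHom_injective (Category.assoc _ _ _).symm

lemma sact_whiskerLeft' (X : C) {Y Z : C} [ComonObj X] [ComonObj Y] (s : Reg Y) (f : Y ⟶ Z) :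
    X ◁ sact (s : Conv Y (𝟙_ C)) f =
      sact (upre (𝟙_ C) (ε[X] ▷ Y ≫ (λ_ Y).hom) s : Conv (X ⊗ Y) (𝟙_ C)) (X ◁ f) := by
  rw [sact_whiskerLeft]
  congr 1
  exact toHom_injective (Category.assoc _ _ _).symm

instance isComonHom_const (X : C) [ComonObj X] : IsComonHom (ε[X] ≫ η[H]) where
  hom_counit := by rw [Category.assoc, BimonObj.one_counit, Category.comp_id]
  hom_comul := by
    rw [Category.assoc, one_comul_hopf, ← tensorHom_comp_tensorHom,
      MonoidalCategory.tensorHom_def ε[X], Category.assoc, ComonObj.counit_comul_assoc,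
      leftUnitor_inv_naturality_assoc]

variable [BraidingLinear H] [MonoidalClosed C]

lemma d₂_eq_one_iff' (σ : Reg (H ⊗ H)) : d₂ H σ = 1 ↔
    upre (𝟙_ C) (ε[H] ▷ (H ⊗ H) ≫ (λ_ (H ⊗ H)).hom) σ * upre (𝟙_ C) (H ◁ μ[H]) σ =
      upre (𝟙_ C) ((α_ H H H).inv ≫ (H ⊗ H) ◁ ε[H] ≫ (ρ_ (H ⊗ H)).hom) σ *
        upre (𝟙_ C) ((α_ H H H).inv ≫ μ[H] ▷ H) σ := by
  rw [d₂_eq_one_iff, upull₂_eq (tailHom_hom H), upull₂_eq (mulRightHom_hom H),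
    upull₂_eq (initHom_hom H), upull₂_eq (mulLeftHom_hom H)]

lemma inrHom_naturality {X Y : C} (f : X ⟶ Y) :
    inrHom H X ≫ H ◁ f = f ≫ inrHom H Y := by
  rw [inrHom, inrHom, Category.assoc, ← whisker_exchange, leftUnitor_inv_naturality_assoc]

lemma inlHom_naturality {X Y : C} (f : X ⟶ Y) :
    inlHom X H ≫ f ▷ H = f ≫ inlHom Y H := by
  rw [inlHom, inlHom, Category.assoc, whisker_exchange, rightUnitor_inv_naturality_assoc]

lemma inrHom_snd (X : C) : inrHom H X ≫ ε[H] ▷ X ≫ (λ_ X).hom = 𝟙 X := by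
  rw [inrHom, Category.assoc, ← comp_whiskerRight_assoc, BimonObj.one_counit]
  simp

lemma inlHom_fst (X : C) : inlHom X H ≫ X ◁ ε[H] ≫ (ρ_ X).hom = 𝟙 X := by
  rw [inlHom, Category.assoc, ← MonoidalCategory.whiskerLeft_comp_assoc, BimonObj.one_counit]
  simp

lemma inrHom_fst : inrHom H H ≫ H ◁ ε[H] ≫ (ρ_ H).hom = ε[H] ≫ η[H] := by
  rw [reassoc_of% inrHom_naturality, inrHom, Category.assoc, rightUnitor_naturality,
    unitors_inv_equal, Iso.inv_hom_id_assoc]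

lemma inlHom_snd : inlHom H H ≫ ε[H] ▷ H ≫ (λ_ H).hom = ε[H] ≫ η[H] := by
  rw [reassoc_of% inlHom_naturality, inlHom, Category.assoc, leftUnitor_naturality,
    ← unitors_inv_equal, Iso.inv_hom_id_assoc]

lemma inrHom_mul_self : inrHom H H ≫ μ[H] = 𝟙 H := by
  rw [inrHom, Category.assoc, MonObj.one_mul, Iso.inv_hom_id]

lemma inlHom_mul_self : inlHom H H ≫ μ[H] = 𝟙 H := by
  rw [inlHom, Category.assoc, MonObj.mul_one, Iso.inv_hom_id]

lemma inrHom_associator_inv (X Y : C) : inrHom H (X ⊗ Y) ≫ (α_ H X Y).inv = inrHom H X ▷ Y := by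
  rw [inrHom, inrHom]; monoidal

lemma whiskerLeft_inrHom (X Y : C) : X ◁ inrHom H Y ≫ (α_ X H Y).inv = inlHom X H ▷ Y := by
  rw [inrHom, inlHom]; monoidal

/-- The cocycle identity at `(1, 1, h)`, where the common factor `σ(1, h)` cancels. -/
lemma cocycle_unit_left {σ : Reg (H ⊗ H)} (h : d₂ H σ = 1) :
    upre (𝟙_ C) (inrHom H H) σ = upre (𝟙_ C) ((ε[H] ≫ η[H]) ≫ inrHom H H) σ := by
  have h1 := congrArg (upre (𝟙_ C) (inrHom H H ≫ inrHom H (H ⊗ H))) ((d₂_eq_one_iff' σ).1 h)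
  simp only [map_mul, upre_upre] at h1
  rw [upre_ext (d := inrHom H H) (by rw [Category.assoc, inrHom_snd, Category.comp_id]),
    upre_ext (c := _ ≫ H ◁ μ[H]) (d := inrHom H H) (by
      rw [Category.assoc, inrHom_naturality, ← Category.assoc, inrHom_mul_self,
        Category.id_comp]),
    upre_ext (c := _ ≫ (α_ H H H).inv ≫ μ[H] ▷ H) (d := inrHom H H) (by
      rw [Category.assoc, reassoc_of% (inrHom_associator_inv H H), ← comp_whiskerRight,
        inrHom_mul_self]
      simp),
    upre_ext (c := _ ≫ (α_ H H H).inv ≫ _ ≫ _) (d := (ε[H] ≫ η[H]) ≫ inrHom H H) (by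
      rw [Category.assoc, reassoc_of% (inrHom_associator_inv H H), ← whisker_exchange_assoc,
        rightUnitor_naturality, ← inrHom_fst, Category.assoc, Category.assoc])] at h1
  exact mul_right_cancel h1

/-- The cocycle identity at `(h, 1, 1)`, where the common factor `σ(h, 1)` cancels. -/
lemma cocycle_unit_right {σ : Reg (H ⊗ H)} (h : d₂ H σ = 1) :
    upre (𝟙_ C) (inlHom H H) σ = upre (𝟙_ C) ((ε[H] ≫ η[H]) ≫ inrHom H H) σ := by
  have h1 := congrArg (upre (𝟙_ C) (inlHom H H ≫ H ◁ inrHom H H)) ((d₂_eq_one_iff' σ).1 h)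
  simp only [map_mul, upre_upre] at h1
  rw [upre_ext (d := (ε[H] ≫ η[H]) ≫ inrHom H H) (by
      rw [Category.assoc, whisker_exchange_assoc, leftUnitor_naturality, ← inlHom_snd,
        Category.assoc, Category.assoc]),
    upre_ext (c := _ ≫ H ◁ μ[H]) (d := inlHom H H) (by
      rw [Category.assoc, ← MonoidalCategory.whiskerLeft_comp, inrHom_mul_self]
      simp),
    upre_ext (c := _ ≫ (α_ H H H).inv ≫ μ[H] ▷ H) (d := inlHom H H) (by
      rw [Category.assoc, reassoc_of% (whiskerLeft_inrHom (H := H) H H), ← comp_whiskerRight,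
        inlHom_mul_self]
      simp),
    upre_ext (c := _ ≫ (α_ H H H).inv ≫ _ ≫ _) (d := inlHom H H) (by
      rw [Category.assoc, reassoc_of% (whiskerLeft_inrHom (H := H) H H), ← whisker_exchange_assoc,
        rightUnitor_naturality, reassoc_of% (inlHom_fst (H := H) H)])] at h1
  exact (mul_right_cancel h1).symm

/-- The value `σ⁻¹(1, 1)`. -/
def invUnit (σ : Reg (H ⊗ H)) : 𝟙_ C ⟶ 𝟙_ C :=
  η[H] ≫ inrHom H H ≫ toHom (↑σ⁻¹ : Conv (H ⊗ H) (𝟙_ C))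

/-- The twisted multiplication `h ⊗ k ↦ σ(h₁, k₁) h₂ k₂`. -/
def twistMul (σ : Reg (H ⊗ H)) : H ⊗ H ⟶ H := sact (σ : Conv (H ⊗ H) (𝟙_ C)) μ[H]

lemma twistMul_assoc_left (σ : Reg (H ⊗ H)) :
    (α_ H H H).inv ≫ twistMul σ ▷ H ≫ twistMul σ =
      sact (↑(upre (𝟙_ C) ((α_ H H H).inv ≫ (H ⊗ H) ◁ ε[H] ≫ (ρ_ (H ⊗ H)).hom) σ *
        upre (𝟙_ C) ((α_ H H H).inv ≫ μ[H] ▷ H) σ) : Conv (H ⊗ (H ⊗ H)) (𝟙_ C))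
        (H ◁ μ[H] ≫ μ[H]) := by
  rw [twistMul, sact_whiskerRight', sact_comp, comp_sact' (μ[H] ▷ H), MonObj.mul_assoc,
    comp_sact', comp_sact', Iso.inv_hom_id_assoc, upre_upre, upre_upre, Units.val_mul, mul_sact]

lemma twistMul_assoc_right (σ : Reg (H ⊗ H)) :
    H ◁ twistMul σ ≫ twistMul σ =
      sact (↑(upre (𝟙_ C) (ε[H] ▷ (H ⊗ H) ≫ (λ_ (H ⊗ H)).hom) σ *
        upre (𝟙_ C) (H ◁ μ[H]) σ) : Conv (H ⊗ (H ⊗ H)) (𝟙_ C)) (H ◁ μ[H] ≫ μ[H]) := by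
  rw [twistMul, sact_whiskerLeft', sact_comp, comp_sact' (H ◁ μ[H]), Units.val_mul, mul_sact]

/-- The twisted multiplication is associative exactly for cocycles. -/
lemma twistMul_assoc_iff (σ : Reg (H ⊗ H)) :
    twistMul σ ▷ H ≫ twistMul σ = (α_ H H H).hom ≫ H ◁ twistMul σ ≫ twistMul σ ↔
      d₂ H σ = 1 := by
  rw [← Iso.inv_comp_eq, twistMul_assoc_left, twistMul_assoc_right, d₂_eq_one_iff', eq_comm]
  exact ⟨fun h => Units.ext (sact_injective h), fun h => by rw [h]⟩

lemma sact_const {X Z : C} [ComonObj X] (k : 𝟙_ C ⟶ 𝟙_ C) (f : X ⟶ Z) :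
    sact (ofHom (ε[X] ≫ k)) f = (λ_ X).inv ≫ k ▷ X ≫ (λ_ X).hom ≫ f := by
  rw [sact, toHom_ofHom, MonoidalCategory.tensorHom_def, comp_whiskerRight, Category.assoc,
    Category.assoc, ComonObj.counit_comul_assoc]
  simp

lemma sact_const' {X Z : C} [ComonObj X] (k : 𝟙_ C ⟶ 𝟙_ C) (f : X ⟶ Z) :
    sact (ofHom (ε[X] ≫ k)) f = (ρ_ X).inv ≫ X ◁ k ≫ (ρ_ X).hom ≫ f := by
  rw [sact_const]
  have h := BraidedCategory.braiding_naturality_left k X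
  rw [braiding_tensorUnit_left] at h
  simp only [Category.assoc] at h ⊢
  have h2 := congrArg (fun t => (λ_ X).inv ≫ t ≫ (ρ_ X).hom ≫ f) h
  simpa using h2

lemma invUnit_sact (σ : Reg (H ⊗ H)) {Z : C} (f : H ⟶ Z) :
    sact (ofHom (ε[H] ≫ invUnit σ)) f =
      sact (↑(upre (𝟙_ C) ((ε[H] ≫ η[H]) ≫ inrHom H H) σ)⁻¹ : Conv H (𝟙_ C)) f := by
  rw [← map_inv]
  congr 1
  apply toHom_injective
  rw [toHom_upre, invUnit, Category.assoc, Category.assoc]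
  rfl

/-- Cocycles are not assumed to be normalized. As `σ(1, h) = σ(1, 1) ε(h)`, the unit of the twisted
multiplication is `σ⁻¹(1, 1) 1`. -/
lemma unit_twistMul_left {σ : Reg (H ⊗ H)} (h : d₂ H σ = 1) :
    (invUnit σ ≫ η[H]) ▷ H ≫ twistMul σ = (λ_ H).hom := by
  rw [← Iso.inv_comp_eq_id]
  calc
    _ = (λ_ H).inv ≫ invUnit σ ▷ H ≫ (λ_ H).hom ≫ (inrHom H H ≫ twistMul σ) := by
      rw [inrHom]; monoidal
    _ = _ := by
      rw [← sact_const, invUnit_sact, twistMul, comp_sact', inrHom_mul_self,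
        cocycle_unit_left h, ← mul_sact, Units.inv_mul, one_sact]

lemma unit_twistMul_right {σ : Reg (H ⊗ H)} (h : d₂ H σ = 1) :
    H ◁ (invUnit σ ≫ η[H]) ≫ twistMul σ = (ρ_ H).hom := by
  rw [← Iso.inv_comp_eq_id]
  calc
    _ = (ρ_ H).inv ≫ H ◁ invUnit σ ≫ (ρ_ H).hom ≫ (inlHom H H ≫ twistMul σ) := by
      rw [inlHom]; monoidal
    _ = _ := by
      rw [← sact_const', invUnit_sact, twistMul, comp_sact', inlHom_mul_self,
        cocycle_unit_right h, ← mul_sact, Units.inv_mul, one_sact]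

lemma comul_sact {X Z W : C} [ComonObj X] (s : Conv X (𝟙_ C)) (f : X ⟶ Z) (g : X ⟶ W) :
    sact s (Δ[X] ≫ (f ⊗ₘ g)) = Δ[X] ≫ (sact s f ⊗ₘ g) := by
  rw [sact, sact]
  generalize toHom s = s
  calc
    _ = 𝟙 _ ⊗≫ (Δ[X] ≫ X ◁ Δ[X]) ⊗≫ s ▷ (X ⊗ X) ⊗≫ (f ⊗ₘ g) ⊗≫ 𝟙 _ := by
      rw [MonoidalCategory.tensorHom_def' s]
      calc
        _ = 𝟙 _ ⊗≫ Δ[X] ⊗≫ X ◁ Δ[X] ⊗≫ (X ◁ (f ⊗ₘ g) ≫ s ▷ (Z ⊗ W)) ⊗≫ 𝟙 _ := by monoidal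
        _ = _ := by rw [whisker_exchange]; monoidal
    _ = _ := by
      rw [ComonObj.comul_assoc, MonoidalCategory.tensorHom_def, MonoidalCategory.tensorHom_def s,
        MonoidalCategory.tensorHom_def]
      monoidal

/-- By coassociativity the scalar can be placed on the first leg, leaving the second leg untwisted.
So the comultiplication is a coaction by algebra morphisms to the twisted algebra tensored with `H`.
-/
lemma twistMul_comul (σ : Reg (H ⊗ H)) : twistMul σ ≫ Δ[H] =
    (Δ[H] ⊗ₘ Δ[H]) ≫ tensorμ H H H H ≫ (twistMul σ ⊗ₘ μ[H]) := by
  rw [twistMul, sact_comp, IsComonHom.hom_comul, comul_sact, Comon.tensorObj_comul,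
    Category.assoc]

/-- The comodule algebra `H` with the multiplication twisted by a cocycle. -/
def twistAlg (σ : (d₂ H).ker) : ComodAlg H where
  alg :=
    { X := H
      mon :=
        { one := invUnit σ.1 ≫ η[H]
          mul := twistMul σ.1
          one_mul := unit_twistMul_left σ.2
          mul_one := unit_twistMul_right σ.2
          mul_assoc := (twistMul_assoc_iff σ.1).2 σ.2 } }
  coact := Δ[H]
  coact_counit := ComonObj.comul_counit H
  coact_comul := ComonObj.comul_assoc H
  one_coact := by
    change (invUnit σ.1 ≫ η[H]) ≫ Δ[H] = (λ_ (𝟙_ C)).inv ≫ ((invUnit σ.1 ≫ η[H]) ⊗ₘ η[H])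
    rw [Category.assoc, one_comul_hopf, leftUnitor_inv_naturality_assoc,
      MonoidalCategory.tensorHom_def, MonoidalCategory.tensorHom_def]
    simp [unitors_inv_equal, unitors_equal]
  mul_coact := twistMul_comul σ.1

/-- `a ⊗ h ↦ a G(h₁) ⊗ h₂`. -/
def rightTwist {A : C} [MonObj A] (G : Conv H A) : A ⊗ H ⟶ A ⊗ H :=
  A ◁ Δ[H] ≫ A ◁ (toHom G ▷ H) ≫ (α_ A A H).inv ≫ μ[A] ▷ H

lemma rightTwist_one {A : C} [MonObj A] : rightTwist (1 : Conv H A) = 𝟙 (A ⊗ H) := by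
  rw [rightTwist, toHom_one]
  calc
    _ = 𝟙 _ ⊗≫ A ◁ (Δ[H] ≫ ε[H] ▷ H) ⊗≫ (A ◁ η[A] ≫ μ[A]) ▷ H ⊗≫ 𝟙 _ := by monoidal
    _ = _ := by rw [ComonObj.counit_comul, MonObj.mul_one]; monoidal

lemma rightTwist_mul {A : C} [MonObj A] (F G : Conv H A) :
    rightTwist (F * G) = rightTwist F ≫ rightTwist G := by
  rw [rightTwist, rightTwist, rightTwist, toHom_mul]
  generalize toHom F = f
  generalize toHom G = g
  symm
  calc
    _ = 𝟙 _ ⊗≫ A ◁ Δ[H] ⊗≫ A ◁ f ▷ H ⊗≫ (μ[A] ▷ H ≫ A ◁ (Δ[H] ≫ g ▷ H)) ⊗≫ μ[A] ▷ H := by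
      monoidal
    _ = 𝟙 _ ⊗≫ A ◁ (Δ[H] ≫ f ▷ H ≫ A ◁ (Δ[H] ≫ g ▷ H)) ⊗≫ (μ[A] ▷ A ≫ μ[A]) ▷ H := by
      rw [← whisker_exchange]; monoidal
    _ = 𝟙 _ ⊗≫ A ◁ ((Δ[H] ≫ H ◁ Δ[H]) ⊗≫ H ◁ g ▷ H ⊗≫ f ▷ (A ⊗ H)) ⊗≫ (A ◁ μ[A] ≫ μ[A]) ▷ H := by
      rw [← whisker_exchange, MonObj.mul_assoc]; monoidal
    _ = _ := by
      rw [ComonObj.comul_assoc, MonoidalCategory.tensorHom_def']; monoidal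

end Cocycle

/-! ### Classification of Galois objects with a normal basis. -/

section GaloisObjects

variable {C : Type u} [Category.{v} C] [MonoidalCategory C] [BraidedCategory C]
  [MonoidalClosed C] {H : C} [HopfObj H] [BraidingLinear H]

lemma comul_id_snd (X Y : C) [ComonObj X] [ComonObj Y] :
    Δ[X ⊗ Y] ≫ (X ⊗ Y) ◁ (ε[X] ▷ Y ≫ (λ_ Y).hom) = X ◁ Δ[Y] ≫ (α_ X Y Y).inv := by
  rw [Comon.tensorObj_comul]
  calc
    _ = 𝟙 _ ⊗≫ X ◁ Δ[Y] ⊗≫ Δ[X] ▷ (Y ⊗ Y) ⊗≫ X ◁ ((β_ X Y).hom ≫ Y ◁ ε[X]) ▷ Y ⊗≫ 𝟙 _ := by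
      rw [MonoidalCategory.tensorHom_def', tensorμ]; monoidal
    _ = 𝟙 _ ⊗≫ X ◁ Δ[Y] ⊗≫ (Δ[X] ≫ X ◁ ε[X]) ▷ (Y ⊗ Y) ⊗≫ 𝟙 _ := by
      rw [← BraidedCategory.braiding_naturality_left, braiding_tensorUnit_left]; monoidal
    _ = _ := by rw [ComonObj.comul_counit]; monoidal

/-- The canonical morphism for the multiplication twisted by `s`. -/
lemma sact_canonical (s : Conv (H ⊗ H) (𝟙_ C)) :
    H ◁ Δ[H] ≫ (α_ H H H).inv ≫ sact s μ[H] ▷ H =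
      sact s (𝟙 _) ≫ rightTwist (idUnit H : Conv H H) := by
  have h (f : H ⊗ H ⟶ H) : H ◁ Δ[H] ≫ (α_ H H H).inv ≫ f ▷ H =
      Δ[H ⊗ H] ≫ (f ⊗ₘ (ε[H] ▷ H ≫ (λ_ H).hom)) := by
    rw [MonoidalCategory.tensorHom_def', reassoc_of% comul_id_snd]
  rw [h, ← comul_sact, ← h, sact_comp]
  congr 1
  have e : toHom (idUnit H : Conv H H) = 𝟙 H := rfl
  rw [rightTwist, e]
  simp

lemma isIso_rightTwist {A : C} [MonObj A] (F : CU H A) : IsIso (rightTwist (F : Conv H A)) :=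
  ⟨rightTwist (↑F⁻¹ : Conv H A), by rw [← rightTwist_mul, Units.mul_inv, rightTwist_one],
    by rw [← rightTwist_mul, Units.inv_mul, rightTwist_one]⟩

/-- The isomorphism `x ↦ s(x₁) x₂`. -/
@[simps]
def sactIso {X : C} [ComonObj X] (s : Reg X) : X ≅ X where
  hom := sact (s : Conv X (𝟙_ C)) (𝟙 X)
  inv := sact (↑s⁻¹ : Conv X (𝟙_ C)) (𝟙 X)
  hom_inv_id := by rw [sact_comp, Category.id_comp, ← mul_sact, Units.mul_inv, one_sact]
  inv_hom_id := by rw [sact_comp, Category.id_comp, ← mul_sact, Units.inv_mul, one_sact]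

/-- Apply the counit to the first leg of the hypothesis. -/
lemma eq_sact {X Y : C} [ComonObj X] [ComonObj Y] {φ f : X ⟶ Y}
    (h : φ ≫ Δ[Y] = Δ[X] ≫ (φ ⊗ₘ f)) : φ = sact (ofHom (φ ≫ ε[Y])) f := by
  have h1 := congrArg (fun t => t ≫ ε[Y] ▷ Y ≫ (λ_ Y).hom) h
  simp only [Category.assoc, ComonObj.counit_comul_assoc, Iso.inv_hom_id, Category.comp_id] at h1
  refine h1.trans ?_
  rw [sact, toHom_ofHom, MonoidalCategory.tensorHom_def', MonoidalCategory.tensorHom_def',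
    comp_whiskerRight]
  simp

/-- The inverse of a colinear isomorphism is colinear, hence is again multiplication by a scalar
function, and the two functions are inverse for convolution. -/
lemma exists_unit_of_isIso_sact {X : C} [ComonObj X] (s : Conv X (𝟙_ C))
    [h : IsIso (sact s (𝟙 X))] : ∃ σ : Reg X, (σ : Conv X (𝟙_ C)) = s := by
  obtain ⟨φ, h1, h2⟩ := h
  have hs : sact s (𝟙 X) ≫ Δ[X] = Δ[X] ≫ sact s (𝟙 X) ▷ X := by
    rw [sact_comp, Category.id_comp, ← tensorHom_id, ← comul_sact, id_tensorHom_id,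
      Category.comp_id]
  have hφ : φ ≫ Δ[X] = Δ[X] ≫ (φ ⊗ₘ 𝟙 X) := by
    calc
      _ = φ ≫ Δ[X] ≫ (sact s (𝟙 X) ≫ φ) ▷ X := by rw [h1]; simp
      _ = (φ ≫ sact s (𝟙 X)) ≫ Δ[X] ≫ φ ▷ X := by
        rw [comp_whiskerRight, ← reassoc_of% hs, Category.assoc]
      _ = _ := by rw [h2, tensorHom_id, Category.id_comp]
  have e := eq_sact hφ
  rw [e, sact_comp, Category.id_comp, ← mul_sact] at h1 h2
  exact ⟨⟨s, ofHom (φ ≫ ε[X]), sact_injective (h1.trans (one_sact _).symm),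
    sact_injective (h2.trans (one_sact _).symm)⟩, rfl⟩

lemma one_of_mul_iso {A B : Mon C} (e : A.X ≅ B.X)
    (h : μ[A.X] ≫ e.hom = (e.hom ⊗ₘ e.hom) ≫ μ[B.X]) : η[A.X] ≫ e.hom = η[B.X] := by
  have h1 : (η[A.X] ≫ e.hom) ▷ B.X ≫ μ[B.X] = (λ_ B.X).hom := by
    have h2 : 𝟙_ C ◁ e.hom ≫ (η[A.X] ≫ e.hom) ▷ B.X ≫ μ[B.X] = 𝟙_ C ◁ e.hom ≫ (λ_ B.X).hom := by
      rw [whisker_exchange_assoc, leftUnitor_naturality, ← MonObj.one_mul A.X, Category.assoc, h,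
        MonoidalCategory.tensorHom_def]
      simp
    exact (cancel_epi _).1 h2
  have h3 : (ρ_ (𝟙_ C)).inv ≫ 𝟙_ C ◁ η[B.X] ≫ (η[A.X] ≫ e.hom) ▷ B.X ≫ μ[B.X] =
      η[A.X] ≫ e.hom := by
    rw [whisker_exchange_assoc, MonObj.mul_one, rightUnitor_naturality, Iso.inv_hom_id_assoc]
  rw [← h3, h1, leftUnitor_naturality, unitors_equal, Iso.inv_hom_id_assoc]

lemma ComodAlg.iso_of_mul {T T' : ComodAlg H} (e : T.alg.X ≅ T'.alg.X)
    (h : μ[T.alg.X] ≫ e.hom = (e.hom ⊗ₘ e.hom) ≫ μ[T'.alg.X])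
    (hc : T.coact ≫ e.hom ▷ H = e.hom ≫ T'.coact) : T.Iso T' := by
  obtain ⟨i, hi⟩ := nonempty_mon_iso e (one_of_mul_iso e h) h
  exact ⟨i, by rw [hi, hc]⟩

lemma isIso_canonical_twistAlg (σ : (d₂ H).ker) :
    IsIso (H ◁ Δ[H] ≫ (α_ H H H).inv ≫ twistMul σ.1 ▷ H) := by
  rw [twistMul, sact_canonical]
  have := isIso_rightTwist (idUnit H)
  have : IsIso (sact (σ.1 : Conv (H ⊗ H) (𝟙_ C)) (𝟙 (H ⊗ H))) := (sactIso σ.1).isIso_hom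
  infer_instance

/-- Carry the multiplication of `T` over to `H` along the normal basis. Since the coaction is
multiplicative, `eq_sact` makes the result the product of `H` times a scalar function on `H ⊗ H`.
The canonical isomorphism of the Galois object makes this function invertible, and associativity
makes it a cocycle. -/
lemma exists_iso_twistAlg (T : ComodAlg H) (hT : IsGalois T) (hn : HasNormalBasis T) :
    ∃ σ, (twistAlg σ).Iso T := by
  obtain ⟨e, he⟩ := hn
  have he' : e.inv ≫ T.coact = Δ[H] ≫ e.inv ▷ H := by
    rw [Iso.inv_comp_eq, ← reassoc_of% he]
    simp
  let m : H ⊗ H ⟶ H := (e.inv ⊗ₘ e.inv) ≫ μ[T.alg.X] ≫ e.hom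
  have hm : m ≫ Δ[H] = Δ[H ⊗ H] ≫ (m ⊗ₘ μ[H]) := by
    rw [Comon.tensorObj_comul]
    simp only [m, Category.assoc]
    rw [← he, reassoc_of% T.mul_coact, tensorHom_comp_tensorHom_assoc, he', ← tensorHom_id,
      ← tensorHom_id, ← tensorHom_comp_tensorHom_assoc, tensorμ_natural_assoc]
    simp only [id_tensorHom_id, tensorHom_comp_tensorHom, Category.id_comp, Category.comp_id]
  have hs := eq_sact hm
  have hcan : IsIso (H ◁ Δ[H] ≫ (α_ H H H).inv ≫ m ▷ H) := by
    have e1 : H ◁ Δ[H] ≫ (α_ H H H).inv ≫ m ▷ H = (e.inv ⊗ₘ e.inv) ≫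
        (T.alg.X ◁ T.coact ≫ (α_ _ _ _).inv ≫ μ[T.alg.X] ▷ H) ≫ e.hom ▷ H := by
      simp only [m, MonoidalCategory.tensorHom_def]
      calc
        _ = 𝟙 _ ⊗≫ (H ◁ Δ[H] ≫ e.inv ▷ (H ⊗ H)) ⊗≫ T.alg.X ◁ e.inv ▷ H ⊗≫ μ[T.alg.X] ▷ H ≫
            e.hom ▷ H := by monoidal
        _ = 𝟙 _ ⊗≫ e.inv ▷ H ⊗≫ T.alg.X ◁ (Δ[H] ≫ e.inv ▷ H) ⊗≫ μ[T.alg.X] ▷ H ≫ e.hom ▷ H := by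
          rw [whisker_exchange]; monoidal
        _ = _ := by rw [← he']; monoidal
    have := hT.2
    rw [e1]
    infer_instance
  rw [hs, sact_canonical] at hcan
  have := isIso_rightTwist (idUnit H)
  have : IsIso (sact (ofHom (m ≫ ε[H])) (𝟙 (H ⊗ H))) :=
      IsIso.of_isIso_comp_right _ (rightTwist (idUnit H : Conv H H))
  obtain ⟨σ, hσ⟩ := exists_unit_of_isIso_sact (ofHom (m ≫ ε[H]))
  rw [← hσ] at hs
  have hmul : m ≫ e.inv = (e.inv ⊗ₘ e.inv) ≫ μ[T.alg.X] := by simp [m]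
  have hassoc : m ▷ H ≫ m = (α_ H H H).hom ≫ H ◁ m ≫ m := by
    rw [← cancel_mono e.inv]
    simp only [Category.assoc, hmul]
    rw [← tensorHom_id, ← id_tensorHom, tensorHom_comp_tensorHom_assoc, hmul,
      tensorHom_comp_tensorHom_assoc, hmul, Category.id_comp]
    have h1 : ((e.inv ⊗ₘ e.inv) ≫ μ[T.alg.X] ⊗ₘ e.inv) =
        ((e.inv ⊗ₘ e.inv) ⊗ₘ e.inv) ≫ μ[T.alg.X] ▷ T.alg.X := by
      rw [← tensorHom_id, tensorHom_comp_tensorHom, Category.comp_id]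
    have h2 : (e.inv ⊗ₘ (e.inv ⊗ₘ e.inv) ≫ μ[T.alg.X]) =
        (e.inv ⊗ₘ (e.inv ⊗ₘ e.inv)) ≫ T.alg.X ◁ μ[T.alg.X] := by
      rw [← id_tensorHom, tensorHom_comp_tensorHom, Category.comp_id]
    rw [h1, h2, Category.assoc, Category.assoc, MonObj.mul_assoc, associator_naturality_assoc]
  refine ⟨⟨σ, (twistMul_assoc_iff σ).1 ?_⟩,
      ComodAlg.iso_of_mul (T := twistAlg _) e.symm ?_ he'.symm⟩
  · rw [hs] at hassoc
    exact hassoc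
  · rw [hs] at hmul
    exact hmul

/-- Both composites are the product of `H` times a scalar function on `H ⊗ H`, so the claim is an
equation between these functions. -/
lemma mul_twistAlg_iff (σ τ : Reg (H ⊗ H)) (s : Reg H) :
    twistMul σ ≫ (sactIso s).hom = ((sactIso s).hom ⊗ₘ (sactIso s).hom) ≫ twistMul τ ↔
      τ = σ * (d₁ H s)⁻¹ := by
  have h1 : twistMul σ ≫ (sactIso s).hom =
      sact (↑(σ * upre (𝟙_ C) μ[H] s) : Conv (H ⊗ H) (𝟙_ C)) μ[H] := by
    rw [twistMul, sact_comp, sactIso_hom, comp_sact', Category.comp_id, Units.val_mul, mul_sact]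
  have h2 : ((sactIso s).hom ⊗ₘ (sactIso s).hom) ≫ twistMul τ =
      sact (↑(upre (𝟙_ C) (H ◁ ε[H] ≫ (ρ_ H).hom) s * upre (𝟙_ C) (ε[H] ▷ H ≫ (λ_ H).hom) s * τ) :
        Conv (H ⊗ H) (𝟙_ C)) μ[H] := by
    rw [MonoidalCategory.tensorHom_def, sactIso_hom, sact_whiskerRight', sact_whiskerLeft',
      sact_comp, sact_comp, id_whiskerRight, Category.id_comp, whiskerLeft_id,
      sact_comp, Category.id_comp, twistMul, Units.val_mul, Units.val_mul, mul_sact, mul_sact]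
  have g : ∀ {G : Type v} [CommGroup G] (a b c t u : G),
      (t * b = c * a * u ↔ u = t * (a * b⁻¹ * c)⁻¹) := by
    intro G _ a b c t u
    have : u * (a * b⁻¹ * c) = c * a * u * b⁻¹ := by
      rw [mul_comm u, mul_comm _ c, mul_assoc, mul_assoc, mul_assoc, mul_assoc, mul_comm u]
    rw [eq_mul_inv_iff_mul_eq, ← eq_mul_inv_iff_mul_eq (a := t), eq_comm, ← this]
  rw [h1, h2, d₁_apply, upull₁_eq (fstHom_hom H), upull₁_eq (sndHom_hom H),
    upull₁_eq (c' := μ[H]) rfl, ← g]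
  exact ⟨fun h => Units.ext (sact_injective h), fun h => by rw [h]⟩

variable [HasCoequalizers C]

/-- A comodule automorphism of `H` has the form `h ↦ s(h₁) h₂`, and `mul_twistAlg_iff` says when
such a map is multiplicative. -/
lemma twistAlg_iso_iff (σ τ : (d₂ H).ker) :
    (twistAlg σ).Iso (twistAlg τ) ↔ H2.mk H σ = H2.mk H τ := by
  rw [H2.mk_eq_mk_iff]
  constructor
  · rintro ⟨e, he⟩
    let φ : H ⟶ H := e.hom.hom
    have : IsIso φ := inferInstanceAs (IsIso ((Mon.forget C).map e.hom))
    have h1 : φ = sact (ofHom (φ ≫ ε[H])) (𝟙 H) := eq_sact (X := H) (Y := H) (by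
      rw [tensorHom_id]; exact he.symm)
    have : IsIso (sact (ofHom (φ ≫ ε[H])) (𝟙 H)) := by rw [← h1]; infer_instance
    obtain ⟨s, hs⟩ := exists_unit_of_isIso_sact (ofHom (φ ≫ ε[H]))
    rw [← hs] at h1
    refine ⟨s, (mul_twistAlg_iff _ _ s).1 ?_⟩
    rw [sactIso_hom, ← h1]
    exact IsMonHom.mul_hom e.hom.hom
  · rintro ⟨s, hs⟩
    refine ComodAlg.iso_of_mul (T := twistAlg σ) (T' := twistAlg τ)
      (show H ≅ H from sactIso s)
      ((mul_twistAlg_iff _ _ s).2 hs) ?_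
    have h : Δ[H] ≫ sact (s : Conv H (𝟙_ C)) (𝟙 H) ▷ H =
        sact (s : Conv H (𝟙_ C)) (𝟙 H) ≫ Δ[H] := by
      rw [sact_comp, Category.id_comp, ← tensorHom_id, ← comul_sact, id_tensorHom_id,
        Category.comp_id]
    exact h

/-- Dualizability makes `H ⊗ -` a right adjoint, so it preserves equalizers. The unit and the counit
make every `X` naturally a retract of `H ⊗ X`, so `H ⊗ -` reflects isomorphisms and hence
equalizers. -/
lemma faithfullyFlat_of_isFinite [HasEqualizers C] (hH : IsFinite H) : FaithfullyFlat H := by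
  obtain ⟨H', ⟨_⟩⟩ : ∃ H' : C, Nonempty (ExactPairing H H') := ⟨_, ⟨IsFinite.exactPairing hH⟩⟩
  have h1 : PreservesLimitsOfShape WalkingParallelPair (tensorLeft H) :=
    (tensorLeftAdjunction H H').rightAdjoint_preservesLimits.preservesLimitsOfShape
  have h2 : (tensorLeft H).ReflectsIsomorphisms := ⟨fun {X Y} f hf => by
    have : IsIso (H ◁ f) := hf
    refine ⟨inrHom H Y ≫ inv (H ◁ f) ≫ ε[H] ▷ X ≫ (λ_ X).hom, ?_, ?_⟩
    · rw [← reassoc_of% (inrHom_naturality (H := H) f), IsIso.hom_inv_id_assoc, inrHom_snd]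
    · have h3 : (ε[H] ▷ X ≫ (λ_ X).hom) ≫ f = H ◁ f ≫ ε[H] ▷ Y ≫ (λ_ Y).hom := by
        rw [whisker_exchange_assoc, leftUnitor_naturality, Category.assoc]
      simp only [Category.assoc] at h3 ⊢
      rw [h3, IsIso.inv_hom_id_assoc, inrHom_snd]⟩
  exact ⟨h1, reflectsLimitsOfShape_of_reflectsIsomorphisms⟩

lemma isGalois_twistAlg [HasEqualizers C] (hH : IsFinite H) (σ : (d₂ H).ker) :
    IsGalois (twistAlg σ) ∧ HasNormalBasis (twistAlg σ) :=
  have h : Δ[H] ≫ (Iso.refl H).hom ▷ H = (Iso.refl H).hom ≫ Δ[H] := by simp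
  ⟨⟨faithfullyFlat_of_isFinite (H := H) hH, isIso_canonical_twistAlg σ⟩, ⟨Iso.refl H, h⟩⟩

/-- The Galois object defined by a cocycle. -/
def twistGalois [HasEqualizers C] (hH : IsFinite H) (σ : (d₂ H).ker) : GaloisNB H :=
  ⟨twistAlg σ, isGalois_twistAlg hH σ⟩

lemma GalNB.mk_eq_mk_iff (T T' : GaloisNB H) : GalNB.mk T = GalNB.mk T' ↔ T.1.Iso T'.1 :=
  Quotient.eq (r := galoisSetoid H)

lemma twistGalois_eq_iff [HasEqualizers C] (hH : IsFinite H) (σ τ : (d₂ H).ker) :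
    GalNB.mk (twistGalois hH σ) = GalNB.mk (twistGalois hH τ) ↔ H2.mk H σ = H2.mk H τ :=
  (GalNB.mk_eq_mk_iff _ _).trans (twistAlg_iso_iff σ τ)

/-- Galois objects with a normal basis are classified by the second Sweedler cohomology. -/
def galoisEquiv [HasEqualizers C] (hH : IsFinite H) : H2 H ≃ GalNB H :=
  Equiv.ofBijective
    (fun x => GalNB.mk (twistGalois hH (QuotientGroup.mk'_surjective _ x).choose)) <| by
    constructor
    · intro x y h
      have h1 := (twistGalois_eq_iff hH _ _).1 h
      exact ((QuotientGroup.mk'_surjective _ x).choose_spec.symm.trans h1).trans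
        (QuotientGroup.mk'_surjective _ y).choose_spec
    · intro T
      induction T using Quotient.ind with | _ T
      obtain ⟨σ, hσ⟩ := exists_iso_twistAlg T.1 T.2.1 T.2.2
      refine ⟨H2.mk H σ, Eq.trans ?_ ((GalNB.mk_eq_mk_iff (twistGalois hH σ) T).2 hσ)⟩
      exact (twistGalois_eq_iff hH _ _).2 (QuotientGroup.mk'_surjective _ (H2.mk H σ)).choose_spec

lemma galoisEquiv_mk [HasEqualizers C] (hH : IsFinite H) (σ : (d₂ H).ker) :
    galoisEquiv hH (H2.mk H σ) = GalNB.mk (twistGalois hH σ) :=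
  (twistGalois_eq_iff hH _ _).2 (QuotientGroup.mk'_surjective _ (H2.mk H σ)).choose_spec

/-- By cocommutativity a scalar function can be placed on either leg of the comultiplication, so `σ`
goes to the first and `τ` to the second. -/
lemma comul_twistMul (σ τ : Reg (H ⊗ H)) : twistMul (σ * τ) ≫ Δ[H] =
    (Δ[H] ⊗ₘ Δ[H]) ≫ tensorμ H H H H ≫ (twistMul σ ⊗ₘ twistMul τ) := by
  have h {Z W : C} (t : Conv (H ⊗ H) (𝟙_ C)) (f : H ⊗ H ⟶ Z) (g : H ⊗ H ⟶ W) :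
      sact t (Δ[H ⊗ H] ≫ (f ⊗ₘ g)) = Δ[H ⊗ H] ≫ (f ⊗ₘ sact t g) := by
    have e {Z W : C} (f : H ⊗ H ⟶ Z) (g : H ⊗ H ⟶ W) :
        Δ[H ⊗ H] ≫ (f ⊗ₘ g) = (Δ[H ⊗ H] ≫ (g ⊗ₘ f)) ≫ (β_ W Z).hom := by
      rw [Category.assoc, BraidedCategory.braiding_naturality, IsCommComonObj.comul_comm_assoc]
    rw [e, ← sact_comp, comul_sact, e f]
  rw [← Category.assoc, ← Comon.tensorObj_comul, twistMul, twistMul, twistMul, ← comul_sact, ← h,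
    ← mul_sact, sact_comp, IsComonHom.hom_comul]
  rfl

lemma invUnit_mul (σ τ : Reg (H ⊗ H)) : invUnit (σ * τ) =
    (λ_ (𝟙_ C)).inv ≫ (invUnit σ ⊗ₘ invUnit τ) ≫ (λ_ (𝟙_ C)).hom := by
  have e : μ[𝟙_ C] = (λ_ (𝟙_ C)).hom := rfl
  rw [invUnit, mul_inv, Units.val_mul, toHom_mul, IsComonHom.hom_comul_assoc, ← Category.assoc,
    one_comul_hopf, e, invUnit, invUnit]
  simp only [Category.assoc, tensorHom_comp_tensorHom_assoc]

/-- The comultiplication as a morphism of twisted algebras. -/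
def comulAlg (σ τ : (d₂ H).ker) :
    (twistAlg (σ * τ)).alg ⟶ (twistAlg σ).alg ⊗ (twistAlg τ).alg :=
  Mon.Hom.mk' (M := (twistAlg (σ * τ)).alg) (N := (twistAlg σ).alg ⊗ (twistAlg τ).alg) Δ[H]
    (by
      have e : η[((twistAlg σ).alg ⊗ (twistAlg τ).alg).X] =
        (λ_ (𝟙_ C)).inv ≫ ((invUnit σ.1 ≫ η[H]) ⊗ₘ (invUnit τ.1 ≫ η[H])) := rfl
      rw [e]
      change (invUnit (σ.1 * τ.1) ≫ η[H]) ≫ Δ[H] = _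
      rw [invUnit_mul, Category.assoc, one_comul_hopf]
      simp [← tensorHom_comp_tensorHom])
    (comul_twistMul σ.1 τ.1)

/-- As comodules this is `H □ H ≅ H` through the comultiplication, with `ε ⊗ id` producing the
factorization. Cocommutativity identifies the braided left coaction with the comultiplication. -/
lemma isCotensor_twistAlg (σ τ : (d₂ H).ker) :
    IsCotensor (twistAlg σ) (twistAlg τ) (twistAlg (σ * τ)) (comulAlg σ τ) where
  coact_comp := by
    change Δ[H] ≫ Δ[H] ▷ H = Δ[H] ≫ H ◁ Δ[H] ≫ (α_ H H H).inv
    rw [ComonObj.comul_assoc_assoc]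
    simp
  isEqualizer := by
    have w : Δ[H] ≫ Δ[H] ▷ H ≫ (α_ H H H).hom = Δ[H] ≫ H ◁ (Δ[H] ≫ (β_ H H).hom) := by
      rw [IsCommComonObj.comul_comm, ComonObj.comul_assoc]
    refine ⟨w, ⟨Fork.IsLimit.mk' (C := C) (f := Δ[H] ▷ H ≫ (α_ H H H).hom)
      (g := H ◁ (Δ[H] ≫ (β_ H H).hom)) (Fork.ofι Δ[H] w) fun s =>
          ⟨s.ι ≫ ε[H] ▷ H ≫ (λ_ H).hom, ?_, ?_⟩⟩⟩
    · change (s.ι ≫ ε[H] ▷ H ≫ (λ_ H).hom) ≫ Δ[H] = s.ι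
      have h := congrArg (fun t => t ≫ ε[H] ▷ (H ⊗ H) ≫ (λ_ (H ⊗ H)).hom) s.condition
      have h1 : Δ[H] ▷ H ≫ (α_ H H H).hom ≫ ε[H] ▷ (H ⊗ H) ≫ (λ_ (H ⊗ H)).hom = 𝟙 _ := by
        calc
          _ = 𝟙 _ ⊗≫ (Δ[H] ≫ ε[H] ▷ H) ▷ H ⊗≫ 𝟙 _ := by monoidal
          _ = _ := by rw [ComonObj.counit_comul]; monoidal
      simp only [Category.assoc, h1, IsCommComonObj.comul_comm, Category.comp_id] at h
      rw [whisker_exchange_assoc, leftUnitor_naturality] at h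
      simp only [Category.assoc]
      exact h.symm
    · intro m hm
      have hm : m ≫ Δ[H] = s.ι := hm
      rw [← hm]
      simp

lemma IsCotensor.of_iso {T T' S S' E : ComodAlg H} {e : E.alg ⟶ T.alg ⊗ T'.alg}
    (h : IsCotensor T T' E e) (i : T.alg ≅ S.alg)
    (hi : T.coact ≫ i.hom.hom ▷ H = i.hom.hom ≫ S.coact)
    (i' : T'.alg ≅ S'.alg) (hi' : T'.coact ≫ i'.hom.hom ▷ H = i'.hom.hom ≫ S'.coact) :
    IsCotensor S S' E (e ≫ (i.hom ⊗ₘ i'.hom)) := by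
  let j : T.alg.X ≅ S.alg.X := (Mon.forget C).mapIso i
  let j' : T'.alg.X ≅ S'.alg.X := (Mon.forget C).mapIso i'
  have hj : T.coact ≫ j.hom ▷ H = j.hom ≫ S.coact := hi
  have hj' : T'.coact ≫ j'.hom ▷ H = j'.hom ≫ S'.coact := hi'
  have e1 : (e ≫ (i.hom ⊗ₘ i'.hom)).hom = e.hom ≫ (j.hom ⊗ₘ j'.hom) := rfl
  obtain ⟨hc, w, ⟨hl⟩⟩ := h
  have c1 : (j.hom ⊗ₘ j'.hom) ≫ S.coact ▷ S'.alg.X ≫ (α_ _ _ _).hom =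
      (T.coact ▷ T'.alg.X ≫ (α_ _ _ _).hom) ≫ (j.hom ⊗ₘ (H ◁ j'.hom)) := by
    rw [MonoidalCategory.tensorHom_def', Category.assoc, ← comp_whiskerRight_assoc, ← hj,
      MonoidalCategory.tensorHom_def']
    calc
      _ = 𝟙 _ ⊗≫ (T.alg.X ◁ j'.hom ≫ T.coact ▷ S'.alg.X) ⊗≫ j.hom ▷ (H ⊗ S'.alg.X) := by monoidal
      _ = _ := by rw [whisker_exchange]; monoidal
  have c2 : (j.hom ⊗ₘ j'.hom) ≫ S.alg.X ◁ (S'.coact ≫ (β_ _ _).hom) =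
      (T.alg.X ◁ (T'.coact ≫ (β_ _ _).hom)) ≫ (j.hom ⊗ₘ (H ◁ j'.hom)) := by
    rw [MonoidalCategory.tensorHom_def, Category.assoc, ← MonoidalCategory.whiskerLeft_comp,
      ← Category.assoc, ← hj', Category.assoc, BraidedCategory.braiding_naturality_left,
      MonoidalCategory.tensorHom_def', ← MonoidalCategory.whiskerLeft_comp_assoc, Category.assoc,
      whisker_exchange]
  refine ⟨?_, ?_⟩
  · have c3 : (T.alg.X ◁ T'.coact ≫ (α_ _ _ _).inv) ≫ (j.hom ⊗ₘ j'.hom) ▷ H =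
        (j.hom ⊗ₘ j'.hom) ≫ S.alg.X ◁ S'.coact ≫ (α_ _ _ _).inv := by
      rw [MonoidalCategory.tensorHom_def, Category.assoc (j.hom ▷ _),
        ← MonoidalCategory.whiskerLeft_comp_assoc, ← hj']
      calc
        _ = 𝟙 _ ⊗≫ (T.alg.X ◁ T'.coact ≫ j.hom ▷ (T'.alg.X ⊗ H)) ⊗≫ S.alg.X ◁ j'.hom ▷ H ⊗≫
            𝟙 _ := by monoidal
        _ = _ := by rw [whisker_exchange]; monoidal
    have c4 := congrArg (fun t => t ≫ (j.hom ⊗ₘ j'.hom) ▷ H) hc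
    simp only [Category.assoc] at c3 c4
    rw [e1, comp_whiskerRight, Category.assoc, ← c3]
    exact c4
  · have w' : (e ≫ (i.hom ⊗ₘ i'.hom)).hom ≫ S.coact ▷ S'.alg.X ≫ (α_ _ _ _).hom =
        (e ≫ (i.hom ⊗ₘ i'.hom)).hom ≫ S.alg.X ◁ (S'.coact ≫ (β_ _ _).hom) := by
      rw [e1, Category.assoc, Category.assoc, c1, c2]
      exact (Category.assoc _ _ _).symm.trans ((congrArg (· ≫ _) w).trans (Category.assoc _ _ _))
    exact ⟨w', ⟨Fork.isLimitOfIsos _ hl (Fork.ofι _ w') (j ⊗ᵢ j') (j ⊗ᵢ (whiskerLeftIso H j'))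
      (Iso.refl _) c1 c2 ((Category.id_comp _).trans rfl)⟩⟩

lemma exists_isCotensor [HasEqualizers C] (hH : IsFinite H) (T T' : GaloisNB H) (σ τ : (d₂ H).ker)
    (hσ : GalNB.mk (twistGalois hH σ) = GalNB.mk T)
    (hτ : GalNB.mk (twistGalois hH τ) = GalNB.mk T') :
    ∃ (e : (twistGalois hH (σ * τ)).1.alg ⟶ T.1.alg ⊗ T'.1.alg),
      IsCotensor T.1 T'.1 (twistGalois hH (σ * τ)).1 e := by
  obtain ⟨i, hi⟩ := (GalNB.mk_eq_mk_iff _ _).1 hσ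
  obtain ⟨i', hi'⟩ := (GalNB.mk_eq_mk_iff _ _).1 hτ
  exact ⟨_, (isCotensor_twistAlg σ τ).of_iso i hi i' hi'⟩

end GaloisObjects

/-! ### The centralizer of an Azumaya algebra in an extension by `H`. -/

section Smash

variable {C : Type u} [Category.{v} C] [MonoidalCategory C] [BraidedCategory C]
  [MonoidalClosed C] {H : C} [HopfObj H] [BraidingLinear H]

lemma comul_cact_cact {X Y P : C} [ComonObj X] (u : X ⊗ Y ⟶ P) (b d : Conv X (iEnd P).X) :
    Δ[X] ▷ Y ≫ (α_ X X Y).hom ≫ X ◁ (Δ[X] ▷ Y ≫ (α_ X X Y).hom ≫ X ◁ u ≫ cact d) ≫ cact b =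
      Δ[X] ▷ Y ≫ (α_ X X Y).hom ≫ X ◁ u ≫ cact (b * d) := by
  rw [cact_mul]
  generalize cact b = b
  generalize cact d = d
  calc
    _ = 𝟙 _ ⊗≫ (Δ[X] ≫ X ◁ Δ[X]) ▷ Y ⊗≫ X ◁ X ◁ u ⊗≫ X ◁ d ≫ b := by monoidal
    _ = 𝟙 _ ⊗≫ Δ[X] ▷ Y ⊗≫ (Δ[X] ▷ (X ⊗ Y) ≫ (X ⊗ X) ◁ u) ⊗≫ X ◁ d ≫ b := by
      rw [ComonObj.comul_assoc]; monoidal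
    _ = _ := by rw [← whisker_exchange]; monoidal

lemma comul_cact_one {X Y P : C} [ComonObj X] (u : X ⊗ Y ⟶ P) :
    Δ[X] ▷ Y ≫ (α_ X X Y).hom ≫ X ◁ u ≫ cact (1 : Conv X (iEnd P).X) = u := by
  rw [cact_one, whisker_exchange_assoc, leftUnitor_naturality]
  calc
    _ = 𝟙 _ ⊗≫ (Δ[X] ≫ ε[X] ▷ X) ▷ Y ⊗≫ u := by monoidal
    _ = _ := by rw [ComonObj.counit_comul]; monoidal

lemma comp_cact_mul {X P Q : C} [ComonObj X] (φ : P ⟶ Q) (b c : Conv X (iEnd Q).X) :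
    X ◁ φ ≫ cact (b * c) = Δ[X] ▷ P ≫ (α_ X X P).hom ≫ X ◁ (X ◁ φ ≫ cact c) ≫ cact b := by
  rw [cact_mul, whisker_exchange_assoc, tensor_whiskerLeft]
  simp

lemma cright_inv_mul_self {X E : C} [ComonObj X] [IsCommComonObj X] [MonObj E] (L : CU X E) :
    cright (↑L⁻¹ : Conv X E) * cright (L : Conv X E) = 1 := by
  rw [cright_mul, Units.mul_inv, cright_one]

/-- Morphisms `u` are determined by `h ⊗ y ↦ u(h₁, y) L(h₂)` for `L` invertible. -/
lemma comul_cright_cancel {X Y E : C} [ComonObj X] [IsCommComonObj X] [MonObj E] (L : CU X E)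
    {u v : X ⊗ Y ⟶ E}
    (h : Δ[X] ▷ Y ≫ (α_ X X Y).hom ≫ X ◁ u ≫ toHom (L : Conv X E) ▷ E ≫ rmul E =
      Δ[X] ▷ Y ≫ (α_ X X Y).hom ≫ X ◁ v ≫ toHom (L : Conv X E) ▷ E ≫ rmul E) : u = v := by
  rw [← cact_cright] at h
  rw [← comul_cact_one u, ← comul_cact_one v, ← cright_inv_mul_self L, ← comul_cact_cact,
    ← comul_cact_cact, h]

lemma intertwines_conj_of_mul {X P E : C} [ComonObj X] [IsCommComonObj X] [MonObj E] {φ : P ⟶ E}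
    {c : Conv X (iEnd P).X} {L : CU X E}
    (h : X ◁ φ ≫ toHom (L : Conv X E) ▷ E ≫ μ[E] = Δ[X] ▷ P ≫ (α_ X X P).hom ≫
      X ◁ (cact c ≫ φ) ≫ toHom (L : Conv X E) ▷ E ≫ rmul E) :
    Intertwines φ c (conj X E L) := by
  rw [Intertwines, conj_apply, cleft_cright, comp_cact_mul, cact_cleft, h, ← cact_cright,
    comul_cact_cact, cright_inv_mul_self, comul_cact_one]

variable {A E : C} [MonObj A] [MonObj E] [ModObj H A] (i : A ⟶ E) [IsMonHom i] (j : H ⟶ E)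
  [IsMonHom j]

/-- `h ↦ F⁻¹(h₁) h₂`. -/
def centralUnit (F : CU H A) : CU H E := (umap H i F)⁻¹ * umap H j (idUnit H)

lemma toHom_centralUnit (F : CU H A) : toHom (centralUnit i j F : Conv H E) =
    Δ[H] ≫ toHom (↑F⁻¹ : Conv H A) ▷ H ≫ (i ⊗ₘ j) ≫ μ[E] := by
  have e : toHom (centralUnit i j F : Conv H E) =
    Δ[H] ≫ ((toHom (↑F⁻¹ : Conv H A) ≫ i) ⊗ₘ (𝟙 H ≫ j)) ≫ μ[E] := toHom_mul _ _
  rw [e, ← tensorHom_comp_tensorHom, tensorHom_id, Category.assoc]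

variable {i j} {F : CU H A}

/-- In `E` both `F(h)` and the image of `h` conjugate `A` by the action of `H`. Their quotient
therefore commutes with `A`. -/
lemma centralUnit_comm (hF : Implements F)
    (hij : (j ⊗ₘ i) ≫ μ[E] = slide H A ≫ (i ⊗ₘ j) ≫ μ[E]) :
    (toHom (centralUnit i j F : Conv H E) ⊗ₘ i) ≫ μ[E] =
      (β_ H A).hom ≫ (i ⊗ₘ toHom (centralUnit i j F : Conv H E)) ≫ μ[E] := by
  have e : toHom (umap H j (idUnit H) : Conv H E) = j := Category.id_comp j
  have h2 : Intertwines i (conj H A F) (conj H E (umap H j (idUnit H))) := by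
    apply intertwines_conj_of_mul
    rw [implements_iff.1 hF, cact_actHom, e, rmul, BraidedCategory.braiding_naturality_left_assoc,
      MonoidalCategory.whiskerLeft_comp, Category.assoc,
      BraidedCategory.braiding_naturality_right_assoc, ← MonoidalCategory.tensorHom_def_assoc,
      ← MonoidalCategory.tensorHom_def'_assoc, hij, slide_eq, fusion]
    simp
  have h1 : Intertwines i (conj H A F) (conj H E (umap H i F)) := intertwines_conj i F
  have h3 := (intertwines_one_conj_iff i _).1 (h1.inv_mul h2)
  rw [rmul, BraidedCategory.braiding_naturality_left_assoc,
    BraidedCategory.braiding_naturality_right_assoc] at h3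
  rw [MonoidalCategory.tensorHom_def', Category.assoc, MonoidalCategory.tensorHom_def,
    Category.assoc]
  exact h3

/-- Write `U(h) = F⁻¹(h₁) h₂`. As `U(h)` commutes with `F(k)`, the product `U(h)U(k)` is
`F⁻¹(k)F⁻¹(h) hk` with arguments comultiplied. The twist of `F` turns this into `σ(h, k) U(hk)`. -/
lemma centralUnit_mul (hF : Implements F) {σ : Reg (H ⊗ H)} (hσ : IsTwist F σ)
    (hij : (j ⊗ₘ i) ≫ μ[E] = slide H A ≫ (i ⊗ₘ j) ≫ μ[E]) :
    (toHom (centralUnit i j F : Conv H E) ⊗ₘ toHom (centralUnit i j F : Conv H E)) ≫ μ[E] =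
      twistMul σ ≫ toHom (centralUnit i j F : Conv H E) := by
  set U := centralUnit i j F with hU
  set K := umap H i F
  set L := umap H j (idUnit H)
  have hK : IsTwist K σ := hσ.map i
  have hL : IsTwist L 1 := by
    have : IsMonHom (toHom (idUnit H : Conv H H)) := inferInstanceAs (IsMonHom (𝟙 H))
    exact (isTwist_one_of_isMonHom (idUnit H)).map j
  have hc : upull₁ E (fstHom H) U * upull₁ E (sndHom H) K =
      upull₁ E (sndHom H) K * upull₁ E (fstHom H) U := by
    have hK' : upull₁ E (sndHom H) K = umap (H ⊗ H) i (upull₁ A (sndHom H) F) :=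
      (umap_upull₁ i _ F).symm
    rw [hK']
    exact Units.ext (conv_commute (X := H ⊗ H) i (toHom (U : Conv H E)) (centralUnit_comm hF hij)
      (toHom (upull₁ A (sndHom H) F : Conv (H ⊗ H) A)) ((fstHom H).hom : H ⊗ H ⟶ H)).symm
  have key : upull₁ E (fstHom H) U * upull₁ E (sndHom H) U =
      uscal (H ⊗ H) E σ * upull₁ E (mulHom H) U := by
    have e : U = K⁻¹ * L := rfl
    rw [IsTwist, map_one, mul_one] at hL
    rw [IsTwist] at hK
    have h1 : upull₁ E (mulHom H) U = (uscal (H ⊗ H) E σ)⁻¹ * (upull₁ E (sndHom H) K)⁻¹ *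
        upull₁ E (fstHom H) U * upull₁ E (sndHom H) L := by
      rw [e, map_mul, map_inv, hK, hL, map_mul, map_inv]
      group
    have h3 : upull₁ E (sndHom H) U = (upull₁ E (sndHom H) K)⁻¹ * upull₁ E (sndHom H) L := by
      rw [e, map_mul, map_inv]
    have h4 := (show Commute _ _ from hc).inv_right.eq
    rw [h1, h3]
    simp only [mul_assoc, mul_inv_cancel_left]
    rw [← mul_assoc, h4, mul_assoc]
  have h2 := congrArg (fun G : CU (H ⊗ H) E => toHom (G : Conv (H ⊗ H) E)) key
  simp only [Units.val_mul, upull₁_val] at h2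
  rw [toHom_fst_mul_snd] at h2
  rw [h2, twistMul, sact_comp]
  exact toHom_cscal_mul _ _

lemma tensorHom_mul_mul {X : C} (u : X ⟶ E) : (i ⊗ₘ ((i ⊗ₘ u) ≫ μ[E])) ≫ μ[E] =
    (α_ A A X).inv ≫ μ[A] ▷ X ≫ (i ⊗ₘ u) ≫ μ[E] := by
  have h1 : (i ⊗ₘ ((i ⊗ₘ u) ≫ μ[E])) = (i ⊗ₘ (i ⊗ₘ u)) ≫ E ◁ μ[E] := by
    rw [← id_tensorHom, tensorHom_comp_tensorHom, Category.comp_id]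
  have h2 : μ[A] ▷ X ≫ (i ⊗ₘ u) = ((i ⊗ₘ i) ⊗ₘ u) ≫ μ[E] ▷ E := by
    rw [← tensorHom_id, ← tensorHom_id, tensorHom_comp_tensorHom, tensorHom_comp_tensorHom,
      IsMonHom.mul_hom, Category.comp_id, Category.id_comp]
  rw [reassoc_of% h2, h1, MonObj.mul_assoc, associator_naturality_assoc, Iso.inv_hom_id_assoc,
    Category.assoc]

lemma tensorHom_comm_mul {u : H ⟶ E} (h : (u ⊗ₘ i) ≫ μ[E] = (β_ H A).hom ≫ (i ⊗ₘ u) ≫ μ[E]) :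
    A ◁ ((i ⊗ₘ u) ≫ μ[E]) ≫ (β_ A E).hom ≫ E ◁ i ≫ μ[E] =
      (α_ A A H).inv ≫ rmul A ▷ H ≫ (i ⊗ₘ u) ≫ μ[E] := by
  have h1 : ((i ⊗ₘ u) ≫ μ[E]) ▷ A ≫ E ◁ i = ((i ⊗ₘ u) ⊗ₘ i) ≫ μ[E] ▷ E := by
    rw [← MonoidalCategory.tensorHom_def, ← tensorHom_id, tensorHom_comp_tensorHom,
      Category.comp_id]
  have h2 : (i ⊗ₘ (u ⊗ₘ i)) ≫ E ◁ μ[E] = A ◁ (β_ H A).hom ≫ (i ⊗ₘ ((i ⊗ₘ u) ≫ μ[E])) := by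
    rw [← id_tensorHom, ← id_tensorHom, tensorHom_comp_tensorHom, tensorHom_comp_tensorHom, h,
      Category.comp_id, Category.id_comp]
  rw [BraidedCategory.braiding_naturality_right_assoc, reassoc_of% h1, MonObj.mul_assoc,
    associator_naturality_assoc, reassoc_of% h2, tensorHom_mul_mul]
  rw [BraidedCategory.braiding_tensor_right_hom]
  calc
    _ = 𝟙 _ ⊗≫ (β_ A A).hom ▷ H ⊗≫ A ◁ ((β_ A H).hom ≫ (β_ H A).hom) ⊗≫ μ[A] ▷ H ≫
        (i ⊗ₘ u) ≫ μ[E] := by monoidal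
    _ = _ := by rw [(transparent (H := H)).symm, rmul]; monoidal

/-- Replacing `h` by `U(h)` amounts to the invertible shear `rightTwist F⁻¹` of `A ⊗ H`, so `a ⊗ h ↦
a U(h)` is an isomorphism as soon as `a ⊗ h ↦ a h` is. -/
lemma central_iso (F : CU H A) : (i ⊗ₘ toHom (centralUnit i j F : Conv H E)) ≫ μ[E] =
    rightTwist (↑F⁻¹ : Conv H A) ≫ (i ⊗ₘ j) ≫ μ[E] := by
  rw [toHom_centralUnit, rightTwist]
  generalize toHom (↑F⁻¹ : Conv H A) = f
  have h : (i ⊗ₘ (Δ[H] ≫ f ▷ H ≫ (i ⊗ₘ j) ≫ μ[E])) =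
      A ◁ (Δ[H] ≫ f ▷ H) ≫ (i ⊗ₘ ((i ⊗ₘ j) ≫ μ[E])) := by
    rw [← id_tensorHom, tensorHom_comp_tensorHom, Category.id_comp, Category.assoc]
  rw [h, Category.assoc, tensorHom_mul_mul]
  simp

/-- The structure of the centralizer of an Azumaya algebra in an extension by inner elements. -/
lemma existsUnique_centralUnit (hA : FaithfullyProjective A) (hu : IsUniversal (biact A))
    (hF : Implements F) (hij : (j ⊗ₘ i) ≫ μ[E] = slide H A ≫ (i ⊗ₘ j) ≫ μ[E])
    (hE : IsIso ((i ⊗ₘ j) ≫ μ[E])) {Z : C} (z : Z ⟶ E)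
    (hz : A ◁ z ≫ i ▷ E ≫ μ[E] = A ◁ z ≫ (β_ A E).hom ≫ E ◁ i ≫ μ[E]) :
    ∃! y : Z ⟶ H, y ≫ toHom (centralUnit i j F : Conv H E) = z := by
  have hc := centralUnit_comm hF hij
  have hΨ : IsIso ((i ⊗ₘ toHom (centralUnit i j F : Conv H E)) ≫ μ[E]) := by
    have := isIso_rightTwist F⁻¹
    rw [central_iso]
    infer_instance
  generalize toHom (centralUnit i j F : Conv H E) = u at *
  have h1 : unitTensor A H ≫ (i ⊗ₘ u) ≫ μ[E] = u := by
    rw [unitTensor, MonoidalCategory.tensorHom_def, Category.assoc, Category.assoc,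
      ← comp_whiskerRight_assoc, IsMonHom.one_hom, ← whisker_exchange_assoc, MonObj.one_mul,
      leftUnitor_naturality, Iso.inv_hom_id_assoc]
  have h2 : A ◁ ((i ⊗ₘ u) ≫ μ[E]) ≫ i ▷ E ≫ μ[E] =
      (α_ A A H).inv ≫ μ[A] ▷ H ≫ (i ⊗ₘ u) ≫ μ[E] := by
    rw [← tensorHom_mul_mul, MonoidalCategory.tensorHom_def' i ((i ⊗ₘ u) ≫ μ[E]), Category.assoc]
  have h3 := tensorHom_comm_mul hc
  generalize (i ⊗ₘ u) ≫ μ[E] = Ψ at *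
  -- Under `A ⊗ H ≅ E`, `a ⊗ h ↦ a u(h)`, left and right multiplication by `A` only affect the
  -- factor `A`. An element commuting with `A` then lies in the factor `H`.
  obtain ⟨y, hy, hy'⟩ := existsUnique_of_central hA hu (z ≫ inv Ψ) (by
    rw [← cancel_mono Ψ]
    simp only [Category.assoc, ← h2, ← h3]
    simp only [← MonoidalCategory.whiskerLeft_comp_assoc, Category.assoc, IsIso.inv_hom_id,
      Category.comp_id]
    exact hz)
  refine ⟨y, ?_, fun y' h => hy' y' ?_⟩
  · change y ≫ u = z
    rw [← h1, reassoc_of% hy, IsIso.inv_hom_id, Category.comp_id]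
  · change y' ≫ unitTensor A H = z ≫ inv Ψ
    rw [← h, ← h1]
    simp

lemma comm_of_braiding {u : H ⟶ E}
    (hc : (u ⊗ₘ i) ≫ μ[E] = (β_ H A).hom ≫ (i ⊗ₘ u) ≫ μ[E]) :
    A ◁ u ≫ i ▷ E ≫ μ[E] = A ◁ u ≫ (β_ A E).hom ≫ E ◁ i ≫ μ[E] := by
  rw [BraidedCategory.braiding_naturality_right_assoc, ← MonoidalCategory.tensorHom_def_assoc,
    hc, ← Category.assoc (β_ A H).hom, (transparent (H := H)).symm, Category.id_comp,
    MonoidalCategory.tensorHom_def', Category.assoc]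

/-- The unit of `E` commutes with `A`, so it comes from some `y` in `H`. Then `y` is a left unit for
the twisted multiplication and must agree with its known unit. -/
lemma unit_centralUnit (hA : FaithfullyProjective A) (hu : IsUniversal (biact A))
    (hF : Implements F) (hij : (j ⊗ₘ i) ≫ μ[E] = slide H A ≫ (i ⊗ₘ j) ≫ μ[E])
    (hE : IsIso ((i ⊗ₘ j) ≫ μ[E])) {σ : Reg (H ⊗ H)} (hσ : IsTwist F σ) (h2 : d₂ H σ = 1) :
    (invUnit σ ≫ η[H]) ≫ toHom (centralUnit i j F : Conv H E) = η[E] := by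
  have hm := centralUnit_mul hF hσ hij
  have hu' := fun {Z : C} (z : Z ⟶ E) => existsUnique_centralUnit hA hu hF hij hE z
  have hc := centralUnit_comm hF hij
  generalize toHom (centralUnit i j F : Conv H E) = u at *
  have hmono {Z : C} {y y' : Z ⟶ H} (h : y ≫ u = y' ≫ u) : y = y' := by
    refine (hu' (y' ≫ u) ?_).unique h rfl
    have e := comm_of_braiding hc
    rw [MonoidalCategory.whiskerLeft_comp, Category.assoc, e, Category.assoc]
  obtain ⟨y, hy, -⟩ := hu' η[E] (by
    rw [whisker_exchange_assoc, MonObj.mul_one, BraidedCategory.braiding_naturality_right_assoc,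
      ← whisker_exchange_assoc, MonObj.one_mul, leftUnitor_naturality, rightUnitor_naturality,
      braiding_tensorUnit_right]
    simp)
  have hy : y ≫ u = η[E] := hy
  rw [← hy]
  congr 1
  have h1 : y ▷ H ≫ twistMul σ = (λ_ H).hom := by
    apply hmono
    rw [Category.assoc, ← hm, MonoidalCategory.tensorHom_def, Category.assoc,
      ← comp_whiskerRight_assoc, hy, ← whisker_exchange_assoc, MonObj.one_mul,
      leftUnitor_naturality]
  have h3 : (ρ_ (𝟙_ C)).inv ≫ 𝟙_ C ◁ (invUnit σ ≫ η[H]) ≫ y ▷ H ≫ twistMul σ = y := by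
    rw [whisker_exchange_assoc, unit_twistMul_right h2, rightUnitor_naturality,
      Iso.inv_hom_id_assoc]
  rw [← h3, h1, leftUnitor_naturality, unitors_equal, Iso.inv_hom_id_assoc]

end Smash

/-! ### The invariants of the smash product are the twisted algebra. -/

section SmashInvariants

variable {C : Type u} [Category.{v} C] [MonoidalCategory C] [BraidedCategory C]
  [MonoidalClosed C] {H : C} [HopfObj H] [BraidingLinear H] (A : Mon (Mod C H))

/-- The inclusion `A ⟶ A # H`. -/
def smashInl : (underlying A).X ⟶ (smash A).X := smashIncl A

/-- The inclusion `H ⟶ A # H`. -/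
def smashInr : H ⟶ (smash A).X := (λ_ H).inv ≫ uone A ▷ H

lemma uone_umul : uone A ▷ A.X.X ≫ umul A = (λ_ _).hom :=
  congrArg Mod.Hom.hom (MonObj.one_mul A.X)

lemma umul_uone : A.X.X ◁ uone A ≫ umul A = (ρ_ _).hom :=
  congrArg Mod.Hom.hom (MonObj.mul_one A.X)

lemma smashInl_mul : ((ρ_ A.X.X).inv ≫ A.X.X ◁ η[H]) ▷ (A.X.X ⊗ H) ≫ smashMul A =
    (α_ _ _ _).inv ≫ umul A ▷ H := by
  rw [smashMul_eq]
  calc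
    _ = 𝟙 _ ⊗≫ A.X.X ◁ (η[H] ▷ A.X.X ≫ slide H A.X.X) ▷ H ⊗≫ umul A ▷ (H ⊗ H) ⊗≫
        A.X.X ◁ μ[H] := by monoidal
    _ = 𝟙 _ ⊗≫ ((A.X.X ⊗ A.X.X) ◁ (η[H] ▷ H) ≫ umul A ▷ (H ⊗ H)) ⊗≫ A.X.X ◁ μ[H] := by
      rw [slide_one]; monoidal
    _ = 𝟙 _ ⊗≫ umul A ▷ H ⊗≫ A.X.X ◁ (η[H] ▷ H ≫ μ[H]) := by
      rw [whisker_exchange]; monoidal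
    _ = _ := by rw [MonObj.one_mul]; monoidal

lemma mul_smashInr : (A.X.X ⊗ H) ◁ ((λ_ H).inv ≫ uone A ▷ H) ≫ smashMul A =
    (α_ _ _ _).hom ≫ A.X.X ◁ μ[H] := by
  rw [smashMul_eq]
  calc
    _ = 𝟙 _ ⊗≫ A.X.X ◁ (H ◁ uone A ≫ slide H A.X.X) ▷ H ⊗≫ umul A ▷ (H ⊗ H) ⊗≫
        A.X.X ◁ μ[H] := by monoidal
    _ = 𝟙 _ ⊗≫ (A.X.X ◁ uone A ≫ umul A) ▷ (H ⊗ H) ⊗≫ A.X.X ◁ μ[H] := by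
      rw [slide_uone, braiding_tensorUnit_right]; monoidal
    _ = _ := by rw [umul_uone]; monoidal

instance : IsMonHom (smashInl A) where
  one_hom := by
    change uone A ≫ (ρ_ _).inv ≫ A.X.X ◁ η[H] = (λ_ (𝟙_ C)).inv ≫ (uone A ⊗ₘ η[H])
    rw [rightUnitor_inv_naturality_assoc, MonoidalCategory.tensorHom_def, unitors_inv_equal]
  mul_hom := by
    change umul A ≫ (ρ_ _).inv ≫ A.X.X ◁ η[H] =
      (((ρ_ A.X.X).inv ≫ A.X.X ◁ η[H]) ⊗ₘ ((ρ_ A.X.X).inv ≫ A.X.X ◁ η[H])) ≫ smashMul A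
    rw [MonoidalCategory.tensorHom_def', Category.assoc, smashInl_mul]
    calc
      _ = 𝟙 _ ⊗≫ (umul A ▷ (𝟙_ C) ≫ A.X.X ◁ η[H]) := by monoidal
      _ = _ := by rw [← whisker_exchange]; monoidal

instance : IsMonHom (smashInr A) where
  one_hom := by
    change η[H] ≫ (λ_ H).inv ≫ uone A ▷ H = (λ_ (𝟙_ C)).inv ≫ (uone A ⊗ₘ η[H])
    rw [leftUnitor_inv_naturality_assoc, MonoidalCategory.tensorHom_def']
  mul_hom := by
    change μ[H] ≫ (λ_ H).inv ≫ uone A ▷ H =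
      (((λ_ H).inv ≫ uone A ▷ H) ⊗ₘ ((λ_ H).inv ≫ uone A ▷ H)) ≫ smashMul A
    rw [MonoidalCategory.tensorHom_def, Category.assoc, mul_smashInr]
    calc
      _ = 𝟙 _ ⊗≫ ((𝟙_ C) ◁ μ[H] ≫ uone A ▷ H) := by monoidal
      _ = _ := by rw [whisker_exchange]; monoidal

lemma smashInl_smashInr : (smashInl A ⊗ₘ smashInr A) ≫ μ[(smash A).X] = 𝟙 (A.X.X ⊗ H) := by
  change (((ρ_ A.X.X).inv ≫ A.X.X ◁ η[H]) ⊗ₘ ((λ_ H).inv ≫ uone A ▷ H)) ≫ smashMul A = _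
  rw [MonoidalCategory.tensorHom_def', Category.assoc, smashInl_mul]
  calc
    _ = 𝟙 _ ⊗≫ (A.X.X ◁ uone A ≫ umul A) ▷ H := by monoidal
    _ = _ := by rw [umul_uone]; monoidal

lemma smashInr_smashInl : (smashInr A ⊗ₘ smashInl A) ≫ μ[(smash A).X] =
    slide H (underlying A).X ≫ (smashInl A ⊗ₘ smashInr A) ≫ μ[(smash A).X] := by
  refine Eq.trans ?_ ((congrArg (fun t : A.X.X ⊗ H ⟶ A.X.X ⊗ H => slide H A.X.X ≫ t)
    (smashInl_smashInr A)).trans (Category.comp_id _)).symm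
  change (((λ_ H).inv ≫ uone A ▷ H) ⊗ₘ ((ρ_ A.X.X).inv ≫ A.X.X ◁ η[H])) ≫ smashMul A =
    slide H A.X.X
  rw [smashMul_eq, MonoidalCategory.tensorHom_def]
  calc
    _ = 𝟙 _ ⊗≫ uone A ▷ (H ⊗ A.X.X) ⊗≫ A.X.X ◁ ((H ⊗ A.X.X) ◁ η[H] ≫ slide H A.X.X ▷ H) ⊗≫
        umul A ▷ (H ⊗ H) ⊗≫ A.X.X ◁ μ[H] := by monoidal
    _ = 𝟙 _ ⊗≫ (uone A ▷ (H ⊗ A.X.X) ≫ A.X.X ◁ slide H A.X.X) ⊗≫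
        ((A.X.X ⊗ A.X.X) ◁ H ◁ η[H] ≫ umul A ▷ (H ⊗ H)) ⊗≫ A.X.X ◁ μ[H] := by
      rw [whisker_exchange]; monoidal
    _ = 𝟙 _ ⊗≫ slide H A.X.X ⊗≫ (uone A ▷ A.X.X ≫ umul A) ▷ H ⊗≫ A.X.X ◁ (H ◁ η[H] ≫ μ[H]) := by
      rw [← whisker_exchange (uone A) (slide H A.X.X), whisker_exchange (umul A) (H ◁ η[H])]
      monoidal
    _ = _ := by rw [uone_umul, MonObj.mul_one]; monoidal

variable {A} {F : CU H (underlying A).X} {σ : (d₂ H).ker}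

/-- The inclusion of the centralizer of `A`. -/
def smashCentral (hA : FaithfullyProjective (underlying A).X) (hu : IsAzF (underlying A))
    (hF : Implements F) (hσ : IsTwist F σ.1) : (twistAlg σ).alg ⟶ smash A :=
  Mon.Hom.mk' (M := (twistAlg σ).alg) (N := smash A)
    (toHom (centralUnit (smashInl A) (smashInr A) F : Conv H (smash A).X))
    (unit_centralUnit hA hu hF (smashInr_smashInl A) (by
      rw [smashInl_smashInr]; exact inferInstanceAs (IsIso (𝟙 (A.X.X ⊗ H)))) hσ σ.2)
    (centralUnit_mul hF hσ (smashInr_smashInl A)).symm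

lemma isSmashInvariants_twistAlg (hA : FaithfullyProjective (underlying A).X)
    (hu : IsAzF (underlying A)) (hF : Implements F) (hσ : IsTwist F σ.1) :
    IsSmashInvariants A (twistAlg σ) (smashCentral hA hu hF hσ) where
  coact_comp := by
    have e0 (f : H ⟶ A.X.X) (g : A.X.X ⊗ H ⟶ A.X.X ⊗ H) (hg : g = 𝟙 _) :
        Δ[H] ≫ f ▷ H ≫ g = Δ[H] ≫ f ▷ H := by rw [hg, Category.comp_id]
    have e : toHom (centralUnit (smashInl A) (smashInr A) F : Conv H (smash A).X) =
        (Δ[H] ≫ toHom (↑F⁻¹ : Conv H (underlying A).X) ▷ H : H ⟶ A.X.X ⊗ H) :=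
      (toHom_centralUnit _ _ F).trans (e0 _ _ (smashInl_smashInr A))
    have h (f : H ⟶ A.X.X) : Δ[H] ≫ (Δ[H] ≫ f ▷ H) ▷ H =
        (Δ[H] ≫ f ▷ H) ≫ A.X.X ◁ Δ[H] ≫ (α_ _ _ _).inv := by
      rw [Category.assoc, ← whisker_exchange_assoc, comp_whiskerRight]
      have h1 : Δ[H] ≫ Δ[H] ▷ H = Δ[H] ≫ H ◁ Δ[H] ≫ (α_ H H H).inv := by
        rw [ComonObj.comul_assoc_assoc]
        simp
      rw [reassoc_of% h1]
      simp
    exact (congrArg (fun t : H ⟶ A.X.X ⊗ H => Δ[H] ≫ t ▷ H) e).trans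
      ((h _).trans (congrArg (fun t : H ⟶ A.X.X ⊗ H => t ≫ A.X.X ◁ Δ[H] ≫ (α_ _ _ _).inv) e).symm)
  isEqualizer := by
    let u : H ⟶ (smash A).X := toHom (centralUnit (smashInl A) (smashInr A) F : Conv H (smash A).X)
    have hc : (u ⊗ₘ smashInl A) ≫ μ[(smash A).X] = (β_ H A.X.X).hom ≫ (smashInl A ⊗ₘ u) ≫
      μ[(smash A).X] := centralUnit_comm hF (smashInr_smashInl A)
    have hE : IsIso ((smashInl A ⊗ₘ smashInr A) ≫ μ[(smash A).X]) := by
      rw [smashInl_smashInr]; exact inferInstanceAs (IsIso (𝟙 (A.X.X ⊗ H)))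
    have hu' := fun {Z : C} (z : Z ⟶ (smash A).X) =>
      existsUnique_centralUnit hA hu hF (smashInr_smashInl A) hE z
    have iff {Z : C} (z : Z ⟶ (smash A).X) :
        z ≫ MonoidalClosed.curry (smashIncl A ▷ (smash A).X ≫ μ[(smash A).X]) =
        z ≫ MonoidalClosed.curry
          ((β_ A.X.X (smash A).X).hom ≫ (smash A).X ◁ smashIncl A ≫ μ[(smash A).X]) ↔
        A.X.X ◁ z ≫ smashIncl A ▷ (smash A).X ≫ μ[(smash A).X] =
        A.X.X ◁ z ≫ (β_ A.X.X (smash A).X).hom ≫ (smash A).X ◁ smashIncl A ≫ μ[(smash A).X] := by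
      rw [← MonoidalClosed.curry_natural_left, ← MonoidalClosed.curry_natural_left]
      exact ⟨fun h => MonoidalClosed.curry_injective h, fun h => by rw [h]⟩
    have w := (iff u).2 (comm_of_braiding (A := (underlying A).X) (E := (smash A).X)
      (i := smashInl A) hc)
    refine ⟨w, ⟨Fork.IsLimit.mk' (C := C) (Fork.ofι u w) fun s => ?_⟩⟩
    have h := hu' s.ι ((iff s.ι).1 s.condition)
    exact ⟨h.choose, h.choose_spec.1, fun {m} hm => h.choose_spec.2 m hm⟩

end SmashInvariants

/-! ### Linear and colinear endomorphisms of `A ⊗ H`. -/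

section RightTwist

variable {C : Type u} [Category.{v} C] [MonoidalCategory C] [BraidedCategory C]
  {H : C} [HopfObj H] {A : C} [MonObj A]

lemma rightTwist_linear (G : Conv H A) : A ◁ rightTwist G ≫ (α_ A A H).inv ≫ μ[A] ▷ H =
    (α_ A A H).inv ≫ μ[A] ▷ H ≫ rightTwist G := by
  rw [rightTwist]
  generalize toHom G = g
  symm
  calc
    _ = 𝟙 _ ⊗≫ (μ[A] ▷ H ≫ A ◁ (Δ[H] ≫ g ▷ H)) ⊗≫ μ[A] ▷ H := by monoidal
    _ = 𝟙 _ ⊗≫ (A ⊗ A) ◁ (Δ[H] ≫ g ▷ H) ⊗≫ (μ[A] ▷ A ≫ μ[A]) ▷ H := by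
      rw [← whisker_exchange]; monoidal
    _ = _ := by rw [MonObj.mul_assoc]; monoidal

lemma rightTwist_colinear (G : Conv H A) : rightTwist G ≫ A ◁ Δ[H] ≫ (α_ A H H).inv =
    A ◁ Δ[H] ≫ (α_ A H H).inv ≫ rightTwist G ▷ H := by
  rw [rightTwist]
  generalize toHom G = g
  calc
    _ = 𝟙 _ ⊗≫ A ◁ (Δ[H] ≫ g ▷ H) ⊗≫ (μ[A] ▷ H ≫ A ◁ Δ[H]) ⊗≫ 𝟙 _ := by monoidal
    _ = 𝟙 _ ⊗≫ A ◁ (Δ[H] ≫ (g ▷ H ≫ A ◁ Δ[H])) ⊗≫ μ[A] ▷ (H ⊗ H) ⊗≫ 𝟙 _ := by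
      rw [← whisker_exchange]; monoidal
    _ = 𝟙 _ ⊗≫ A ◁ (Δ[H] ≫ H ◁ Δ[H]) ⊗≫ A ◁ (g ▷ (H ⊗ H)) ⊗≫ μ[A] ▷ (H ⊗ H) ⊗≫ 𝟙 _ := by
      rw [← whisker_exchange]; monoidal
    _ = _ := by rw [ComonObj.comul_assoc]; monoidal

/-- Linear and colinear endomorphisms of `A ⊗ H` come from convolution. -/
lemma eq_rightTwist {S : A ⊗ H ⟶ A ⊗ H}
    (h1 : A ◁ S ≫ (α_ A A H).inv ≫ μ[A] ▷ H = (α_ A A H).inv ≫ μ[A] ▷ H ≫ S)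
    (h2 : S ≫ A ◁ Δ[H] ≫ (α_ A H H).inv = A ◁ Δ[H] ≫ (α_ A H H).inv ≫ S ▷ H) :
    rightTwist (ofHom (inrHom A H ≫ S ≫ A ◁ ε[H] ≫ (ρ_ A).hom)) = S := by
  have h3 : Δ[H] ≫ (inrHom A H ≫ S ≫ A ◁ ε[H] ≫ (ρ_ A).hom) ▷ H = inrHom A H ≫ S := by
    calc
      _ = 𝟙 _ ⊗≫ ((𝟙_ C) ◁ Δ[H] ≫ η[A] ▷ (H ⊗ H)) ⊗≫ S ▷ H ⊗≫ (A ◁ ε[H]) ▷ H ⊗≫ 𝟙 _ := by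
        rw [inrHom]; monoidal
      _ = inrHom A H ≫ (A ◁ Δ[H] ≫ (α_ A H H).inv ≫ S ▷ H) ≫ (A ◁ ε[H]) ▷ H ≫
          (ρ_ A).hom ▷ H := by
        rw [whisker_exchange, inrHom]; monoidal
      _ = 𝟙 _ ⊗≫ (inrHom A H ≫ S) ⊗≫ A ◁ (Δ[H] ≫ ε[H] ▷ H) ⊗≫ 𝟙 _ := by
        rw [← h2]; monoidal
      _ = _ := by rw [ComonObj.counit_comul]; monoidal
  rw [rightTwist, toHom_ofHom, ← MonoidalCategory.whiskerLeft_comp_assoc, h3,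
    MonoidalCategory.whiskerLeft_comp, Category.assoc, h1, inrHom]
  calc
    _ = 𝟙 _ ⊗≫ (A ◁ η[A] ≫ μ[A]) ▷ H ⊗≫ S := by monoidal
    _ = _ := by rw [MonObj.mul_one]; monoidal

lemma rightTwist_apply (G : Conv H A) :
    inrHom A H ≫ rightTwist G ≫ A ◁ ε[H] ≫ (ρ_ A).hom = toHom G := by
  rw [rightTwist, inrHom]
  generalize toHom G = g
  calc
    _ = 𝟙 _ ⊗≫ (η[A] ▷ H ≫ A ◁ (Δ[H] ≫ g ▷ H)) ⊗≫ μ[A] ▷ H ⊗≫ A ◁ ε[H] ⊗≫ 𝟙 _ := by monoidal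
    _ = 𝟙 _ ⊗≫ Δ[H] ⊗≫ g ▷ H ⊗≫ (η[A] ▷ A ≫ μ[A]) ▷ H ⊗≫ A ◁ ε[H] ⊗≫ 𝟙 _ := by
      rw [← whisker_exchange]; monoidal
    _ = 𝟙 _ ⊗≫ Δ[H] ⊗≫ (g ▷ H ≫ A ◁ ε[H]) ⊗≫ 𝟙 _ := by
      rw [MonObj.one_mul]; monoidal
    _ = 𝟙 _ ⊗≫ (Δ[H] ≫ H ◁ ε[H]) ⊗≫ g ⊗≫ 𝟙 _ := by
      rw [← whisker_exchange]; monoidal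
    _ = _ := by rw [ComonObj.comul_counit]; monoidal

lemma rightTwist_injective {F G : Conv H A} (h : rightTwist F = rightTwist G) : F = G :=
  toHom_injective (by rw [← rightTwist_apply F, ← rightTwist_apply G, h])

/-- The inverse of the shear is again linear over `A` and colinear, so it is the shear of some
morphism, and this morphism is the convolution inverse. -/
lemma exists_unit_of_isIso_rightTwist [BraidingLinear H] [MonoidalClosed C] (G : Conv H A)
    [IsIso (rightTwist G)] :
    ∃ F : CU H A, (F : Conv H A) = G := by
  let S := inv (rightTwist G)
  have h1 : A ◁ S ≫ (α_ A A H).inv ≫ μ[A] ▷ H = (α_ A A H).inv ≫ μ[A] ▷ H ≫ S := by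
    rw [← cancel_epi (A ◁ rightTwist G), ← MonoidalCategory.whiskerLeft_comp_assoc,
      IsIso.hom_inv_id, MonoidalCategory.whiskerLeft_id, Category.id_comp,
      reassoc_of% (rightTwist_linear G), IsIso.hom_inv_id, Category.comp_id]
  have h2 : S ≫ A ◁ Δ[H] ≫ (α_ A H H).inv = A ◁ Δ[H] ≫ (α_ A H H).inv ≫ S ▷ H := by
    rw [← cancel_epi (rightTwist G), IsIso.hom_inv_id_assoc,
      reassoc_of% (rightTwist_colinear G), ← comp_whiskerRight, IsIso.hom_inv_id]
    simp
  have h3 := eq_rightTwist h1 h2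
  exact ⟨⟨G, _, rightTwist_injective (by rw [rightTwist_mul, h3, rightTwist_one]; simp [S]),
    rightTwist_injective (by rw [rightTwist_mul, h3, rightTwist_one]; simp [S])⟩, rfl⟩

/-- A convolution invertible morphism which is multiplicative up to `σ` has twist `σ⁻¹`. -/
lemma isTwist_of_twistMul [BraidingLinear H] [MonoidalClosed C] {K : CU H A} {σ : Reg (H ⊗ H)}
    (h : (toHom (K : Conv H A) ⊗ₘ toHom (K : Conv H A)) ≫ μ[A] =
      twistMul σ ≫ toHom (K : Conv H A)) : IsTwist K σ⁻¹ := by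
  have h1 : upull₁ A (fstHom H) K * upull₁ A (sndHom H) K =
      uscal (H ⊗ H) A σ * upull₁ A (mulHom H) K := by
    apply Units.ext
    apply toHom_injective
    simp only [Units.val_mul, upull₁_val]
    rw [toHom_fst_mul_snd, h, twistMul, sact_comp]
    exact (toHom_cscal_mul _ _).symm
  rw [IsTwist, ← uscal_commute, h1, map_inv, inv_mul_cancel_left]

/-- The shear attached to the identity of `H`, viewed as a morphism to the twisted algebra, is the
canonical morphism of the Galois object. This is invertible, so the identity is convolution
invertible. -/
lemma exists_isTwist_inv [BraidingLinear H] [MonoidalClosed C] (σ : (d₂ H).ker) :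
    ∃ K : CU H (twistAlg σ).alg.X, IsTwist K σ.1⁻¹ := by
  let G : Conv H (twistAlg σ).alg.X := ofHom (𝟙 H)
  have : IsIso (rightTwist G) := by
    have h := isIso_canonical_twistAlg σ
    have e : H ◁ Δ[H] ≫ H ◁ (𝟙 H ▷ H) ≫ (α_ H H H).inv ≫ twistMul σ.1 ▷ H =
      H ◁ Δ[H] ≫ (α_ H H H).inv ≫ twistMul σ.1 ▷ H := by simp
    rw [← e] at h
    exact h
  obtain ⟨K, hK⟩ := exists_unit_of_isIso_rightTwist G
  refine ⟨K, isTwist_of_twistMul ?_⟩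
  rw [hK]
  have e : (𝟙 H ⊗ₘ 𝟙 H) ≫ twistMul σ.1 = twistMul σ.1 ≫ 𝟙 H := by simp
  exact e

end RightTwist

/-! ### The module algebra defined by a morphism with a twist. -/

section InnerAlgebra

variable {C : Type u} [Category.{v} C] [MonoidalCategory C] [BraidedCategory C]
  [MonoidalClosed C] {H : C} [HopfObj H] [BraidingLinear H] {A : C} [MonObj A]

/-- Conjugation kills scalars, so `conj` of `F` has trivial twist. -/
lemma isMonHom_conj {F : CU H A} {σ : Reg (H ⊗ H)} (h : IsTwist F σ) :
    IsMonHom (toHom (conj H A F)) := by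
  let c : CU H (iEnd A).X := (conj H A).toHomUnits F
  have e (f : coalg H ⊗ coalg H ⟶ coalg H) :
      (upull₁ (iEnd A).X f c : Conv (H ⊗ H) (iEnd A).X) =
        conj (H ⊗ H) A (upull₁ A f F) := by
    have : IsCommComonObj (coalg H ⊗ coalg H).X := cocomm₂ (H := H)
    exact cpull_conj f F
  have hc : IsTwist c 1 := by
    apply Units.ext
    rw [map_one, mul_one, Units.val_mul, e, e, e, h, map_mul, map_mul, conj_uscal, mul_one]
  exact isMonHom_of_isTwist_one hc

/-- The inner action given by `F`. -/
@[reducible]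
def innerMod (F : CU H A) {σ : Reg (H ⊗ H)} (h : IsTwist F σ) : ModObj H A where
  smul := cact (conj H A F)
  one_smul := by
    have := isMonHom_conj h
    change η[H] ▷ A ≫ cact (conj H A F) = (λ_ A).hom
    rw [cact, ← comp_whiskerRight_assoc, IsMonHom.one_hom, elev_one]
  mul_smul := by
    have := isMonHom_conj h
    change μ[H] ▷ A ≫ cact (conj H A F) =
      (α_ H H A).hom ≫ H ◁ cact (conj H A F) ≫ cact (conj H A F)
    rw [cact, ← comp_whiskerRight_assoc, IsMonHom.mul_hom, tensorHom_mul_elev]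

lemma implements_innerMod (F : CU H A) {σ : Reg (H ⊗ H)} (h : IsTwist F σ) :
    letI := innerMod F h
    Implements F := by
  let := innerMod F h
  rw [implements_iff]
  apply cact_injective
  rw [cact_actHom]
  rfl

lemma comul_hact_cright {Y : C} [ModObj H Y] (v : Y ⟶ A) (f : H ⟶ A) :
    Δ[H] ▷ Y ≫ (α_ H H Y).hom ≫ H ◁ (hact H Y ≫ v) ≫ f ▷ A ≫ rmul A =
      slide H Y ≫ v ▷ H ≫ A ◁ f ≫ μ[A] := by
  rw [slide_eq, fusion, rmul, BraidedCategory.braiding_naturality_left_assoc]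
  simp

variable [ModObj H A] {F : CU H A}

lemma Implements.one_linear (hF : Implements F) :
    (ε[H] ▷ 𝟙_ C ≫ (λ_ (𝟙_ C)).hom) ≫ η[A] = H ◁ η[A] ≫ hact H A := by
  apply comul_cright_cancel F
  let := trivMod H (𝟙_ C)
  have h1 := comul_hact_cright (H := H) η[A] (toHom (F : Conv H A))
  rw [hact_triv, slide_triv] at h1
  have h2 := comul_hact_cright (H := H) (𝟙 A) (toHom (F : Conv H A))
  rw [Category.comp_id, id_whiskerRight, Category.id_comp, ← hF] at h2
  rw [h1, MonoidalCategory.whiskerLeft_comp, Category.assoc]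
  have h3 : Δ[H] ▷ (𝟙_ C) ≫ (α_ H H (𝟙_ C)).hom ≫ H ◁ H ◁ η[A] =
      H ◁ η[A] ≫ Δ[H] ▷ A ≫ (α_ H H A).hom := by
    rw [whisker_exchange_assoc]; simp
  rw [reassoc_of% h3, h2, whisker_exchange_assoc, MonObj.mul_one, ← whisker_exchange_assoc,
    MonObj.one_mul, braiding_tensorUnit_right, rightUnitor_naturality]
  simp

/-- Multiply by `F` on the right, which can be cancelled: `(h₁·(ab)) F(h₂)` and `(h₁·a)(h₂·b) F(h₃)`
are both `F(h) a b`. -/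
lemma Implements.mul_linear (hF : Implements F) :
    letI := tensorMod (H := H) A A
    hact H (A ⊗ A) ≫ μ[A] = H ◁ μ[A] ≫ hact H A := by
  let := tensorMod (H := H) A A
  apply comul_cright_cancel F
  rw [comul_hact_cright, slide_tensor]
  have h2 := comul_hact_cright (H := H) (𝟙 A) (toHom (F : Conv H A))
  rw [Category.comp_id, id_whiskerRight, Category.id_comp, ← hF] at h2
  have h3 : Δ[H] ▷ (A ⊗ A) ≫ (α_ H H (A ⊗ A)).hom ≫ H ◁ H ◁ μ[A] =
      H ◁ μ[A] ≫ Δ[H] ▷ A ≫ (α_ H H A).hom := by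
    rw [whisker_exchange_assoc]; simp
  rw [MonoidalCategory.whiskerLeft_comp]
  simp only [Category.assoc]
  rw [reassoc_of% h3, h2]
  rw [Implements] at hF
  generalize toHom (F : Conv H A) = f at *
  calc
    _ = 𝟙 _ ⊗≫ slide H A ▷ A ⊗≫ A ◁ slide H A ⊗≫ (μ[A] ▷ H ≫ A ◁ f) ⊗≫ μ[A] := by monoidal
    _ = 𝟙 _ ⊗≫ slide H A ▷ A ⊗≫ A ◁ slide H A ⊗≫ A ◁ A ◁ f ⊗≫ (μ[A] ▷ A ≫ μ[A]) := by
      rw [← whisker_exchange]; monoidal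
    _ = 𝟙 _ ⊗≫ slide H A ▷ A ⊗≫ A ◁ (slide H A ≫ A ◁ f ≫ μ[A]) ⊗≫ μ[A] := by
      rw [MonObj.mul_assoc]; monoidal
    _ = 𝟙 _ ⊗≫ slide H A ▷ A ⊗≫ A ◁ f ▷ A ⊗≫ ((α_ A A A).hom ≫ A ◁ μ[A] ≫ μ[A]) := by
      rw [← hF]; monoidal
    _ = 𝟙 _ ⊗≫ (slide H A ≫ A ◁ f ≫ μ[A]) ▷ A ⊗≫ μ[A] := by
      rw [← MonObj.mul_assoc]; monoidal
    _ = 𝟙 _ ⊗≫ f ▷ A ▷ A ⊗≫ (μ[A] ▷ A ≫ μ[A]) := by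
      rw [← hF]; monoidal
    _ = 𝟙 _ ⊗≫ (f ▷ (A ⊗ A) ≫ A ◁ μ[A]) ⊗≫ μ[A] := by
      rw [MonObj.mul_assoc]; monoidal
    _ = _ := by rw [← whisker_exchange]; monoidal

/-- An algebra with an inner action. -/
def Implements.modAlg (hF : Implements F) : Mon (Mod C H) where
  X := ⟨A⟩
  mon :=
    { one := mkHom (X := 𝟙_ (Mod C H)) (Y := ⟨A⟩) η[A] hF.one_linear
      mul := mkHom (X := (⟨A⟩ : Mod C H) ⊗ ⟨A⟩) (Y := ⟨A⟩) μ[A] hF.mul_linear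
      one_mul := Mod.hom_ext _ _ (MonObj.one_mul A)
      mul_one := Mod.hom_ext _ _ (MonObj.mul_one A)
      mul_assoc := Mod.hom_ext _ _ (MonObj.mul_assoc A) }

lemma Implements.hasTwist_modAlg (hF : Implements F) {σ : Reg (H ⊗ H)} (h : IsTwist F σ) :
    HasTwist hF.modAlg σ := ⟨F, hF, h⟩

end InnerAlgebra

/-! ### Every cocycle occurs as a twist. -/

section Surjectivity

variable {C : Type u} [Category.{v} C] [MonoidalCategory C] [BraidedCategory C]
  [MonoidalClosed C] {H : C} [HopfObj H]

lemma isDescent_of_section {E : C} {e : E ⟶ 𝟙_ C} (s : 𝟙_ C ⟶ E) (h : s ≫ e = 𝟙 _) :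
    IsDescent e := by
  intro Z f hf
  refine ⟨s ≫ f, ?_, fun g hg => ?_⟩
  · have h1 := congrArg (fun t => (ρ_ E).inv ≫ E ◁ s ≫ t) hf
    simp only [Category.assoc, ← MonoidalCategory.whiskerLeft_comp_assoc, h] at h1
    rw [whisker_exchange_assoc, leftUnitor_naturality_assoc, unitors_equal,
      rightUnitor_naturality_assoc] at h1
    simpa using h1.symm
  · change e ≫ g = f at hg
    rw [← hg, reassoc_of% h]

/-- The counit is an element of `[H, I]` with `ε(1) = 1`. Together with the unit it gives a section
of the evaluation, and split epimorphisms to the unit object are of effective descent. -/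
lemma faithfullyProjective_of_hopf (hH : IsFinite H) : FaithfullyProjective H := by
  refine (faithfullyProjective_iff_isDescent hH).2
    (isDescent_of_section ((λ_ (𝟙_ C)).inv ≫ (𝟙_ C) ◁ η[H] ≫ lcurry ((λ_ H).hom ≫ ε[H]) ▷ H) ?_)
  rw [Category.assoc, Category.assoc, lcurry_lev, leftUnitor_naturality_assoc,
    BimonObj.one_counit]
  simp

/-- Every cocycle is the twist of an Azumaya algebra. -/
lemma exists_azumaya_hasTwist [BraidingLinear H] [HasCoequalizers C] (hH : IsFinite H)
    (σ : (d₂ H).ker) : ∃ A : Azumaya (Mod C H), HasTwist A.1 σ.1 := by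
  -- The inverse cocycle is used because the identity of `H`, viewed in an algebra twisted by a
  -- cocycle, has the inverse of that cocycle as its twist. Passing to the endomorphism algebra
  -- keeps the twist and ensures that the algebra is Azumaya.
  obtain ⟨K, hK⟩ := exists_isTwist_inv σ⁻¹
  have hF := hK.map (lmulHom (twistAlg σ⁻¹).alg.X)
  let := innerMod _ hF
  have hi := implements_innerMod _ hF
  have h2 : IsAzumaya (underlying hi.modAlg) :=
    (faithfullyProjective_of_hopf hH).isAzumaya_iEnd
  have e : ((σ⁻¹ : (d₂ H).ker) : Reg (H ⊗ H))⁻¹ = σ.1 := by rw [Subgroup.coe_inv, inv_inv]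
  have h3 : HasTwist hi.modAlg σ.1 := e ▸ hi.hasTwist_modAlg hF
  exact ⟨⟨hi.modAlg, (isAzumaya_underlying_iff _).2 h2⟩, h3⟩

end Surjectivity

/-! ### The split exact sequence. -/

section Sequence

variable {C : Type u} [Category.{v} C] [MonoidalCategory C] [BraidedCategory C]
  [MonoidalClosed C] [HasCoequalizers C] {H : C} [HopfObj H] [BraidingLinear H]

lemma mk_mem_BMinn {A : Azumaya (Mod C H)} {σ : Reg (H ⊗ H)} (h : HasTwist A.1 σ) :
    Br.mk A ∈ BMinn H := (mem_innerClasses_iff A).2 h.isInner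

lemma exists_hasTwist_of_mem {A : Azumaya (Mod C H)} (h : Br.mk A ∈ BMinn H) :
    ∃ σ, HasTwist A.1 σ := A.exists_hasTwist ((mem_innerClasses_iff A).1 h)

/-- The class of the twist of an element of the Brauer group with inner action. -/
def twistFun (x : BMinn H) : H2 H := twistClass x.2.choose x.2.choose_spec.1

lemma twistFun_mk {A : Azumaya (Mod C H)} (hA : Br.mk A ∈ BMinn H) {σ : Reg (H ⊗ H)}
    (h : HasTwist A.1 σ) : twistFun ⟨Br.mk A, hA⟩ = H2.mk H ⟨σ, A.d₂_eq_one h⟩ := by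
  have hx : ∃ B : Azumaya (Mod C H), IsInner B.1 ∧ Br.mk B = Br.mk A := hA
  have e : Br.mk A = Br.mk hx.choose := hx.choose_spec.2.symm
  exact twistClass_eq hx.choose (((Br.mk_eq_mk_iff _ _).1 e).hasTwist h)

variable (H) in
/-- The homomorphism sending a class with inner action to the class of its twist. -/
def twistHom : BMinn H →* H2 H :=
  MonoidHom.mk' twistFun (by
    rintro ⟨x, hx⟩ ⟨y, hy⟩
    induction x using Quot.ind with | _ A
    induction y using Quot.ind with | _ B
    obtain ⟨σ, hσ⟩ := exists_hasTwist_of_mem hx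
    obtain ⟨τ, hτ⟩ := exists_hasTwist_of_mem hy
    have h : HasTwist (A.mul B).1 (σ * τ) := hσ.tensor hτ
    have e : (⟨Br.mk A, hx⟩ * ⟨Br.mk B, hy⟩ : BMinn H) = ⟨Br.mk (A.mul B), mk_mem_BMinn h⟩ := rfl
    refine (congrArg twistFun e).trans ((twistFun_mk _ h).trans ?_)
    refine Eq.trans ?_ (congrArg₂ (· * ·) (twistFun_mk hx hσ) (twistFun_mk hy hτ)).symm
    exact map_mul (H2.mk H) ⟨σ, A.d₂_eq_one hσ⟩ ⟨τ, B.d₂_eq_one hτ⟩)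

lemma twistHom_mk {A : Azumaya (Mod C H)} (hA : Br.mk A ∈ BMinn H) {σ : Reg (H ⊗ H)}
    (h : HasTwist A.1 σ) : twistHom H ⟨Br.mk A, hA⟩ = H2.mk H ⟨σ, A.d₂_eq_one h⟩ :=
  twistFun_mk hA h

lemma trivBr_mem (x : Br C) : trivBr H x ∈ BMinn H := by
  induction x using Quot.ind with | _ A
  exact mk_mem_BMinn (A := A.triv H) (hasTwist_trivAlg A.1)

variable (H) in
/-- The inclusion of the classes with trivial action. -/
def trivInn : Br C →* BMinn H := (trivBr H).codRestrict (BMinn H) trivBr_mem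

variable (H) in
/-- Forgetting an inner action. -/
def forgetInn : BMinn H →* Br C := (forgetBr H).comp (BMinn H).subtype

lemma forgetInn_comp_trivInn : (forgetInn H).comp (trivInn H) = MonoidHom.id (Br C) :=
  MonoidHom.ext forgetBr_trivBr

lemma trivInn_injective : Function.Injective (trivInn (C := C) H) :=
  Function.LeftInverse.injective (g := forgetInn H) forgetBr_trivBr

lemma range_trivInn : (trivInn H).range = (twistHom H).ker := by
  ext ⟨x, hx⟩
  rw [MonoidHom.mem_ker]
  constructor
  · rintro ⟨y, hy⟩
    rw [← hy]
    induction y using Quot.ind with | _ A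
    exact (twistHom_mk (A := A.triv H) (trivBr_mem (Br.mk A)) (hasTwist_trivAlg A.1)).trans
      (map_one (H2.mk H))
  · induction x using Quot.ind with | _ A
    intro h
    obtain ⟨σ, hσ⟩ := exists_hasTwist_of_mem hx
    have h1 : H2.mk H ⟨σ, A.d₂_eq_one hσ⟩ = H2.mk H 1 :=
      ((twistHom_mk hx hσ).symm.trans h).trans (map_one (H2.mk H)).symm
    obtain ⟨s, hs⟩ := (H2.mk_eq_mk_iff _ _).1 h1
    have h2 : HasTwist A.1 1 := (congrArg (HasTwist A.1) hs).mpr (hσ.mul_d₁ s)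
    exact ⟨forgetBr H (Br.mk A), Subtype.ext (A.mk_eq_of_hasTwist_one h2).symm⟩

lemma twistHom_surjective (hH : IsFinite H) : Function.Surjective (twistHom H) := by
  intro x
  obtain ⟨σ, rfl⟩ := QuotientGroup.mk'_surjective ((d₁ H).range.subgroupOf (d₂ H).ker) x
  obtain ⟨A, hA⟩ := exists_azumaya_hasTwist hH σ
  exact ⟨⟨Br.mk A, mk_mem_BMinn hA⟩, twistHom_mk _ hA⟩

/-- A homomorphism splitting the kernel inclusion of an extension gives, together with the quotient
map, an isomorphism to the product. No commutativity is needed. -/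
lemma forgetInn_twistHom_bijective (hH : IsFinite H) :
    Function.Bijective ((forgetInn H).prod (twistHom H)) := by
  have hpq (y : Br C) : forgetInn H (trivInn H y) = y := forgetBr_trivBr y
  have hYq (y : Br C) : twistHom H (trivInn H y) = 1 := by
    rw [← MonoidHom.mem_ker, ← range_trivInn]
    exact ⟨y, rfl⟩
  constructor
  · rw [injective_iff_map_eq_one]
    intro x hx
    have h1 : x ∈ (trivInn H).range := by
      rw [range_trivInn, MonoidHom.mem_ker]
      exact congrArg Prod.snd hx
    obtain ⟨y, rfl⟩ := h1
    have h2 : forgetInn H (trivInn H y) = 1 := congrArg Prod.fst hx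
    rw [hpq] at h2
    rw [h2, map_one]
  · rintro ⟨y, z⟩
    obtain ⟨x, rfl⟩ := twistHom_surjective hH z
    refine ⟨trivInn H (y * (forgetInn H x)⁻¹) * x, Prod.ext ?_ ?_⟩
    · change forgetInn H _ = y
      rw [map_mul, hpq, inv_mul_cancel_right]
    · change twistHom H _ = _
      rw [map_mul, hYq, one_mul]

/-- The classes with inner action as a product. -/
def innEquiv (hH : IsFinite H) : BMinn H ≃* Br C × H2 H :=
  MulEquiv.ofBijective _ (forgetInn_twistHom_bijective hH)

variable [HasEqualizers C]

/-- The group structure on the classes of Galois objects with a normal basis. -/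
@[reducible]
def galGroup (hH : IsFinite H) : Group (GalNB H) := (galoisEquiv hH).symm.group

/-- The isomorphism of the second cohomology group with the group of Galois objects. -/
def galoisMulEquiv (hH : IsFinite H) :
    letI := galGroup hH
    H2 H ≃* GalNB H :=
  letI := galGroup hH
  { galoisEquiv hH with
    map_mul' := fun x y => by
      change galoisEquiv hH (x * y) = (galoisEquiv hH).symm.symm _
      simp }

/-- The group structure is transported from `H²`. It is given by cotensor products because the
algebras twisted by `σ` and `τ` have as cotensor product the one twisted by `σ τ`. -/
lemma isGaloisGroup (hH : IsFinite H) : letI := galGroup hH; IsGaloisGroup H := by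
  let := galGroup hH
  intro T T'
  have key (T : GaloisNB H) : ∃ σ, GalNB.mk (twistGalois hH σ) = GalNB.mk T := by
    obtain ⟨x, hx⟩ := (galoisEquiv hH).surjective (GalNB.mk T)
    obtain ⟨σ, rfl⟩ := QuotientGroup.mk'_surjective ((d₁ H).range.subgroupOf (d₂ H).ker) x
    exact ⟨σ, (galoisEquiv_mk hH σ).symm.trans hx⟩
  obtain ⟨σ, hσ⟩ := key T
  obtain ⟨τ, hτ⟩ := key T'
  obtain ⟨e, he⟩ := exists_isCotensor hH T T' σ τ hσ hτ
  refine ⟨_, e, he, ?_⟩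
  rw [← hσ, ← hτ, ← galoisEquiv_mk, ← galoisEquiv_mk, ← galoisEquiv_mk, map_mul]
  exact (map_mul (galoisMulEquiv hH) _ _).symm

end Sequence

end

end HopfBrauer

theorem mainTheorem2 {C : Type u} [Category.{v} C] [MonoidalCategory C] [BraidedCategory C]
    [MonoidalClosed C] [HasEqualizers C] [HasCoequalizers C]
    (H : C) [HopfObj H] [IsCommMonObj H] (hH : HopfBrauer.IsFinite H)
    [HopfBrauer.BraidingLinear H] :
    ∃ (_ : Group (HopfBrauer.Br C)) (_ : Group (HopfBrauer.BM H)) (_ : Group (HopfBrauer.GalNB H))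
      (BMinn : Subgroup (HopfBrauer.BM H))
      (q : HopfBrauer.Br C →* BMinn) (p : BMinn →* HopfBrauer.Br C)
      (Y : BMinn →* HopfBrauer.GalNB H),
      HopfBrauer.IsBrauerGroup C ∧
      HopfBrauer.IsBrauerGroup (Mod C H) ∧
      HopfBrauer.IsGaloisGroup H ∧
      (BMinn : Set (HopfBrauer.BM H)) = HopfBrauer.innerClasses H ∧
      (∀ A : HopfBrauer.Azumaya C, ∃ h : HopfBrauer.IsAzumaya (HopfBrauer.trivAlg H A.1),
        (q (HopfBrauer.Br.mk A) : HopfBrauer.BM H) =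
          HopfBrauer.Br.mk ⟨HopfBrauer.trivAlg H A.1, h⟩) ∧
      (∀ (A : HopfBrauer.Azumaya (Mod C H)) (hA : HopfBrauer.Br.mk A ∈ BMinn),
        ∃ h : HopfBrauer.IsAzumaya (HopfBrauer.underlying A.1),
          p ⟨HopfBrauer.Br.mk A, hA⟩ = HopfBrauer.Br.mk ⟨HopfBrauer.underlying A.1, h⟩) ∧
      (∀ (A : HopfBrauer.Azumaya (Mod C H)) (hA : HopfBrauer.Br.mk A ∈ BMinn),
        ∃ (T : HopfBrauer.GaloisNB H) (j : T.1.alg ⟶ HopfBrauer.smash A.1),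
          HopfBrauer.IsSmashInvariants A.1 T.1 j ∧
            Y ⟨HopfBrauer.Br.mk A, hA⟩ = HopfBrauer.GalNB.mk T) ∧
      Function.Injective q ∧
      q.range = Y.ker ∧
      Function.Surjective Y ∧
      p.comp q = MonoidHom.id (HopfBrauer.Br C) ∧
      Nonempty (BMinn ≃* HopfBrauer.Br C × HopfBrauer.H2 H) := by
  let := HopfBrauer.galGroup hH
  refine ⟨HopfBrauer.brGroup, HopfBrauer.brGroup, inferInstance, HopfBrauer.BMinn H,
    HopfBrauer.trivInn H,
    HopfBrauer.forgetInn H, (HopfBrauer.galoisMulEquiv hH).toMonoidHom.comp (HopfBrauer.twistHom H),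
    HopfBrauer.isBrauerGroup, HopfBrauer.isBrauerGroup, HopfBrauer.isGaloisGroup hH, rfl,
    fun A => ⟨HopfBrauer.isAzumaya_trivAlg A.2, rfl⟩,
    fun A _ => ⟨(HopfBrauer.isAzumaya_underlying_iff A.1).1 A.2, rfl⟩, fun A hA => ?_,
    HopfBrauer.trivInn_injective, ?_, ?_, HopfBrauer.forgetInn_comp_trivInn,
    ⟨HopfBrauer.innEquiv hH⟩⟩
  -- One implementing morphism `F` serves both sides: its twist `σ` represents the class in `H²`,
  -- and the elements `F⁻¹(h₁) # h₂` form a copy of the algebra twisted by `σ` inside the smash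
  -- product.
  · obtain ⟨σ, F, hF, hσ⟩ := HopfBrauer.exists_hasTwist_of_mem hA
    refine ⟨HopfBrauer.twistGalois hH ⟨σ, A.d₂_eq_one ⟨F, hF, hσ⟩⟩,
      HopfBrauer.smashCentral A.faithfullyProjective A.isAzF hF hσ,
      HopfBrauer.isSmashInvariants_twistAlg A.faithfullyProjective A.isAzF hF hσ, ?_⟩
    exact (congrArg (HopfBrauer.galoisEquiv hH) (HopfBrauer.twistHom_mk hA ⟨F, hF, hσ⟩)).trans
      (HopfBrauer.galoisEquiv_mk hH _)
  · rw [HopfBrauer.range_trivInn]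
    exact (MonoidHom.ker_mulEquiv_comp (HopfBrauer.twistHom H)
      (HopfBrauer.galoisMulEquiv hH)).symm
  · exact (HopfBrauer.galoisMulEquiv hH).surjective.comp (HopfBrauer.twistHom_surjective hH)
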